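/- Let $N\ge 4$ be an integer, $\mu_1=\frac{N-3}{N}\pi$, $\mu_2=\frac{N-1}{N}\pi$, and for $i=1,2$ put $c_i=\cos\mu_i$, $s_i=\sin\mu_i$, $cc_i=1-c_i$, $$r_1=\frac{2(c_1-1)^2}{s_1(c_1-c_2)},\quad r_2=\frac{2(c_2-1)^2}{s_2(c_2-c_1)},\quad L_{1}=\frac{cc_1cc_2- 3(cc_2-cc_1)}{-cc_1cc_2+3(cc_1+cc_2)},\quad L_{2}=\frac{cc_1cc_2+ 3(cc_2-cc_1)}{-cc_1cc_2+3(cc_1+cc_2)}.$$ Equip $V=\mathbb R^4$ with the symplectic form $\langle x,y\rangle=x^tJy$ and consider the anti-symplectic involutions $A,B,C$, where $$J=\begin{bmatrix}0&r_2&0&0\\-r_2&0&0&0\\0&0&0&r_1\\0&0&-r_1&0\end{bmatrix},\ A=\begin{bmatrix}-1&0&0&0\\-r_1&1&-r_1&0\\0&0&-1&0\\-r_2&0&-r_2&1\end{bmatrix},\ B=\mathrm{diag}(-1,1,-1,1),\ C=\begin{bmatrix}-c_1&s_1&0&0\\s_1&c_1&0&0\\0&0&-c_2&s_2\\0&0&s_2&c_2\end{bmatrix}.$$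 Let $\tilde\Gamma_N=\langle A,B,C\rangle\subset \mathrm{GSp}(V)$, $R=BC$, $T=AB$, and $\Gamma_N=\langle R,T\rangle\subset\tilde\Gamma_N$. Let $\mathrm{LGr}(V)$ be the Lagrangian Grassmannian with its usual topology, and for $0\ne v\in V$ let $\phi(v)=\{L\in\mathrm{LGr}(V): v\in L\}$ be the photon of $v$. *Crooked surfaces.* Let $e_1,f_1,e_2,f_2$ be a basis of $V$ with $\langle e_1,f_1\rangle=\langle e_2,f_2\rangle\neq0$ and all other pairings of basis vectors (up to order) zero, spanning the simplicial cone $\mathcal C$. The $e$-wing is $\mathcal W_e=\bigcup\phi(se_1+te_2)$ over $s,t\ge0$, $s+t=1$, and the $f$-wing $\mathcal W_f$ is defined likewise with $f_1,f_2$. The stem $\mathcal S$ is the set of the Lagrangians $L$ spanned by a vector of $\mathrm{span}(e_1,f_1)$ and a vector of $\mathrm{span}(e_2,f_2)$ on which the quadratic form $x+y\mapsto\langle x,y\rangle$ ($x\in\mathrm{span}(e_1,f_2)$, $y\in\mathrm{span}(e_2,f_1)$) is definite (Maslov index $\pm2$). The crooked surface is $\mathcal{WS}=\mathcal W_e\cup\mathcal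 S\cup\mathcal W_f$, and $\mathcal L_s$ denotes the connected component of $\mathrm{LGr}(V)\setminus\mathcal{WS}$ that contains the photons $\phi(v)$ with $v$ in the interior of $\mathcal C$. *Ping-pong cones.* Let $\mathcal C_0$ be the cone with $e_1=v_0$, $f_1=v_3$, $e_2=v_2$, $f_2=v_1$, where $v_0,v_1,v_2,v_3$ are the columns, in this order, of $$\begin{bmatrix}0&-L_2cc_1&0&cc_1\\-L_1\frac{cc_1}{s_1}&-\frac{cc_1^2}{s_1}&-\frac{cc_1}{s_1}&-\frac{cc_1^2}{s_1}\\0&L_1cc_2&0&-cc_2\\L_2\frac{cc_2}{s_2}&\frac{cc_2^2}{s_2}&\frac{cc_2}{s_2}&\frac{cc_2^2}{s_2}\end{bmatrix}.$$ For $i\in I=\{0,0',\dots,N-1,(N-1)'\}$ let $g_k=R^k$, $g_{k'}=R^kB$, $\mathcal C_i=g_i\mathcal C_0$, $A_i=g_iAg_i^{-1}$, let $\mathcal W_{e,i}$ be the $e$-wing of $\mathcal C_i$, and let $\overline{\mathcal L_{i,s}}$ be the closure of the component $\mathcal L_{i,s}$ attached to $\mathcal C_i$. *The domains.* For $n\ge1$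 let $\Lambda_n$ be the set of all $A_{i_n}\cdots A_{i_2}y$ with $i_1,\dots,i_n\in I$, $i_l\ne i_{l+1}$, $y\in\overline{\mathcal L_{i_1,s}}$; let $\Omega_n=\mathrm{LGr}(V)\setminus\Lambda_n$ and $\Omega^\circ=\bigcup_{n\ge1}\Omega_n$. Call attractor photons the $\tilde\Gamma_N$-translates of the two photons $\phi(\mathrm{im}(AB-1))$ (attractor of the rank one unipotent $AB$) and $\phi(v_3)$ (attractor of the maximally unipotent $AC$), and let $P$ be the union of all attractor photons. Let $$\Omega=\tilde\Gamma_N\cdot\Big(\Omega_2\cup\bigcup_{i\in I}\big(\mathcal W_{e,i}\setminus P\big)\Big).$$ **Theorem.** For every $N\geq 4$: 1. $g_0=CA$, $g_1=T$, $g_\infty=R$ satisfy the conditions that characterize the local monodromies of the hypergeometric equation with parameters $\alpha=(\frac{N-3}{2N},\frac{N-1}{2N},\frac{N+1}{2N},\frac{N+3}{2N})$, $\beta=(1,1,1,1)$: $g_0g_1g_\infty=1$; $\det(t-g_\infty)=\prod_j(t-e^{2\pi i\alpha_j})$ and $\det(t-g_0^{-1})=(t-1)^4$, with one Jordan block for each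 eigenvalue; $\mathrm{rk}(g_1-1)=1$ and $\det g_1=e^{2\pi i\sum_j(\beta_j-\alpha_j)}$. 2. $\Omega^\circ$ and $\Omega$ are open, $\Omega^\circ$ is nonempty, and $\Omega^\circ\subsetneq\Omega$. 3. $\tilde\Gamma_N$ and its subgroup $\Gamma_N$ preserve $\Omega^\circ$ and $\Omega$ and act properly discontinuously on each of them: for every compact $K\subset\Omega^\circ$ (resp. $K\subset\Omega$) only finitely many elements $\gamma$ of the group satisfy $\gamma K\cap K\neq\emptyset$. -/

import Mathlib

open Matrix Polynomial

noncomputable section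

namespace CyclotomicCones

/-! ### Parameters -/

/-- The ambient space `V = ℝ⁴`. -/
abbrev V : Type := Fin 4 → ℝ

def mu1 (N : ℕ) : ℝ := ((N : ℝ) - 3) / N * Real.pi
def mu2 (N : ℕ) : ℝ := ((N : ℝ) - 1) / N * Real.pi
def c1 (N : ℕ) : ℝ := Real.cos (mu1 N)
def c2 (N : ℕ) : ℝ := Real.cos (mu2 N)
def s1 (N : ℕ) : ℝ := Real.sin (mu1 N)
def s2 (N : ℕ) : ℝ := Real.sin (mu2 N)
def r1 (N : ℕ) : ℝ := 2 * (c1 N - 1) ^ 2 / (s1 N * (c1 N - c2 N))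
def r2 (N : ℕ) : ℝ := 2 * (c2 N - 1) ^ 2 / (s2 N * (c2 N - c1 N))
def cc1 (N : ℕ) : ℝ := 1 - c1 N
def cc2 (N : ℕ) : ℝ := 1 - c2 N
def L1 (N : ℕ) : ℝ :=
  (cc1 N * cc2 N - 3 * (cc2 N - cc1 N)) / (-(cc1 N * cc2 N) + 3 * (cc1 N + cc2 N))
def L2 (N : ℕ) : ℝ :=
  (cc1 N * cc2 N + 3 * (cc2 N - cc1 N)) / (-(cc1 N * cc2 N) + 3 * (cc1 N + cc2 N))

/-! ### Symplectic form and reflection matrices -/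

def J (N : ℕ) : Matrix (Fin 4) (Fin 4) ℝ :=
  !![0, r2 N, 0, 0;
     -r2 N, 0, 0, 0;
     0, 0, 0, r1 N;
     0, 0, -r1 N, 0]

/-- The symplectic pairing `⟨x, y⟩ = xᵗ J y`. -/
def pairing (N : ℕ) (x y : V) : ℝ := x ⬝ᵥ (J N *ᵥ y)

def matA (N : ℕ) : Matrix (Fin 4) (Fin 4) ℝ :=
  !![-1, 0, 0, 0;
     -r1 N, 1, -r1 N, 0;
     0, 0, -1, 0;
     -r2 N, 0, -r2 N, 1]

def matB : Matrix (Fin 4) (Fin 4) ℝ :=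
  !![-1, 0, 0, 0;
     0, 1, 0, 0;
     0, 0, -1, 0;
     0, 0, 0, 1]

def matC (N : ℕ) : Matrix (Fin 4) (Fin 4) ℝ :=
  !![-c1 N, s1 N, 0, 0;
     s1 N, c1 N, 0, 0;
     0, 0, -c2 N, s2 N;
     0, 0, s2 N, c2 N]

theorem matA_mul_self (N : ℕ) : matA N * matA N = 1 := by
  ext i j
  fin_cases i <;> fin_cases j <;> simp [matA, Matrix.mul_apply, Fin.sum_univ_four]

theorem matB_mul_self : matB * matB = 1 := by
  ext i j
  fin_cases i <;> fin_cases j <;> simp [matB, Matrix.mul_apply, Fin.sum_univ_four]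

theorem matC_mul_self (N : ℕ) : matC N * matC N = 1 := by
  have h1 : c1 N * c1 N + s1 N * s1 N = 1 := by
    have := Real.cos_sq_add_sin_sq (mu1 N); simp only [c1, s1]; nlinarith
  have h2 : c2 N * c2 N + s2 N * s2 N = 1 := by
    have := Real.cos_sq_add_sin_sq (mu2 N); simp only [c2, s2]; nlinarith
  ext i j
  fin_cases i <;> fin_cases j <;>
    simp [matC, Matrix.mul_apply, Fin.sum_univ_four] <;> linarith

theorem matA_conj (N : ℕ) : (matA N)ᵀ * J N * matA N = (-1 : ℝ) • J N := by
  ext i j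
  fin_cases i <;> fin_cases j <;>
    simp [matA, J, Matrix.mul_apply, Fin.sum_univ_four] <;> ring

theorem matB_conj (N : ℕ) : matBᵀ * J N * matB = (-1 : ℝ) • J N := by
  ext i j
  fin_cases i <;> fin_cases j <;>
    simp [matB, J, Matrix.mul_apply, Fin.sum_univ_four]

theorem matC_conj (N : ℕ) : (matC N)ᵀ * J N * matC N = (-1 : ℝ) • J N := by
  have h1 : s1 N * s1 N = 1 - c1 N * c1 N := by
    have := Real.cos_sq_add_sin_sq (mu1 N); simp only [c1, s1]; nlinarith
  have h2 : s2 N * s2 N = 1 - c2 N * c2 N := by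
    have := Real.cos_sq_add_sin_sq (mu2 N); simp only [c2, s2]; nlinarith
  ext i j
  fin_cases i <;> fin_cases j <;>
    simp [matC, J, Matrix.mul_apply, Fin.sum_univ_four] <;>
    first
      | linear_combination (r2 N) * h1
      | linear_combination (-r2 N) * h1
      | linear_combination (r1 N) * h2
      | linear_combination (-r1 N) * h2
      | ring

/-- The general symplectic group of `(V, J)`: invertible matrices that scale the pairing. -/
def GSp (N : ℕ) : Subgroup (GL (Fin 4) ℝ) where
  carrier := {g | ∃ χ : ℝˣ, (g : Matrix (Fin 4) (Fin 4) ℝ)ᵀ * J N * g = (χ : ℝ) • J N}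
  one_mem' := ⟨1, by simp⟩
  mul_mem' := by
    rintro g h ⟨χ, hg⟩ ⟨ψ, hh⟩
    refine ⟨χ * ψ, ?_⟩
    calc ((g * h : GL (Fin 4) ℝ) : Matrix (Fin 4) (Fin 4) ℝ)ᵀ * J N * (g * h : GL (Fin 4) ℝ)
        = (h : Matrix (Fin 4) (Fin 4) ℝ)ᵀ *
            ((g : Matrix (Fin 4) (Fin 4) ℝ)ᵀ * J N * g) * h := by
          simp [Matrix.transpose_mul, Matrix.mul_assoc]
      _ = ((χ * ψ : ℝˣ) : ℝ) • J N := by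
          rw [hg, Matrix.mul_smul, Matrix.smul_mul, hh, smul_smul]; simp
  inv_mem' := by
    rintro g ⟨χ, hg⟩
    refine ⟨χ⁻¹, ?_⟩
    have h1 : (g : Matrix (Fin 4) (Fin 4) ℝ) * (g⁻¹ : GL (Fin 4) ℝ) = 1 := by
      rw [← Units.val_mul, mul_inv_cancel, Units.val_one]
    have h2 : ((g⁻¹ : GL (Fin 4) ℝ) : Matrix (Fin 4) (Fin 4) ℝ)ᵀ *
        (g : Matrix (Fin 4) (Fin 4) ℝ)ᵀ = 1 := by
      rw [← Matrix.transpose_mul, h1, Matrix.transpose_one]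
    have h3 : (χ : ℝ) • J N = (g : Matrix (Fin 4) (Fin 4) ℝ)ᵀ * J N * g := hg.symm
    have h4 : J N = ((χ⁻¹ : ℝˣ) : ℝ) •
        ((g : Matrix (Fin 4) (Fin 4) ℝ)ᵀ * J N * g) := by
      rw [← h3, smul_smul]; simp
    calc ((g⁻¹ : GL (Fin 4) ℝ) : Matrix (Fin 4) (Fin 4) ℝ)ᵀ * J N * (g⁻¹ : GL (Fin 4) ℝ)
        = ((χ⁻¹ : ℝˣ) : ℝ) • ((((g⁻¹ : GL (Fin 4) ℝ) : Matrix (Fin 4) (Fin 4) ℝ)ᵀ *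
            (g : Matrix (Fin 4) (Fin 4) ℝ)ᵀ) * J N *
            ((g : Matrix (Fin 4) (Fin 4) ℝ) * (g⁻¹ : GL (Fin 4) ℝ))) := by
          conv_lhs => rw [h4]
          simp only [Matrix.mul_smul, Matrix.smul_mul, Matrix.mul_assoc]
      _ = ((χ⁻¹ : ℝˣ) : ℝ) • J N := by rw [h1, h2, Matrix.one_mul, Matrix.mul_one]

def A (N : ℕ) : GSp N :=
  ⟨⟨matA N, matA N, matA_mul_self N, matA_mul_self N⟩, -1, by simpa using matA_conj N⟩

def B (N : ℕ) : GSp N :=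
  ⟨⟨matB, matB, matB_mul_self, matB_mul_self⟩, -1, by simpa using matB_conj N⟩

def C (N : ℕ) : GSp N :=
  ⟨⟨matC N, matC N, matC_mul_self N, matC_mul_self N⟩, -1, by simpa using matC_conj N⟩

def R (N : ℕ) : GSp N := B N * C N

def T (N : ℕ) : GSp N := A N * B N

/-- The underlying matrix of an element of `GSp`. -/
def toMat {N : ℕ} (g : GSp N) : Matrix (Fin 4) (Fin 4) ℝ := ((g : GL (Fin 4) ℝ) : Matrix _ _ ℝ)

/-- The reflection group `Γ̃_N = ⟨A, B, C⟩`. -/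
def reflectionGroup (N : ℕ) : Subgroup (GSp N) := Subgroup.closure {A N, B N, C N}

/-- The monodromy group `Γ_N = ⟨R, T⟩`. -/
def monodromyGroup (N : ℕ) : Subgroup (GSp N) := Subgroup.closure {R N, T N}

/-- The hypergeometric parameters `α₁, …, α₄`. -/
def alpha (N : ℕ) : Fin 4 → ℝ :=
  ![((N : ℝ) - 3) / (2 * N), ((N : ℝ) - 1) / (2 * N),
    ((N : ℝ) + 1) / (2 * N), ((N : ℝ) + 3) / (2 * N)]

/-- `g₀, g₁, g∞` are local monodromies, around `0, 1, ∞`, of a hypergeometric local system with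
parameters `α = alpha N` and `β = (1, 1, 1, 1)`: the loops compose to the identity, the
characteristic polynomials of `g∞` and `g₀⁻¹` have roots `exp (2πi αⱼ)` and `exp (2πi βⱼ) = 1`
with a single Jordan block for every eigenvalue, and `g₁` is a complex reflection with
determinant `exp (2πi ∑ (βⱼ - αⱼ))`. -/
def IsHypergeometricTriple (N : ℕ) (g₀ g₁ gInf : Matrix (Fin 4) (Fin 4) ℝ) : Prop :=
  g₀ * g₁ * gInf = 1 ∧
  gInf.charpoly.map (algebraMap ℝ ℂ) =
    ∏ j : Fin 4, (X - Polynomial.C (Complex.exp (2 * Real.pi * Complex.I * (alpha N j : ℂ)))) ∧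
  minpoly ℝ gInf = gInf.charpoly ∧
  (g₀⁻¹).charpoly = (X - 1) ^ 4 ∧
  minpoly ℝ g₀⁻¹ = (g₀⁻¹).charpoly ∧
  (g₁ - 1).rank = 1 ∧
  ((g₁.det : ℝ) : ℂ) =
    Complex.exp (2 * Real.pi * Complex.I * (∑ j : Fin 4, (1 - (alpha N j : ℂ))))

/-! ### The Lagrangian Grassmannian -/

theorem pairing_add_left (N : ℕ) (x y z : V) :
    pairing N (x + y) z = pairing N x z + pairing N y z := by
  simp [pairing, add_dotProduct]

theorem pairing_smul_left (N : ℕ) (a : ℝ) (x y : V) :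
    pairing N (a • x) y = a * pairing N x y := by
  simp [pairing, smul_dotProduct]

theorem pairing_swap (N : ℕ) (x y : V) : pairing N x y = -pairing N y x := by
  simp [pairing, J, dotProduct, Matrix.mulVec, Fin.sum_univ_four]; ring

theorem pairing_add_right (N : ℕ) (x y z : V) :
    pairing N x (y + z) = pairing N x y + pairing N x z := by
  simp [pairing, Matrix.mulVec_add, dotProduct_add]

theorem pairing_smul_right (N : ℕ) (a : ℝ) (x y : V) :
    pairing N x (a • y) = a * pairing N x y := by
  simp [pairing, Matrix.mulVec_smul, dotProduct_smul]

theorem pairing_self (N : ℕ) (x : V) : pairing N x x = 0 := by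
  have := pairing_swap N x x
  linarith

/-- Lagrangian planes of `V`. -/
def LGr (N : ℕ) : Type :=
  {L : Submodule ℝ V // Module.finrank ℝ L = 2 ∧ ∀ x ∈ L, ∀ y ∈ L, pairing N x y = 0}

/-- Frames (ordered bases) of Lagrangian planes, with the subspace topology of `V × V`. -/
abbrev LagFrame (N : ℕ) : Type :=
  {p : V × V // LinearIndependent ℝ ![p.1, p.2] ∧ pairing N p.1 p.2 = 0}

/-- The Lagrangian plane spanned by a frame. -/
def LagFrame.span {N : ℕ} (p : LagFrame N) : LGr N :=
  ⟨Submodule.span ℝ {p.1.1, p.1.2}, by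
    constructor
    · have h := finrank_span_eq_card p.2.1
      rw [Matrix.range_cons, Matrix.range_cons, Matrix.range_empty, Set.union_empty,
        Set.singleton_union] at h
      simpa using h
    · intro x hx y hy
      obtain ⟨a, b, rfl⟩ := Submodule.mem_span_pair.1 hx
      obtain ⟨c, d, rfl⟩ := Submodule.mem_span_pair.1 hy
      have h := p.2.2
      have h' := pairing_swap N p.1.2 p.1.1
      simp only [pairing_add_left, pairing_add_right, pairing_smul_left, pairing_smul_right,
        pairing_self, h, h']
      ring⟩

/-- The usual topology of the Grassmannian: the quotient topology from the space of frames. -/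
instance (N : ℕ) : TopologicalSpace (LGr N) :=
  TopologicalSpace.coinduced LagFrame.span inferInstance

theorem toMat_pairing {N : ℕ} (g : GSp N) :
    ∃ χ : ℝ, ∀ x y : V, pairing N (toMat g *ᵥ x) (toMat g *ᵥ y) = χ * pairing N x y := by
  obtain ⟨χ, h⟩ := g.2
  refine ⟨χ, fun x y => ?_⟩
  have h' : (toMat g)ᵀ * J N * toMat g = (χ : ℝ) • J N := h
  calc pairing N (toMat g *ᵥ x) (toMat g *ᵥ y)
      = x ⬝ᵥ (((toMat g)ᵀ * J N * toMat g) *ᵥ y) := by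
        rw [pairing, ← Matrix.mulVec_mulVec, ← Matrix.mulVec_mulVec, Matrix.dotProduct_mulVec x,
          Matrix.vecMul_transpose]
    _ = χ * pairing N x y := by
        rw [h', Matrix.smul_mulVec, dotProduct_smul, smul_eq_mul, pairing]

theorem toMat_injective {N : ℕ} (g : GSp N) :
    Function.Injective (Matrix.mulVecLin (toMat g)) := by
  intro x y hxy
  have h1 : toMat g⁻¹ * toMat g = 1 := by
    simp [toMat]
  have h2 : toMat g⁻¹ *ᵥ (toMat g *ᵥ x) = toMat g⁻¹ *ᵥ (toMat g *ᵥ y) :=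
    congrArg (fun z => toMat g⁻¹ *ᵥ z) hxy
  simpa [Matrix.mulVec_mulVec, h1] using h2

/-- `GSp` acts on the Lagrangian Grassmannian by `g • L = g(L)`. -/
instance (N : ℕ) : MulAction (GSp N) (LGr N) where
  smul g L := ⟨L.1.map (Matrix.mulVecLin (toMat g)), by
    constructor
    · rw [← (Submodule.equivMapOfInjective _ (toMat_injective g) L.1).finrank_eq]
      exact L.2.1
    · rintro _ ⟨x, hx, rfl⟩ _ ⟨y, hy, rfl⟩
      obtain ⟨χ, h⟩ := toMat_pairing g
      rw [Matrix.mulVecLin_apply, Matrix.mulVecLin_apply, h, L.2.2 x hx y hy, mul_zero]⟩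
  one_smul L := by
    apply Subtype.ext
    change L.1.map (Matrix.mulVecLin (toMat 1)) = L.1
    have : toMat (1 : GSp N) = 1 := rfl
    rw [this, Matrix.mulVecLin_one, Submodule.map_id]
  mul_smul g h L := by
    apply Subtype.ext
    change L.1.map (Matrix.mulVecLin (toMat (g * h))) =
      (L.1.map (Matrix.mulVecLin (toMat h))).map (Matrix.mulVecLin (toMat g))
    have : toMat (g * h) = toMat g * toMat h := rfl
    rw [this, Matrix.mulVecLin_mul, Submodule.map_comp]

/-! ### Crooked surfaces -/

/-- The four vertices of a simplicial cone, labelled so that `[e₁, e₂]` and `[f₁, f₂]` are the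
edges of the wings and `⟨e₁, f₁⟩`, `⟨e₂, f₂⟩` are the nonzero pairings. -/
structure Tetra where
  e₁ : V
  f₁ : V
  e₂ : V
  f₂ : V

/-- The interior of the simplicial cone. -/
def Tetra.interiorCone (t : Tetra) : Set V :=
  {v | ∃ a b c d : ℝ, 0 < a ∧ 0 < b ∧ 0 < c ∧ 0 < d ∧
    v = a • t.e₁ + b • t.f₁ + c • t.e₂ + d • t.f₂}

/-- The photon `φ(v)` of Lagrangians that contain `v`. -/
def photon (N : ℕ) (v : V) : Set (LGr N) := {L | v ∈ L.1}

/-- The union of the photons over the interval `[p, q]`. -/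
def wing (N : ℕ) (p q : V) : Set (LGr N) :=
  ⋃ (s : ℝ) (t : ℝ) (_ : 0 ≤ s ∧ 0 ≤ t ∧ s + t = 1), photon N (s • p + t • q)

def Tetra.eWing (N : ℕ) (t : Tetra) : Set (LGr N) := wing N t.e₁ t.e₂

def Tetra.fWing (N : ℕ) (t : Tetra) : Set (LGr N) := wing N t.f₁ t.f₂

/-- The Einstein torus of Lagrangians spanned by one vector of `span(e₁, f₁)` and one vector of
`span(e₂, f₂)`. -/
def Tetra.einsteinTorus (N : ℕ) (t : Tetra) : Set (LGr N) :=
  {L | ∃ w₁ ∈ Submodule.span ℝ {t.e₁, t.f₁}, ∃ w₂ ∈ Submodule.span ℝ {t.e₂, t.f₂},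
    w₁ ≠ 0 ∧ w₂ ≠ 0 ∧ L.1 = Submodule.span ℝ {w₁, w₂}}

/-- The stem: Lagrangians `L` of the Einstein torus whose Maslov index relative to
`L_{e₁f₂}, L_{e₂f₁}` is `±2`, that is, the quadratic form `x + y ↦ ⟨x, y⟩`
(`x ∈ L_{e₁f₂}`, `y ∈ L_{e₂f₁}`) is positive or negative definite on the plane `L`. -/
def Tetra.stem (N : ℕ) (t : Tetra) : Set (LGr N) :=
  {L | L ∈ t.einsteinTorus N ∧
    ((∀ x ∈ Submodule.span ℝ {t.e₁, t.f₂}, ∀ y ∈ Submodule.span ℝ {t.e₂, t.f₁},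
        x + y ∈ L.1 → x + y ≠ 0 → 0 < pairing N x y) ∨
     (∀ x ∈ Submodule.span ℝ {t.e₁, t.f₂}, ∀ y ∈ Submodule.span ℝ {t.e₂, t.f₁},
        x + y ∈ L.1 → x + y ≠ 0 → pairing N x y < 0))}

def Tetra.crookedSurface (N : ℕ) (t : Tetra) : Set (LGr N) :=
  t.eWing N ∪ t.stem N ∪ t.fWing N

/-- The side of the crooked surface determined by the cone: the connected component of the
complement of the crooked surface that contains the photons `φ(v)`, `v` in the interior of the
cone. -/
def Tetra.smallSide (N : ℕ) (t : Tetra) : Set (LGr N) :=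
  ⋃ (v ∈ t.interiorCone) (M ∈ photon N v), connectedComponentIn (t.crookedSurface N)ᶜ M

/-! ### The ping-pong cones -/

def v₀ (N : ℕ) : V := ![0, -(L1 N * (cc1 N / s1 N)), 0, L2 N * (cc2 N / s2 N)]
def v₁ (N : ℕ) : V :=
  ![-(L2 N * cc1 N), -(cc1 N ^ 2 / s1 N), L1 N * cc2 N, cc2 N ^ 2 / s2 N]
def v₂ (N : ℕ) : V := ![0, -(cc1 N / s1 N), 0, cc2 N / s2 N]
def v₃ (N : ℕ) : V := ![cc1 N, -(cc1 N ^ 2 / s1 N), -cc2 N, cc2 N ^ 2 / s2 N]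

/-- The cone `𝒞₀ = [v₀ | v₁ | v₂ | v₃]`. -/
def baseTetra (N : ℕ) : Tetra where
  e₁ := v₀ N
  f₁ := v₃ N
  e₂ := v₂ N
  f₂ := v₁ N

def Tetra.translate {N : ℕ} (g : GSp N) (t : Tetra) : Tetra where
  e₁ := toMat g *ᵥ t.e₁
  f₁ := toMat g *ᵥ t.f₁
  e₂ := toMat g *ᵥ t.e₂
  f₂ := toMat g *ᵥ t.f₂

/-- The index set `{0, 0', …, N-1, (N-1)'}`; the Boolean is `true` for a primed index. -/
abbrev Idx (N : ℕ) : Type := Fin N × Bool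

/-- The element `Rᵏ` (or `Rᵏ B`, for a primed index) that takes `𝒞₀` to the cone of index `i`. -/
def place {N : ℕ} (i : Idx N) : GSp N :=
  if i.2 then R N ^ (i.1 : ℕ) * B N else R N ^ (i.1 : ℕ)

def tetra {N : ℕ} (i : Idx N) : Tetra := (baseTetra N).translate (place i)

/-- The reflection `A_i` associated to the cone of index `i`. -/
def reflection {N : ℕ} (i : Idx N) : GSp N := place i * A N * (place i)⁻¹

/-- The closed small side `closure 𝓛_{i,s}`. -/
def closedSmallSide {N : ℕ} (i : Idx N) : Set (LGr N) := closure ((tetra i).smallSide N)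

/-! ### The domains -/

/-- `Λ_n`, for `n ≥ 1`: the points `A_{i_n} ⋯ A_{i_2} y` with `y ∈ closure 𝓛_{i_1,s}` and
consecutive indices distinct; the list `w` is `[i_2, …, i_n]`. -/
def limitApprox (N n : ℕ) : Set (LGr N) :=
  {x | ∃ (i₁ : Idx N) (w : List (Idx N)), w.length + 1 = n ∧ List.IsChain (· ≠ ·) (i₁ :: w) ∧
    ∃ y ∈ closedSmallSide i₁, x = (w.reverse.map reflection).prod • y}

/-- `Ω_n`. -/
def domainApprox (N n : ℕ) : Set (LGr N) := (limitApprox N n)ᶜ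

/-- `Ω°`. -/
def innerDomain (N : ℕ) : Set (LGr N) := ⋃ (n : ℕ) (_ : 1 ≤ n), domainApprox N n

/-- The attractor photon of the rank one unipotent `AB` on the `e`-wing of `𝒞₀`: the Lagrangians
that contain the line `im (AB - 1)`. -/
def rankOneAttractorPhoton (N : ℕ) : Set (LGr N) :=
  {L | LinearMap.range (Matrix.mulVecLin (toMat (A N * B N) - 1)) ≤ L.1}

/-- The attractor photon of the maximally unipotent `AC`: the photon of the vertex `f₁ = v₃`. -/
def maxUnipotentAttractorPhoton (N : ℕ) : Set (LGr N) := photon N (v₃ N)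

/-- The union of all attractor photons: the translates under the reflection group of the two
attractor photons. -/
def attractorPhotons (N : ℕ) : Set (LGr N) :=
  {L | ∃ γ ∈ reflectionGroup N,
    ∃ M ∈ rankOneAttractorPhoton N ∪ maxUnipotentAttractorPhoton N, L = γ • M}

/-- `Ω`: the translates under the reflection group of `Ω_2`, enlarged by the parts of the
`e`-wings that are away from the attractor photons. -/
def domain (N : ℕ) : Set (LGr N) :=
  {x | ∃ γ ∈ reflectionGroup N,
    ∃ y ∈ domainApprox N 2 ∪ ⋃ i : Idx N, (tetra i).eWing N \ attractorPhotons N, x = γ • y}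

/-- The subgroup `Γ` preserves `Ω` and acts properly discontinuously on it: for every compact
`K ⊆ Ω` only finitely many `γ ∈ Γ` satisfy `γK ∩ K ≠ ∅`. -/
def ActsProperlyDiscontinuously {G X : Type*} [Group G] [MulAction G X] [TopologicalSpace X]
    (Γ : Subgroup G) (Ω : Set X) : Prop :=
  (∀ γ ∈ Γ, ∀ x ∈ Ω, γ • x ∈ Ω) ∧
  ∀ K ⊆ Ω, IsCompact K → {γ | γ ∈ Γ ∧ (((γ • ·) '' K) ∩ K).Nonempty}.Finite

end CyclotomicCones

end

open Matrix Polynomial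

noncomputable section

namespace CyclotomicCones

/-! ### Trigonometric parameters -/

/-! The two sides of a crooked surface are read off from the cone. Call the flipped cone the cone
with the signs of its `f`-vertices changed. By Hahn-Banach and L = L^⊥, a Lagrangian meets either
the open cone or the closed flipped cone in a nonzero vector, and isotropy excludes both. So the
small side is the set of Lagrangians that meet the open cone, its closure consists of those that
meet the closed cone (`Tetra.IsSymplectic.smallSide_eq`, `closure_smallSide`), and the surface is
where both closed sides meet. The involution `A` fixes v₀, v₂ and negates v₁, v₃, hence exchanges
the two sides of the base surface.

Ping-pong therefore needs only that every other cone lies, up to sign, in the flipped base cone. In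
dual coordinates this says that the pairings of the vertices with their images under `R ^ k` and `R
^ k * B`, for 0 < k < N, have a fixed sign. With θ = π/N, each of them is a positive constant times
a binary cubic in p = sin((k-1)θ)/sin θ and q = sin((k+1)θ)/sin θ, both nonnegative, whose
coefficients are polynomials in cos θ; these cubics are positive for 7/10 < cos θ < 1, apart from a
few zeros at k = 1 and k = N - 1 (`cross`, `flipCoords_of_mem_cone`). Abstract ping-pong
(`PingPong`) then settles Ω°: a reduced word longer than n sends every point outside the small sides
into the n-th level, so only finitely many elements return to the complement of that level.

The zeros of the cubics tell where closed sides touch: the intersection of two of them is, after a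
translation, contained in the `e`-wing together with the photon of v₃
(`mem_eWing_of_mem_coneHit_zero`, `mem_eWing_or_photon`). Such points belong to every Λ_n, so every
orbit in Ω° meets Ω_2.

For Ω, the wall group ⟨A, B⟩ is generated by `B` and the transvection `T = A * B` along `axis` = v₀
+ v₂, and it fixes every vector of the edge of the wing. A point is tame if it does not contain the
axis and its wall orbit avoids the closed sides of index other than 0, 0'. Points of the wing off
the attractor photons are tame, tameness is an open condition, and tame points lie in Ω
(`IsTame.eventually`, `mem_domain_of_isTame`); so Ω is open. An element that relates two tame points
has the form T^m h T^n with h in the finite group ⟨B, C⟩, and the north-south dynamics of `T` bounds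
both exponents (`finite_T_zpow_mul_mul`, `locallyFinitePair_isTame`). -/

/-- `cos (π / N)`. -/
def cosN (N : ℕ) : ℝ := Real.cos (Real.pi / N)

/-- `sin (π / N)`. -/
def sinN (N : ℕ) : ℝ := Real.sin (Real.pi / N)

theorem sinN_sq (N : ℕ) : sinN N ^ 2 = 1 - cosN N ^ 2 := by
  have := Real.cos_sq_add_sin_sq (Real.pi / N)
  simp only [sinN, cosN]; linarith

section

variable {N : ℕ}

/-- The extreme case is N = 4, where cos(π/4) = √2/2. The rational bound 7/10 is what makes the
later polynomial inequalities in `cosN N` provable on a single interval (7/10, 1). -/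
theorem cosN_gt (hN : 4 ≤ N) : 7 / 10 < cosN N := by
  have hN' : (4 : ℝ) ≤ N := by exact_mod_cast hN
  have h : Real.cos (Real.pi / 4) ≤ Real.cos (Real.pi / N) := by
    apply Real.cos_le_cos_of_nonneg_of_le_pi
    · positivity
    · have := Real.pi_pos; linarith
    · gcongr
  rw [Real.cos_pi_div_four] at h
  have h2 : (7 / 5 : ℝ) < √2 := by
    rw [Real.lt_sqrt (by norm_num)]; norm_num
  simp only [cosN]; linarith

theorem sinN_pos (hN : 4 ≤ N) : 0 < sinN N := by
  have hN' : (4 : ℝ) ≤ N := by exact_mod_cast hN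
  apply Real.sin_pos_of_pos_of_lt_pi
  · have := Real.pi_pos; positivity
  · rw [div_lt_iff₀ (by linarith)]
    have := Real.pi_pos; nlinarith

theorem cosN_lt_one (hN : 4 ≤ N) : cosN N < 1 := by
  have h1 := sinN_pos hN
  have h2 := sinN_sq N
  nlinarith [sq_nonneg (cosN N - 1)]

theorem mu1_eq (hN : 4 ≤ N) : mu1 N = Real.pi - 3 * (Real.pi / N) := by
  have : (N : ℝ) ≠ 0 := by positivity
  simp only [mu1]; field_simp

theorem mu2_eq (hN : 4 ≤ N) : mu2 N = Real.pi - Real.pi / N := by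
  have : (N : ℝ) ≠ 0 := by positivity
  simp only [mu2]; field_simp

theorem c1_eq (hN : 4 ≤ N) : c1 N = -(4 * cosN N ^ 3 - 3 * cosN N) := by
  rw [c1, mu1_eq hN, Real.cos_pi_sub, Real.cos_three_mul, cosN]

theorem c2_eq (hN : 4 ≤ N) : c2 N = -cosN N := by
  rw [c2, mu2_eq hN, Real.cos_pi_sub, cosN]

theorem s1_eq (hN : 4 ≤ N) : s1 N = sinN N * (4 * cosN N ^ 2 - 1) := by
  have h : s1 N = 3 * sinN N - 4 * sinN N ^ 3 := by
    rw [s1, mu1_eq hN, Real.sin_pi_sub, Real.sin_three_mul, sinN]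
  rw [h]
  linear_combination (-4 * sinN N) * sinN_sq N

theorem s2_eq (hN : 4 ≤ N) : s2 N = sinN N := by
  rw [s2, mu2_eq hN, Real.sin_pi_sub, sinN]

theorem cc1_eq (hN : 4 ≤ N) : cc1 N = (1 + cosN N) * (2 * cosN N - 1) ^ 2 := by
  rw [cc1, c1_eq hN]; ring

theorem cc2_eq (hN : 4 ≤ N) : cc2 N = 1 + cosN N := by
  rw [cc2, c2_eq hN]; ring

/-- The denominator of `L1` and `L2` is `(1 + x)` times this polynomial in `x = cos (π / N)`. -/
def den (x : ℝ) : ℝ := 3 + (2 - x) * (2 * x - 1) ^ 2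

theorem den_pos {x : ℝ} (hx : x < 1) : 0 < den x := by
  have : 0 ≤ (2 - x) * (2 * x - 1) ^ 2 := mul_nonneg (by linarith) (sq_nonneg _)
  simp only [den]; linarith

theorem denominator_eq (hN : 4 ≤ N) :
    -(cc1 N * cc2 N) + 3 * (cc1 N + cc2 N) = (1 + cosN N) * den (cosN N) := by
  rw [cc1_eq hN, cc2_eq hN, den]; ring

theorem L1_eq (hN : 4 ≤ N) :
    L1 N = ((4 + cosN N) * (2 * cosN N - 1) ^ 2 - 3) / den (cosN N) := by
  have h1 := den_pos (cosN_lt_one hN)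
  have h2 := cosN_gt hN
  rw [L1, denominator_eq hN, div_eq_div_iff (by positivity) h1.ne', cc1_eq hN, cc2_eq hN]
  ring

theorem L2_eq (hN : 4 ≤ N) :
    L2 N = (3 - (2 - cosN N) * (2 * cosN N - 1) ^ 2) / den (cosN N) := by
  have h1 := den_pos (cosN_lt_one hN)
  have h2 := cosN_gt hN
  rw [L2, denominator_eq hN, div_eq_div_iff (by positivity) h1.ne', cc1_eq hN, cc2_eq hN]
  ring

theorem s1_pos (hN : 4 ≤ N) : 0 < s1 N := by
  rw [s1_eq hN]
  have := cosN_gt hN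
  exact mul_pos (sinN_pos hN) (by nlinarith)

theorem s2_pos (hN : 4 ≤ N) : 0 < s2 N := by
  rw [s2_eq hN]; exact sinN_pos hN

theorem cc1_pos (hN : 4 ≤ N) : 0 < cc1 N := by
  rw [cc1_eq hN]
  have := cosN_gt hN
  have h : 0 < 2 * cosN N - 1 := by linarith
  positivity

theorem cc2_pos (hN : 4 ≤ N) : 0 < cc2 N := by
  rw [cc2_eq hN]
  have := cosN_gt hN
  linarith

theorem cc1_lt_cc2 (hN : 4 ≤ N) : cc1 N < cc2 N := by
  rw [cc1_eq hN, cc2_eq hN]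
  have h1 := cosN_gt hN
  have h2 := cosN_lt_one hN
  have : (2 * cosN N - 1) ^ 2 < 1 := by nlinarith
  nlinarith

theorem r1_eq (N : ℕ) : r1 N = 2 * cc1 N ^ 2 / (s1 N * (cc2 N - cc1 N)) := by
  simp only [r1, cc1, cc2]; congr 1 <;> ring

theorem r2_eq (N : ℕ) : r2 N = -(2 * cc2 N ^ 2 / (s2 N * (cc2 N - cc1 N))) := by
  simp only [r2, cc1, cc2]; rw [← div_neg]; congr 1 <;> ring

theorem r1_pos (hN : 4 ≤ N) : 0 < r1 N := by
  have h1 := cc1_pos hN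
  have h2 := sub_pos.2 (cc1_lt_cc2 hN)
  have h3 := s1_pos hN
  rw [r1_eq]; positivity

theorem r2_neg (hN : 4 ≤ N) : r2 N < 0 := by
  have h1 := cc2_pos hN
  have h2 := sub_pos.2 (cc1_lt_cc2 hN)
  have h3 := s2_pos hN
  rw [r2_eq, neg_lt_zero]; positivity

theorem pairing_apply (N : ℕ) (x y : V) :
    pairing N x y = r2 N * (x 0 * y 1 - x 1 * y 0) + r1 N * (x 2 * y 3 - x 3 * y 2) := by
  simp [pairing, J, dotProduct, Matrix.mulVec, Fin.sum_univ_four]; ring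

end

/-! ### The topology of the Lagrangian Grassmannian -/

section

variable {N : ℕ}

theorem pairing_neg_left (N : ℕ) (x y : V) : pairing N (-x) y = -pairing N x y := by
  simpa using pairing_smul_left N (-1) x y

theorem pairing_neg_right (N : ℕ) (x y : V) : pairing N x (-y) = -pairing N x y := by
  simpa using pairing_smul_right N (-1) x y

theorem continuous_pairing (N : ℕ) : Continuous fun p : V × V => pairing N p.1 p.2 := by
  simp only [pairing_apply]; fun_prop

/-- The symplectic pairing as a bilinear form. -/
def pairingForm (N : ℕ) : LinearMap.BilinForm ℝ V :=
  LinearMap.mk₂ ℝ (pairing N) (pairing_add_left N) (pairing_smul_left N)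
    (pairing_add_right N) (pairing_smul_right N)

theorem eq_zero_of_pairing (hN : 4 ≤ N) {x : V} (h : ∀ y, pairing N x y = 0) : x = 0 := by
  have h1 := (r1_pos hN).ne'
  have h2 := (r2_neg hN).ne
  have e0 := h (Pi.single 0 1)
  have e1 := h (Pi.single 1 1)
  have e2 := h (Pi.single 2 1)
  have e3 := h (Pi.single 3 1)
  simp [pairing_apply, h1, h2] at e0 e1 e2 e3
  ext i
  fin_cases i <;> simp [e0, e1, e2, e3]

/-- By nondegeneracy L^⊥ has dimension 4 - 2 = 2, and it contains L, so L = L^⊥. -/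
theorem LGr.mem_of_pairing (hN : 4 ≤ N) (L : LGr N) {x : V}
    (h : ∀ y ∈ L.1, pairing N y x = 0) : x ∈ L.1 := by
  have hrefl : (pairingForm N).IsRefl := fun a b hab => by
    change pairing N b a = 0
    rw [pairing_swap]
    change pairing N a b = 0 at hab
    rw [hab, neg_zero]
  have hnd : (pairingForm N).Nondegenerate :=
    hrefl.nondegenerate_iff_separatingLeft.2 fun a ha => eq_zero_of_pairing hN ha
  have hfr := LinearMap.BilinForm.finrank_orthogonal hnd L.1
  rw [L.2.1] at hfr
  have hle : L.1 ≤ (pairingForm N).orthogonal L.1 := fun a ha b hb => L.2.2 b hb a ha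
  have heq := Submodule.eq_of_le_of_finrank_eq hle (by rw [hfr, L.2.1]; simp)
  rw [heq]
  exact fun b hb => h b hb

theorem LagFrame.mem_span (hN : 4 ≤ N) (p : LagFrame N) (x : V) :
    x ∈ p.span.1 ↔ pairing N p.1.1 x = 0 ∧ pairing N p.1.2 x = 0 := by
  have m1 : p.1.1 ∈ p.span.1 := Submodule.subset_span (Or.inl rfl)
  have m2 : p.1.2 ∈ p.span.1 := Submodule.subset_span (Or.inr rfl)
  constructor
  · exact fun h => ⟨p.span.2.2 _ m1 _ h, p.span.2.2 _ m2 _ h⟩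
  · rintro ⟨h1, h2⟩
    apply LGr.mem_of_pairing hN
    intro y hy
    obtain ⟨a, b, rfl⟩ := Submodule.mem_span_pair.1 hy
    rw [pairing_add_left, pairing_smul_left, pairing_smul_left, h1, h2]; ring

theorem LGr.isOpen_iff {U : Set (LGr N)} : IsOpen U ↔ IsOpen (LagFrame.span ⁻¹' U) :=
  isOpen_coinduced

theorem LagFrame.continuous_span : Continuous (LagFrame.span (N := N)) := continuous_coinduced_rng

/-- The Lagrangians that meet a set of vectors. -/
def hit (N : ℕ) (S : Set V) : Set (LGr N) := {L | ∃ x ∈ S, x ∈ L.1}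

theorem hit_mono {S S' : Set V} (h : S ⊆ S') : hit N S ⊆ hit N S' :=
  fun _ ⟨x, hx, hL⟩ => ⟨x, h hx, hL⟩

/-- For fixed coefficients a, b the condition on the frame is open; the preimage in the space of
frames is the union over all a, b. -/
theorem isOpen_hit {S : Set V} (hS : IsOpen S) : IsOpen (hit N S) := by
  rw [LGr.isOpen_iff]
  have : LagFrame.span ⁻¹' (hit N S) =
      ⋃ (a : ℝ) (b : ℝ), {p : LagFrame N | a • p.1.1 + b • p.1.2 ∈ S} := by
    ext p
    simp only [Set.mem_preimage, hit, Set.mem_ofPred_eq, Set.mem_iUnion]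
    constructor
    · rintro ⟨x, hx, hL⟩
      obtain ⟨a, b, rfl⟩ := Submodule.mem_span_pair.1 hL
      exact ⟨a, b, hx⟩
    · rintro ⟨a, b, h⟩
      exact ⟨_, h, Submodule.mem_span_pair.2 ⟨a, b, rfl⟩⟩
  rw [this]
  exact isOpen_iUnion fun a => isOpen_iUnion fun b => hS.preimage (by fun_prop)

/-- Since L = L^⊥, incidence of a vector and a frame is a closed condition, and the projection along
a compact factor is a closed map. -/
theorem isClosed_hit (hN : 4 ≤ N) {Q : Set V} (hQ : IsCompact Q) : IsClosed (hit N Q) := by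
  rw [← isOpen_compl_iff, LGr.isOpen_iff, Set.preimage_compl, isOpen_compl_iff]
  have : LagFrame.span ⁻¹' (hit N Q) = Prod.fst ''
      {z : LagFrame N × Q | pairing N z.1.1.1 z.2 = 0 ∧ pairing N z.1.1.2 z.2 = 0} := by
    ext p
    simp only [Set.mem_preimage, hit, Set.mem_ofPred_eq, Set.mem_image, LagFrame.mem_span hN]
    constructor
    · rintro ⟨x, hx, h⟩
      exact ⟨(p, ⟨x, hx⟩), h, rfl⟩
    · rintro ⟨⟨p', x⟩, h, rfl⟩
      exact ⟨x, x.2, h⟩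
  rw [this]
  have := isCompact_iff_compactSpace.1 hQ
  apply isClosedMap_fst_of_compactSpace
  have hc := continuous_pairing N
  exact (isClosed_eq (hc.comp (by fun_prop : Continuous fun z : LagFrame N × Q =>
    ((z.1.1.1, (z.2 : V)) : V × V))) continuous_const).inter
    (isClosed_eq (hc.comp (by fun_prop : Continuous fun z : LagFrame N × Q =>
    ((z.1.1.2, (z.2 : V)) : V × V))) continuous_const)

/-! ### The action of the group on Lagrangians. -/

theorem mem_smul_iff (g : GSp N) (L : LGr N) (x : V) :
    x ∈ (g • L).1 ↔ ∃ y ∈ L.1, toMat g *ᵥ y = x := by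
  change x ∈ L.1.map (Matrix.mulVecLin (toMat g)) ↔ _
  simp [Submodule.mem_map]

theorem mulVec_mem_smul {g : GSp N} {L : LGr N} {x : V} (h : x ∈ L.1) :
    toMat g *ᵥ x ∈ (g • L).1 := (mem_smul_iff _ _ _).2 ⟨x, h, rfl⟩

theorem toMat_mul (g h : GSp N) : toMat (g * h) = toMat g * toMat h := rfl

theorem toMat_mulVec_mulVec (g h : GSp N) (x : V) :
    toMat g *ᵥ (toMat h *ᵥ x) = toMat (g * h) *ᵥ x := by
  rw [toMat_mul, Matrix.mulVec_mulVec]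

theorem toMat_one : toMat (1 : GSp N) = 1 := rfl

theorem toMat_inv_mulVec (g : GSp N) (x : V) : toMat g⁻¹ *ᵥ (toMat g *ᵥ x) = x := by
  rw [toMat_mulVec_mulVec, inv_mul_cancel, toMat_one, Matrix.one_mulVec]

theorem mem_inv_smul_iff (g : GSp N) (L : LGr N) (x : V) :
    x ∈ (g⁻¹ • L).1 ↔ toMat g *ᵥ x ∈ L.1 := by
  constructor
  · intro h
    have := mulVec_mem_smul (g := g) h
    rwa [smul_inv_smul] at this
  · intro h
    have := mulVec_mem_smul (g := g⁻¹) h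
    rwa [toMat_inv_mulVec] at this

theorem smul_hit (g : GSp N) {S : Set V} {L : LGr N} :
    g • L ∈ hit N ((toMat g *ᵥ ·) '' S) ↔ L ∈ hit N S := by
  constructor
  · rintro ⟨_, ⟨x, hx, rfl⟩, hL⟩
    refine ⟨x, hx, ?_⟩
    have := (mem_inv_smul_iff g (g • L) x).2 hL
    rwa [inv_smul_smul] at this
  · rintro ⟨x, hx, hL⟩
    exact ⟨_, ⟨x, hx, rfl⟩, mulVec_mem_smul hL⟩

instance : ContinuousConstSMul (GSp N) (LGr N) where
  continuous_const_smul g := by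
    rw [continuous_coinduced_dom]
    have hmem : ∀ p : LagFrame N, LinearIndependent ℝ ![toMat g *ᵥ p.1.1, toMat g *ᵥ p.1.2] ∧
        pairing N (toMat g *ᵥ p.1.1) (toMat g *ᵥ p.1.2) = 0 := by
      intro p
      constructor
      · have h := p.2.1.map' (Matrix.mulVecLin (toMat g))
          (LinearMap.ker_eq_bot.2 (toMat_injective g))
        have he : ![toMat g *ᵥ p.1.1, toMat g *ᵥ p.1.2] =
            Matrix.mulVecLin (toMat g) ∘ ![p.1.1, p.1.2] := by
          funext i; fin_cases i <;> rfl
        rw [he]; exact h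
      · obtain ⟨χ, h⟩ := toMat_pairing g
        rw [h, p.2.2, mul_zero]
    let F : LagFrame N → LagFrame N := fun p => ⟨(toMat g *ᵥ p.1.1, toMat g *ᵥ p.1.2), hmem p⟩
    have hF : Continuous F := by
      apply Continuous.subtype_mk
      exact (Continuous.matrix_mulVec continuous_const (by fun_prop)).prodMk
        (Continuous.matrix_mulVec continuous_const (by fun_prop))
    have : (fun L : LGr N => g • L) ∘ LagFrame.span = LagFrame.span ∘ F := by
      funext p
      apply Subtype.ext
      change (Submodule.span ℝ {p.1.1, p.1.2}).map (Matrix.mulVecLin (toMat g)) =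
        Submodule.span ℝ {toMat g *ᵥ p.1.1, toMat g *ᵥ p.1.2}
      rw [Submodule.map_span, Set.image_pair]
      rfl
    rw [this]
    exact LagFrame.continuous_span.comp hF

theorem exists_pairing_ne (hN : 4 ≤ N) {x : V} (hx : x ≠ 0) : ∃ z, pairing N x z ≠ 0 := by
  by_contra! h
  exact hx (eq_zero_of_pairing hN h)

theorem LGr.exists_frame_of_mem (L : LGr N) {x : V} (hx : x ∈ L.1) (hx0 : x ≠ 0) :
    ∃ y, LinearIndependent ℝ ![x, y] ∧ pairing N x y = 0 ∧ L.1 = Submodule.span ℝ {x, y} := by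
  obtain ⟨y, hy, hxy⟩ : ∃ y ∈ L.1, y ∉ Submodule.span ℝ {x} := by
    by_contra! h
    have hle : L.1 ≤ Submodule.span ℝ {x} := h
    have h1 := Submodule.finrank_mono hle
    rw [L.2.1, finrank_span_singleton hx0] at h1
    omega
  have hli : LinearIndependent ℝ ![x, y] := by
    rw [LinearIndependent.pair_iff' hx0]
    intro a ha
    exact hxy (ha ▸ Submodule.smul_mem _ _ (Submodule.mem_span_singleton_self x))
  refine ⟨y, hli, L.2.2 x hx y hy, ?_⟩
  symm
  apply Submodule.eq_of_le_of_finrank_eq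
  · rw [Submodule.span_le]
    rintro _ (rfl | rfl) <;> assumption
  · exact (LagFrame.span ⟨(x, y), hli, L.2.2 x hx y hy⟩).2.1.trans L.2.1.symm

/-- Complete x to a frame (x, y) of L. For x' in S near x, correct y along a fixed z with ⟨x, z⟩ ≠ 0
so that it is orthogonal to x'; this gives Lagrangians through x' that tend to L. -/
theorem mem_closure_hit (hN : 4 ≤ N) {S : Set V} {x : V} (hx0 : x ≠ 0) (hx : x ∈ closure S)
    {L : LGr N} (hL : x ∈ L.1) : L ∈ closure (hit N S) := by
  obtain ⟨y, hli, hxy, hspan⟩ := L.exists_frame_of_mem hL hx0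
  obtain ⟨z, hz⟩ := exists_pairing_ne hN hx0
  let F : V → V × V := fun x' => (x', y - (pairing N x' y / pairing N x' z) • z)
  have hcy : ∀ w, Continuous fun x' => pairing N x' w := fun w =>
    (continuous_pairing N).comp (by fun_prop : Continuous fun x' : V => (x', w))
  have hF : ContinuousAt F x := by
    have h : ContinuousAt (fun x' => pairing N x' y / pairing N x' z) x :=
      (hcy y).continuousAt.div (hcy z).continuousAt hz
    fun_prop
  have hFx : F x = (x, y) := by simp [F, hxy]
  rw [mem_closure_iff]
  intro U hU hLU
  rw [LGr.isOpen_iff] at hU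
  obtain ⟨W, hW, hWU⟩ := isOpen_induced_iff.1 hU
  let p₀ : LagFrame N := ⟨(x, y), hli, hxy⟩
  have hp₀ : p₀.span = L := Subtype.ext hspan.symm
  have hp₀W : (x, y) ∈ W := by
    have : p₀ ∈ Subtype.val ⁻¹' W := by rw [hWU]; change p₀.span ∈ U; rwa [hp₀]
    exact this
  have hI : IsOpen {p : V × V | LinearIndependent ℝ ![p.1, p.2]} :=
    (isOpen_setOfPred_linearIndependent (𝕜 := ℝ) (E := V) (ι := Fin 2)).preimage
      (f := fun p : V × V => ![p.1, p.2]) (by fun_prop)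
  have e1 : ∀ᶠ x' in nhds x, F x' ∈ W := hF (hW.mem_nhds (by rwa [hFx]))
  have e2 : ∀ᶠ x' in nhds x, LinearIndependent ℝ ![(F x').1, (F x').2] :=
    hF (hI.mem_nhds (by rw [hFx]; exact hli))
  have e3 : ∀ᶠ x' in nhds x, pairing N x' z ≠ 0 := (hcy z).continuousAt.eventually_ne hz
  obtain ⟨x', hx'S, h1, h2, h3⟩ :=
    ((mem_closure_iff_frequently.1 hx).and_eventually (e1.and (e2.and e3))).exists
  have hpair : pairing N (F x').1 (F x').2 = 0 := by
    simp only [F, sub_eq_add_neg, pairing_add_right, pairing_neg_right, pairing_smul_right]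
    field_simp
    ring
  let p : LagFrame N := ⟨F x', h2, hpair⟩
  refine ⟨p.span, ?_, x', hx'S, Submodule.subset_span (Or.inl rfl)⟩
  have : p ∈ Subtype.val ⁻¹' W := h1
  rwa [hWU] at this

end

/-! ### Crooked surfaces and simplicial cones -/

section

variable {N : ℕ}

/-- The vector with the given coordinates with respect to the vertices of a tetrahedron. -/
def Tetra.vec (t : Tetra) (a b c d : ℝ) : V := a • t.e₁ + b • t.f₁ + c • t.e₂ + d • t.f₂

/-- The vertices form a symplectic basis, up to the factor `ω`. -/
structure Tetra.IsSymplectic (N : ℕ) (t : Tetra) (ω : ℝ) : Prop where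
  ne_zero : ω ≠ 0
  e₁_f₁ : pairing N t.e₁ t.f₁ = ω
  e₂_f₂ : pairing N t.e₂ t.f₂ = ω
  e₁_e₂ : pairing N t.e₁ t.e₂ = 0
  e₁_f₂ : pairing N t.e₁ t.f₂ = 0
  e₂_f₁ : pairing N t.e₂ t.f₁ = 0
  f₁_f₂ : pairing N t.f₁ t.f₂ = 0

/-- The tetrahedron whose `f`-vertices have the opposite signs. -/
def Tetra.flip (t : Tetra) : Tetra := ⟨t.e₁, -t.f₁, t.e₂, -t.f₂⟩

/-- The closed simplicial cone spanned by the vertices. -/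
def Tetra.cone (t : Tetra) : Set V :=
  {v | ∃ a b c d : ℝ, 0 ≤ a ∧ 0 ≤ b ∧ 0 ≤ c ∧ 0 ≤ d ∧ v = t.vec a b c d}

/-- The Lagrangians that meet the closed cone in a nonzero vector. -/
def Tetra.coneHit (N : ℕ) (t : Tetra) : Set (LGr N) := hit N {x | x ∈ t.cone ∧ x ≠ 0}

theorem Tetra.vec_add (t : Tetra) (a b c d a' b' c' d' : ℝ) :
    t.vec a b c d + t.vec a' b' c' d' = t.vec (a + a') (b + b') (c + c') (d + d') := by
  simp only [Tetra.vec]; module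

theorem Tetra.smul_vec (t : Tetra) (k a b c d : ℝ) :
    k • t.vec a b c d = t.vec (k * a) (k * b) (k * c) (k * d) := by
  simp only [Tetra.vec]; module

theorem Tetra.neg_vec (t : Tetra) (a b c d : ℝ) :
    -t.vec a b c d = t.vec (-a) (-b) (-c) (-d) := by
  simp only [Tetra.vec]; module

theorem Tetra.vec_zero (t : Tetra) : t.vec 0 0 0 0 = 0 := by simp [Tetra.vec]

theorem Tetra.flip_vec (t : Tetra) (a b c d : ℝ) :
    t.flip.vec a b c d = t.vec a (-b) c (-d) := by
  simp only [Tetra.vec, Tetra.flip]; module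

theorem Tetra.flip_flip (t : Tetra) : t.flip.flip = t := by
  simp [Tetra.flip]

theorem Tetra.vec_mem_interiorCone (t : Tetra) {a b c d : ℝ} (ha : 0 < a) (hb : 0 < b)
    (hc : 0 < c) (hd : 0 < d) : t.vec a b c d ∈ t.interiorCone :=
  ⟨a, b, c, d, ha, hb, hc, hd, rfl⟩

theorem Tetra.interiorCone_subset_cone (t : Tetra) : t.interiorCone ⊆ t.cone := by
  rintro _ ⟨a, b, c, d, ha, hb, hc, hd, rfl⟩
  exact ⟨a, b, c, d, ha.le, hb.le, hc.le, hd.le, rfl⟩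

namespace Tetra.IsSymplectic

variable {t : Tetra} {ω : ℝ}

theorem flip (ht : t.IsSymplectic N ω) : t.flip.IsSymplectic N (-ω) where
  ne_zero := neg_ne_zero.2 ht.ne_zero
  e₁_f₁ := by simp [Tetra.flip, pairing_neg_right, ht.e₁_f₁]
  e₂_f₂ := by simp [Tetra.flip, pairing_neg_right, ht.e₂_f₂]
  e₁_e₂ := by simp [Tetra.flip, ht.e₁_e₂]
  e₁_f₂ := by simp [Tetra.flip, pairing_neg_right, ht.e₁_f₂]
  e₂_f₁ := by simp [Tetra.flip, pairing_neg_right, ht.e₂_f₁]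
  f₁_f₂ := by simp [Tetra.flip, pairing_neg_right, pairing_neg_left, ht.f₁_f₂]

theorem pairing_vec (ht : t.IsSymplectic N ω) (a b c d a' b' c' d' : ℝ) :
    pairing N (t.vec a b c d) (t.vec a' b' c' d') = ω * (a * b' - b * a' + c * d' - d * c') := by
  have h1 := pairing_swap N t.f₁ t.e₁
  have h2 := pairing_swap N t.f₂ t.e₂
  have h3 := pairing_swap N t.e₂ t.e₁
  have h4 := pairing_swap N t.f₂ t.e₁
  have h5 := pairing_swap N t.f₁ t.e₂
  have h6 := pairing_swap N t.f₂ t.f₁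
  simp only [Tetra.vec, pairing_add_left, pairing_add_right, pairing_smul_left,
    pairing_smul_right, pairing_self, h1, h2, h3, h4, h5, h6, ht.e₁_f₁, ht.e₂_f₂, ht.e₁_e₂,
    ht.e₁_f₂, ht.e₂_f₁, ht.f₁_f₂]
  ring

theorem vec_inj (ht : t.IsSymplectic N ω) {a b c d a' b' c' d' : ℝ}
    (h : t.vec a b c d = t.vec a' b' c' d') : a = a' ∧ b = b' ∧ c = c' ∧ d = d' := by
  have h0 := ht.ne_zero
  have k : ∀ p q r s : ℝ, a * q - b * p + c * s - d * r = a' * q - b' * p + c' * s - d' * r := by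
    intro p q r s
    have := congrArg (fun z => pairing N z (t.vec p q r s)) h
    simp only [ht.pairing_vec] at this
    exact mul_left_cancel₀ h0 this
  have k1 := k 0 1 0 0
  have k2 := k 1 0 0 0
  have k3 := k 0 0 0 1
  have k4 := k 0 0 1 0
  refine ⟨?_, ?_, ?_, ?_⟩ <;> linarith

theorem vec_eq_zero (ht : t.IsSymplectic N ω) {a b c d : ℝ} (h : t.vec a b c d = 0) :
    a = 0 ∧ b = 0 ∧ c = 0 ∧ d = 0 := ht.vec_inj (h.trans t.vec_zero.symm)

theorem exists_vec (ht : t.IsSymplectic N ω) (x : V) : ∃ a b c d, x = t.vec a b c d := by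
  have hli : LinearIndependent ℝ ![t.e₁, t.f₁, t.e₂, t.f₂] := by
    rw [Fintype.linearIndependent_iff]
    intro g hg
    rw [Fin.sum_univ_four] at hg
    obtain ⟨h0, h1, h2, h3⟩ := ht.vec_eq_zero (a := g 0) (b := g 1) (c := g 2) (d := g 3) hg
    intro i; fin_cases i <;> assumption
  have htop := hli.span_eq_top_of_card_eq_finrank (by simp)
  have hx : x ∈ Submodule.span ℝ (Set.range ![t.e₁, t.f₁, t.e₂, t.f₂]) := by
    rw [htop]; trivial
  obtain ⟨g, hg⟩ := (Submodule.mem_span_range_iff_exists_fun ℝ).1 hx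
  rw [Fin.sum_univ_four] at hg
  exact ⟨g 0, g 1, g 2, g 3, hg.symm⟩

/-- In a symplectic basis a coordinate is the pairing with the conjugate vertex divided by ω, so the
open cone is cut out by four strict linear inequalities. -/
theorem mem_interiorCone (ht : t.IsSymplectic N ω) (x : V) :
    x ∈ t.interiorCone ↔ 0 < pairing N x t.f₁ / ω ∧ 0 < pairing N t.e₁ x / ω ∧
      0 < pairing N x t.f₂ / ω ∧ 0 < pairing N t.e₂ x / ω := by
  obtain ⟨a, b, c, d, rfl⟩ := ht.exists_vec x
  have h0 := ht.ne_zero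
  have e1 : t.e₁ = t.vec 1 0 0 0 := by simp [Tetra.vec]
  have e2 : t.e₂ = t.vec 0 0 1 0 := by simp [Tetra.vec]
  have f1 : t.f₁ = t.vec 0 1 0 0 := by simp [Tetra.vec]
  have f2 : t.f₂ = t.vec 0 0 0 1 := by simp [Tetra.vec]
  have k1 : pairing N (t.vec a b c d) t.f₁ / ω = a := by
    rw [f1, ht.pairing_vec]; field_simp; ring
  have k2 : pairing N t.e₁ (t.vec a b c d) / ω = b := by
    rw [e1, ht.pairing_vec]; field_simp; ring
  have k3 : pairing N (t.vec a b c d) t.f₂ / ω = c := by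
    rw [f2, ht.pairing_vec]; field_simp; ring
  have k4 : pairing N t.e₂ (t.vec a b c d) / ω = d := by
    rw [e2, ht.pairing_vec]; field_simp; ring
  rw [k1, k2, k3, k4]
  constructor
  · rintro ⟨a', b', c', d', ha, hb, hc, hd, h⟩
    obtain ⟨rfl, rfl, rfl, rfl⟩ := ht.vec_inj h
    exact ⟨ha, hb, hc, hd⟩
  · rintro ⟨ha, hb, hc, hd⟩
    exact t.vec_mem_interiorCone ha hb hc hd

theorem isOpen_interiorCone (ht : t.IsSymplectic N ω) : IsOpen t.interiorCone := by
  have : t.interiorCone = {x | 0 < pairing N x t.f₁ / ω ∧ 0 < pairing N t.e₁ x / ω ∧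
      0 < pairing N x t.f₂ / ω ∧ 0 < pairing N t.e₂ x / ω} := Set.ext ht.mem_interiorCone
  rw [this]
  have hl : ∀ w, Continuous fun x => pairing N x w / ω := fun w =>
    ((continuous_pairing N).comp (by fun_prop : Continuous fun x : V => (x, w))).div_const ω
  have hr : ∀ w, Continuous fun x => pairing N w x / ω := fun w =>
    ((continuous_pairing N).comp (by fun_prop : Continuous fun x : V => (w, x))).div_const ω
  exact (isOpen_lt continuous_const (hl _)).inter ((isOpen_lt continuous_const (hr _)).inter
    ((isOpen_lt continuous_const (hl _)).inter (isOpen_lt continuous_const (hr _))))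

theorem _root_.CyclotomicCones.Tetra.convex_interiorCone (t : Tetra) : Convex ℝ t.interiorCone := by
  rintro _ ⟨a, b, c, d, ha, hb, hc, hd, rfl⟩ _ ⟨a', b', c', d', ha', hb', hc', hd', rfl⟩ p q hp hq hpq
  have key : ∀ u w : ℝ, 0 < u → 0 < w → 0 < p * u + q * w := by
    intro u w hu hw
    rcases hp.eq_or_lt with rfl | hp'
    · have : q = 1 := by linarith
      subst this; linarith
    · have : 0 ≤ q * w := by positivity
      have : 0 < p * u := by positivity
      linarith
  refine ⟨_, _, _, _, key a a' ha ha', key b b' hb hb', key c c' hc hc', key d d' hd hd', ?_⟩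
  module

theorem mem_interiorCone_of_ne (ht : t.IsSymplectic N ω) {x : V} (hx : x ∈ t.interiorCone) :
    x ≠ 0 := by
  rintro rfl
  obtain ⟨a, b, c, d, ha, hb, hc, hd, h⟩ := hx
  exact ha.ne' (ht.vec_eq_zero (h.symm : t.vec a b c d = 0)).1

/-- A Lagrangian that misses the interior of the cone meets the flipped cone. -/
theorem coneHit_flip_of_notMem (hN : 4 ≤ N) (ht : t.IsSymplectic N ω) {L : LGr N}
    (hL : L ∉ hit N t.interiorCone) : L ∈ t.flip.coneHit N := by
  have hdisj : Disjoint t.interiorCone (L.1 : Set V) := by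
    rw [Set.disjoint_left]
    exact fun x hx hxL => hL ⟨x, hx, hxL⟩
  -- A separating functional is bounded below on the subspace L, hence vanishes there, and is
  -- negative on the open cone.
  obtain ⟨f, u, h1, h2⟩ := geometric_hahn_banach_open t.convex_interiorCone
    ht.isOpen_interiorCone L.1.convex hdisj
  have hu : u ≤ 0 := by simpa using h2 0 L.1.zero_mem
  have hf : ∀ x ∈ L.1, f x = 0 := by
    intro x hx
    by_contra hne
    have := h2 (((u - 1) / f x) • x) (L.1.smul_mem _ hx)
    rw [map_smul, smul_eq_mul, div_mul_cancel₀ _ hne] at this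
    linarith
  have hvec : ∀ a b c d, f (t.vec a b c d) =
      a * f t.e₁ + b * f t.f₁ + c * f t.e₂ + d * f t.f₂ := by
    intro a b c d; simp [Tetra.vec]
  have hneg : ∀ a b c d : ℝ, 0 < a → 0 < b → 0 < c → 0 < d →
      a * f t.e₁ + b * f t.f₁ + c * f t.e₂ + d * f t.f₂ < 0 := by
    intro a b c d ha hb hc hd
    rw [← hvec]
    exact (h1 _ (t.vec_mem_interiorCone ha hb hc hd)).trans_le hu
  -- Letting one coefficient grow shows that f is nonpositive on the corresponding vertex.
  have aux : ∀ P Q : ℝ, (∀ a : ℝ, 0 < a → a * P + Q < 0) → P ≤ 0 := by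
    intro P Q h
    by_contra! hP
    have := h ((|Q| + 1) / P) (by positivity)
    rw [div_mul_cancel₀ _ hP.ne'] at this
    have := neg_abs_le Q
    linarith
  have he1 : f t.e₁ ≤ 0 := aux _ (f t.f₁ + f t.e₂ + f t.f₂) fun a ha => by
    have := hneg a 1 1 1 ha one_pos one_pos one_pos; linarith
  have hf1 : f t.f₁ ≤ 0 := aux _ (f t.e₁ + f t.e₂ + f t.f₂) fun a ha => by
    have := hneg 1 a 1 1 one_pos ha one_pos one_pos; linarith
  have he2 : f t.e₂ ≤ 0 := aux _ (f t.f₁ + f t.e₁ + f t.f₂) fun a ha => by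
    have := hneg 1 1 a 1 one_pos one_pos ha one_pos; linarith
  have hf2 : f t.f₂ ≤ 0 := aux _ (f t.f₁ + f t.e₁ + f t.e₂) fun a ha => by
    have := hneg 1 1 1 a one_pos one_pos one_pos ha; linarith
  -- This vector represents f through the symplectic form, up to the factor ω. As f vanishes on L,
  -- it lies in L^⊥ = L, and its coordinates in the flipped basis are the values of -f on the
  -- vertices.
  refine ⟨t.vec (-f t.f₁) (f t.e₁) (-f t.f₂) (f t.e₂), ⟨⟨-f t.f₁, -f t.e₁, -f t.f₂, -f t.e₂,
    by linarith, by linarith, by linarith, by linarith, ?_⟩, ?_⟩, ?_⟩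
  · rw [t.flip_vec]; simp
  · intro h
    obtain ⟨k1, k2, k3, k4⟩ := ht.vec_eq_zero h
    have := hneg 1 1 1 1 one_pos one_pos one_pos one_pos
    linarith
  · apply L.mem_of_pairing hN
    intro x hx
    have hx0 := hf x hx
    obtain ⟨a, b, c, d, rfl⟩ := ht.exists_vec x
    rw [hvec] at hx0
    rw [ht.pairing_vec]
    linear_combination ω * hx0

/-- The four terms of the pairing of a vector of the cone with a vector of the flipped cone have the
same sign, so isotropy makes each of them zero; strict positivity on one side then kills the other
vector. -/
theorem notMem_coneHit_flip (ht : t.IsSymplectic N ω) {L : LGr N}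
    (hL : L ∈ hit N t.interiorCone) : L ∉ t.flip.coneHit N := by
  obtain ⟨_, ⟨a, b, c, d, ha, hb, hc, hd, rfl⟩, hx⟩ := hL
  rintro ⟨_, ⟨⟨a', b', c', d', ha', hb', hc', hd', rfl⟩, hne⟩, hy⟩
  have h := L.2.2 _ hx _ hy
  rw [t.flip_vec] at h hne
  have h' := (ht.pairing_vec a b c d a' (-b') c' (-d')).symm.trans h
  have h'' := (mul_eq_zero.1 h').resolve_left ht.ne_zero
  have p1 := mul_nonneg ha.le hb'
  have p2 := mul_nonneg hb.le ha'
  have p3 := mul_nonneg hc.le hd'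
  have p4 := mul_nonneg hd.le hc'
  have q1 := (mul_eq_zero.1 (by linarith : a * b' = 0)).resolve_left ha.ne'
  have q2 := (mul_eq_zero.1 (by linarith : b * a' = 0)).resolve_left hb.ne'
  have q3 := (mul_eq_zero.1 (by linarith : c * d' = 0)).resolve_left hc.ne'
  have q4 := (mul_eq_zero.1 (by linarith : d * c' = 0)).resolve_left hd.ne'
  apply hne
  rw [q1, q2, q3, q4]
  simpa using t.vec_zero

theorem compl_hit_interiorCone (hN : 4 ≤ N) (ht : t.IsSymplectic N ω) :
    (hit N t.interiorCone)ᶜ = t.flip.coneHit N :=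
  Set.ext fun _ => ⟨ht.coneHit_flip_of_notMem hN, fun h h' => ht.notMem_coneHit_flip h' h⟩

theorem compl_hit_interiorCone_flip (hN : 4 ≤ N) (ht : t.IsSymplectic N ω) :
    (hit N t.flip.interiorCone)ᶜ = t.coneHit N := by
  rw [ht.flip.compl_hit_interiorCone hN, t.flip_flip]

theorem isClosed_coneHit (hN : 4 ≤ N) (ht : t.IsSymplectic N ω) : IsClosed (t.coneHit N) := by
  rw [← ht.compl_hit_interiorCone_flip hN]
  exact (isOpen_hit ht.flip.isOpen_interiorCone).isClosed_compl

theorem closure_hit_interiorCone (hN : 4 ≤ N) (ht : t.IsSymplectic N ω) :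
    closure (hit N t.interiorCone) = t.coneHit N := by
  apply subset_antisymm
  · apply closure_minimal _ (ht.isClosed_coneHit hN)
    exact hit_mono fun x hx => ⟨t.interiorCone_subset_cone hx, ht.mem_interiorCone_of_ne hx⟩
  · rintro L ⟨x, ⟨⟨a, b, c, d, ha, hb, hc, hd, rfl⟩, hne⟩, hxL⟩
    apply mem_closure_hit hN hne _ hxL
    -- Adding ε > 0 to all four coordinates moves a vector of the closed cone into the open cone.
    have hlim : Filter.Tendsto (fun ε : ℝ => t.vec (a + ε) (b + ε) (c + ε) (d + ε))
        (nhdsWithin 0 (Set.Ioi 0)) (nhds (t.vec a b c d)) := by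
      have hc : Continuous fun ε : ℝ => t.vec (a + ε) (b + ε) (c + ε) (d + ε) := by
        simp only [Tetra.vec]; fun_prop
      simpa using (hc.tendsto 0).mono_left nhdsWithin_le_nhds
    apply mem_closure_of_tendsto hlim
    filter_upwards [self_mem_nhdsWithin] with ε (hε : 0 < ε)
    exact t.vec_mem_interiorCone (by linarith) (by linarith) (by linarith) (by linarith)

end Tetra.IsSymplectic

/-! ### Wings, stem and the two sides of a crooked surface. -/

theorem mem_wing_of_mem {p q : V} {L : LGr N} {s t : ℝ} (hs : 0 ≤ s) (ht : 0 ≤ t)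
    (hst : 0 < s + t) (h : s • p + t • q ∈ L.1) : L ∈ wing N p q := by
  simp only [wing, Set.mem_iUnion]
  refine ⟨s / (s + t), t / (s + t), ⟨by positivity, by positivity, by field_simp⟩, ?_⟩
  have := L.1.smul_mem (s + t)⁻¹ h
  change (s / (s + t)) • p + (t / (s + t)) • q ∈ L.1
  convert this using 1
  rw [smul_add, smul_smul, smul_smul, div_eq_inv_mul, div_eq_inv_mul]

theorem exists_of_mem_wing {p q : V} {L : LGr N} (h : L ∈ wing N p q) :
    ∃ s t : ℝ, 0 ≤ s ∧ 0 ≤ t ∧ s + t = 1 ∧ s • p + t • q ∈ L.1 := by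
  simp only [wing, Set.mem_iUnion] at h
  obtain ⟨s, t, ⟨hs, ht, hst⟩, h⟩ := h
  exact ⟨s, t, hs, ht, hst, h⟩

namespace Tetra.IsSymplectic

variable {t : Tetra} {ω : ℝ}

theorem mem_eWing_of_vec_mem {L : LGr N} {a c : ℝ} (ha : 0 ≤ a)
    (hc : 0 ≤ c) (hne : t.vec a 0 c 0 ≠ 0) (h : t.vec a 0 c 0 ∈ L.1) : L ∈ t.eWing N := by
  refine mem_wing_of_mem ha hc ?_ (by simpa [Tetra.vec] using h)
  by_contra! hac
  obtain rfl : a = 0 := by linarith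
  obtain rfl : c = 0 := by linarith
  exact hne t.vec_zero

theorem mem_fWing_of_vec_mem {L : LGr N} {b d : ℝ} (hb : 0 ≤ b)
    (hd : 0 ≤ d) (hne : t.vec 0 b 0 d ≠ 0) (h : t.vec 0 b 0 d ∈ L.1) : L ∈ t.fWing N := by
  refine mem_wing_of_mem hb hd ?_ (by simpa [Tetra.vec] using h)
  by_contra! hac
  obtain rfl : b = 0 := by linarith
  obtain rfl : d = 0 := by linarith
  exact hne t.vec_zero

/-- On α w₁ + β w₂, with w₁ and w₂ the two given vectors, the Maslov form equals ω (α² ab - β² cd).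
It is definite when ab and cd have opposite signs. -/
theorem mem_stem_of_vec_mem (ht : t.IsSymplectic N ω) {L : LGr N} {a b c d : ℝ}
    (hs : 0 < a * b ∧ c * d < 0 ∨ a * b < 0 ∧ 0 < c * d)
    (h₁ : t.vec a b 0 0 ∈ L.1) (h₂ : t.vec 0 0 c d ∈ L.1) : L ∈ t.stem N := by
  have hab : a * b ≠ 0 := by rcases hs with h | h; exacts [h.1.ne', h.1.ne]
  have hcd : c * d ≠ 0 := by rcases hs with h | h; exacts [h.2.ne, h.2.ne']
  have hne₁ : t.vec a b 0 0 ≠ 0 := fun h => hab (by rw [(ht.vec_eq_zero h).1, zero_mul])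
  have hne₂ : t.vec 0 0 c d ≠ 0 := fun h => hcd (by rw [(ht.vec_eq_zero h).2.2.1, zero_mul])
  have hli : LinearIndependent ℝ ![t.vec a b 0 0, t.vec 0 0 c d] := by
    rw [LinearIndependent.pair_iff' hne₁]
    intro k hk
    rw [t.smul_vec] at hk
    obtain ⟨-, -, h3, -⟩ := ht.vec_inj hk
    exact hcd (by rw [← h3]; ring)
  have hspan : L.1 = Submodule.span ℝ {t.vec a b 0 0, t.vec 0 0 c d} := by
    symm
    apply Submodule.eq_of_le_of_finrank_eq
    · rw [Submodule.span_le]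
      rintro _ (rfl | rfl) <;> assumption
    · exact (LagFrame.span ⟨(_, _), hli, L.2.2 _ h₁ _ h₂⟩).2.1.trans L.2.1.symm
  refine ⟨⟨t.vec a b 0 0, Submodule.mem_span_pair.2 ⟨a, b, by simp [Tetra.vec]⟩, t.vec 0 0 c d,
    Submodule.mem_span_pair.2 ⟨c, d, by simp [Tetra.vec]⟩, hne₁, hne₂, hspan⟩, ?_⟩
  have key : ∀ x ∈ Submodule.span ℝ {t.e₁, t.f₂}, ∀ y ∈ Submodule.span ℝ {t.e₂, t.f₁},
      x + y ∈ L.1 → x + y ≠ 0 → ∃ α β : ℝ, (α ≠ 0 ∨ β ≠ 0) ∧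
        pairing N x y = ω * (α ^ 2 * (a * b) - β ^ 2 * (c * d)) := by
    intro x hx y hy hxy hne
    obtain ⟨x1, x2, rfl⟩ := Submodule.mem_span_pair.1 hx
    obtain ⟨y1, y2, rfl⟩ := Submodule.mem_span_pair.1 hy
    rw [hspan] at hxy
    obtain ⟨α, β, h⟩ := Submodule.mem_span_pair.1 hxy
    have hx' : x1 • t.e₁ + x2 • t.f₂ = t.vec x1 0 0 x2 := by simp [Tetra.vec]
    have hy' : y1 • t.e₂ + y2 • t.f₁ = t.vec 0 y2 y1 0 := by simp [Tetra.vec, add_comm]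
    rw [hx', hy'] at h hne ⊢
    refine ⟨α, β, ?_, ?_⟩
    · by_contra! h0
      apply hne
      rw [← h, h0.1, h0.2]; simp
    rw [t.smul_vec, t.smul_vec, t.vec_add, t.vec_add] at h
    obtain ⟨k1, k2, k3, k4⟩ := ht.vec_inj h
    rw [ht.pairing_vec]
    simp only [mul_zero, zero_add, add_zero] at k1 k2 k3 k4
    rw [← k1, ← k2, ← k3, ← k4]; ring
  have hpos : ∀ α β P Q : ℝ, (α ≠ 0 ∨ β ≠ 0) → 0 < P → Q < 0 → 0 < α ^ 2 * P - β ^ 2 * Q := by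
    intro α β P Q h hP hQ
    rcases h with h | h
    · have : 0 < α ^ 2 * P := by positivity
      have : 0 ≤ β ^ 2 * (-Q) := mul_nonneg (sq_nonneg _) (by linarith)
      linarith
    · have : 0 ≤ α ^ 2 * P := by positivity
      have : 0 < β ^ 2 * (-Q) := mul_pos (by positivity) (by linarith)
      linarith
  have hdef : (0 < ω * (a * b) ∧ ω * (c * d) < 0) ∨ (ω * (a * b) < 0 ∧ 0 < ω * (c * d)) := by
    rcases lt_or_gt_of_ne ht.ne_zero with hω | hω <;> rcases hs with h | h
    · exact Or.inr ⟨mul_neg_of_neg_of_pos hω h.1, mul_pos_of_neg_of_neg hω h.2⟩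
    · exact Or.inl ⟨mul_pos_of_neg_of_neg hω h.1, mul_neg_of_neg_of_pos hω h.2⟩
    · exact Or.inl ⟨mul_pos hω h.1, mul_neg_of_pos_of_neg hω h.2⟩
    · exact Or.inr ⟨mul_neg_of_pos_of_neg hω h.1, mul_pos hω h.2⟩
  rcases hdef with ⟨h1, h2⟩ | ⟨h1, h2⟩
  · left
    intro x hx y hy hxy hne
    obtain ⟨α, β, hαβ, h⟩ := key x hx y hy hxy hne
    have := hpos α β _ _ hαβ h1 h2
    linarith
  · right
    intro x hx y hy hxy hne
    obtain ⟨α, β, hαβ, h⟩ := key x hx y hy hxy hne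
    have := hpos β α _ _ hαβ.symm h2 h1
    linarith

/-- Evaluate the Maslov form on the two generators. In the second one the `f₂`-part belongs to the
first argument of the pairing, which gives -ω cd against ω ab. -/
theorem exists_vec_of_mem_stem (ht : t.IsSymplectic N ω) {L : LGr N} (hL : L ∈ t.stem N) :
    ∃ a b c d : ℝ, (0 < a * b ∧ c * d < 0 ∨ a * b < 0 ∧ 0 < c * d) ∧
      t.vec a b 0 0 ∈ L.1 ∧ t.vec 0 0 c d ∈ L.1 := by
  obtain ⟨⟨w₁, hw₁, w₂, hw₂, hne₁, hne₂, hspan⟩, hdef⟩ := hL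
  obtain ⟨a, b, rfl⟩ := Submodule.mem_span_pair.1 hw₁
  obtain ⟨c, d, rfl⟩ := Submodule.mem_span_pair.1 hw₂
  have m₁ : a • t.e₁ + b • t.f₁ ∈ L.1 := by rw [hspan]; exact Submodule.subset_span (Or.inl rfl)
  have m₂ : c • t.e₂ + d • t.f₂ ∈ L.1 := by rw [hspan]; exact Submodule.subset_span (Or.inr rfl)
  have p1 : pairing N (a • t.e₁) (b • t.f₁) = ω * (a * b) := by
    rw [pairing_smul_left, pairing_smul_right, ht.e₁_f₁]; ring
  have p2 : pairing N (d • t.f₂) (c • t.e₂) = -(ω * (c * d)) := by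
    rw [pairing_smul_left, pairing_smul_right, pairing_swap, ht.e₂_f₂]; ring
  have me : ∀ (k : ℝ) (p q : V), k • p ∈ Submodule.span ℝ {p, q} := fun k p q =>
    Submodule.mem_span_pair.2 ⟨k, 0, by simp⟩
  have mf : ∀ (k : ℝ) (p q : V), k • q ∈ Submodule.span ℝ {p, q} := fun k p q =>
    Submodule.mem_span_pair.2 ⟨0, k, by simp⟩
  have m₂' : d • t.f₂ + c • t.e₂ ∈ L.1 := by rwa [add_comm]
  have hne₂' : d • t.f₂ + c • t.e₂ ≠ 0 := by rwa [add_comm]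
  refine ⟨a, b, c, d, ?_, by simpa [Tetra.vec] using m₁, by simpa [Tetra.vec] using m₂⟩
  rcases hdef with h | h
  · have k1 := h _ (me a _ _) _ (mf b _ _) m₁ hne₁
    have k2 := h _ (mf d _ _) _ (me c _ _) m₂' hne₂'
    rw [p1] at k1
    rw [p2] at k2
    rcases lt_or_gt_of_ne ht.ne_zero with hω | hω
    · right; constructor <;> nlinarith
    · left; constructor <;> nlinarith
  · have k1 := h _ (me a _ _) _ (mf b _ _) m₁ hne₁
    have k2 := h _ (mf d _ _) _ (me c _ _) m₂' hne₂'
    rw [p1] at k1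
    rw [p2] at k2
    rcases lt_or_gt_of_ne ht.ne_zero with hω | hω
    · left; constructor <;> nlinarith
    · right; constructor <;> nlinarith

theorem vec_mem_coneHit {L : LGr N} {a b c d : ℝ}
    (h : 0 ≤ a ∧ 0 ≤ b ∧ 0 ≤ c ∧ 0 ≤ d) (hne : t.vec a b c d ≠ 0) (hL : t.vec a b c d ∈ L.1) :
    L ∈ t.coneHit N := ⟨_, ⟨⟨a, b, c, d, h.1, h.2.1, h.2.2.1, h.2.2.2, rfl⟩, hne⟩, hL⟩

theorem coneHit_of_pair (ht : t.IsSymplectic N ω) {L : LGr N} {a b : ℝ} (hab : 0 < a * b) :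
    (t.vec a b 0 0 ∈ L.1 → L ∈ t.coneHit N) ∧ (t.vec 0 0 a b ∈ L.1 → L ∈ t.coneHit N) := by
  have ha : a ≠ 0 := by rintro rfl; simp at hab
  constructor
  · intro h
    rcases lt_or_gt_of_ne ha with ha' | ha'
    · have hb : b < 0 := by nlinarith
      have h' := L.1.neg_mem h
      rw [t.neg_vec] at h'
      refine vec_mem_coneHit ⟨by linarith, by linarith, by simp, by simp⟩ (fun h0 => ?_) h'
      have := (ht.vec_eq_zero h0).1; exact ha (by linarith)
    · have hb : 0 < b := by nlinarith
      refine vec_mem_coneHit ⟨by linarith, by linarith, by simp, by simp⟩ (fun h0 => ?_) h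
      exact ha (ht.vec_eq_zero h0).1
  · intro h
    rcases lt_or_gt_of_ne ha with ha' | ha'
    · have hb : b < 0 := by nlinarith
      have h' := L.1.neg_mem h
      rw [t.neg_vec] at h'
      refine vec_mem_coneHit ⟨by simp, by simp, by linarith, by linarith⟩ (fun h0 => ?_) h'
      have := (ht.vec_eq_zero h0).2.2.1; exact ha (by linarith)
    · have hb : 0 < b := by nlinarith
      refine vec_mem_coneHit ⟨by simp, by simp, by linarith, by linarith⟩ (fun h0 => ?_) h
      exact ha (ht.vec_eq_zero h0).2.2.1

theorem crookedSurface_subset_coneHit (ht : t.IsSymplectic N ω) :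
    t.crookedSurface N ⊆ t.coneHit N := by
  rintro L ((hL | hL) | hL)
  · obtain ⟨p, q, hp, hq, hpq, h⟩ := exists_of_mem_wing hL
    refine vec_mem_coneHit (a := p) (b := 0) (c := q) (d := 0) ⟨hp, le_rfl, hq, le_rfl⟩
      (fun h0 => ?_) (by simpa [Tetra.vec] using h)
    have := ht.vec_eq_zero h0; linarith
  · obtain ⟨a, b, c, d, h | h, h₁, h₂⟩ := ht.exists_vec_of_mem_stem hL
    · exact (ht.coneHit_of_pair h.1).1 h₁
    · exact (ht.coneHit_of_pair h.2).2 h₂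
  · obtain ⟨p, q, hp, hq, hpq, h⟩ := exists_of_mem_wing hL
    refine vec_mem_coneHit (a := 0) (b := p) (c := 0) (d := q) ⟨le_rfl, hp, le_rfl, hq⟩
      (fun h0 => ?_) (by simpa [Tetra.vec] using h)
    have := ht.vec_eq_zero h0; linarith

/-- The lines of the wings do not change when the signs of `f₁`, `f₂` do. On the stem exactly one of
ab, cd is positive, and the flip makes the other one positive. -/
theorem crookedSurface_subset_coneHit_flip (ht : t.IsSymplectic N ω) :
    t.crookedSurface N ⊆ t.flip.coneHit N := by
  rintro L ((hL | hL) | hL)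
  · exact ht.flip.crookedSurface_subset_coneHit (Or.inl (Or.inl hL))
  · obtain ⟨a, b, c, d, h | h, h₁, h₂⟩ := ht.exists_vec_of_mem_stem hL
    · refine (ht.flip.coneHit_of_pair (a := c) (b := -d) (by linarith)).2 ?_
      rw [t.flip_vec]; simpa using h₂
    · refine (ht.flip.coneHit_of_pair (a := a) (b := -b) (by linarith)).1 ?_
      rw [t.flip_vec]; simpa using h₁
  · apply ht.flip.crookedSurface_subset_coneHit
    right
    obtain ⟨p, q, hp, hq, hpq, h⟩ := exists_of_mem_wing hL
    refine mem_wing_of_mem hp hq (by linarith) ?_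
    convert L.1.neg_mem h using 1
    simp only [Tetra.flip]; module

/-- Isotropy forces x in the cone and y in the flipped cone to have complementary supports. Either
one of them lies on an edge of a wing, or a combination of the two is an `e`-vertex, or they span a
Lagrangian of the stem. -/
theorem mem_crookedSurface (ht : t.IsSymplectic N ω) {L : LGr N} (h : L ∈ t.coneHit N)
    (h' : L ∈ t.flip.coneHit N) : L ∈ t.crookedSurface N := by
  obtain ⟨_, ⟨⟨a, b, c, d, ha, hb, hc, hd, rfl⟩, hne⟩, hx⟩ := h
  obtain ⟨_, ⟨⟨a', b', c', d', ha', hb', hc', hd', rfl⟩, hne'⟩, hy⟩ := h'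
  have hxy := L.2.2 _ hx _ hy
  rw [t.flip_vec] at hxy hne' hy
  rw [ht.pairing_vec] at hxy
  have h0 := (mul_eq_zero.1 hxy).resolve_left ht.ne_zero
  have p1 := mul_nonneg ha hb'
  have p2 := mul_nonneg hb ha'
  have p3 := mul_nonneg hc hd'
  have p4 := mul_nonneg hd hc'
  have q1 : a * b' = 0 := by linarith
  have q2 : b * a' = 0 := by linarith
  have q3 : c * d' = 0 := by linarith
  have q4 : d * c' = 0 := by linarith
  by_cases hbd : b = 0 ∧ d = 0
  · obtain ⟨rfl, rfl⟩ := hbd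
    exact Or.inl (Or.inl (mem_eWing_of_vec_mem ha hc hne hx))
  by_cases hac : a = 0 ∧ c = 0
  · obtain ⟨rfl, rfl⟩ := hac
    exact Or.inr (mem_fWing_of_vec_mem hb hd hne hx)
  by_cases hbd' : b' = 0 ∧ d' = 0
  · obtain ⟨rfl, rfl⟩ := hbd'
    rw [neg_zero] at hy hne'
    exact Or.inl (Or.inl (mem_eWing_of_vec_mem ha' hc' hne' hy))
  by_cases hac' : a' = 0 ∧ c' = 0
  · obtain ⟨rfl, rfl⟩ := hac'
    have hy' := L.1.neg_mem hy
    have hne'' := neg_ne_zero.2 hne'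
    rw [t.neg_vec] at hy' hne''
    simp only [neg_zero, neg_neg] at hy' hne''
    exact Or.inr (mem_fWing_of_vec_mem hb' hd' hne'' hy')
  rcases mul_eq_zero.1 q1 with rfl | rfl
  · have hc0 : c ≠ 0 := fun h => hac ⟨rfl, h⟩
    obtain rfl := (mul_eq_zero.1 q3).resolve_left hc0
    have hb0 : b' ≠ 0 := fun h => hbd' ⟨h, rfl⟩
    rcases mul_eq_zero.1 q4 with rfl | rfl
    · have hb1 : b ≠ 0 := fun h => hbd ⟨h, rfl⟩
      obtain rfl := (mul_eq_zero.1 q2).resolve_left hb1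
      have hc1 : c' ≠ 0 := fun h => hac' ⟨rfl, h⟩
      -- Here x and y both lie in the span of `f₁` and `e₂`; eliminating `f₁` leaves a positive
      -- multiple of `e₂`.
      have m := L.1.add_mem (L.1.smul_mem b' hx) (L.1.smul_mem b hy)
      rw [t.smul_vec, t.smul_vec, t.vec_add] at m
      have hpos : 0 < b' * c + b * c' := by
        have : 0 < b' := lt_of_le_of_ne hb' hb0.symm
        have : 0 < c := lt_of_le_of_ne hc hc0.symm
        have : 0 < b := lt_of_le_of_ne hb hb1.symm
        have : 0 < c' := lt_of_le_of_ne hc' hc1.symm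
        positivity
      refine Or.inl (Or.inl (mem_eWing_of_vec_mem (a := 0) (c := b' * c + b * c') le_rfl hpos.le
        (fun h => hpos.ne' (ht.vec_eq_zero h).2.2.1) ?_))
      convert m using 1; congr 1 <;> ring
    · have ha0 : a' ≠ 0 := fun h => hac' ⟨h, rfl⟩
      obtain rfl := (mul_eq_zero.1 q2).resolve_right ha0
      have hd0 : d ≠ 0 := fun h => hbd ⟨rfl, h⟩
      -- Now y lies in the span of `e₁`, `f₁` with coordinates of opposite signs, and x in the span
      -- of `e₂`, `f₂` with coordinates of equal signs.
      refine Or.inl (Or.inr (ht.mem_stem_of_vec_mem (a := a') (b := -b') (c := c) (d := d)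
        (Or.inr ⟨?_, ?_⟩) (by simpa using hy) hx))
      · have : 0 < a' := lt_of_le_of_ne ha' ha0.symm
        have : 0 < b' := lt_of_le_of_ne hb' hb0.symm
        nlinarith
      · have : 0 < c := lt_of_le_of_ne hc hc0.symm
        have : 0 < d := lt_of_le_of_ne hd hd0.symm
        positivity
  · have hd0 : d' ≠ 0 := fun h => hbd' ⟨rfl, h⟩
    obtain rfl := (mul_eq_zero.1 q3).resolve_right hd0
    have ha0 : a ≠ 0 := fun h => hac ⟨h, rfl⟩
    rcases mul_eq_zero.1 q2 with rfl | rfl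
    · have hd1 : d ≠ 0 := fun h => hbd ⟨rfl, h⟩
      obtain rfl := (mul_eq_zero.1 q4).resolve_left hd1
      have ha1 : a' ≠ 0 := fun h => hac' ⟨h, rfl⟩
      have m := L.1.add_mem (L.1.smul_mem d' hx) (L.1.smul_mem d hy)
      rw [t.smul_vec, t.smul_vec, t.vec_add] at m
      have hpos : 0 < d' * a + d * a' := by
        have : 0 < d' := lt_of_le_of_ne hd' hd0.symm
        have : 0 < a := lt_of_le_of_ne ha ha0.symm
        have : 0 < d := lt_of_le_of_ne hd hd1.symm
        have : 0 < a' := lt_of_le_of_ne ha' ha1.symm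
        positivity
      refine Or.inl (Or.inl (mem_eWing_of_vec_mem (a := d' * a + d * a') (c := 0) hpos.le le_rfl
        (fun h => hpos.ne' (ht.vec_eq_zero h).1) ?_))
      convert m using 1; congr 1 <;> ring
    · have hc0 : c' ≠ 0 := fun h => hac' ⟨rfl, h⟩
      obtain rfl := (mul_eq_zero.1 q4).resolve_right hc0
      have hb0 : b ≠ 0 := fun h => hbd ⟨h, rfl⟩
      refine Or.inl (Or.inr (ht.mem_stem_of_vec_mem (a := a) (b := b) (c := c') (d := -d')
        (Or.inl ⟨?_, ?_⟩) hx (by simpa using hy)))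
      · have : 0 < a := lt_of_le_of_ne ha ha0.symm
        have : 0 < b := lt_of_le_of_ne hb hb0.symm
        positivity
      · have : 0 < c' := lt_of_le_of_ne hc' hc0.symm
        have : 0 < d' := lt_of_le_of_ne hd' hd0.symm
        nlinarith

/-- The small side consists of the Lagrangians that meet the interior of the cone. -/
theorem smallSide_eq (hN : 4 ≤ N) (ht : t.IsSymplectic N ω) :
    t.smallSide N = hit N t.interiorCone := by
  have hcompl : ∀ L ∈ hit N t.interiorCone, L ∈ (t.crookedSurface N)ᶜ := fun L hL hL' =>
    ht.notMem_coneHit_flip hL (ht.crookedSurface_subset_coneHit_flip hL')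
  apply subset_antisymm
  · simp only [Tetra.smallSide, Set.iUnion_subset_iff]
    intro v hv M hM
    have hMU : M ∈ hit N t.interiorCone := ⟨v, hv, hM⟩
    -- The Lagrangians that meet the open cone and those that meet the open flipped cone are
    -- disjoint open sets covering the complement of the surface, so a component stays in the one
    -- where it starts.
    apply isPreconnected_connectedComponentIn.subset_left_of_subset_union
      (isOpen_hit ht.isOpen_interiorCone) (isOpen_hit ht.flip.isOpen_interiorCone)
    · rw [Set.disjoint_left]
      rintro L h1 ⟨x, hx, hxL⟩
      exact ht.notMem_coneHit_flip h1
        ⟨x, ⟨t.flip.interiorCone_subset_cone hx, ht.flip.mem_interiorCone_of_ne hx⟩, hxL⟩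
    · intro L hL
      by_contra hU
      rw [Set.mem_union, not_or] at hU
      have h1 := ht.coneHit_flip_of_notMem hN hU.1
      have h2 := ht.flip.coneHit_flip_of_notMem hN hU.2
      rw [t.flip_flip] at h2
      exact connectedComponentIn_subset _ _ hL (ht.mem_crookedSurface h2 h1)
    · exact ⟨M, mem_connectedComponentIn (hcompl M hMU), hMU⟩
  -- The union runs over all photons of interior vectors, so L is reached through its own component.
  · rintro L ⟨v, hv, hL⟩
    simp only [Tetra.smallSide, Set.mem_iUnion]
    exact ⟨v, hv, L, hL, mem_connectedComponentIn (hcompl L ⟨v, hv, hL⟩)⟩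

theorem closure_smallSide (hN : 4 ≤ N) (ht : t.IsSymplectic N ω) :
    closure (t.smallSide N) = t.coneHit N := by
  rw [ht.smallSide_eq hN, ht.closure_hit_interiorCone hN]

end Tetra.IsSymplectic

end

/-! ### Ping-pong for reflections -/

/-- Involutions `refl i` that take the complement of `small i` into `closed i`, where `small i` is
disjoint from the other `closed j`, together with a finite group `H` that permutes them. -/
structure PingPong (G X I : Type*) [Group G] [MulAction G X] where
  small : I → Set X
  closed : I → Set X
  refl : I → G
  H : Subgroup G
  Γ : Subgroup G
  refl_mul_self : ∀ i, refl i * refl i = 1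
  small_subset : ∀ i, small i ⊆ closed i
  refl_smul_mem : ∀ i x, x ∉ small i → refl i • x ∈ closed i
  refl_smul_notMem : ∀ i x, x ∈ closed i → refl i • x ∉ small i
  disjoint : ∀ i j, i ≠ j → ∀ x ∈ closed j, x ∉ small i
  finite_H : (H : Set G).Finite
  perm : ∀ h ∈ H, ∃ σ : Equiv.Perm I, ∀ i, h * refl i = refl (σ i) * h ∧
    (∀ x, h • x ∈ small (σ i) ↔ x ∈ small i) ∧ (∀ x, h • x ∈ closed (σ i) ↔ x ∈ closed i)
  Γ_eq : Γ = Subgroup.closure (Set.range refl ∪ H)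

namespace PingPong

variable {G X I : Type*} [Group G] [MulAction G X] (P : PingPong G X I)

theorem refl_smul_smul (i : I) (x : X) : P.refl i • P.refl i • x = x := by
  rw [smul_smul, P.refl_mul_self, one_smul]

theorem refl_inv (i : I) : (P.refl i)⁻¹ = P.refl i :=
  inv_eq_of_mul_eq_one_left (P.refl_mul_self i)

theorem refl_mem (i : I) : P.refl i ∈ P.Γ := by
  rw [P.Γ_eq]; exact Subgroup.subset_closure (Or.inl ⟨i, rfl⟩)

/-- The points that are taken by a reduced word of length `n`, with first letter `i`, from a
closed small side. -/
def lev : ℕ → I → Set X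
  | 0, i => P.closed i
  | n + 1, i => {x | ∃ j ≠ i, P.refl i • x ∈ lev n j}

/-- For the first level: a point of closed j is outside small i, so the reflection i carries it into
closed i. Later levels follow by induction. -/
theorem lev_succ_subset (n : ℕ) (i : I) : P.lev (n + 1) i ⊆ P.lev n i := by
  induction n generalizing i with
  | zero =>
    rintro x ⟨j, hj, hx⟩
    have := P.refl_smul_mem i _ (P.disjoint i j hj.symm _ hx)
    rwa [refl_smul_smul] at this
  | succ n ih =>
    rintro x ⟨j, hj, hx⟩
    exact ⟨j, hj, ih j hx⟩

theorem lev_anti {m n : ℕ} (h : m ≤ n) (i : I) : P.lev n i ⊆ P.lev m i := by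
  induction h with
  | refl => rfl
  | step _ ih => exact (P.lev_succ_subset _ i).trans ih

theorem lev_subset_closed (n : ℕ) (i : I) : P.lev n i ⊆ P.closed i := P.lev_anti (Nat.zero_le n) i

/-- The complement of the small sides. -/
def free : Set X := {x | ∀ i, x ∉ P.small i}

theorem mem_free_of_mem_closed {i j : I} (hij : i ≠ j) {x : X} (hi : x ∈ P.closed i)
    (hj : x ∈ P.closed j) : x ∈ P.free := by
  intro k
  by_cases hk : k = i
  · subst hk; exact P.disjoint k j hij x hj
  · exact P.disjoint k i hk x hi

/-- The complement of the points that are reached by words of length `n + 1`. -/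
def approx (n : ℕ) : Set X := {x | ∀ i, x ∉ P.lev n i}

theorem approx_mono {m n : ℕ} (h : m ≤ n) : P.approx m ⊆ P.approx n :=
  fun _ hx i hi => hx i (P.lev_anti h i hi)

/-- This is the ping-pong argument: the last letter takes a free point into its closed side, and
every further letter goes one level deeper. -/
theorem word_smul_mem_lev {x : X} (hx : x ∈ P.free) (i : I) (w : List I)
    (hw : List.IsChain (· ≠ ·) (i :: w)) : ((i :: w).map P.refl).prod • x ∈ P.lev w.length i := by
  induction w generalizing i with
  | nil => simpa [lev] using P.refl_smul_mem i x (hx i)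
  | cons j w ih =>
    rw [List.isChain_cons_cons] at hw
    refine ⟨j, hw.1.symm, ?_⟩
    rw [List.map_cons, List.prod_cons, mul_smul, refl_smul_smul]
    exact ih j hw.2

theorem smul_mem_lev {h : G} (σ : Equiv.Perm I)
    (hσ : ∀ i, h * P.refl i = P.refl (σ i) * h ∧
      (∀ x, h • x ∈ P.small (σ i) ↔ x ∈ P.small i) ∧
      (∀ x, h • x ∈ P.closed (σ i) ↔ x ∈ P.closed i)) (n : ℕ) (i : I) (x : X) :
    h • x ∈ P.lev n (σ i) ↔ x ∈ P.lev n i := by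
  induction n generalizing i x with
  | zero => exact (hσ i).2.2 x
  | succ n ih =>
    simp only [lev, Set.mem_ofPred_eq]
    rw [smul_smul, ← (hσ i).1, mul_smul]
    constructor
    · rintro ⟨j, hj, hx⟩
      obtain ⟨j, rfl⟩ := σ.surjective j
      exact ⟨j, fun e => hj (by rw [e]), (ih j _).1 hx⟩
    · rintro ⟨j, hj, hx⟩
      exact ⟨σ j, fun e => hj (σ.injective e), (ih j _).2 hx⟩

theorem smul_mem_free {h : G} (hh : h ∈ P.H) {x : X} (hx : x ∈ P.free) : h • x ∈ P.free := by
  obtain ⟨σ, hσ⟩ := P.perm h hh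
  intro i hi
  obtain ⟨i, rfl⟩ := σ.surjective i
  exact hx i (((hσ i).2.1 x).1 hi)

theorem smul_mem_approx {h : G} (hh : h ∈ P.H) {n : ℕ} {x : X} (hx : x ∈ P.approx n) :
    h • x ∈ P.approx n := by
  obtain ⟨σ, hσ⟩ := P.perm h hh
  intro i hi
  obtain ⟨i, rfl⟩ := σ.surjective i
  exact hx i ((P.smul_mem_lev σ hσ n i x).1 hi)

/-- Suppose the image were in level n + 1 with first letter j. If j = i, the reflection cancels and
x is in level n of another index; if j ≠ i, then x is even in level n + 2 of i. -/
theorem refl_smul_mem_approx (i : I) {n : ℕ} {x : X} (hx : x ∈ P.approx n) :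
    P.refl i • x ∈ P.approx (n + 1) := by
  rintro j ⟨k, hk, hjk⟩
  by_cases hij : i = j
  · subst hij
    rw [refl_smul_smul] at hjk
    exact hx k hjk
  · have : x ∈ P.lev (n + 2) i := ⟨j, fun e => hij e.symm, k, hk, hjk⟩
    exact hx i (P.lev_anti (by omega) i this)

/-- Every element of the group is a reduced word followed by an element of the finite group. -/
theorem exists_word {γ : G} (hγ : γ ∈ P.Γ) :
    ∃ w : List I, List.IsChain (· ≠ ·) w ∧ ∃ h ∈ P.H, γ = (w.map P.refl).prod * h := by
  -- An element of H moves past a word by relabelling the letters through σ, which is injective and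
  -- hence keeps the word reduced.
  have hH : ∀ h ∈ P.H, ∀ w : List I, List.IsChain (· ≠ ·) w →
      ∃ w' : List I, List.IsChain (· ≠ ·) w' ∧
        h * (w.map P.refl).prod = (w'.map P.refl).prod * h := by
    intro h hh w hw
    obtain ⟨σ, hσ⟩ := P.perm h hh
    refine ⟨w.map σ, ?_, ?_⟩
    · rw [List.isChain_map]
      exact hw.imp fun a b hab e => hab (σ.injective e)
    · clear hw
      induction w with
      | nil => simp
      | cons i w ih =>
        simp only [List.map_cons, List.prod_cons]
        rw [← mul_assoc, (hσ i).1, mul_assoc, ih, mul_assoc]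
  have hgen : ∀ x ∈ Set.range P.refl ∪ (P.H : Set G), ∀ y : G,
      (∃ w : List I, List.IsChain (· ≠ ·) w ∧ ∃ h ∈ P.H, y = (w.map P.refl).prod * h) →
      ∃ w : List I, List.IsChain (· ≠ ·) w ∧ ∃ h ∈ P.H, x * y = (w.map P.refl).prod * h := by
    rintro x (⟨i, rfl⟩ | hx) _ ⟨w, hw, h, hh, rfl⟩
    · cases w with
      | nil => exact ⟨[i], by simp, h, hh, by simp⟩
      | cons j w =>
        by_cases hij : i = j
        · subst hij
          refine ⟨w, hw.tail, h, hh, ?_⟩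
          simp only [List.map_cons, List.prod_cons]
          rw [← mul_assoc, ← mul_assoc, P.refl_mul_self, one_mul]
        · exact ⟨i :: j :: w, List.isChain_cons_cons.2 ⟨hij, hw⟩, h, hh, by simp [mul_assoc]⟩
    · obtain ⟨w', hw', e⟩ := hH x hx w hw
      exact ⟨w', hw', x * h, P.H.mul_mem hx hh, by rw [← mul_assoc, e, mul_assoc]⟩
  rw [P.Γ_eq] at hγ
  induction hγ using Subgroup.closure_induction_left with
  | one => exact ⟨[], by simp, 1, P.H.one_mem, by simp⟩
  | mul_left x hx y _ ih => exact hgen x hx y ih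
  | inv_mul_cancel x hx y _ ih =>
    refine hgen x⁻¹ ?_ y ih
    rcases hx with ⟨i, rfl⟩ | hx
    · exact Or.inl ⟨i, (P.refl_inv i).symm⟩
    · exact Or.inr (P.H.inv_mem hx)

theorem smul_mem_iUnion_approx {γ : G} (hγ : γ ∈ P.Γ) {n : ℕ} {x : X} (hx : x ∈ P.approx n) :
    ∃ m, γ • x ∈ P.approx m := by
  obtain ⟨w, -, h, hh, rfl⟩ := P.exists_word hγ
  clear hγ
  induction w with
  | nil => exact ⟨n, by simpa using P.smul_mem_approx hh hx⟩
  | cons i w ih =>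
    obtain ⟨m, hm⟩ := ih
    refine ⟨m + 1, ?_⟩
    rw [List.map_cons, List.prod_cons, mul_assoc, mul_smul]
    exact P.refl_smul_mem_approx i hm

/-- If no translate is free, reflecting a point in small i puts it in some small j with j ≠ i, and
this continues for ever. So x lies in every level, contrary to the hypothesis. -/
theorem exists_smul_mem_free {n : ℕ} {x : X} (hx : x ∈ P.approx n) :
    ∃ γ ∈ P.Γ, γ • x ∈ P.free := by
  by_contra! hno
  have key : ∀ (m : ℕ) (y : X) (i : I), (∀ γ ∈ P.Γ, γ • y ∉ P.free) → y ∈ P.small i →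
      y ∈ P.lev m i := by
    intro m
    induction m with
    | zero => exact fun y i _ hy => P.small_subset i hy
    | succ m ih =>
      intro y i hy hyi
      have h1 := P.refl_smul_notMem i y (P.small_subset i hyi)
      obtain ⟨j, hj⟩ : ∃ j, P.refl i • y ∈ P.small j := by
        by_contra! h
        exact hy _ (P.refl_mem i) h
      refine ⟨j, fun e => h1 (e ▸ hj), ih _ j (fun γ hγ => ?_) hj⟩
      rw [smul_smul]
      exact hy _ (P.Γ.mul_mem hγ (P.refl_mem i))
  obtain ⟨i, hi⟩ : ∃ i, x ∈ P.small i := by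
    by_contra! h
    exact hno 1 P.Γ.one_mem (by rwa [one_smul])
  exact hx i (key n x i hno hi)

/-- A reduced word of length greater than n carries free points into level n, so only the words of
length at most n are left, times the finite group H. -/
theorem finite_free_approx [Finite I] (n : ℕ) :
    {γ | γ ∈ P.Γ ∧ ∃ z ∈ P.free, γ • z ∈ P.approx n}.Finite := by
  have hfin : ((fun p : List I × G => (p.1.map P.refl).prod * p.2) ''
      ({w : List I | w.length ≤ n} ×ˢ (P.H : Set G))).Finite :=
    ((List.finite_length_le I n).prod P.finite_H).image _
  refine hfin.subset ?_
  rintro γ ⟨hγ, z, hz, hγz⟩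
  obtain ⟨w, hw, h, hh, rfl⟩ := P.exists_word hγ
  refine ⟨(w, h), ⟨?_, hh⟩, rfl⟩
  change w.length ≤ n
  by_contra! hlen
  cases w with
  | nil => simp at hlen
  | cons i w =>
    rw [mul_smul] at hγz
    have := P.word_smul_mem_lev (P.smul_mem_free hh hz) i w hw
    exact hγz i (P.lev_anti (by simpa [Nat.lt_succ_iff] using hlen) i this)

/-- Pass through a free point δ • x: both γ δ⁻¹ and δ⁻¹ take it to the complement of level n, and γ
is the quotient of the two. -/
theorem finite_approx_approx [Finite I] (n : ℕ) :
    {γ | γ ∈ P.Γ ∧ ∃ x ∈ P.approx n, γ • x ∈ P.approx n}.Finite := by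
  have hfin := P.finite_free_approx n
  refine ((hfin.prod hfin).image fun p : G × G => p.1 * p.2⁻¹).subset ?_
  rintro γ ⟨hγ, x, hx, hγx⟩
  obtain ⟨δ, hδ, hδx⟩ := P.exists_smul_mem_free hx
  refine ⟨(γ * δ⁻¹, δ⁻¹), ⟨⟨P.Γ.mul_mem hγ (P.Γ.inv_mem hδ), δ • x, hδx, ?_⟩,
    P.Γ.inv_mem hδ, δ • x, hδx, ?_⟩, by simp⟩
  · rwa [mul_smul, inv_smul_smul]
  · rwa [inv_smul_smul]

/-- A set in two closed small sides that is preserved by both reflections is never left. -/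
theorem mem_lev_of_invariant {i j : I} (hij : i ≠ j) {S : Set X} (hi : S ⊆ P.closed i)
    (hj : S ⊆ P.closed j) (hSi : ∀ x ∈ S, P.refl i • x ∈ S) (hSj : ∀ x ∈ S, P.refl j • x ∈ S)
    (n : ℕ) : S ⊆ P.lev n i ∧ S ⊆ P.lev n j := by
  induction n with
  | zero => exact ⟨hi, hj⟩
  | succ n ih =>
    exact ⟨fun x hx => ⟨j, hij.symm, ih.2 (hSi x hx)⟩, fun x hx => ⟨i, hij, ih.1 (hSj x hx)⟩⟩

/-- If the `D`-orbit of `γ • z` avoids the closed small sides outside `S`, then `γ ∈ D H`. -/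
theorem exists_mul_of_avoids {S : Set I} {D : Subgroup G} (hD : ∀ i ∈ S, P.refl i ∈ D)
    {γ : G} (hγ : γ ∈ P.Γ) {z : X} (hz : z ∈ P.free)
    (h : ∀ d ∈ D, ∀ i ∉ S, d • γ • z ∉ P.closed i) : ∃ d ∈ D, ∃ h ∈ P.H, γ = d * h := by
  obtain ⟨w, hw, k, hk, rfl⟩ := P.exists_word hγ
  clear hγ
  induction w with
  | nil => exact ⟨1, D.one_mem, k, hk, by simp⟩
  | cons i w ih =>
    by_cases hi : i ∈ S
    · obtain ⟨d, hd, l, hl, e⟩ := ih hw.tail (fun d hd j hj hmem => by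
        refine h (d * P.refl i) (D.mul_mem hd (hD i hi)) j hj ?_
        rwa [List.map_cons, List.prod_cons, mul_assoc, mul_smul (P.refl i), mul_smul d,
          refl_smul_smul])
      refine ⟨P.refl i * d, D.mul_mem (hD i hi) hd, l, hl, ?_⟩
      rw [List.map_cons, List.prod_cons, mul_assoc, e, mul_assoc]
    · exfalso
      refine h 1 D.one_mem i hi ?_
      rw [one_smul, mul_smul]
      exact P.lev_subset_closed _ _ (P.word_smul_mem_lev (P.smul_mem_free hk hz) i w hw)

theorem word_mem_lev (l : List I) (i₁ : I) (hl : List.IsChain (· ≠ ·) (l ++ [i₁])) {y : X}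
    (hy : y ∈ P.closed i₁) :
    ∃ i, (l ++ [i₁]).head? = some i ∧ (l.map P.refl).prod • y ∈ P.lev l.length i := by
  induction l with
  | nil => exact ⟨i₁, rfl, by simpa [lev] using hy⟩
  | cons k l ih =>
    rw [List.cons_append, List.isChain_cons] at hl
    obtain ⟨i, hi, hmem⟩ := ih hl.2
    refine ⟨k, rfl, i, (hl.1 i hi).symm, ?_⟩
    rwa [List.map_cons, List.prod_cons, mul_smul, refl_smul_smul]

theorem exists_word_of_mem_lev {n : ℕ} {i : I} {x : X} (hx : x ∈ P.lev n i) :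
    ∃ (l : List I) (i₁ : I), l.length = n ∧ List.IsChain (· ≠ ·) (l ++ [i₁]) ∧
      (l ++ [i₁]).head? = some i ∧ ∃ y ∈ P.closed i₁, x = (l.map P.refl).prod • y := by
  induction n generalizing i x with
  | zero => exact ⟨[], i, rfl, by simp, rfl, x, hx, by simp⟩
  | succ n ih =>
    obtain ⟨j, hj, hx⟩ := hx
    obtain ⟨l, i₁, hlen, hch, hhead, y, hy, e⟩ := ih hx
    refine ⟨i :: l, i₁, by simp [hlen], ?_, rfl, y, hy, ?_⟩
    · rw [List.cons_append, List.isChain_cons]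
      refine ⟨fun k hk => ?_, hch⟩
      rw [hhead] at hk
      cases hk
      exact hj.symm
    · rw [List.map_cons, List.prod_cons, mul_smul, ← e, refl_smul_smul]

/-- Connects the recursive levels with the words in the definition of Λ_n: words with n letters in
all, i₁ included, correspond to level n - 1. -/
theorem mem_iUnion_lev_iff (n : ℕ) (x : X) :
    (∃ (i₁ : I) (w : List I), w.length + 1 = n + 1 ∧ List.IsChain (· ≠ ·) (i₁ :: w) ∧
      ∃ y ∈ P.closed i₁, x = (w.reverse.map P.refl).prod • y) ↔ ∃ i, x ∈ P.lev n i := by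
  have hrev : ∀ (i₁ : I) (w : List I), List.IsChain (· ≠ ·) (i₁ :: w) ↔
      List.IsChain (· ≠ ·) (w.reverse ++ [i₁]) := by
    intro i₁ w
    rw [← List.reverse_cons, List.isChain_reverse]
    constructor <;> exact fun h => h.imp fun _ _ h => h.symm
  constructor
  · rintro ⟨i₁, w, hlen, hch, y, hy, rfl⟩
    obtain ⟨i, -, hi⟩ := P.word_mem_lev w.reverse i₁ ((hrev i₁ w).1 hch) hy
    rw [List.length_reverse, Nat.succ_injective hlen] at hi
    exact ⟨i, hi⟩
  · rintro ⟨i, hi⟩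
    obtain ⟨l, i₁, hlen, hch, -, y, hy, e⟩ := P.exists_word_of_mem_lev hi
    refine ⟨i₁, l.reverse, by simp [hlen], (hrev _ _).2 (by simpa using hch), y, hy,
      by simpa using e⟩

end PingPong

/-! ### Properly discontinuous actions -/

section

variable {G X : Type*} [Group G] [MulAction G X] [TopologicalSpace X]

/-- Only finitely many elements of `Γ` take points near `x` to points near `y`. -/
def LocallyFinitePair (Γ : Subgroup G) (x y : X) : Prop :=
  ∃ F : Set G, F.Finite ∧ ∀ᶠ p in nhds x ×ˢ nhds y, ∀ γ ∈ Γ, γ • p.1 = p.2 → γ ∈ F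

theorem LocallyFinitePair.symm {Γ : Subgroup G} {x y : X} (h : LocallyFinitePair Γ x y) :
    LocallyFinitePair Γ y x := by
  obtain ⟨F, hF, h⟩ := h
  refine ⟨F⁻¹, hF.inv, ?_⟩
  rw [Filter.eventually_swap_iff]
  filter_upwards [h] with p hp γ hγ e
  refine hp γ⁻¹ (Γ.inv_mem hγ) ?_
  simp only [Prod.swap] at e
  rw [← e, inv_smul_smul]

theorem LocallyFinitePair.smul_right [ContinuousConstSMul G X] {Γ : Subgroup G} {x y : X}
    (h : LocallyFinitePair Γ x y) {δ : G} (hδ : δ ∈ Γ) : LocallyFinitePair Γ x (δ • y) := by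
  obtain ⟨F, hF, h⟩ := h
  refine ⟨(δ * ·) '' F, hF.image _, ?_⟩
  have ht : Filter.Tendsto (fun p : X × X => (p.1, δ⁻¹ • p.2)) (nhds x ×ˢ nhds (δ • y))
      (nhds x ×ˢ nhds y) := by
    refine Filter.tendsto_fst.prodMk ?_
    have hc := (continuous_const_smul δ⁻¹ (T := X)).tendsto (δ • y)
    rw [inv_smul_smul] at hc
    exact hc.comp Filter.tendsto_snd
  filter_upwards [ht.eventually h] with p hp γ hγ e
  refine ⟨δ⁻¹ * γ, hp _ (Γ.mul_mem (Γ.inv_mem hδ) hγ) ?_, by simp⟩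
  simp only [mul_smul, e]

theorem LocallyFinitePair.smul_left [ContinuousConstSMul G X] {Γ : Subgroup G} {x y : X}
    (h : LocallyFinitePair Γ x y) {δ : G} (hδ : δ ∈ Γ) : LocallyFinitePair Γ (δ • x) y :=
  (h.symm.smul_right hδ).symm

/-- Cover the compact set K × K by finitely many neighbourhoods of pairs, each of which admits
finitely many elements. -/
theorem actsProperlyDiscontinuously_of_locallyFinitePair {Γ : Subgroup G} {Ω : Set X}
    (hΩ : ∀ γ ∈ Γ, ∀ x ∈ Ω, γ • x ∈ Ω) (h : ∀ x ∈ Ω, ∀ y ∈ Ω, LocallyFinitePair Γ x y) :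
    ActsProperlyDiscontinuously Γ Ω := by
  refine ⟨hΩ, fun K hK hKc => ?_⟩
  have key : {γ : G | γ ∈ Γ ∧ ∃ p ∈ K ×ˢ K, γ • p.1 = p.2}.Finite := by
    refine (hKc.prod hKc).induction_on
      (p := fun S : Set (X × X) => {γ : G | γ ∈ Γ ∧ ∃ p ∈ S, γ • p.1 = p.2}.Finite) ?_ ?_ ?_ ?_
    · simp
    · rintro S S' hSS' hS'
      exact hS'.subset fun γ ⟨hγ, p, hp, e⟩ => ⟨hγ, p, hSS' hp, e⟩
    · intro S S' hS hS'
      refine (hS.union hS').subset ?_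
      rintro γ ⟨hγ, p, hp | hp, e⟩
      · exact Or.inl ⟨hγ, p, hp, e⟩
      · exact Or.inr ⟨hγ, p, hp, e⟩
    · rintro ⟨x, y⟩ ⟨hx, hy⟩
      obtain ⟨F, hF, hev⟩ := h x (hK hx) y (hK hy)
      rw [← nhds_prod_eq] at hev
      refine ⟨_, mem_nhdsWithin_of_mem_nhds hev, hF.subset ?_⟩
      rintro γ ⟨hγ, p, hp, e⟩
      exact hp γ hγ e
  refine key.subset ?_
  rintro γ ⟨hγ, _, ⟨x, hx, rfl⟩, hy⟩
  exact ⟨hγ, (x, γ • x), ⟨hx, hy⟩, rfl⟩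

theorem ActsProperlyDiscontinuously.mono {Γ Γ' : Subgroup G} {Ω : Set X} (hle : Γ' ≤ Γ)
    (h : ActsProperlyDiscontinuously Γ Ω) : ActsProperlyDiscontinuously Γ' Ω :=
  ⟨fun γ hγ => h.1 γ (hle hγ), fun K hK hKc =>
    (h.2 K hK hKc).subset fun _ hγ => ⟨hle hγ.1, hγ.2⟩⟩

end

/-! ### Positivity of the cubics that give the pairings of the vertices -/

/-- The numerator of `L1`. -/
def numL1 (x : ℝ) : ℝ := (4 + x) * (2 * x - 1) ^ 2 - 3

/-- The numerator of `L2`. -/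
def numL2 (x : ℝ) : ℝ := 3 - (2 - x) * (2 * x - 1) ^ 2

/-- `cc1` as a polynomial in `cos (π / N)`. -/
def numC (x : ℝ) : ℝ := (1 + x) * (2 * x - 1) ^ 2

/-- The homogeneous cubic in `X = cos φ` and `y = sin φ / sin θ`, with `x = cos θ`, that gives the
pairing of a vector with a vector rotated by `(3 φ, φ)`. -/
def pairPoly (x X y a b e g a' b' e' g' : ℝ) : ℝ :=
  -(y * (3 * X ^ 2 - (1 - x ^ 2) * y ^ 2) *
      ((1 - x ^ 2) * (4 * x ^ 2 - 1) ^ 2 * (a * a') + b * b') +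
    (4 * x ^ 2 - 1) * X * (X ^ 2 - 3 * (1 - x ^ 2) * y ^ 2) * (a * b' - b * a') -
    (4 * x ^ 2 - 1) * y * (X ^ 2 + (1 - x ^ 2) * y ^ 2) * ((1 - x ^ 2) * (e * e') + g * g') -
    (4 * x ^ 2 - 1) * X * (X ^ 2 + (1 - x ^ 2) * y ^ 2) * (e * g' - g * e'))

/-- Reflects the fact that `B` is anti-symplectic and inverts rotations, while the rotation by (3π,
π) is -1: the angle φ becomes π - φ, which changes the sign of X and keeps y. -/
theorem pairPoly_flip (x X y a b e g a' b' e' g' : ℝ) :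
    pairPoly x X y (-a) b (-e) g (-a') b' (-e') g' =
      pairPoly x (-X) y a b e g a' b' e' g' := by
  simp only [pairPoly]; ring

/-- Antisymmetry of the form, together with moving the rotation to the other argument: again φ
becomes π - φ. -/
theorem pairPoly_swap (x X y a b e g a' b' e' g' : ℝ) :
    pairPoly x X y a b e g a' b' e' g' = pairPoly x (-X) y a' b' e' g' a b e g := by
  simp only [pairPoly]; ring

/-- The binary cubic form with the given coefficients. -/
def cubic (α β γ δ p q : ℝ) : ℝ := α * p ^ 3 + β * p ^ 2 * q + γ * p * q ^ 2 + δ * q ^ 3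

theorem cubic_reverse (α β γ δ p q : ℝ) : cubic α β γ δ p q = cubic δ γ β α q p := by
  simp only [cubic]; ring

/-- A negative γ is absorbed by the square q (p - ρ q)² ≥ 0, at a cost to β and δ measured by the
two conditions on ρ. -/
theorem cubic_pos_of_pos {α β γ δ ρ p q : ℝ} (hρ : 0 < ρ) (hα : 0 ≤ α) (hβ : 0 ≤ β) (hδ : 0 < δ)
    (h₁ : 0 ≤ 2 * ρ * β + γ) (h₂ : 0 < 2 * δ + ρ * γ) (hp : 0 ≤ p) (hq : 0 < q) :
    0 < cubic α β γ δ p q := by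
  rcases le_or_gt 0 γ with hγ | hγ
  · simp only [cubic]; positivity
  · have e : cubic α β γ δ p q = α * p ^ 3 + (-γ) / (2 * ρ) * (q * (p - ρ * q) ^ 2) +
        (2 * ρ * β + γ) / (2 * ρ) * (p ^ 2 * q) + (2 * δ + ρ * γ) / 2 * q ^ 3 := by
      simp only [cubic]; field_simp; ring
    have hγ' : 0 < -γ := by linarith
    rw [e]; positivity

theorem cubic_pos_of_mid {α β γ δ ρ p q : ℝ} (hρ : 0 < ρ) (hα : 0 < α) (hβ : 0 ≤ β) (hδ : 0 < δ)
    (h₁ : 0 ≤ 2 * ρ * β + γ) (h₂ : 0 < 2 * δ + ρ * γ) (hp : 0 ≤ p) (hq : 0 ≤ q)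
    (hpq : 0 < p + q) : 0 < cubic α β γ δ p q := by
  rcases hq.eq_or_lt with rfl | hq
  · have : 0 < p := by linarith
    simp only [cubic]; ring_nf; positivity
  · exact cubic_pos_of_pos hρ hα.le hβ hδ h₁ h₂ hp hq

/-- Both middle coefficients may be negative. They are absorbed by c (p + q)(p - q)² = c (p³ - p²q -
pq² + q³) with c = max(0, -β, -γ). -/
theorem cubic_pos_of_symm {α β γ δ p q : ℝ} (hα : 0 < α) (hδ : 0 < δ) (h₁ : 0 < α + β)
    (h₂ : 0 < α + γ) (h₃ : 0 < δ + β) (h₄ : 0 < δ + γ) (hp : 0 ≤ p) (hq : 0 ≤ q)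
    (hpq : 0 < p + q) : 0 < cubic α β γ δ p q := by
  obtain ⟨c, hc0, hcα, hcδ, hcβ, hcγ⟩ : ∃ c, 0 ≤ c ∧ c < α ∧ c < δ ∧ 0 ≤ c + β ∧ 0 ≤ c + γ := by
    refine ⟨max 0 (max (-β) (-γ)), le_max_left _ _, ?_, ?_, ?_, ?_⟩
    · simp only [max_lt_iff]; exact ⟨hα, by linarith, by linarith⟩
    · simp only [max_lt_iff]; exact ⟨hδ, by linarith, by linarith⟩
    · have := (le_max_left (-β) (-γ)).trans (le_max_right 0 (max (-β) (-γ))); linarith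
    · have := (le_max_right (-β) (-γ)).trans (le_max_right 0 (max (-β) (-γ))); linarith
  have e : cubic α β γ δ p q = (α - c) * p ^ 3 + (δ - c) * q ^ 3 + c * ((p + q) * (p - q) ^ 2) +
      (c + β) * (p ^ 2 * q) + (c + γ) * (p * q ^ 2) := by
    simp only [cubic]; ring
  have hα' : 0 < α - c := by linarith
  have hδ' : 0 < δ - c := by linarith
  have hmain : 0 < (α - c) * p ^ 3 + (δ - c) * q ^ 3 := by
    rcases hp.eq_or_lt with rfl | hp
    · have : 0 < q := by linarith
      positivity
    · positivity
  have : 0 ≤ c * ((p + q) * (p - q) ^ 2) + (c + β) * (p ^ 2 * q) + (c + γ) * (p * q ^ 2) := by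
    positivity
  rw [e]; linarith

/-- The pattern of all the sign lemmas: in p = xy - X and q = xy + X the form becomes, after
multiplication by 8x³, a positive factor times a binary cubic with coefficients in ℝ[x], to which a
criterion for positive cubics applies. -/
theorem pairPoly_zero_zero {x X y : ℝ} (h0 : 7 / 10 < x) (h1x : x < 1) (hp : 0 ≤ x * y - X)
    (hq : 0 ≤ x * y + X) (hy : 0 < y) :
    0 < pairPoly x X y 0 (numL1 x) 0 (numL2 x) 0 (numL1 x) 0 (numL2 x) := by
  -- On (7/10, 1) both u and w are positive, and u + w = 3. A polynomial in x that is homogenised in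
  -- u, w with positive coefficients is visibly positive there.
  obtain ⟨u, hu⟩ : ∃ u, u = 10 * x - 7 := ⟨_, rfl⟩
  obtain ⟨w, hw⟩ : ∃ w, w = 10 - 10 * x := ⟨_, rfl⟩
  have hu0 : 0 < u := by linarith
  have hw0 : 0 < w := by linarith
  have hα : 0 < -3 + 12 * x - 48 * x ^ 3 + 48 * x ^ 4 := by
    have e : -3 + 12 * x - 48 * x ^ 3 + 48 * x ^ 4 = 1 / 5625 * (32 * w ^ 4 + 280 * u * w ^ 3
      + 900 * u ^ 2 * w ^ 2 + 1250 * u ^ 3 * w + 625 * u ^ 4) := by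
      rw [hu, hw]; ring
    rw [e]; positivity
  have h1 : 0 < -12 + 49 * x - 18 * x ^ 2 + 9 * x ^ 3 - 160 * x ^ 4 + 216 * x ^ 5 - 96 * x ^
      6 + 16 * x ^ 7 := by
    have e : -12 + 49 * x - 18 * x ^ 2 + 9 * x ^ 3 - 160 * x ^ 4 + 216 * x ^ 5 - 96 * x ^ 6 +
      16 * x ^ 7 = 1 / 1366875000 * (2798428 * w ^ 7 + 18311440 * u * w ^ 6 + 50095200 * u ^ 2 *
      w ^ 5 + 75357500 * u ^ 3 * w ^ 4 + 69179375 * u ^ 4 * w ^ 3 + 40406250 * u ^ 5 * w ^ 2 +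
      14500000 * u ^ 6 * w + 2500000 * u ^ 7) := by
      rw [hu, hw]; ring
    rw [e]; positivity
  have key : 8 * x ^ 3 * pairPoly x X y 0 (numL1 x) 0 (numL2 x) 0 (numL1 x) 0 (numL2 x) = 16
      * x * (1 - x) * (1 + x) * cubic (-3 + 12 * x - 48 * x ^ 3 + 48 * x ^ 4) (-9 + 37 * x - 18
      * x ^ 2 + 57 * x ^ 3 - 208 * x ^ 4 + 216 * x ^ 5 - 96 * x ^ 6 + 16 * x ^ 7) (-9 + 37 * x -
      18 * x ^ 2 + 57 * x ^ 3 - 208 * x ^ 4 + 216 * x ^ 5 - 96 * x ^ 6 + 16 * x ^ 7) (-3 + 12 *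
      x - 48 * x ^ 3 + 48 * x ^ 4) (x * y - X) (x * y + X) := by
    simp only [pairPoly, cubic, numL1, numL2]; ring
  have hx : 0 < x := by linarith
  have hx1 : 0 < 1 - x := by linarith
  have hx2 : 0 < 2 * x - 1 := by linarith
  have hpq : 0 < (x * y - X) + (x * y + X) := by nlinarith
  have hc : 0 < cubic (-3 + 12 * x - 48 * x ^ 3 + 48 * x ^ 4) (-9 + 37 * x - 18 * x ^ 2 + 57
      * x ^ 3 - 208 * x ^ 4 + 216 * x ^ 5 - 96 * x ^ 6 + 16 * x ^ 7) (-9 + 37 * x - 18 * x ^ 2 +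
      57 * x ^ 3 - 208 * x ^ 4 + 216 * x ^ 5 - 96 * x ^ 6 + 16 * x ^ 7) (-3 + 12 * x - 48 * x ^
      3 + 48 * x ^ 4) (x * y - X) (x * y + X) := by
    apply cubic_pos_of_symm _ _ _ _ _ _ hp hq hpq <;> linarith
  have h8 : 0 < 8 * x ^ 3 := by positivity
  refine (mul_pos_iff_of_pos_left h8).1 ?_
  rw [key]; positivity

theorem pairPoly_zero_two {x X y : ℝ} (h0 : 7 / 10 < x) (h1x : x < 1) (hp : 0 ≤ x * y - X)
    (hq : 0 ≤ x * y + X) (hy : 0 < y) :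
    0 < pairPoly x X y 0 (numL1 x) 0 (numL2 x) 0 1 0 1 := by
  obtain ⟨u, hu⟩ : ∃ u, u = 10 * x - 7 := ⟨_, rfl⟩
  obtain ⟨w, hw⟩ : ∃ w, w = 10 - 10 * x := ⟨_, rfl⟩
  have hu0 : 0 < u := by linarith
  have hw0 : 0 < w := by linarith
  have hα : 0 < -3/2 + 6 * x ^ 2 := by
    have e : -3/2 + 6 * x ^ 2 = 1 / 50 * (8 * w ^ 2 + 30 * u * w + 25 * u ^ 2) := by
      rw [hu, hw]; ring
    rw [e]; positivity
  have h1 : 0 < -6 + x + 16 * x ^ 2 - 3 * x ^ 3 - 8 * x ^ 4 + 4 * x ^ 5 := by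
    have e : -6 + x + 16 * x ^ 2 - 3 * x ^ 3 - 8 * x ^ 4 + 4 * x ^ 5 = 1 / 6075000 * (6562 * w
      ^ 5 + 128930 * u * w ^ 4 + 449875 * u ^ 2 * w ^ 3 + 637750 * u ^ 3 * w ^ 2 + 410000 * u ^
      4 * w + 100000 * u ^ 5) := by
      rw [hu, hw]; ring
    rw [e]; positivity
  have key : 8 * x ^ 3 * pairPoly x X y 0 (numL1 x) 0 (numL2 x) 0 1 0 1 = 16 * x * (1 - x) *
      cubic (-3/2 + 6 * x ^ 2) (-9/2 + x + 10 * x ^ 2 - 3 * x ^ 3 - 8 * x ^ 4 + 4 * x ^ 5) (-9/2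
      + x + 10 * x ^ 2 - 3 * x ^ 3 - 8 * x ^ 4 + 4 * x ^ 5) (-3/2 + 6 * x ^ 2) (x * y - X) (x *
      y + X) := by
    simp only [pairPoly, cubic, numL1, numL2]; ring
  have hx : 0 < x := by linarith
  have hx1 : 0 < 1 - x := by linarith
  have hx2 : 0 < 2 * x - 1 := by linarith
  have hpq : 0 < (x * y - X) + (x * y + X) := by nlinarith
  have hc : 0 < cubic (-3/2 + 6 * x ^ 2) (-9/2 + x + 10 * x ^ 2 - 3 * x ^ 3 - 8 * x ^ 4 + 4
      * x ^ 5) (-9/2 + x + 10 * x ^ 2 - 3 * x ^ 3 - 8 * x ^ 4 + 4 * x ^ 5) (-3/2 + 6 * x ^ 2) (x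
      * y - X) (x * y + X) := by
    apply cubic_pos_of_symm _ _ _ _ _ _ hp hq hpq <;> linarith
  have h8 : 0 < 8 * x ^ 3 := by positivity
  refine (mul_pos_iff_of_pos_left h8).1 ?_
  rw [key]; positivity

/-- The cubic is pq(p + q), which vanishes when p = 0 or q = 0; hence the strict hypotheses. -/
theorem pairPoly_two_two {x X y : ℝ} (h0 : 7 / 10 < x) (h1x : x < 1) (hp : 0 < x * y - X)
    (hq : 0 < x * y + X) :
    0 < pairPoly x X y 0 1 0 1 0 1 0 1 := by
  have key : 8 * x ^ 3 * pairPoly x X y 0 1 0 1 0 1 0 1 = 16 * x * x * (1 - x) * (1 + x) *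
      cubic 0 (1) (1) 0 (x * y - X) (x * y + X) := by
    simp only [pairPoly, cubic]; ring
  have hx : 0 < x := by linarith
  have hx1 : 0 < 1 - x := by linarith
  have hx2 : 0 < 2 * x - 1 := by linarith
  have hc : 0 < cubic 0 (1) (1) 0 (x * y - X) (x * y + X) := by
    generalize x * y - X = p at hp
    generalize x * y + X = q at hq
    simp only [cubic]
    ring_nf; positivity
  have h8 : 0 < 8 * x ^ 3 := by positivity
  refine (mul_pos_iff_of_pos_left h8).1 ?_
  rw [key]; positivity

theorem pairPoly_zero_one {x X y : ℝ} (h0 : 7 / 10 < x) (h1x : x < 1) (hp : 0 ≤ x * y - X)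
    (hq : 0 ≤ x * y + X) (hy : 0 < y) :
    0 < pairPoly x X y 0 (numL1 x) 0 (numL2 x) (-numL2 x) (den x * numC x) (-numL1 x) (den x *
      (1 + x)) := by
  obtain ⟨u, hu⟩ : ∃ u, u = 10 * x - 7 := ⟨_, rfl⟩
  obtain ⟨w, hw⟩ : ∃ w, w = 10 - 10 * x := ⟨_, rfl⟩
  have hu0 : 0 < u := by linarith
  have hw0 : 0 < w := by linarith
  have hα : 0 < 17 - 32 * x + 75 * x ^ 2 + 118 * x ^ 3 - 424 * x ^ 4 + 336 * x ^ 5 - 16 * x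
      ^ 6 - 32 * x ^ 7 := by
    have e : 17 - 32 * x + 75 * x ^ 2 + 118 * x ^ 3 - 424 * x ^ 4 + 336 * x ^ 5 - 16 * x ^ 6 -
      32 * x ^ 7 = 1 / 227812500 * (2289104 * w ^ 7 + 16824100 * u * w ^ 6 + 53418600 * u ^ 2 *
      w ^ 5 + 95408500 * u ^ 3 * w ^ 4 + 104022500 * u ^ 4 * w ^ 3 + 69496875 * u ^ 5 * w ^ 2 +
      26375000 * u ^ 6 * w + 4375000 * u ^ 7) := by
      rw [hu, hw]; ring
    rw [e]; positivity
  have hδ : 0 < 18 - 36 * x - 72 * x ^ 2 + 144 * x ^ 3 := by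
    have e : 18 - 36 * x - 72 * x ^ 2 + 144 * x ^ 3 = 2 / 125 * (16 * w ^ 3 + 100 * u * w ^ 2
      + 200 * u ^ 2 * w + 125 * u ^ 3) := by
      rw [hu, hw]; ring
    rw [e]; positivity
  have h1 : 0 < 69 - 142 * x + 261 * x ^ 2 + 72 * x ^ 3 - 656 * x ^ 4 + 432 * x ^ 5 + 48 * x
      ^ 6 - 64 * x ^ 7 := by
    have e : 69 - 142 * x + 261 * x ^ 2 + 72 * x ^ 3 - 656 * x ^ 4 + 432 * x ^ 5 + 48 * x ^ 6
      - 64 * x ^ 7 = 1 / 683437500 * (11769724 * w ^ 7 + 77093200 * u * w ^ 6 + 212928600 * u ^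
      2 * w ^ 5 + 321395750 * u ^ 3 * w ^ 4 + 287335625 * u ^ 4 * w ^ 3 + 153665625 * u ^ 5 * w
      ^ 2 + 46375000 * u ^ 6 * w + 6250000 * u ^ 7) := by
      rw [hu, hw]; ring
    rw [e]; positivity
  have h2 : 0 < 70 - 146 * x + 114 * x ^ 2 + 98 * x ^ 3 - 232 * x ^ 4 + 96 * x ^ 5 + 64 * x
      ^ 6 - 32 * x ^ 7 := by
    have e : 70 - 146 * x + 114 * x ^ 2 + 98 * x ^ 3 - 232 * x ^ 4 + 96 * x ^ 5 + 64 * x ^ 6 -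
      32 * x ^ 7 = 1 / 683437500 * (7062412 * w ^ 7 + 48760900 * u * w ^ 6 + 146632800 * u ^ 2 *
      w ^ 5 + 249685250 * u ^ 3 * w ^ 4 + 260928125 * u ^ 4 * w ^ 3 + 167925000 * u ^ 5 * w ^ 2
      + 61750000 * u ^ 6 * w + 10000000 * u ^ 7) := by
      rw [hu, hw]; ring
    rw [e]; positivity
  have h4 : 0 < 71 - 150 * x - 33 * x ^ 2 + 124 * x ^ 3 + 192 * x ^ 4 - 240 * x ^ 5 + 80 * x
      ^ 6 := by
    have e : 71 - 150 * x - 33 * x ^ 2 + 124 * x ^ 3 + 192 * x ^ 4 - 240 * x ^ 5 + 80 * x ^ 6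
      = 1 / 9112500 * (94204 * w ^ 6 + 722940 * u * w ^ 5 + 2490540 * u ^ 2 * w ^ 4 + 4628450 *
      u ^ 3 * w ^ 3 + 4752375 * u ^ 4 * w ^ 2 + 2535000 * u ^ 5 * w + 550000 * u ^ 6) := by
      rw [hu, hw]; ring
    rw [e]; positivity
  have key : 8 * x ^ 3 * pairPoly x X y 0 (numL1 x) 0 (numL2 x) (-numL2 x) (den x * numC x)
      (-numL1 x) (den x * (1 + x)) = 8 * x * (1 - x) * (1 + x) * (2 * x - 1) * cubic (17 - 32 *
      x + 75 * x ^ 2 + 118 * x ^ 3 - 424 * x ^ 4 + 336 * x ^ 5 - 16 * x ^ 6 - 32 * x ^ 7) (52 -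
      110 * x + 186 * x ^ 2 - 46 * x ^ 3 - 232 * x ^ 4 + 96 * x ^ 5 + 64 * x ^ 6 - 32 * x ^ 7)
      (53 - 114 * x + 39 * x ^ 2 - 20 * x ^ 3 + 192 * x ^ 4 - 240 * x ^ 5 + 80 * x ^ 6) (18 - 36
      * x - 72 * x ^ 2 + 144 * x ^ 3) (x * y - X) (x * y + X) := by
    simp only [pairPoly, cubic, numL1, numL2, numC, den]; ring
  have hx : 0 < x := by linarith
  have hx1 : 0 < 1 - x := by linarith
  have hx2 : 0 < 2 * x - 1 := by linarith
  have hpq : 0 < (x * y - X) + (x * y + X) := by nlinarith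
  have hc : 0 < cubic (17 - 32 * x + 75 * x ^ 2 + 118 * x ^ 3 - 424 * x ^ 4 + 336 * x ^ 5 -
      16 * x ^ 6 - 32 * x ^ 7) (52 - 110 * x + 186 * x ^ 2 - 46 * x ^ 3 - 232 * x ^ 4 + 96 * x ^
      5 + 64 * x ^ 6 - 32 * x ^ 7) (53 - 114 * x + 39 * x ^ 2 - 20 * x ^ 3 + 192 * x ^ 4 - 240 *
      x ^ 5 + 80 * x ^ 6) (18 - 36 * x - 72 * x ^ 2 + 144 * x ^ 3) (x * y - X) (x * y + X) := by
    apply cubic_pos_of_symm _ _ _ _ _ _ hp hq hpq <;> linarith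
  have h8 : 0 < 8 * x ^ 3 := by positivity
  refine (mul_pos_iff_of_pos_left h8).1 ?_
  rw [key]; positivity

theorem pairPoly_zero_three {x X y : ℝ} (h0 : 7 / 10 < x) (h1x : x < 1) (hp : 0 ≤ x * y - X)
    (hq : 0 ≤ x * y + X) (hy : 0 < y) :
    0 < pairPoly x X y 0 (numL1 x) 0 (numL2 x) 1 (numC x) 1 (1 + x) := by
  obtain ⟨u, hu⟩ : ∃ u, u = 10 * x - 7 := ⟨_, rfl⟩
  obtain ⟨w, hw⟩ : ∃ w, w = 10 - 10 * x := ⟨_, rfl⟩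
  have hu0 : 0 < u := by linarith
  have hw0 : 0 < w := by linarith
  have hα : 0 < 3 + 6 * x := by
    have e : 3 + 6 * x = 3 / 5 * (4 * w + 5 * u) := by
      rw [hu, hw]; ring
    rw [e]; positivity
  have hβ : 0 < 10 + 10 * x - 3 * x ^ 2 - 8 * x ^ 3 + 4 * x ^ 4 := by
    have e : 10 + 10 * x - 3 * x ^ 2 - 8 * x ^ 3 + 4 * x ^ 4 = 1 / 202500 * (34366 * w ^ 4 +
      137110 * u * w ^ 3 + 203325 * u ^ 2 * w ^ 2 + 133000 * u ^ 3 * w + 32500 * u ^ 4) := by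
      rw [hu, hw]; ring
    rw [e]; positivity
  have hδ : 0 < 4 - 19 * x ^ 2 + 10 * x ^ 3 + 36 * x ^ 4 + 8 * x ^ 5 := by
    have e : 4 - 19 * x ^ 2 + 10 * x ^ 3 + 36 * x ^ 4 + 8 * x ^ 5 = 1 / 1012500 * (33784 * w ^
      5 + 227790 * u * w ^ 4 + 624050 * u ^ 2 * w ^ 3 + 860125 * u ^ 3 * w ^ 2 + 592500 * u ^ 4
      * w + 162500 * u ^ 5) := by
      rw [hu, hw]; ring
    rw [e]; positivity
  have h1 : 0 < 133/3 + 112/3 * x - 32 * x ^ 2 - 146/3 * x ^ 3 + 16/3 * x ^ 4 + 8 * x ^ 5 :=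
      by
    have e : 133/3 + 112/3 * x - 32 * x ^ 2 - 146/3 * x ^ 3 + 16/3 * x ^ 4 + 8 * x ^ 5 = 1 /
      9112500 * (1526966 * w ^ 5 + 6936370 * u * w ^ 4 + 12168425 * u ^ 2 * w ^ 3 + 10162250 * u
      ^ 3 * w ^ 2 + 3940000 * u ^ 4 * w + 537500 * u ^ 5) := by
      rw [hu, hw]; ring
    rw [e]; positivity
  have h2 : 0 < 79/3 + 20/3 * x - 224/3 * x ^ 2 - 50/3 * x ^ 3 + 176/3 * x ^ 4 + 88/3 * x ^
      5 := by
    have e : 79/3 + 20/3 * x - 224/3 * x ^ 2 - 50/3 * x ^ 3 + 176/3 * x ^ 4 + 88/3 * x ^ 5 = 1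
      / 9112500 * (289222 * w ^ 5 + 1371170 * u * w ^ 4 + 3144025 * u ^ 2 * w ^ 3 + 4392250 * u
      ^ 3 * w ^ 2 + 3440000 * u ^ 4 * w + 1112500 * u ^ 5) := by
      rw [hu, hw]; ring
    rw [e]; positivity
  have key : 8 * x ^ 3 * pairPoly x X y 0 (numL1 x) 0 (numL2 x) 1 (numC x) 1 (1 + x) = 8 * x
      * (1 - x) * (2 * x - 1) * cubic (4 - 19 * x ^ 2 + 10 * x ^ 3 + 36 * x ^ 4 + 8 * x ^ 5) (11
      + 4 * x - 22 * x ^ 2 - 22 * x ^ 3 - 8 * x ^ 4 + 8 * x ^ 5) (10 + 10 * x - 3 * x ^ 2 - 8 *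
      x ^ 3 + 4 * x ^ 4) (3 + 6 * x) (x * y - X) (x * y + X) := by
    simp only [pairPoly, cubic, numL1, numL2, numC]; ring
  have hx : 0 < x := by linarith
  have hx1 : 0 < 1 - x := by linarith
  have hx2 : 0 < 2 * x - 1 := by linarith
  have hpq : 0 < (x * y - X) + (x * y + X) := by nlinarith
  have hc : 0 < cubic (4 - 19 * x ^ 2 + 10 * x ^ 3 + 36 * x ^ 4 + 8 * x ^ 5) (11 + 4 * x -
      22 * x ^ 2 - 22 * x ^ 3 - 8 * x ^ 4 + 8 * x ^ 5) (10 + 10 * x - 3 * x ^ 2 - 8 * x ^ 3 + 4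
      * x ^ 4) (3 + 6 * x) (x * y - X) (x * y + X) := by
    -- Only the coefficient of p²q can be negative, and reversing the cubic puts it in the place of
    -- γ. The weight 5/3 satisfies both conditions `h1` and `h2` of the criterion.
    rw [cubic_reverse]
    apply cubic_pos_of_mid (ρ := (5 / 3)) _ _ _ _ _ _ hq hp (by linarith) <;> linarith
  have h8 : 0 < 8 * x ^ 3 := by positivity
  refine (mul_pos_iff_of_pos_left h8).1 ?_
  rw [key]; positivity

theorem pairPoly_two_one {x X y : ℝ} (h0 : 7 / 10 < x) (h1x : x < 1) (hp : 0 ≤ x * y - X)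
    (hq : 0 ≤ x * y + X) (hy : 0 < y) :
    0 < pairPoly x X y 0 1 0 1 (-numL2 x) (den x * numC x) (-numL1 x) (den x * (1 + x)) := by
  obtain ⟨u, hu⟩ : ∃ u, u = 10 * x - 7 := ⟨_, rfl⟩
  obtain ⟨w, hw⟩ : ∃ w, w = 10 - 10 * x := ⟨_, rfl⟩
  have hu0 : 0 < u := by linarith
  have hw0 : 0 < w := by linarith
  have hα : 0 < 3 + 6 * x := by
    have e : 3 + 6 * x = 3 / 5 * (4 * w + 5 * u) := by
      rw [hu, hw]; ring
    rw [e]; positivity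
  have hβ : 0 < 8 + 2 * x + 3 * x ^ 2 + 20 * x ^ 3 + 20 * x ^ 4 := by
    have e : 8 + 2 * x + 3 * x ^ 2 + 20 * x ^ 3 + 20 * x ^ 4 = 1 / 40500 * (11266 * w ^ 4 +
      54520 * u * w ^ 3 + 100635 * u ^ 2 * w ^ 2 + 83800 * u ^ 3 * w + 26500 * u ^ 4) := by
      rw [hu, hw]; ring
    rw [e]; positivity
  have hδ : 0 < 2 - 5 * x ^ 2 + 14 * x ^ 3 + 12 * x ^ 4 - 8 * x ^ 5 := by
    have e : 2 - 5 * x ^ 2 + 14 * x ^ 3 + 12 * x ^ 4 - 8 * x ^ 5 = 1 / 1012500 * (24536 * w ^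
      5 + 148230 * u * w ^ 4 + 359650 * u ^ 2 * w ^ 3 + 435875 * u ^ 3 * w ^ 2 + 262500 * u ^ 4
      * w + 62500 * u ^ 5) := by
      rw [hu, hw]; ring
    rw [e]; positivity
  have h1 : 0 < 23 + 4 * x ^ 2 + 50 * x ^ 3 + 24 * x ^ 4 - 8 * x ^ 5 := by
    have e : 23 + 4 * x ^ 2 + 50 * x ^ 3 + 24 * x ^ 4 - 8 * x ^ 5 = 1 / 1012500 * (193866 * w
      ^ 5 + 1097360 * u * w ^ 4 + 2507825 * u ^ 2 * w ^ 3 + 2886750 * u ^ 3 * w ^ 2 + 1670000 *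
      u ^ 4 * w + 387500 * u ^ 5) := by
      rw [hu, hw]; ring
    rw [e]; positivity
  have h2 : 0 < 11 - 4 * x - 12 * x ^ 2 + 38 * x ^ 3 + 8 * x ^ 4 - 24 * x ^ 5 := by
    have e : 11 - 4 * x - 12 * x ^ 2 + 38 * x ^ 3 + 8 * x ^ 4 - 24 * x ^ 5 = 1 / 3037500 *
      (165514 * w ^ 5 + 892160 * u * w ^ 4 + 1923625 * u ^ 2 * w ^ 3 + 2053750 * u ^ 3 * w ^ 2 +
      1070000 * u ^ 4 * w + 212500 * u ^ 5) := by
      rw [hu, hw]; ring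
    rw [e]; positivity
  have key : 8 * x ^ 3 * pairPoly x X y 0 1 0 1 (-numL2 x) (den x * numC x) (-numL1 x) (den
      x * (1 + x)) = 8 * x * (1 - x) * (2 * x - 1) * cubic (2 - 5 * x ^ 2 + 14 * x ^ 3 + 12 * x
      ^ 4 - 8 * x ^ 5) (7 - 4 * x - 2 * x ^ 2 + 10 * x ^ 3 - 16 * x ^ 4 - 8 * x ^ 5) (8 + 2 * x
      + 3 * x ^ 2 + 20 * x ^ 3 + 20 * x ^ 4) (3 + 6 * x) (x * y - X) (x * y + X) := by
    simp only [pairPoly, cubic, numL1, numL2, numC, den]; ring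
  have hx : 0 < x := by linarith
  have hx1 : 0 < 1 - x := by linarith
  have hx2 : 0 < 2 * x - 1 := by linarith
  have hpq : 0 < (x * y - X) + (x * y + X) := by nlinarith
  have hc : 0 < cubic (2 - 5 * x ^ 2 + 14 * x ^ 3 + 12 * x ^ 4 - 8 * x ^ 5) (7 - 4 * x - 2 *
      x ^ 2 + 10 * x ^ 3 - 16 * x ^ 4 - 8 * x ^ 5) (8 + 2 * x + 3 * x ^ 2 + 20 * x ^ 3 + 20 * x
      ^ 4) (3 + 6 * x) (x * y - X) (x * y + X) := by
    rw [cubic_reverse]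
    apply cubic_pos_of_mid (ρ := 1) _ _ _ _ _ _ hq hp (by linarith) <;> linarith
  have h8 : 0 < 8 * x ^ 3 := by positivity
  refine (mul_pos_iff_of_pos_left h8).1 ?_
  rw [key]; positivity

/-- The cubic is divisible by p and has positive remaining coefficients, so only p = 0 has to be
excluded. -/
theorem pairPoly_two_three {x X y : ℝ} (h0 : 7 / 10 < x) (h1x : x < 1) (hp : 0 < x * y - X)
    (hq : 0 ≤ x * y + X) :
    0 < pairPoly x X y 0 1 0 1 1 (numC x) 1 (1 + x) := by
  have key : 8 * x ^ 3 * pairPoly x X y 0 1 0 1 1 (numC x) 1 (1 + x) = 8 * x * (1 - x) * (1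
      + x) * (2 * x - 1) * cubic (1 + 2 * x) (2 + 2 * x) (1) 0 (x * y - X) (x * y + X) := by
    simp only [pairPoly, cubic, numC]; ring
  have hx : 0 < x := by linarith
  have hx1 : 0 < 1 - x := by linarith
  have hx2 : 0 < 2 * x - 1 := by linarith
  have hc : 0 < cubic (1 + 2 * x) (2 + 2 * x) (1) 0 (x * y - X) (x * y + X) := by
    generalize x * y - X = p at hp
    generalize x * y + X = q at hq
    simp only [cubic]
    ring_nf; positivity
  have h8 : 0 < 8 * x ^ 3 := by positivity
  refine (mul_pos_iff_of_pos_left h8).1 ?_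
  rw [key]; positivity

/-- The coefficient of p³ vanishes, so the cubic is divisible by q and needs q > 0. -/
theorem pairPoly_one_flip_three {x X y : ℝ} (h0 : 7 / 10 < x) (h1x : x < 1) (hp : 0 ≤ x * y
    - X) (hq : 0 < x * y + X) :
    0 < pairPoly x X y (-numL2 x) (den x * numC x) (-numL1 x) (den x * (1 + x)) (-1) (numC x)
      (-1) (1 + x) := by
  obtain ⟨u, hu⟩ : ∃ u, u = 10 * x - 7 := ⟨_, rfl⟩
  obtain ⟨w, hw⟩ : ∃ w, w = 10 - 10 * x := ⟨_, rfl⟩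
  have hu0 : 0 < u := by linarith
  have hw0 : 0 < w := by linarith
  have hβ : 0 < 4 - 24 * x + 48 * x ^ 2 + 16 * x ^ 3 := by
    have e : 4 - 24 * x + 48 * x ^ 2 + 16 * x ^ 3 = 2 / 3375 * (1013 * w ^ 3 + 4290 * u * w ^
      2 + 6000 * u ^ 2 * w + 2750 * u ^ 3) := by
      rw [hu, hw]; ring
    rw [e]; positivity
  have hδ : 0 < 4 - 12 * x + 20 * x ^ 2 + 80 * x ^ 3 - 136 * x ^ 4 - 16 * x ^ 5 + 160 * x ^
      6 - 64 * x ^ 7 := by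
    have e : 4 - 12 * x + 20 * x ^ 2 + 80 * x ^ 3 - 136 * x ^ 4 - 16 * x ^ 5 + 160 * x ^ 6 -
      64 * x ^ 7 = 1 / 37968750 * (191848 * w ^ 7 + 1532730 * u * w ^ 6 + 5298250 * u ^ 2 * w ^
      5 + 10299625 * u ^ 3 * w ^ 4 + 12186250 * u ^ 4 * w ^ 3 + 8781250 * u ^ 5 * w ^ 2 +
      3562500 * u ^ 6 * w + 625000 * u ^ 7) := by
      rw [hu, hw]; ring
    rw [e]; positivity
  have h1 : 0 < 16 - 84 * x + 164 * x ^ 2 + 88 * x ^ 3 - 144 * x ^ 4 + 32 * x ^ 5 := by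
    have e : 16 - 84 * x + 164 * x ^ 2 + 88 * x ^ 3 - 144 * x ^ 4 + 32 * x ^ 5 = 1 / 253125 *
      (40154 * w ^ 5 + 236960 * u * w ^ 4 + 549600 * u ^ 2 * w ^ 3 + 624125 * u ^ 3 * w ^ 2 +
      346250 * u ^ 4 * w + 75000 * u ^ 5) := by
      rw [hu, hw]; ring
    rw [e]; positivity
  have h2 : 0 < 16 - 60 * x + 108 * x ^ 2 + 216 * x ^ 3 - 416 * x ^ 4 + 320 * x ^ 6 - 128 *
      x ^ 7 := by
    have e : 16 - 60 * x + 108 * x ^ 2 + 216 * x ^ 3 - 416 * x ^ 4 + 320 * x ^ 6 - 128 * x ^ 7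
      = 1 / 170859375 * (2205682 * w ^ 7 + 16734670 * u * w ^ 6 + 54364800 * u ^ 2 * w ^ 5 +
      98363000 * u ^ 3 * w ^ 4 + 107551250 * u ^ 4 * w ^ 3 + 71428125 * u ^ 5 * w ^ 2 + 26781250
      * u ^ 6 * w + 4375000 * u ^ 7) := by
      rw [hu, hw]; ring
    rw [e]; positivity
  have key : 8 * x ^ 3 * pairPoly x X y (-numL2 x) (den x * numC x) (-numL1 x) (den x * (1 +
      x)) (-1) (numC x) (-1) (1 + x) = 8 * x * (1 - x) * (1 + x) * (2 * x - 1) * cubic 0 (4 - 24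
      * x + 48 * x ^ 2 + 16 * x ^ 3) (8 - 36 * x + 68 * x ^ 2 + 56 * x ^ 3 - 144 * x ^ 4 + 32 *
      x ^ 5) (4 - 12 * x + 20 * x ^ 2 + 80 * x ^ 3 - 136 * x ^ 4 - 16 * x ^ 5 + 160 * x ^ 6 - 64
      * x ^ 7) (x * y - X) (x * y + X) := by
    simp only [pairPoly, cubic, numL1, numL2, numC, den]; ring
  have hx : 0 < x := by linarith
  have hx1 : 0 < 1 - x := by linarith
  have hx2 : 0 < 2 * x - 1 := by linarith
  have hc : 0 < cubic 0 (4 - 24 * x + 48 * x ^ 2 + 16 * x ^ 3) (8 - 36 * x + 68 * x ^ 2 + 56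
      * x ^ 3 - 144 * x ^ 4 + 32 * x ^ 5) (4 - 12 * x + 20 * x ^ 2 + 80 * x ^ 3 - 136 * x ^ 4 -
      16 * x ^ 5 + 160 * x ^ 6 - 64 * x ^ 7) (x * y - X) (x * y + X) := by
    apply cubic_pos_of_pos (ρ := 1) _ _ _ _ _ _ hp hq <;> linarith
  have h8 : 0 < 8 * x ^ 3 := by positivity
  refine (mul_pos_iff_of_pos_left h8).1 ?_
  rw [key]; positivity

theorem pairPoly_one_flip_one {x X y : ℝ} (h0 : 7 / 10 < x) (h1x : x < 1) (hp : 0 ≤ x * y -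
    X) (hq : 0 ≤ x * y + X) (hy : 0 < y) :
    0 < pairPoly x X y (-numL2 x) (den x * numC x) (-numL1 x) (den x * (1 + x)) (numL2 x) (den
      x * numC x) (numL1 x) (den x * (1 + x)) := by
  obtain ⟨u, hu⟩ : ∃ u, u = 10 * x - 7 := ⟨_, rfl⟩
  obtain ⟨w, hw⟩ : ∃ w, w = 10 - 10 * x := ⟨_, rfl⟩
  have hu0 : 0 < u := by linarith
  have hw0 : 0 < w := by linarith
  have hα : 0 < 36 - 72 * x - 144 * x ^ 2 + 288 * x ^ 3 := by
    have e : 36 - 72 * x - 144 * x ^ 2 + 288 * x ^ 3 = 4 / 125 * (16 * w ^ 3 + 100 * u * w ^ 2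
      + 200 * u ^ 2 * w + 125 * u ^ 3) := by
      rw [hu, hw]; ring
    rw [e]; positivity
  have hβ : 0 < 98 - 276 * x + 174 * x ^ 2 - 8 * x ^ 3 + 480 * x ^ 4 - 672 * x ^ 5 + 416 * x
      ^ 6 := by
    have e : 98 - 276 * x + 174 * x ^ 2 - 8 * x ^ 3 + 480 * x ^ 4 - 672 * x ^ 5 + 416 * x ^ 6
      = 1 / 22781250 * (1205092 * w ^ 6 + 9360240 * u * w ^ 5 + 30867000 * u ^ 2 * w ^ 4 +
      54724250 * u ^ 3 * w ^ 3 + 54796875 * u ^ 4 * w ^ 2 + 29400000 * u ^ 5 * w + 6625000 * u ^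
      6) := by
      rw [hu, hw]; ring
    rw [e]; positivity
  have hδ : 0 < 26 - 84 * x + 166 * x ^ 2 - 728 * x ^ 4 + 2024 * x ^ 5 - 1488 * x ^ 6 - 1216
      * x ^ 7 + 2560 * x ^ 8 - 1408 * x ^ 9 + 256 * x ^ 10 := by
    have e : 26 - 84 * x + 166 * x ^ 2 - 728 * x ^ 4 + 2024 * x ^ 5 - 1488 * x ^ 6 - 1216 * x
      ^ 7 + 2560 * x ^ 8 - 1408 * x ^ 9 + 256 * x ^ 10 = 1 / 256289062500 * (159326096 * w ^ 10
      + 1771443860 * u * w ^ 9 + 8867048200 * u ^ 2 * w ^ 8 + 26302607000 * u ^ 3 * w ^ 7 +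
      51196180000 * u ^ 4 * w ^ 6 + 68332465625 * u ^ 5 * w ^ 5 + 63361000000 * u ^ 6 * w ^ 4 +
      40323125000 * u ^ 7 * w ^ 3 + 16864843750 * u ^ 8 * w ^ 2 + 4187500000 * u ^ 9 * w +
      468750000 * u ^ 10) := by
      rw [hu, hw]; ring
    rw [e]; positivity
  have h1 : 0 < 284 - 840 * x + 832 * x ^ 2 - 512 * x ^ 3 + 1032 * x ^ 4 - 160 * x ^ 5 -
      1408 * x ^ 6 + 1152 * x ^ 7 - 128 * x ^ 8 := by
    have e : 284 - 840 * x + 832 * x ^ 2 - 512 * x ^ 3 + 1032 * x ^ 4 - 160 * x ^ 5 - 1408 * x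
      ^ 6 + 1152 * x ^ 7 - 128 * x ^ 8 = 1 / 1708593750 * (18437348 * w ^ 8 + 166289360 * u * w
      ^ 7 + 666892200 * u ^ 2 * w ^ 6 + 1544656750 * u ^ 3 * w ^ 5 + 2253214375 * u ^ 4 * w ^ 4
      + 2118600000 * u ^ 5 * w ^ 3 + 1256000000 * u ^ 6 * w ^ 2 + 430625000 * u ^ 7 * w +
      65625000 * u ^ 8) := by
      rw [hu, hw]; ring
    rw [e]; positivity
  have h2 : 0 < 140 - 456 * x + 816 * x ^ 2 - 496 * x ^ 3 - 1384 * x ^ 4 + 5232 * x ^ 5 -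
      5216 * x ^ 6 - 1280 * x ^ 7 + 4992 * x ^ 8 - 2816 * x ^ 9 + 512 * x ^ 10 := by
    have e : 140 - 456 * x + 816 * x ^ 2 - 496 * x ^ 3 - 1384 * x ^ 4 + 5232 * x ^ 5 - 5216 *
      x ^ 6 - 1280 * x ^ 7 + 4992 * x ^ 8 - 2816 * x ^ 9 + 512 * x ^ 10 = 1 / 1153300781250 *
      (1310370964 * w ^ 10 + 13454538940 * u * w ^ 9 + 61723413900 * u ^ 2 * w ^ 8 +
      166110678750 * u ^ 3 * w ^ 7 + 289544716875 * u ^ 4 * w ^ 6 + 340517053125 * u ^ 5 * w ^ 5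
      + 272767265625 * u ^ 6 * w ^ 4 + 146485312500 * u ^ 7 * w ^ 3 + 50315625000 * u ^ 8 * w ^
      2 + 9953125000 * u ^ 9 * w + 859375000 * u ^ 10) := by
      rw [hu, hw]; ring
    rw [e]; positivity
  have key : 8 * x ^ 3 * pairPoly x X y (-numL2 x) (den x * numC x) (-numL1 x) (den x * (1 +
      x)) (numL2 x) (den x * numC x) (numL1 x) (den x * (1 + x)) = 8 * x * (1 - x) * (1 + x) *
      (2 * x - 1) * cubic (36 - 72 * x - 144 * x ^ 2 + 288 * x ^ 3) (98 - 276 * x + 174 * x ^ 2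
      - 8 * x ^ 3 + 480 * x ^ 4 - 672 * x ^ 5 + 416 * x ^ 6) (88 - 288 * x + 484 * x ^ 2 - 496 *
      x ^ 3 + 72 * x ^ 4 + 1184 * x ^ 5 - 2240 * x ^ 6 + 1152 * x ^ 7 - 128 * x ^ 8) (26 - 84 *
      x + 166 * x ^ 2 - 728 * x ^ 4 + 2024 * x ^ 5 - 1488 * x ^ 6 - 1216 * x ^ 7 + 2560 * x ^ 8
      - 1408 * x ^ 9 + 256 * x ^ 10) (x * y - X) (x * y + X) := by
    simp only [pairPoly, cubic, numL1, numL2, numC, den]; ring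
  have hx : 0 < x := by linarith
  have hx1 : 0 < 1 - x := by linarith
  have hx2 : 0 < 2 * x - 1 := by linarith
  have hpq : 0 < (x * y - X) + (x * y + X) := by nlinarith
  have hc : 0 < cubic (36 - 72 * x - 144 * x ^ 2 + 288 * x ^ 3) (98 - 276 * x + 174 * x ^ 2
      - 8 * x ^ 3 + 480 * x ^ 4 - 672 * x ^ 5 + 416 * x ^ 6) (88 - 288 * x + 484 * x ^ 2 - 496 *
      x ^ 3 + 72 * x ^ 4 + 1184 * x ^ 5 - 2240 * x ^ 6 + 1152 * x ^ 7 - 128 * x ^ 8) (26 - 84 *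
      x + 166 * x ^ 2 - 728 * x ^ 4 + 2024 * x ^ 5 - 1488 * x ^ 6 - 1216 * x ^ 7 + 2560 * x ^ 8
      - 1408 * x ^ 9 + 256 * x ^ 10) (x * y - X) (x * y + X) := by
    apply cubic_pos_of_mid (ρ := 1) _ _ _ _ _ _ hp hq hpq <;> linarith
  have h8 : 0 < 8 * x ^ 3 := by positivity
  refine (mul_pos_iff_of_pos_left h8).1 ?_
  rw [key]; positivity

theorem pairPoly_three_flip_three {x X y : ℝ} (h0 : 7 / 10 < x) (h1x : x < 1) (hp : 0 ≤ x *
    y - X) (hq : 0 < x * y + X) :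
    0 < pairPoly x X y 1 (numC x) 1 (1 + x) (-1) (numC x) (-1) (1 + x) := by
  obtain ⟨u, hu⟩ : ∃ u, u = 10 * x - 7 := ⟨_, rfl⟩
  obtain ⟨w, hw⟩ : ∃ w, w = 10 - 10 * x := ⟨_, rfl⟩
  have hu0 : 0 < u := by linarith
  have hw0 : 0 < w := by linarith
  have hβ : 0 < 2 := by
    norm_num
  have hδ : 0 < 2 - 8 * x ^ 2 + 8 * x ^ 3 + 16 * x ^ 4 := by
    have e : 2 - 8 * x ^ 2 + 8 * x ^ 3 + 16 * x ^ 4 = 1 / 5625 * (324 * w ^ 4 + 1765 * u * w ^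
      3 + 3700 * u ^ 2 * w ^ 2 + 3500 * u ^ 3 * w + 1250 * u ^ 4) := by
      rw [hu, hw]; ring
    rw [e]; positivity
  have h1 : 0 < 10 - 8 * x ^ 2 := by
    have e : 10 - 8 * x ^ 2 = 2 / 225 * (76 * w ^ 2 + 110 * u * w + 25 * u ^ 2) := by
      rw [hu, hw]; ring
    rw [e]; positivity
  have h2 : 0 < 10 - 28 * x ^ 2 + 16 * x ^ 3 + 32 * x ^ 4 := by
    have e : 10 - 28 * x ^ 2 + 16 * x ^ 3 + 32 * x ^ 4 = 1 / 16875 * (1969 * w ^ 4 + 9640 * u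
      * w ^ 3 + 18975 * u ^ 2 * w ^ 2 + 17500 * u ^ 3 * w + 6250 * u ^ 4) := by
      rw [hu, hw]; ring
    rw [e]; positivity
  have key : 8 * x ^ 3 * pairPoly x X y 1 (numC x) 1 (1 + x) (-1) (numC x) (-1) (1 + x) = 8
      * x * (1 - x) * (1 + x) * (2 * x - 1) * cubic 0 (2) (4 - 8 * x ^ 2) (2 - 8 * x ^ 2 + 8 * x
      ^ 3 + 16 * x ^ 4) (x * y - X) (x * y + X) := by
    simp only [pairPoly, cubic, numC]; ring
  have hx : 0 < x := by linarith
  have hx1 : 0 < 1 - x := by linarith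
  have hx2 : 0 < 2 * x - 1 := by linarith
  have hc : 0 < cubic 0 (2) (4 - 8 * x ^ 2) (2 - 8 * x ^ 2 + 8 * x ^ 3 + 16 * x ^ 4) (x * y
      - X) (x * y + X) := by
    apply cubic_pos_of_pos (ρ := (3 / 2)) _ _ _ _ _ _ hp hq <;> linarith
  have h8 : 0 < 8 * x ^ 3 := by positivity
  refine (mul_pos_iff_of_pos_left h8).1 ?_
  rw [key]; positivity

theorem pairPoly_one_one {x X y : ℝ} (h0 : 7 / 10 < x) (h1x : x < 1) (hp : 0 ≤ x * y - X)
    (hq : 0 ≤ x * y + X) (hy : 0 < y) :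
    0 < pairPoly x X y (-numL2 x) (den x * numC x) (-numL1 x) (den x * (1 + x)) (-numL2 x)
      (den x * numC x) (-numL1 x) (den x * (1 + x)) := by
  obtain ⟨u, hu⟩ : ∃ u, u = 10 * x - 7 := ⟨_, rfl⟩
  obtain ⟨w, hw⟩ : ∃ w, w = 10 - 10 * x := ⟨_, rfl⟩
  have hu0 : 0 < u := by linarith
  have hw0 : 0 < w := by linarith
  have hα : 0 < 19 - 52 * x + 111 * x ^ 2 + 206 * x ^ 3 - 680 * x ^ 4 + 336 * x ^ 5 + 304 *
      x ^ 6 - 160 * x ^ 7 := by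
    have e : 19 - 52 * x + 111 * x ^ 2 + 206 * x ^ 3 - 680 * x ^ 4 + 336 * x ^ 5 + 304 * x ^ 6
      - 160 * x ^ 7 = 1 / 45562500 * (488336 * w ^ 7 + 3739732 * u * w ^ 6 + 12609000 * u ^ 2 *
      w ^ 5 + 24428500 * u ^ 3 * w ^ 4 + 29463500 * u ^ 4 * w ^ 3 + 22066875 * u ^ 5 * w ^ 2 +
      9425000 * u ^ 6 * w + 1750000 * u ^ 7) := by
      rw [hu, hw]; ring
    rw [e]; positivity
  have hβ : 0 < 57 - 208 * x + 597 * x ^ 2 - 522 * x ^ 3 - 296 * x ^ 4 + 624 * x ^ 5 - 48 *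
      x ^ 6 - 160 * x ^ 7 := by
    have e : 57 - 208 * x + 597 * x ^ 2 - 522 * x ^ 3 - 296 * x ^ 4 + 624 * x ^ 5 - 48 * x ^ 6
      - 160 * x ^ 7 = 1 / 136687500 * (2491640 * w ^ 7 + 17878148 * u * w ^ 6 + 55131720 * u ^ 2
      * w ^ 5 + 94749400 * u ^ 3 * w ^ 4 + 97840750 * u ^ 4 * w ^ 3 + 60309375 * u ^ 5 * w ^ 2 +
      20225000 * u ^ 6 * w + 2750000 * u ^ 7) := by
      rw [hu, hw]; ring
    rw [e]; positivity
  have h1 : 0 < 171 - 624 * x + 1791 * x ^ 2 - 1566 * x ^ 3 - 888 * x ^ 4 + 1872 * x ^ 5 -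
      144 * x ^ 6 - 480 * x ^ 7 := by
    have e : 171 - 624 * x + 1791 * x ^ 2 - 1566 * x ^ 3 - 888 * x ^ 4 + 1872 * x ^ 5 - 144 *
      x ^ 6 - 480 * x ^ 7 = 1 / 45562500 * (2491640 * w ^ 7 + 17878148 * u * w ^ 6 + 55131720 *
      u ^ 2 * w ^ 5 + 94749400 * u ^ 3 * w ^ 4 + 97840750 * u ^ 4 * w ^ 3 + 60309375 * u ^ 5 * w
      ^ 2 + 20225000 * u ^ 6 * w + 2750000 * u ^ 7) := by
      rw [hu, hw]; ring
    rw [e]; positivity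
  have h2 : 0 < 95 - 312 * x + 819 * x ^ 2 - 110 * x ^ 3 - 1656 * x ^ 4 + 1296 * x ^ 5 + 560
      * x ^ 6 - 480 * x ^ 7 := by
    have e : 95 - 312 * x + 819 * x ^ 2 - 110 * x ^ 3 - 1656 * x ^ 4 + 1296 * x ^ 5 + 560 * x
      ^ 6 - 480 * x ^ 7 = 1 / 136687500 * (5421656 * w ^ 7 + 40316540 * u * w ^ 6 + 130785720 *
      u ^ 2 * w ^ 5 + 241320400 * u ^ 3 * w ^ 4 + 274621750 * u ^ 4 * w ^ 3 + 192710625 * u ^ 5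
      * w ^ 2 + 76775000 * u ^ 6 * w + 13250000 * u ^ 7) := by
      rw [hu, hw]; ring
    rw [e]; positivity
  have key : 8 * x ^ 3 * pairPoly x X y (-numL2 x) (den x * numC x) (-numL1 x) (den x * (1 +
      x)) (-numL2 x) (den x * numC x) (-numL1 x) (den x * (1 + x)) = 8 * x * (1 - x) * (1 + x) *
      (2 * x - 1) * cubic (19 - 52 * x + 111 * x ^ 2 + 206 * x ^ 3 - 680 * x ^ 4 + 336 * x ^ 5 +
      304 * x ^ 6 - 160 * x ^ 7) (57 - 208 * x + 597 * x ^ 2 - 522 * x ^ 3 - 296 * x ^ 4 + 624 *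
      x ^ 5 - 48 * x ^ 6 - 160 * x ^ 7) (57 - 208 * x + 597 * x ^ 2 - 522 * x ^ 3 - 296 * x ^ 4
      + 624 * x ^ 5 - 48 * x ^ 6 - 160 * x ^ 7) (19 - 52 * x + 111 * x ^ 2 + 206 * x ^ 3 - 680 *
      x ^ 4 + 336 * x ^ 5 + 304 * x ^ 6 - 160 * x ^ 7) (x * y - X) (x * y + X) := by
    simp only [pairPoly, cubic, numL1, numL2, numC, den]; ring
  have hx : 0 < x := by linarith
  have hx1 : 0 < 1 - x := by linarith
  have hx2 : 0 < 2 * x - 1 := by linarith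
  have hpq : 0 < (x * y - X) + (x * y + X) := by nlinarith
  have hc : 0 < cubic (19 - 52 * x + 111 * x ^ 2 + 206 * x ^ 3 - 680 * x ^ 4 + 336 * x ^ 5 +
      304 * x ^ 6 - 160 * x ^ 7) (57 - 208 * x + 597 * x ^ 2 - 522 * x ^ 3 - 296 * x ^ 4 + 624 *
      x ^ 5 - 48 * x ^ 6 - 160 * x ^ 7) (57 - 208 * x + 597 * x ^ 2 - 522 * x ^ 3 - 296 * x ^ 4
      + 624 * x ^ 5 - 48 * x ^ 6 - 160 * x ^ 7) (19 - 52 * x + 111 * x ^ 2 + 206 * x ^ 3 - 680 *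
      x ^ 4 + 336 * x ^ 5 + 304 * x ^ 6 - 160 * x ^ 7) (x * y - X) (x * y + X) := by
    apply cubic_pos_of_mid (ρ := 1) _ _ _ _ _ _ hp hq hpq <;> linarith
  have h8 : 0 < 8 * x ^ 3 := by positivity
  refine (mul_pos_iff_of_pos_left h8).1 ?_
  rw [key]; positivity

theorem pairPoly_one_three {x X y : ℝ} (h0 : 7 / 10 < x) (h1x : x < 1) (hp : 0 ≤ x * y - X)
    (hq : 0 ≤ x * y + X) (hy : 0 < y) :
    0 < pairPoly x X y (-numL2 x) (den x * numC x) (-numL1 x) (den x * (1 + x)) 1 (numC x) 1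
      (1 + x) := by
  obtain ⟨u, hu⟩ : ∃ u, u = 10 * x - 7 := ⟨_, rfl⟩
  obtain ⟨w, hw⟩ : ∃ w, w = 10 - 10 * x := ⟨_, rfl⟩
  have hu0 : 0 < u := by linarith
  have hw0 : 0 < w := by linarith
  have hα : 0 < 11 - 5 * x - 42 * x ^ 2 + 44 * x ^ 3 + 40 * x ^ 4 := by
    have e : 11 - 5 * x - 42 * x ^ 2 + 44 * x ^ 3 + 40 * x ^ 4 = 1 / 6750 * (968 * w ^ 4 +
      5266 * u * w ^ 3 + 11250 * u ^ 2 * w ^ 2 + 10925 * u ^ 3 * w + 4000 * u ^ 4) := by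
      rw [hu, hw]; ring
    rw [e]; positivity
  have hβ : 0 < 27 - 17 * x - 42 * x ^ 2 + 12 * x ^ 3 + 40 * x ^ 4 := by
    have e : 27 - 17 * x - 42 * x ^ 2 + 12 * x ^ 3 + 40 * x ^ 4 = 1 / 20250 * (2060 * w ^ 4 +
      7994 * u * w ^ 3 + 13890 * u ^ 2 * w ^ 2 + 12875 * u ^ 3 * w + 5000 * u ^ 4) := by
      rw [hu, hw]; ring
    rw [e]; positivity
  have hδ : 0 < 5 + x - 6 * x ^ 2 + 20 * x ^ 3 - 8 * x ^ 4 := by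
    have e : 5 + x - 6 * x ^ 2 + 20 * x ^ 3 - 8 * x ^ 4 = 1 / 33750 * (3208 * w ^ 4 + 14210 *
      u * w ^ 3 + 23850 * u ^ 2 * w ^ 2 + 17875 * u ^ 3 * w + 5000 * u ^ 4) := by
      rw [hu, hw]; ring
    rw [e]; positivity
  have h1 : 0 < 75 - 45 * x - 90 * x ^ 2 + 12 * x ^ 3 + 72 * x ^ 4 := by
    have e : 75 - 45 * x - 90 * x ^ 2 + 12 * x ^ 3 + 72 * x ^ 4 = 1 / 33750 * (8668 * w ^ 4 +
      27850 * u * w ^ 3 + 37050 * u ^ 2 * w ^ 2 + 27625 * u ^ 3 * w + 10000 * u ^ 4) := by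
      rw [hu, hw]; ring
    rw [e]; positivity
  have h2 : 0 < 31 - 9 * x - 18 * x ^ 2 + 28 * x ^ 3 - 24 * x ^ 4 := by
    have e : 31 - 9 * x - 18 * x ^ 2 + 28 * x ^ 3 - 24 * x ^ 4 = 1 / 101250 * (24652 * w ^ 4 +
      88870 * u * w ^ 3 + 115350 * u ^ 2 * w ^ 2 + 61375 * u ^ 3 * w + 10000 * u ^ 4) := by
      rw [hu, hw]; ring
    rw [e]; positivity
  have key : 8 * x ^ 3 * pairPoly x X y (-numL2 x) (den x * numC x) (-numL1 x) (den x * (1 +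
      x)) 1 (numC x) 1 (1 + x) = 8 * x * (1 - x) * (1 + x) * (2 * x - 1) * cubic (11 - 5 * x -
      42 * x ^ 2 + 44 * x ^ 3 + 40 * x ^ 4) (27 - 17 * x - 42 * x ^ 2 + 12 * x ^ 3 + 40 * x ^ 4)
      (21 - 11 * x - 6 * x ^ 2 - 12 * x ^ 3 - 8 * x ^ 4) (5 + x - 6 * x ^ 2 + 20 * x ^ 3 - 8 * x
      ^ 4) (x * y - X) (x * y + X) := by
    simp only [pairPoly, cubic, numL1, numL2, numC, den]; ring
  have hx : 0 < x := by linarith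
  have hx1 : 0 < 1 - x := by linarith
  have hx2 : 0 < 2 * x - 1 := by linarith
  have hpq : 0 < (x * y - X) + (x * y + X) := by nlinarith
  have hc : 0 < cubic (11 - 5 * x - 42 * x ^ 2 + 44 * x ^ 3 + 40 * x ^ 4) (27 - 17 * x - 42
      * x ^ 2 + 12 * x ^ 3 + 40 * x ^ 4) (21 - 11 * x - 6 * x ^ 2 - 12 * x ^ 3 - 8 * x ^ 4) (5 +
      x - 6 * x ^ 2 + 20 * x ^ 3 - 8 * x ^ 4) (x * y - X) (x * y + X) := by
    apply cubic_pos_of_mid (ρ := 1) _ _ _ _ _ _ hp hq hpq <;> linarith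
  have h8 : 0 < 8 * x ^ 3 := by positivity
  refine (mul_pos_iff_of_pos_left h8).1 ?_
  rw [key]; positivity

theorem pairPoly_three_three {x X y : ℝ} (h0 : 7 / 10 < x) (h1x : x < 1) (hp : 0 ≤ x * y -
    X) (hq : 0 ≤ x * y + X) (hy : 0 < y) :
    0 < pairPoly x X y 1 (numC x) 1 (1 + x) 1 (numC x) 1 (1 + x) := by
  obtain ⟨u, hu⟩ : ∃ u, u = 10 * x - 7 := ⟨_, rfl⟩
  obtain ⟨w, hw⟩ : ∃ w, w = 10 - 10 * x := ⟨_, rfl⟩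
  have hu0 : 0 < u := by linarith
  have hw0 : 0 < w := by linarith
  have hα : 0 < 1 + 2 * x := by
    have e : 1 + 2 * x = 1 / 5 * (4 * w + 5 * u) := by
      rw [hu, hw]; ring
    rw [e]; positivity
  have hβ : 0 < 3 + 2 * x := by
    have e : 3 + 2 * x = 1 / 15 * (22 * w + 25 * u) := by
      rw [hu, hw]; ring
    rw [e]; positivity
  have h1 : 0 < 9 + 6 * x := by
    have e : 9 + 6 * x = 1 / 5 * (22 * w + 25 * u) := by
      rw [hu, hw]; ring
    rw [e]; positivity
  have h2 : 0 < 5 + 6 * x := by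
    have e : 5 + 6 * x = 1 / 15 * (46 * w + 55 * u) := by
      rw [hu, hw]; ring
    rw [e]; positivity
  have key : 8 * x ^ 3 * pairPoly x X y 1 (numC x) 1 (1 + x) 1 (numC x) 1 (1 + x) = 8 * x *
      (1 - x) * (1 + x) * (2 * x - 1) * cubic (1 + 2 * x) (3 + 2 * x) (3 + 2 * x) (1 + 2 * x) (x
      * y - X) (x * y + X) := by
    simp only [pairPoly, cubic, numC]; ring
  have hx : 0 < x := by linarith
  have hx1 : 0 < 1 - x := by linarith
  have hx2 : 0 < 2 * x - 1 := by linarith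
  have hpq : 0 < (x * y - X) + (x * y + X) := by nlinarith
  have hc : 0 < cubic (1 + 2 * x) (3 + 2 * x) (3 + 2 * x) (1 + 2 * x) (x * y - X) (x * y +
      X) := by
    apply cubic_pos_of_mid (ρ := 1) _ _ _ _ _ _ hp hq hpq <;> linarith
  have h8 : 0 < 8 * x ^ 3 := by positivity
  refine (mul_pos_iff_of_pos_left h8).1 ?_
  rw [key]; positivity

/-! ### The vertices of the ping-pong cones -/

section

variable {N : ℕ}

theorem toMat_A (N : ℕ) : toMat (A N) = matA N := rfl
theorem toMat_B (N : ℕ) : toMat (B N) = matB := rfl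
theorem toMat_C (N : ℕ) : toMat (C N) = matC N := rfl

theorem matB_mulVec (y : V) : matB *ᵥ y = ![-y 0, y 1, -y 2, y 3] := by
  ext i
  fin_cases i <;> simp [matB, Matrix.mulVec, dotProduct, Fin.sum_univ_four]

theorem matA_mulVec (N : ℕ) (y : V) : matA N *ᵥ y =
    ![-y 0, y 1 - r1 N * (y 0 + y 2), -y 2, y 3 - r2 N * (y 0 + y 2)] := by
  ext i
  fin_cases i <;> simp [matA, Matrix.mulVec, dotProduct, Fin.sum_univ_four] <;> ring

theorem matC_mulVec (N : ℕ) (y : V) : matC N *ᵥ y =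
    ![-c1 N * y 0 + s1 N * y 1, s1 N * y 0 + c1 N * y 1,
      -c2 N * y 2 + s2 N * y 3, s2 N * y 2 + c2 N * y 3] := by
  ext i
  fin_cases i <;> simp [matC, Matrix.mulVec, dotProduct, Fin.sum_univ_four]

theorem r1_mul (hN : 4 ≤ N) : r1 N * (cc1 N - cc2 N) = -(2 * (cc1 N ^ 2 / s1 N)) := by
  have h1 := (s1_pos hN).ne'
  have h2 := (sub_pos.2 (cc1_lt_cc2 hN)).ne'
  rw [r1_eq]; field_simp; ring

theorem r2_mul (hN : 4 ≤ N) : r2 N * (cc1 N - cc2 N) = 2 * (cc2 N ^ 2 / s2 N) := by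
  have h1 := (s2_pos hN).ne'
  have h2 := (sub_pos.2 (cc1_lt_cc2 hN)).ne'
  rw [r2_eq]; field_simp; ring

/-- The factor `κ` in `T x = x + κ λ(x) v`. -/
def kap (N : ℕ) : ℝ := (-(cc1 N * cc2 N) + 3 * (cc1 N + cc2 N)) / 3

theorem kap_pos (hN : 4 ≤ N) : 0 < kap N := by
  have h1 := den_pos (cosN_lt_one hN)
  have h2 := cosN_gt hN
  rw [kap, denominator_eq hN]; positivity

/-- With `kap_L2`, this is the property for which `L1` and `L2` are chosen: it makes `kap N • (v₀ N
+ v₂ N)` equal to v₃ plus its image under `B`. -/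
theorem kap_L1 (hN : 4 ≤ N) : kap N * (L1 N + 1) = 2 * cc1 N := by
  have h : -(cc1 N * cc2 N) + 3 * (cc1 N + cc2 N) ≠ 0 := fun h0 =>
    (kap_pos hN).ne' (by rw [kap, h0, zero_div])
  rw [kap, L1, div_add_one h, div_mul_div_comm, mul_comm, mul_div_mul_right _ _ h]
  ring

theorem kap_L2 (hN : 4 ≤ N) : kap N * (L2 N + 1) = 2 * cc2 N := by
  have h : -(cc1 N * cc2 N) + 3 * (cc1 N + cc2 N) ≠ 0 := fun h0 =>
    (kap_pos hN).ne' (by rw [kap, h0, zero_div])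
  rw [kap, L2, div_add_one h, div_mul_div_comm, mul_comm, mul_div_mul_right _ _ h]
  ring

/-- The functional y 0 + y 2, through which `A` acts on the other coordinates, takes the same value
cc1 - cc2 on v₁ as on v₃; so `A` negates both. -/
theorem L_rel (hN : 4 ≤ N) : -(L2 N * cc1 N) + L1 N * cc2 N = cc1 N - cc2 N := by
  have h := (kap_pos hN).ne'
  have h1 := kap_L1 hN
  have h2 := kap_L2 hN
  apply mul_left_cancel₀ h
  linear_combination cc2 N * h1 - cc1 N * h2

/-- With the next three lemmas: `A` acts as +1 on the `e`-vertices and as -1 on the `f`-vertices, so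
it carries the base cone to the flipped one. -/
theorem A_v₀ (N : ℕ) : toMat (A N) *ᵥ v₀ N = v₀ N := by
  rw [toMat_A, matA_mulVec]; ext i; fin_cases i <;> simp [v₀]

theorem A_v₂ (N : ℕ) : toMat (A N) *ᵥ v₂ N = v₂ N := by
  rw [toMat_A, matA_mulVec]; ext i; fin_cases i <;> simp [v₂]

theorem A_v₃ (hN : 4 ≤ N) : toMat (A N) *ᵥ v₃ N = -v₃ N := by
  rw [toMat_A, matA_mulVec]
  have h1 := r1_mul hN
  have h2 := r2_mul hN
  ext i; fin_cases i <;> simp [v₃] <;> linarith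

theorem A_v₁ (hN : 4 ≤ N) : toMat (A N) *ᵥ v₁ N = -v₁ N := by
  rw [toMat_A, matA_mulVec]
  have h1 := r1_mul hN
  have h2 := r2_mul hN
  have h3 := L_rel hN
  ext i; fin_cases i <;> simp [v₁]
  · rw [h3, h1]; ring
  · rw [h3, h2]; ring

theorem B_v₀ (N : ℕ) : toMat (B N) *ᵥ v₀ N = v₀ N := by
  rw [toMat_B, matB_mulVec]; ext i; fin_cases i <;> simp [v₀]

theorem B_v₂ (N : ℕ) : toMat (B N) *ᵥ v₂ N = v₂ N := by
  rw [toMat_B, matB_mulVec]; ext i; fin_cases i <;> simp [v₂]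

/-- `B` agrees with `A` on the vertices up to a multiple of v₀ + v₂, which is why `A * B` is a
transvection in this direction. -/
theorem B_v₃ (hN : 4 ≤ N) : toMat (B N) *ᵥ v₃ N = kap N • (v₀ N + v₂ N) - v₃ N := by
  rw [toMat_B, matB_mulVec]
  have h1 := kap_L1 hN
  have h2 := kap_L2 hN
  ext i; fin_cases i <;> simp [v₀, v₂, v₃]
  · linear_combination (cc1 N / s1 N) * h1
  · linear_combination (-(cc2 N / s2 N)) * h2

theorem B_v₁ (hN : 4 ≤ N) : toMat (B N) *ᵥ v₁ N = kap N • (v₀ N + v₂ N) - v₁ N := by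
  rw [toMat_B, matB_mulVec]
  have h1 := kap_L1 hN
  have h2 := kap_L2 hN
  ext i; fin_cases i <;> simp [v₀, v₂, v₁]
  · linear_combination (cc1 N / s1 N) * h1
  · linear_combination (-(cc2 N / s2 N)) * h2

theorem s1_sq (N : ℕ) : s1 N * s1 N = 1 - c1 N * c1 N := by
  have := Real.cos_sq_add_sin_sq (mu1 N); simp only [c1, s1]; nlinarith

theorem s2_sq (N : ℕ) : s2 N * s2 N = 1 - c2 N * c2 N := by
  have := Real.cos_sq_add_sin_sq (mu2 N); simp only [c2, s2]; nlinarith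

/-- So the base cone and its image under `C` share the vertex line of v₃. -/
theorem C_v₃ (hN : 4 ≤ N) : toMat (C N) *ᵥ v₃ N = -v₃ N := by
  rw [toMat_C, matC_mulVec]
  have h1 := (s1_pos hN).ne'
  have h2 := (s2_pos hN).ne'
  have k1 := s1_sq N
  have k2 := s2_sq N
  ext i; fin_cases i <;> simp [v₃]
  · field_simp; simp only [cc1]; ring
  · field_simp; simp only [cc1]; linear_combination (1 - c1 N) * k1
  · field_simp; simp only [cc2]; ring
  · field_simp; simp only [cc2]; linear_combination (-(1 - c2 N)) * k2

theorem C_v₂ (hN : 4 ≤ N) : toMat (C N) *ᵥ v₂ N = v₂ N - v₃ N := by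
  rw [toMat_C, matC_mulVec]
  have h1 := (s1_pos hN).ne'
  have h2 := (s2_pos hN).ne'
  ext i; fin_cases i <;> simp [v₃, v₂]
  · field_simp
  · field_simp; simp only [cc1]; ring
  · field_simp
  · field_simp; simp only [cc2]; ring

/-- The vector with the given coordinates in a basis adapted to the rotation planes. -/
def planeVec (N : ℕ) (a b e g : ℝ) : V :=
  ![a * cc1 N, -(b * (cc1 N / s1 N)), -(e * cc2 N), g * (cc2 N / s2 N)]

theorem smul_planeVec (k a b e g : ℝ) :
    k • planeVec N a b e g = planeVec N (k * a) (k * b) (k * e) (k * g) := by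
  ext i; fin_cases i <;> simp [planeVec] <;> ring

theorem B_planeVec (a b e g : ℝ) :
    toMat (B N) *ᵥ planeVec N a b e g = planeVec N (-a) b (-e) g := by
  rw [toMat_B, matB_mulVec]; ext i; fin_cases i <;> simp [planeVec]

theorem den_smul_v₀ (hN : 4 ≤ N) :
    den (cosN N) • v₀ N = planeVec N 0 (numL1 (cosN N)) 0 (numL2 (cosN N)) := by
  have h := (den_pos (cosN_lt_one hN)).ne'
  have e : v₀ N = planeVec N 0 (L1 N) 0 (L2 N) := by
    ext i; fin_cases i <;> simp [planeVec, v₀]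
  rw [e, smul_planeVec, L1_eq hN, L2_eq hN, mul_div_cancel₀ _ h, mul_div_cancel₀ _ h]
  simp [numL1, numL2]

theorem v₂_eq (N : ℕ) : v₂ N = planeVec N 0 1 0 1 := by
  ext i; fin_cases i <;> simp [planeVec, v₂]

theorem v₃_eq (hN : 4 ≤ N) :
    v₃ N = planeVec N 1 (numC (cosN N)) 1 (1 + cosN N) := by
  have h : v₃ N = planeVec N 1 (cc1 N) 1 (cc2 N) := by
    ext i; fin_cases i <;> simp [planeVec, v₃] <;> ring
  rw [h, cc1_eq hN, cc2_eq hN, numC]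

theorem den_smul_v₁ (hN : 4 ≤ N) : den (cosN N) • v₁ N =
    planeVec N (-numL2 (cosN N)) (den (cosN N) * numC (cosN N)) (-numL1 (cosN N))
      (den (cosN N) * (1 + cosN N)) := by
  have h := (den_pos (cosN_lt_one hN)).ne'
  have e : v₁ N = planeVec N (-L2 N) (cc1 N) (-L1 N) (cc2 N) := by
    ext i; fin_cases i <;> simp [planeVec, v₁] <;> ring
  rw [e, smul_planeVec, L1_eq hN, L2_eq hN, mul_neg, mul_neg, mul_div_cancel₀ _ h,
    mul_div_cancel₀ _ h, cc1_eq hN, cc2_eq hN, numC, numL1, numL2]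

/-- The rotation by `(3φ, φ)`. -/
def rotVec (φ : ℝ) (y : V) : V :=
  ![Real.cos (3 * φ) * y 0 + Real.sin (3 * φ) * y 1,
    -Real.sin (3 * φ) * y 0 + Real.cos (3 * φ) * y 1,
    Real.cos φ * y 2 + Real.sin φ * y 3, -Real.sin φ * y 2 + Real.cos φ * y 3]

/-- The angles μ₁, μ₂ are π minus 3π/N and π/N, which accounts for the sign. -/
theorem R_mulVec (hN : 4 ≤ N) (y : V) :
    toMat (R N) *ᵥ y = -rotVec (Real.pi / N) y := by
  have hc1 : c1 N = -Real.cos (3 * (Real.pi / N)) := by rw [c1, mu1_eq hN, Real.cos_pi_sub]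
  have hs1 : s1 N = Real.sin (3 * (Real.pi / N)) := by rw [s1, mu1_eq hN, Real.sin_pi_sub]
  have hc2 : c2 N = -Real.cos (Real.pi / N) := by rw [c2, mu2_eq hN, Real.cos_pi_sub]
  have hs2 : s2 N = Real.sin (Real.pi / N) := by rw [s2, mu2_eq hN, Real.sin_pi_sub]
  rw [R, toMat_mul, ← Matrix.mulVec_mulVec, toMat_C, matC_mulVec, toMat_B, matB_mulVec, hc1, hc2,
    hs1, hs2]
  ext i; fin_cases i <;> simp [rotVec] <;> ring

theorem rotVec_rotVec (φ ψ : ℝ) (y : V) : rotVec φ (rotVec ψ y) = rotVec (φ + ψ) y := by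
  ext i
  fin_cases i <;> simp [rotVec, mul_add, Real.cos_add, Real.sin_add] <;> ring

theorem rotVec_smul (φ k : ℝ) (y : V) : rotVec φ (k • y) = k • rotVec φ y := by
  ext i; fin_cases i <;> simp [rotVec] <;> ring

theorem R_pow_mulVec (hN : 4 ≤ N) (k : ℕ) (y : V) :
    toMat (R N ^ k) *ᵥ y = (-1 : ℝ) ^ k • rotVec (k * (Real.pi / N)) y := by
  induction k with
  | zero =>
    rw [pow_zero, toMat_one, Matrix.one_mulVec]
    ext i; fin_cases i <;> simp [rotVec]
  | succ k ih =>
    rw [pow_succ', ← toMat_mulVec_mulVec, ih, R_mulVec hN, rotVec_smul, rotVec_rotVec]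
    rw [show Real.pi / N + k * (Real.pi / N) = ((k + 1 : ℕ) : ℝ) * (Real.pi / N) by
      push_cast; ring]
    rw [pow_succ]; module

/-- The positive constant in `pairing_rotVec`. -/
def pairConst (N : ℕ) : ℝ :=
  2 * cc1 N ^ 2 * cc2 N ^ 2 / ((cc2 N - cc1 N) * s1 N * s2 N * (4 * cosN N ^ 2 - 1))

theorem four_mul_sq_sub_pos (hN : 4 ≤ N) : 0 < 4 * cosN N ^ 2 - 1 := by
  have := cosN_gt hN; nlinarith

theorem pairConst_pos (hN : 4 ≤ N) : 0 < pairConst N := by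
  have h1 := cc1_pos hN
  have h2 := cc2_pos hN
  have h3 := sub_pos.2 (cc1_lt_cc2 hN)
  have h4 := s1_pos hN
  have h5 := s2_pos hN
  have h6 := four_mul_sq_sub_pos hN
  rw [pairConst]; positivity

theorem pairing_rotVec (hN : 4 ≤ N) (φ a b e g a' b' e' g' : ℝ) :
    pairing N (planeVec N a b e g) (rotVec φ (planeVec N a' b' e' g')) =
      -(pairConst N *
        pairPoly (cosN N) (Real.cos φ) (Real.sin φ / sinN N) a b e g a' b' e' g') := by
  have hs := (sinN_pos hN).ne'
  have hM := (four_mul_sq_sub_pos hN).ne'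
  have hΔ := (sub_pos.2 (cc1_lt_cc2 hN)).ne'
  have hsq : 1 - cosN N ^ 2 = sinN N ^ 2 := (sinN_sq N).symm
  -- Dividing sin φ by sin θ removes every odd power of sin θ, so that the coefficients become
  -- polynomials in cos θ.
  obtain ⟨y, hy⟩ : ∃ y, Real.sin φ = sinN N * y := ⟨Real.sin φ / sinN N, by field_simp⟩
  have hy' : Real.sin φ / sinN N = y := by rw [hy]; field_simp
  have h1 := Real.cos_sq_add_sin_sq φ
  have hS3 : Real.sin (3 * φ) =
      Real.sin φ * (3 * Real.cos φ ^ 2 - Real.sin φ ^ 2) := by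
    rw [Real.sin_three_mul]; linear_combination (-3 * Real.sin φ) * h1
  have hC3 : Real.cos (3 * φ) = Real.cos φ * (Real.cos φ ^ 2 - 3 * Real.sin φ ^ 2) := by
    rw [Real.cos_three_mul]; linear_combination (3 * Real.cos φ) * h1
  rw [hy', pairing_apply, r1_eq, r2_eq, pairConst]
  simp only [planeVec, rotVec, Matrix.cons_val_zero, Matrix.cons_val_one, Matrix.cons_val]
  rw [s1_eq hN, s2_eq hN, hS3, hC3]
  simp only [pairPoly, hsq]
  rw [hy] at h1 ⊢
  generalize Real.cos φ = X at *
  generalize cosN N = x at *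
  generalize sinN N = s at *
  generalize cc1 N = p at *
  generalize cc2 N = q at *
  obtain ⟨M, hMe⟩ : ∃ M, M = 4 * x ^ 2 - 1 := ⟨_, rfl⟩
  rw [← hMe] at hM ⊢
  -- This is the factor by which the terms of degree one were multiplied in `pairPoly` to make it
  -- homogeneous of degree three.
  have h1' : X ^ 2 + s ^ 2 * y ^ 2 = 1 := by linear_combination h1
  rw [h1']
  field_simp
  ring

end

/-! ### Signs of the pairings between the vertices and their rotations -/

/-- On the boundary p = 0 or q = 0 the form vanishes identically; elsewhere the strict version
applies. -/
theorem pairPoly_two_two_nonneg {x X y : ℝ} (h0 : 7 / 10 < x) (h1x : x < 1)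
    (hp : 0 ≤ x * y - X) (hq : 0 ≤ x * y + X) : 0 ≤ pairPoly x X y 0 1 0 1 0 1 0 1 := by
  rcases hp.eq_or_lt with hp | hp
  · obtain rfl : X = x * y := by linarith
    exact le_of_eq (by simp only [pairPoly]; ring)
  rcases hq.eq_or_lt with hq | hq
  · obtain rfl : X = -(x * y) := by linarith
    exact le_of_eq (by simp only [pairPoly]; ring)
  exact (pairPoly_two_two h0 h1x hp hq).le

theorem pairPoly_two_three_nonneg {x X y : ℝ} (h0 : 7 / 10 < x) (h1x : x < 1)
    (hp : 0 ≤ x * y - X) (hq : 0 ≤ x * y + X) :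
    0 ≤ pairPoly x X y 0 1 0 1 1 (numC x) 1 (1 + x) := by
  rcases hp.eq_or_lt with hp | hp
  · obtain rfl : X = x * y := by linarith
    exact le_of_eq (by simp only [pairPoly, numC]; ring)
  exact (pairPoly_two_three h0 h1x hp hq).le

theorem pairPoly_one_flip_three_nonneg {x X y : ℝ} (h0 : 7 / 10 < x) (h1x : x < 1)
    (hp : 0 ≤ x * y - X) (hq : 0 ≤ x * y + X) :
    0 ≤ pairPoly x X y (-numL2 x) (den x * numC x) (-numL1 x) (den x * (1 + x))
      (-1) (numC x) (-1) (1 + x) := by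
  rcases hq.eq_or_lt with hq | hq
  · obtain rfl : X = -(x * y) := by linarith
    exact le_of_eq (by simp only [pairPoly, numC, numL1, numL2, den]; ring)
  exact (pairPoly_one_flip_three h0 h1x hp hq).le

theorem pairPoly_three_flip_three_nonneg {x X y : ℝ} (h0 : 7 / 10 < x) (h1x : x < 1)
    (hp : 0 ≤ x * y - X) (hq : 0 ≤ x * y + X) :
    0 ≤ pairPoly x X y 1 (numC x) 1 (1 + x) (-1) (numC x) (-1) (1 + x) := by
  rcases hq.eq_or_lt with hq | hq
  · obtain rfl : X = -(x * y) := by linarith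
    exact le_of_eq (by simp only [pairPoly, numC]; ring)
  exact (pairPoly_three_flip_three h0 h1x hp hq).le

section

variable {N : ℕ}

/-- The pairing of `x` with `Rᵏ y`, with the sign that makes it positive on the vertices. -/
def cross (N k : ℕ) (x y : V) : ℝ := -((-1) ^ k * pairing N x (toMat (R N ^ k) *ᵥ y))

theorem cross_smul (k : ℕ) (a b : ℝ) (x y : V) :
    cross N k (a • x) (b • y) = a * (b * cross N k x y) := by
  simp only [cross, Matrix.mulVec_smul, pairing_smul_left, pairing_smul_right]; ring

theorem cross_planeVec (hN : 4 ≤ N) (k : ℕ) (a b e g a' b' e' g' : ℝ) :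
    cross N k (planeVec N a b e g) (planeVec N a' b' e' g') = pairConst N *
      pairPoly (cosN N) (Real.cos (k * (Real.pi / N))) (Real.sin (k * (Real.pi / N)) / sinN N)
        a b e g a' b' e' g' := by
  have h : ((-1 : ℝ) ^ k) * (-1) ^ k = 1 := by rw [← mul_pow]; simp
  rw [cross, R_pow_mulVec hN, pairing_smul_right, pairing_rotVec hN]
  linear_combination (pairConst N *
      pairPoly (cosN N) (Real.cos (k * (Real.pi / N))) (Real.sin (k * (Real.pi / N)) / sinN N)
        a b e g a' b' e' g') * h

theorem sin_nat_mul_nonneg (hN : 4 ≤ N) {k : ℕ} (hk : k ≤ N) :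
    0 ≤ Real.sin (k * (Real.pi / N)) := by
  have hN0 : (0 : ℝ) < N := by positivity
  apply Real.sin_nonneg_of_nonneg_of_le_pi
  · have := Real.pi_pos; positivity
  · have hk' : (k : ℝ) ≤ N := by exact_mod_cast hk
    rw [mul_div_assoc', div_le_iff₀ hN0]
    have := Real.pi_pos; nlinarith

theorem sin_nat_mul_pos (hN : 4 ≤ N) {k : ℕ} (h0 : 0 < k) (hk : k < N) :
    0 < Real.sin (k * (Real.pi / N)) := by
  have hN0 : (0 : ℝ) < N := by positivity
  apply Real.sin_pos_of_pos_of_lt_pi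
  · have := Real.pi_pos; positivity
  · have hk' : (k : ℝ) < N := by exact_mod_cast hk
    rw [mul_div_assoc', div_lt_iff₀ hN0]
    have := Real.pi_pos; nlinarith

/-- The variable p at φ = (k+1)θ is sin(kθ)/sin θ, so for 1 ≤ k < N the value at kθ is nonnegative
and vanishes only at k = 1. In the same way `add_eq_sin` gives q, which vanishes only at k = N - 1.
-/
theorem sub_eq_sin (hN : 4 ≤ N) (k : ℕ) :
    cosN N * (Real.sin ((k + 1 : ℕ) * (Real.pi / N)) / sinN N) -
      Real.cos ((k + 1 : ℕ) * (Real.pi / N)) = Real.sin (k * (Real.pi / N)) / sinN N := by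
  have hs := (sinN_pos hN).ne'
  have h : (k : ℝ) * (Real.pi / N) = (k + 1 : ℕ) * (Real.pi / N) - Real.pi / N := by
    push_cast; ring
  rw [h, Real.sin_sub]
  simp only [cosN, sinN] at hs ⊢
  field_simp

theorem add_eq_sin (hN : 4 ≤ N) (k : ℕ) :
    cosN N * (Real.sin (k * (Real.pi / N)) / sinN N) +
      Real.cos (k * (Real.pi / N)) = Real.sin ((k + 1 : ℕ) * (Real.pi / N)) / sinN N := by
  have hs := (sinN_pos hN).ne'
  have h : ((k + 1 : ℕ) : ℝ) * (Real.pi / N) = k * (Real.pi / N) + Real.pi / N := by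
    push_cast; ring
  rw [h, Real.sin_add]
  simp only [cosN, sinN] at hs ⊢
  field_simp

section

variable {k : ℕ}

theorem sub_nonneg_of_pos (hN : 4 ≤ N) (h1 : 1 ≤ k) (hk : k < N) :
    0 ≤ cosN N * (Real.sin (k * (Real.pi / N)) / sinN N) - Real.cos (k * (Real.pi / N)) := by
  obtain ⟨k, rfl⟩ := Nat.exists_eq_add_of_le' h1
  rw [sub_eq_sin hN]
  exact div_nonneg (sin_nat_mul_nonneg hN (by omega)) (sinN_pos hN).le

theorem sub_pos_of_two_le (hN : 4 ≤ N) (h1 : 2 ≤ k) (hk : k < N) :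
    0 < cosN N * (Real.sin (k * (Real.pi / N)) / sinN N) - Real.cos (k * (Real.pi / N)) := by
  obtain ⟨k, rfl⟩ := Nat.exists_eq_add_of_le' (le_of_lt h1)
  rw [sub_eq_sin hN]
  exact div_pos (sin_nat_mul_pos hN (by omega) (by omega)) (sinN_pos hN)

theorem add_nonneg_of_lt (hN : 4 ≤ N) (hk : k < N) :
    0 ≤ cosN N * (Real.sin (k * (Real.pi / N)) / sinN N) + Real.cos (k * (Real.pi / N)) := by
  rw [add_eq_sin hN]
  exact div_nonneg (sin_nat_mul_nonneg hN (by omega)) (sinN_pos hN).le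

theorem add_pos_of_lt (hN : 4 ≤ N) (hk : k + 1 < N) :
    0 < cosN N * (Real.sin (k * (Real.pi / N)) / sinN N) + Real.cos (k * (Real.pi / N)) := by
  rw [add_eq_sin hN]
  exact div_pos (sin_nat_mul_pos hN (by omega) (by omega)) (sinN_pos hN)

theorem ratio_pos (hN : 4 ≤ N) (h1 : 1 ≤ k) (hk : k < N) :
    0 < Real.sin (k * (Real.pi / N)) / sinN N :=
  div_pos (sin_nat_mul_pos hN (by omega) hk) (sinN_pos hN)

theorem cross_pos_of_smul {a b : ℝ} (ha : 0 < a) (hb : 0 < b) {x y : V}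
    (h : 0 < cross N k (a • x) (b • y)) : 0 < cross N k x y := by
  rw [cross_smul] at h
  exact (mul_pos_iff_of_pos_left hb).1 ((mul_pos_iff_of_pos_left ha).1 h)

theorem cross_nonneg_of_smul {a b : ℝ} (ha : 0 < a) (hb : 0 < b) {x y : V}
    (h : 0 ≤ cross N k (a • x) (b • y)) : 0 ≤ cross N k x y := by
  rw [cross_smul] at h
  exact (mul_nonneg_iff_of_pos_left hb).1 ((mul_nonneg_iff_of_pos_left ha).1 h)

theorem den_smul_B_v₁ (hN : 4 ≤ N) : den (cosN N) • (toMat (B N) *ᵥ v₁ N) =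
    planeVec N (numL2 (cosN N)) (den (cosN N) * numC (cosN N)) (numL1 (cosN N))
      (den (cosN N) * (1 + cosN N)) := by
  rw [← Matrix.mulVec_smul, den_smul_v₁ hN, B_planeVec, neg_neg, neg_neg]

theorem B_v₃_eq (hN : 4 ≤ N) :
    toMat (B N) *ᵥ v₃ N = planeVec N (-1) (numC (cosN N)) (-1) (1 + cosN N) := by
  rw [v₃_eq hN, B_planeVec]

/-- First entry of a sign table for all pairs of vertices. The entries that are only nonnegative
vanish at k = 1 or k = N - 1, where neighbouring cones touch. -/
theorem cross_v₀_v₀_pos (hN : 4 ≤ N) (h1 : 1 ≤ k) (hk : k < N) :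
    0 < cross N k (v₀ N) (v₀ N) := by
  apply cross_pos_of_smul (den_pos (cosN_lt_one hN)) (den_pos (cosN_lt_one hN))
  rw [den_smul_v₀ hN, cross_planeVec hN]
  refine mul_pos (pairConst_pos hN) ?_
  exact pairPoly_zero_zero (cosN_gt hN) (cosN_lt_one hN) (sub_nonneg_of_pos hN h1 hk)
      (add_nonneg_of_lt hN hk) (ratio_pos hN h1 hk)

theorem cross_v₀_v₁_pos (hN : 4 ≤ N) (h1 : 1 ≤ k) (hk : k < N) :
    0 < cross N k (v₀ N) (v₁ N) := by
  apply cross_pos_of_smul (den_pos (cosN_lt_one hN)) (den_pos (cosN_lt_one hN))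
  rw [den_smul_v₁ hN, den_smul_v₀ hN, cross_planeVec hN]
  refine mul_pos (pairConst_pos hN) ?_
  exact pairPoly_zero_one (cosN_gt hN) (cosN_lt_one hN) (sub_nonneg_of_pos hN h1 hk)
      (add_nonneg_of_lt hN hk) (ratio_pos hN h1 hk)

theorem cross_v₀_v₂_pos (hN : 4 ≤ N) (h1 : 1 ≤ k) (hk : k < N) :
    0 < cross N k (v₀ N) (v₂ N) := by
  apply cross_pos_of_smul (den_pos (cosN_lt_one hN)) one_pos
  rw [one_smul, v₂_eq, den_smul_v₀ hN, cross_planeVec hN]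
  refine mul_pos (pairConst_pos hN) ?_
  exact pairPoly_zero_two (cosN_gt hN) (cosN_lt_one hN) (sub_nonneg_of_pos hN h1 hk)
      (add_nonneg_of_lt hN hk) (ratio_pos hN h1 hk)

theorem cross_v₀_v₃_pos (hN : 4 ≤ N) (h1 : 1 ≤ k) (hk : k < N) :
    0 < cross N k (v₀ N) (v₃ N) := by
  apply cross_pos_of_smul (den_pos (cosN_lt_one hN)) one_pos
  rw [one_smul, v₃_eq hN, den_smul_v₀ hN, cross_planeVec hN]
  refine mul_pos (pairConst_pos hN) ?_
  exact pairPoly_zero_three (cosN_gt hN) (cosN_lt_one hN) (sub_nonneg_of_pos hN h1 hk)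
      (add_nonneg_of_lt hN hk) (ratio_pos hN h1 hk)

/-- An argument moved by `B` is reduced by `pairPoly_flip` to the pair (v₀, v₁) with X replaced by
-X; this exchanges p and q. -/
theorem cross_v₀_B_v₁_pos (hN : 4 ≤ N) (h1 : 1 ≤ k) (hk : k < N) :
    0 < cross N k (v₀ N) (toMat (B N) *ᵥ v₁ N) := by
  apply cross_pos_of_smul (den_pos (cosN_lt_one hN)) (den_pos (cosN_lt_one hN))
  rw [den_smul_B_v₁ hN, den_smul_v₀ hN, cross_planeVec hN]
  refine mul_pos (pairConst_pos hN) ?_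
  have e := pairPoly_flip (cosN N) (Real.cos (k * (Real.pi / N)))
    (Real.sin (k * (Real.pi / N)) / sinN N) 0 (numL1 (cosN N)) 0 (numL2 (cosN N))
    (-numL2 (cosN N)) (den (cosN N) * numC (cosN N)) (-numL1 (cosN N)) (den (cosN N) * (1 + cosN N))
  simp only [neg_zero, neg_neg] at e
  rw [e]
  exact pairPoly_zero_one (cosN_gt hN) (cosN_lt_one hN) (by simpa [sub_neg_eq_add] using
      (add_nonneg_of_lt hN hk)) (by simpa [sub_neg_eq_add] using (sub_nonneg_of_pos hN h1 hk))
          (ratio_pos hN h1 hk)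

theorem cross_v₀_B_v₃_pos (hN : 4 ≤ N) (h1 : 1 ≤ k) (hk : k < N) :
    0 < cross N k (v₀ N) (toMat (B N) *ᵥ v₃ N) := by
  apply cross_pos_of_smul (den_pos (cosN_lt_one hN)) one_pos
  rw [one_smul, B_v₃_eq hN, den_smul_v₀ hN, cross_planeVec hN]
  refine mul_pos (pairConst_pos hN) ?_
  have e := pairPoly_flip (cosN N) (Real.cos (k * (Real.pi / N)))
    (Real.sin (k * (Real.pi / N)) / sinN N) 0 (numL1 (cosN N)) 0 (numL2 (cosN N))
    1 (numC (cosN N)) 1 (1 + cosN N)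
  simp only [neg_zero] at e
  rw [e]
  exact pairPoly_zero_three (cosN_gt hN) (cosN_lt_one hN) (by simpa [sub_neg_eq_add] using
      (add_nonneg_of_lt hN hk)) (by simpa [sub_neg_eq_add] using (sub_nonneg_of_pos hN h1 hk))
          (ratio_pos hN h1 hk)

theorem cross_v₁_v₀_pos (hN : 4 ≤ N) (h1 : 1 ≤ k) (hk : k < N) :
    0 < cross N k (v₁ N) (v₀ N) := by
  apply cross_pos_of_smul (den_pos (cosN_lt_one hN)) (den_pos (cosN_lt_one hN))
  rw [den_smul_v₀ hN, den_smul_v₁ hN, cross_planeVec hN]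
  refine mul_pos (pairConst_pos hN) ?_
  rw [pairPoly_swap]
  exact pairPoly_zero_one (cosN_gt hN) (cosN_lt_one hN) (by simpa [sub_neg_eq_add] using
      (add_nonneg_of_lt hN hk)) (by simpa [sub_neg_eq_add] using (sub_nonneg_of_pos hN h1 hk))
          (ratio_pos hN h1 hk)

theorem cross_v₁_v₁_pos (hN : 4 ≤ N) (h1 : 1 ≤ k) (hk : k < N) :
    0 < cross N k (v₁ N) (v₁ N) := by
  apply cross_pos_of_smul (den_pos (cosN_lt_one hN)) (den_pos (cosN_lt_one hN))
  rw [den_smul_v₁ hN, cross_planeVec hN]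
  refine mul_pos (pairConst_pos hN) ?_
  exact pairPoly_one_one (cosN_gt hN) (cosN_lt_one hN) (sub_nonneg_of_pos hN h1 hk)
      (add_nonneg_of_lt hN hk) (ratio_pos hN h1 hk)

theorem cross_v₁_v₂_pos (hN : 4 ≤ N) (h1 : 1 ≤ k) (hk : k < N) :
    0 < cross N k (v₁ N) (v₂ N) := by
  apply cross_pos_of_smul (den_pos (cosN_lt_one hN)) one_pos
  rw [one_smul, v₂_eq, den_smul_v₁ hN, cross_planeVec hN]
  refine mul_pos (pairConst_pos hN) ?_
  rw [pairPoly_swap]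
  exact pairPoly_two_one (cosN_gt hN) (cosN_lt_one hN) (by simpa [sub_neg_eq_add] using
      (add_nonneg_of_lt hN hk)) (by simpa [sub_neg_eq_add] using (sub_nonneg_of_pos hN h1 hk))
          (ratio_pos hN h1 hk)

theorem cross_v₁_v₃_pos (hN : 4 ≤ N) (h1 : 1 ≤ k) (hk : k < N) :
    0 < cross N k (v₁ N) (v₃ N) := by
  apply cross_pos_of_smul (den_pos (cosN_lt_one hN)) one_pos
  rw [one_smul, v₃_eq hN, den_smul_v₁ hN, cross_planeVec hN]
  refine mul_pos (pairConst_pos hN) ?_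
  exact pairPoly_one_three (cosN_gt hN) (cosN_lt_one hN) (sub_nonneg_of_pos hN h1 hk)
      (add_nonneg_of_lt hN hk) (ratio_pos hN h1 hk)

theorem cross_v₁_B_v₁_pos (hN : 4 ≤ N) (h1 : 1 ≤ k) (hk : k < N) :
    0 < cross N k (v₁ N) (toMat (B N) *ᵥ v₁ N) := by
  apply cross_pos_of_smul (den_pos (cosN_lt_one hN)) (den_pos (cosN_lt_one hN))
  rw [den_smul_B_v₁ hN, den_smul_v₁ hN, cross_planeVec hN]
  refine mul_pos (pairConst_pos hN) ?_
  exact pairPoly_one_flip_one (cosN_gt hN) (cosN_lt_one hN) (sub_nonneg_of_pos hN h1 hk)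
      (add_nonneg_of_lt hN hk) (ratio_pos hN h1 hk)

theorem cross_v₁_B_v₃_nonneg (hN : 4 ≤ N) (h1 : 1 ≤ k) (hk : k < N) :
    0 ≤ cross N k (v₁ N) (toMat (B N) *ᵥ v₃ N) := by
  apply cross_nonneg_of_smul (den_pos (cosN_lt_one hN)) one_pos
  rw [one_smul, B_v₃_eq hN, den_smul_v₁ hN, cross_planeVec hN]
  refine mul_nonneg (pairConst_pos hN).le ?_
  exact pairPoly_one_flip_three_nonneg (cosN_gt hN) (cosN_lt_one hN) (sub_nonneg_of_pos hN h1 hk)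
      (add_nonneg_of_lt hN hk)

theorem cross_v₁_B_v₃_pos (hN : 4 ≤ N) (h1 : 1 ≤ k) (h2 : k + 1 < N) :
    0 < cross N k (v₁ N) (toMat (B N) *ᵥ v₃ N) := by
  apply cross_pos_of_smul (den_pos (cosN_lt_one hN)) one_pos
  rw [one_smul, B_v₃_eq hN, den_smul_v₁ hN, cross_planeVec hN]
  refine mul_pos (pairConst_pos hN) ?_
  exact pairPoly_one_flip_three (cosN_gt hN) (cosN_lt_one hN) (sub_nonneg_of_pos hN h1 (by omega))
      (add_pos_of_lt hN h2)

theorem cross_v₂_v₀_pos (hN : 4 ≤ N) (h1 : 1 ≤ k) (hk : k < N) :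
    0 < cross N k (v₂ N) (v₀ N) := by
  apply cross_pos_of_smul one_pos (den_pos (cosN_lt_one hN))
  rw [one_smul, den_smul_v₀ hN, v₂_eq, cross_planeVec hN]
  refine mul_pos (pairConst_pos hN) ?_
  rw [pairPoly_swap]
  exact pairPoly_zero_two (cosN_gt hN) (cosN_lt_one hN) (by simpa [sub_neg_eq_add] using
      (add_nonneg_of_lt hN hk)) (by simpa [sub_neg_eq_add] using (sub_nonneg_of_pos hN h1 hk))
          (ratio_pos hN h1 hk)

theorem cross_v₂_v₁_pos (hN : 4 ≤ N) (h1 : 1 ≤ k) (hk : k < N) :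
    0 < cross N k (v₂ N) (v₁ N) := by
  apply cross_pos_of_smul one_pos (den_pos (cosN_lt_one hN))
  rw [one_smul, den_smul_v₁ hN, v₂_eq, cross_planeVec hN]
  refine mul_pos (pairConst_pos hN) ?_
  exact pairPoly_two_one (cosN_gt hN) (cosN_lt_one hN) (sub_nonneg_of_pos hN h1 hk)
      (add_nonneg_of_lt hN hk) (ratio_pos hN h1 hk)

theorem cross_v₂_v₂_nonneg (hN : 4 ≤ N) (h1 : 1 ≤ k) (hk : k < N) :
    0 ≤ cross N k (v₂ N) (v₂ N) := by
  apply cross_nonneg_of_smul one_pos one_pos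
  rw [one_smul, v₂_eq, cross_planeVec hN]
  refine mul_nonneg (pairConst_pos hN).le ?_
  exact pairPoly_two_two_nonneg (cosN_gt hN) (cosN_lt_one hN) (sub_nonneg_of_pos hN h1 hk)
      (add_nonneg_of_lt hN hk)

theorem cross_v₂_v₂_pos (hN : 4 ≤ N) (h2 : 2 ≤ k) (h3 : k + 1 < N) :
    0 < cross N k (v₂ N) (v₂ N) := by
  apply cross_pos_of_smul one_pos one_pos
  rw [one_smul, v₂_eq, cross_planeVec hN]
  refine mul_pos (pairConst_pos hN) ?_
  exact pairPoly_two_two (cosN_gt hN) (cosN_lt_one hN) (sub_pos_of_two_le hN h2 (by omega))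
      (add_pos_of_lt hN h3)

theorem cross_v₂_v₃_nonneg (hN : 4 ≤ N) (h1 : 1 ≤ k) (hk : k < N) :
    0 ≤ cross N k (v₂ N) (v₃ N) := by
  apply cross_nonneg_of_smul one_pos one_pos
  rw [one_smul, one_smul, v₃_eq hN, v₂_eq, cross_planeVec hN]
  refine mul_nonneg (pairConst_pos hN).le ?_
  exact pairPoly_two_three_nonneg (cosN_gt hN) (cosN_lt_one hN) (sub_nonneg_of_pos hN h1 hk)
      (add_nonneg_of_lt hN hk)

theorem cross_v₂_v₃_pos (hN : 4 ≤ N) (h2 : 2 ≤ k) (hk : k < N) :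
    0 < cross N k (v₂ N) (v₃ N) := by
  apply cross_pos_of_smul one_pos one_pos
  rw [one_smul, one_smul, v₃_eq hN, v₂_eq, cross_planeVec hN]
  refine mul_pos (pairConst_pos hN) ?_
  exact pairPoly_two_three (cosN_gt hN) (cosN_lt_one hN) (sub_pos_of_two_le hN h2 hk)
      (add_nonneg_of_lt hN hk)

theorem cross_v₂_B_v₁_pos (hN : 4 ≤ N) (h1 : 1 ≤ k) (hk : k < N) :
    0 < cross N k (v₂ N) (toMat (B N) *ᵥ v₁ N) := by
  apply cross_pos_of_smul one_pos (den_pos (cosN_lt_one hN))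
  rw [one_smul, den_smul_B_v₁ hN, v₂_eq, cross_planeVec hN]
  refine mul_pos (pairConst_pos hN) ?_
  have e := pairPoly_flip (cosN N) (Real.cos (k * (Real.pi / N)))
    (Real.sin (k * (Real.pi / N)) / sinN N) 0 1 0 1
    (-numL2 (cosN N)) (den (cosN N) * numC (cosN N)) (-numL1 (cosN N)) (den (cosN N) * (1 + cosN N))
  simp only [neg_zero, neg_neg] at e
  rw [e]
  exact pairPoly_two_one (cosN_gt hN) (cosN_lt_one hN) (by simpa [sub_neg_eq_add] using
      (add_nonneg_of_lt hN hk)) (by simpa [sub_neg_eq_add] using (sub_nonneg_of_pos hN h1 hk))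
          (ratio_pos hN h1 hk)

theorem cross_v₂_B_v₃_nonneg (hN : 4 ≤ N) (h1 : 1 ≤ k) (hk : k < N) :
    0 ≤ cross N k (v₂ N) (toMat (B N) *ᵥ v₃ N) := by
  apply cross_nonneg_of_smul one_pos one_pos
  rw [one_smul, one_smul, B_v₃_eq hN, v₂_eq, cross_planeVec hN]
  refine mul_nonneg (pairConst_pos hN).le ?_
  have e := pairPoly_flip (cosN N) (Real.cos (k * (Real.pi / N)))
    (Real.sin (k * (Real.pi / N)) / sinN N) 0 1 0 1
    1 (numC (cosN N)) 1 (1 + cosN N)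
  simp only [neg_zero] at e
  rw [e]
  exact pairPoly_two_three_nonneg (cosN_gt hN) (cosN_lt_one hN) (by simpa [sub_neg_eq_add] using
      (add_nonneg_of_lt hN hk)) (by simpa [sub_neg_eq_add] using (sub_nonneg_of_pos hN h1 hk))

theorem cross_v₂_B_v₃_pos (hN : 4 ≤ N) (h1 : 1 ≤ k) (h2 : k + 1 < N) :
    0 < cross N k (v₂ N) (toMat (B N) *ᵥ v₃ N) := by
  apply cross_pos_of_smul one_pos one_pos
  rw [one_smul, one_smul, B_v₃_eq hN, v₂_eq, cross_planeVec hN]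
  refine mul_pos (pairConst_pos hN) ?_
  have e := pairPoly_flip (cosN N) (Real.cos (k * (Real.pi / N)))
    (Real.sin (k * (Real.pi / N)) / sinN N) 0 1 0 1
    1 (numC (cosN N)) 1 (1 + cosN N)
  simp only [neg_zero] at e
  rw [e]
  exact pairPoly_two_three (cosN_gt hN) (cosN_lt_one hN) (by simpa [sub_neg_eq_add] using
      (add_pos_of_lt hN h2)) (by simpa [sub_neg_eq_add] using (sub_nonneg_of_pos hN h1 (by omega)))

theorem cross_v₃_v₀_pos (hN : 4 ≤ N) (h1 : 1 ≤ k) (hk : k < N) :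
    0 < cross N k (v₃ N) (v₀ N) := by
  apply cross_pos_of_smul one_pos (den_pos (cosN_lt_one hN))
  rw [one_smul, den_smul_v₀ hN, v₃_eq hN, cross_planeVec hN]
  refine mul_pos (pairConst_pos hN) ?_
  rw [pairPoly_swap]
  exact pairPoly_zero_three (cosN_gt hN) (cosN_lt_one hN) (by simpa [sub_neg_eq_add] using
      (add_nonneg_of_lt hN hk)) (by simpa [sub_neg_eq_add] using (sub_nonneg_of_pos hN h1 hk))
          (ratio_pos hN h1 hk)

theorem cross_v₃_v₁_pos (hN : 4 ≤ N) (h1 : 1 ≤ k) (hk : k < N) :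
    0 < cross N k (v₃ N) (v₁ N) := by
  apply cross_pos_of_smul one_pos (den_pos (cosN_lt_one hN))
  rw [one_smul, den_smul_v₁ hN, v₃_eq hN, cross_planeVec hN]
  refine mul_pos (pairConst_pos hN) ?_
  rw [pairPoly_swap]
  exact pairPoly_one_three (cosN_gt hN) (cosN_lt_one hN) (by simpa [sub_neg_eq_add] using
      (add_nonneg_of_lt hN hk)) (by simpa [sub_neg_eq_add] using (sub_nonneg_of_pos hN h1 hk))
          (ratio_pos hN h1 hk)

theorem cross_v₃_v₂_nonneg (hN : 4 ≤ N) (h1 : 1 ≤ k) (hk : k < N) :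
    0 ≤ cross N k (v₃ N) (v₂ N) := by
  apply cross_nonneg_of_smul one_pos one_pos
  rw [one_smul, one_smul, v₂_eq, v₃_eq hN, cross_planeVec hN]
  refine mul_nonneg (pairConst_pos hN).le ?_
  rw [pairPoly_swap]
  exact pairPoly_two_three_nonneg (cosN_gt hN) (cosN_lt_one hN) (by simpa [sub_neg_eq_add] using
      (add_nonneg_of_lt hN hk)) (by simpa [sub_neg_eq_add] using (sub_nonneg_of_pos hN h1 hk))

theorem cross_v₃_v₃_pos (hN : 4 ≤ N) (h1 : 1 ≤ k) (hk : k < N) :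
    0 < cross N k (v₃ N) (v₃ N) := by
  apply cross_pos_of_smul one_pos one_pos
  rw [one_smul, v₃_eq hN, cross_planeVec hN]
  refine mul_pos (pairConst_pos hN) ?_
  exact pairPoly_three_three (cosN_gt hN) (cosN_lt_one hN) (sub_nonneg_of_pos hN h1 hk)
      (add_nonneg_of_lt hN hk) (ratio_pos hN h1 hk)

theorem cross_v₃_B_v₁_nonneg (hN : 4 ≤ N) (h1 : 1 ≤ k) (hk : k < N) :
    0 ≤ cross N k (v₃ N) (toMat (B N) *ᵥ v₁ N) := by
  apply cross_nonneg_of_smul one_pos (den_pos (cosN_lt_one hN))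
  rw [one_smul, den_smul_B_v₁ hN, v₃_eq hN, cross_planeVec hN]
  refine mul_nonneg (pairConst_pos hN).le ?_
  have e := pairPoly_flip (cosN N) (-Real.cos (k * (Real.pi / N)))
    (Real.sin (k * (Real.pi / N)) / sinN N) (-numL2 (cosN N)) (den (cosN N) * numC (cosN N))
    (-numL1 (cosN N)) (den (cosN N) * (1 + cosN N)) (-1) (numC (cosN N)) (-1) (1 + cosN N)
  simp only [neg_neg] at e
  rw [pairPoly_swap, e]
  exact pairPoly_one_flip_three_nonneg (cosN_gt hN) (cosN_lt_one hN) (sub_nonneg_of_pos hN h1 hk)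
      (add_nonneg_of_lt hN hk)

theorem cross_v₃_B_v₃_nonneg (hN : 4 ≤ N) (h1 : 1 ≤ k) (hk : k < N) :
    0 ≤ cross N k (v₃ N) (toMat (B N) *ᵥ v₃ N) := by
  apply cross_nonneg_of_smul one_pos one_pos
  rw [one_smul, one_smul, B_v₃_eq hN, v₃_eq hN, cross_planeVec hN]
  refine mul_nonneg (pairConst_pos hN).le ?_
  exact pairPoly_three_flip_three_nonneg (cosN_gt hN) (cosN_lt_one hN) (sub_nonneg_of_pos hN h1
      hk) (add_nonneg_of_lt hN hk)

end

end

/-! ### The base cone and its rotations -/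

section

variable {N : ℕ}

/-- The common value of the nonzero pairings of the vertices of the base cone. -/
def omega (N : ℕ) : ℝ := pairing N (v₀ N) (v₃ N)

/-- The case k = 0 of the formula for rotated vectors. -/
theorem pairing_planeVec (hN : 4 ≤ N) (a b e g a' b' e' g' : ℝ) :
    pairing N (planeVec N a b e g) (planeVec N a' b' e' g') =
      pairConst N * (4 * cosN N ^ 2 - 1) * ((a * b' - b * a') - (e * g' - g * e')) := by
  have h := cross_planeVec hN 0 a b e g a' b' e' g'
  simp [cross, toMat_one, pairPoly] at h
  linear_combination -h

theorem baseTetra_isSymplectic (hN : 4 ≤ N) :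
    (baseTetra N).IsSymplectic N (omega N) ∧ 0 < omega N := by
  have hd := den_pos (cosN_lt_one hN)
  have hx0 := cosN_gt hN
  have hx1 := cosN_lt_one hN
  have hc := mul_pos (pairConst_pos hN) (four_mul_sq_sub_pos hN)
  have hl : 0 < numL2 (cosN N) - numL1 (cosN N) := by
    have : (2 * cosN N - 1) ^ 2 < 1 := by nlinarith
    simp only [numL1, numL2]; nlinarith
  have h03 : den (cosN N) * pairing N (v₀ N) (v₃ N) =
      pairConst N * (4 * cosN N ^ 2 - 1) * (numL2 (cosN N) - numL1 (cosN N)) := by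
    rw [← pairing_smul_left, den_smul_v₀ hN, v₃_eq hN, pairing_planeVec hN]; ring
  have h21 : den (cosN N) * pairing N (v₂ N) (v₁ N) =
      pairConst N * (4 * cosN N ^ 2 - 1) * (numL2 (cosN N) - numL1 (cosN N)) := by
    rw [← pairing_smul_right, den_smul_v₁ hN, v₂_eq, pairing_planeVec hN]; ring
  have hω : 0 < omega N := by
    have h := mul_pos hc hl
    rw [← h03] at h
    exact (mul_pos_iff_of_pos_left hd).1 h
  refine ⟨⟨hω.ne', rfl, ?_, ?_, ?_, ?_, ?_⟩, hω⟩
  · exact mul_left_cancel₀ hd.ne' (h21.trans h03.symm)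
  · apply mul_left_cancel₀ hd.ne'
    change _ * pairing N (v₀ N) (v₂ N) = _
    rw [← pairing_smul_left, den_smul_v₀ hN, v₂_eq, pairing_planeVec hN]; ring
  · apply mul_left_cancel₀ hd.ne'
    apply mul_left_cancel₀ hd.ne'
    change _ * (_ * pairing N (v₀ N) (v₁ N)) = _
    rw [← pairing_smul_right, ← pairing_smul_left, den_smul_v₀ hN, den_smul_v₁ hN,
      pairing_planeVec hN]; ring
  · change pairing N (v₂ N) (v₃ N) = 0
    rw [v₂_eq, v₃_eq hN, pairing_planeVec hN]; ring
  · apply mul_left_cancel₀ hd.ne'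
    change _ * pairing N (v₃ N) (v₁ N) = _
    rw [← pairing_smul_right, den_smul_v₁ hN, v₃_eq hN, pairing_planeVec hN]
    simp only [den, numL1, numL2, numC]; ring

theorem baseTetra_symp (hN : 4 ≤ N) : (baseTetra N).IsSymplectic N (omega N) :=
  (baseTetra_isSymplectic hN).1

theorem omega_pos (hN : 4 ≤ N) : 0 < omega N := (baseTetra_isSymplectic hN).2

theorem v₀_eq_vec (N : ℕ) : v₀ N = (baseTetra N).vec 1 0 0 0 := by simp [Tetra.vec, baseTetra]
theorem v₁_eq_vec (N : ℕ) : v₁ N = (baseTetra N).vec 0 0 0 1 := by simp [Tetra.vec, baseTetra]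
theorem v₂_eq_vec (N : ℕ) : v₂ N = (baseTetra N).vec 0 0 1 0 := by simp [Tetra.vec, baseTetra]
theorem v₃_eq_vec (N : ℕ) : v₃ N = (baseTetra N).vec 0 1 0 0 := by simp [Tetra.vec, baseTetra]

/-- Coordinates are pairings with conjugate vertices, so the signs of `cross` place rotated vectors,
up to a scalar, in the flipped base cone. -/
theorem smul_R_pow_mulVec (hN : 4 ≤ N) (k : ℕ) (y : V) :
    ((-1) ^ k * omega N) • (toMat (R N ^ k) *ᵥ y) = (baseTetra N).flip.vec
      (cross N k (v₃ N) y) (cross N k (v₀ N) y) (cross N k (v₁ N) y) (cross N k (v₂ N) y) := by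
  have ht := baseTetra_symp hN
  obtain ⟨a, b, c, d, h⟩ := ht.exists_vec (toMat (R N ^ k) *ᵥ y)
  rw [Tetra.flip_vec]
  simp only [cross]
  rw [h, v₃_eq_vec, v₀_eq_vec, v₁_eq_vec, v₂_eq_vec, Tetra.smul_vec, ht.pairing_vec,
    ht.pairing_vec, ht.pairing_vec, ht.pairing_vec]
  congr 1 <;> ring

theorem R_v₃ (hN : 4 ≤ N) : toMat (R N) *ᵥ v₃ N = -(toMat (B N) *ᵥ v₃ N) := by
  rw [R, ← toMat_mulVec_mulVec, C_v₃ hN, Matrix.mulVec_neg]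

theorem R_v₂ (hN : 4 ≤ N) : toMat (R N) *ᵥ v₂ N = v₂ N - toMat (B N) *ᵥ v₃ N := by
  rw [R, ← toMat_mulVec_mulVec, C_v₂ hN, Matrix.mulVec_sub, B_v₂]

/-- The N-th power rotates by the angles 3π and π, both odd multiples of π, so it is a sign. -/
theorem R_pow_N_mulVec (hN : 4 ≤ N) (y : V) :
    toMat (R N ^ N) *ᵥ y = (-1 : ℝ) ^ (N + 1) • y := by
  have hN0 : (N : ℝ) ≠ 0 := by positivity
  have h3 : Real.cos (3 * Real.pi) = -1 := by
    rw [show 3 * Real.pi = Real.pi + 2 * Real.pi by ring, Real.cos_add_two_pi, Real.cos_pi]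
  have h3' : Real.sin (3 * Real.pi) = 0 := by
    rw [show 3 * Real.pi = Real.pi + 2 * Real.pi by ring, Real.sin_add_two_pi, Real.sin_pi]
  rw [R_pow_mulVec hN, mul_div_cancel₀ _ hN0, pow_succ]
  have : rotVec Real.pi y = -y := by
    ext i; fin_cases i <;> simp [rotVec, h3, h3']
  rw [this]; module

theorem A_mul_A (N : ℕ) : A N * A N = 1 := Subtype.ext (Units.ext (matA_mul_self N))
theorem B_mul_B (N : ℕ) : B N * B N = 1 := Subtype.ext (Units.ext matB_mul_self)
theorem C_mul_C (N : ℕ) : C N * C N = 1 := Subtype.ext (Units.ext (matC_mul_self N))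

theorem R_C_B_mulVec (N : ℕ) (y : V) :
    toMat (R N) *ᵥ (toMat (C N) *ᵥ (toMat (B N) *ᵥ y)) = y := by
  rw [toMat_mulVec_mulVec, toMat_mulVec_mulVec, R]
  rw [show B N * C N * C N * B N = 1 by
    rw [mul_assoc (B N), C_mul_C, mul_one, B_mul_B], toMat_one, Matrix.one_mulVec]

theorem R_pow_pred_mulVec (hN : 4 ≤ N) {k : ℕ} (hk : k + 1 = N) (y : V) :
    toMat (R N ^ k) *ᵥ y = (-1 : ℝ) ^ (N + 1) • (toMat (C N) *ᵥ (toMat (B N) *ᵥ y)) := by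
  conv_lhs => rw [← R_C_B_mulVec N y]
  rw [toMat_mulVec_mulVec (R N ^ k), ← pow_succ, hk, R_pow_N_mulVec hN]

theorem B_B_mulVec (N : ℕ) (y : V) : toMat (B N) *ᵥ (toMat (B N) *ᵥ y) = y := by
  rw [toMat_mulVec_mulVec, B_mul_B, toMat_one, Matrix.one_mulVec]

theorem R_pow_pred_v₂ (hN : 4 ≤ N) {k : ℕ} (hk : k + 1 = N) :
    toMat (R N ^ k) *ᵥ v₂ N = (-1 : ℝ) ^ (N + 1) • (v₂ N - v₃ N) := by
  rw [R_pow_pred_mulVec hN hk, B_v₂, C_v₂ hN]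

theorem R_pow_pred_B_v₃ (hN : 4 ≤ N) {k : ℕ} (hk : k + 1 = N) :
    toMat (R N ^ k) *ᵥ (toMat (B N) *ᵥ v₃ N) = (-1 : ℝ) ^ (N + 1) • -v₃ N := by
  rw [R_pow_pred_mulVec hN hk, B_B_mulVec, C_v₃ hN]

/-! ### Position of the rotated cones in the flipped base cone. -/

/-- The coordinates of a nonzero vector of a rotated cone with respect to the flipped base cone. -/
structure FlipCoords (N : ℕ) (y : V) : Prop where
  exists_coords : ∃ σ a b c d : ℝ, σ ≠ 0 ∧ 0 ≤ a ∧ 0 < b ∧ 0 ≤ c ∧ 0 ≤ d ∧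
    σ • y = (baseTetra N).flip.vec a b c d ∧ (c = 0 → ∃ r : ℝ, r ≠ 0 ∧ y = r • v₃ N) ∧
    (d = 0 → ∃ (r s : ℝ) (w : V), s ≠ 0 ∧ (w = v₃ N ∨ w = toMat (B N) *ᵥ v₃ N) ∧
      y = r • v₂ N + s • w)

theorem coeffs_eq_zero {α γ δ P Q S : ℝ} (hα : 0 ≤ α) (hγ : 0 ≤ γ) (hδ : 0 ≤ δ) (hP : 0 < P)
    (hQ : 0 < Q) (hS : 0 < S) {x : ℝ} (hx : 0 ≤ x) (h : α * P + x + γ * Q + δ * S = 0) :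
    α = 0 ∧ x = 0 ∧ γ = 0 ∧ δ = 0 := by
  have p1 := mul_nonneg hα hP.le
  have p2 := mul_nonneg hγ hQ.le
  have p3 := mul_nonneg hδ hS.le
  exact ⟨(mul_eq_zero.1 (by linarith : α * P = 0)).resolve_right hP.ne', by linarith,
    (mul_eq_zero.1 (by linarith : γ * Q = 0)).resolve_right hQ.ne',
    (mul_eq_zero.1 (by linarith : δ * S = 0)).resolve_right hS.ne'⟩

theorem comb_pos {α β γ δ P Q R S : ℝ} (hα : 0 ≤ α) (hβ : 0 ≤ β) (hγ : 0 ≤ γ) (hδ : 0 ≤ δ)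
    (hP : 0 < P) (hQ : 0 < Q) (hR : 0 < R) (hS : 0 < S)
    (h : ¬(α = 0 ∧ β = 0 ∧ γ = 0 ∧ δ = 0)) : 0 < α * P + β * Q + γ * R + δ * S := by
  by_contra! hle
  have p1 := mul_nonneg hα hP.le
  have p2 := mul_nonneg hβ hQ.le
  have p3 := mul_nonneg hγ hR.le
  have p4 := mul_nonneg hδ hS.le
  obtain ⟨h1, h2, h3, h4⟩ := coeffs_eq_zero hα hγ hδ hP hR hS p2
    (by linarith : α * P + β * Q + γ * R + δ * S = 0)
  exact h ⟨h1, (mul_eq_zero.1 h2).resolve_right hQ.ne', h3, h4⟩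

/-- The columns for v₀ and v₁ of the sign table are strict, so two coordinates are positive. The one
measured by v₂ can vanish only through v₂ and v₃ at k = 1, or through v₂ at k = N - 1, and there the
image vector is explicit. -/
theorem flipCoords_of_comb (hN : 4 ≤ N) {k : ℕ} (h1 : 1 ≤ k) (hk : k < N) {α β γ δ : ℝ}
    (hα : 0 ≤ α) (hβ : 0 ≤ β) (hγ : 0 ≤ γ) (hδ : 0 ≤ δ)
    (hne : ¬(α = 0 ∧ β = 0 ∧ γ = 0 ∧ δ = 0)) :
    FlipCoords N (toMat (R N ^ k) *ᵥ (α • v₀ N + β • v₃ N + γ • v₂ N + δ • v₁ N)) := by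
  have hadd : ∀ x : V, cross N k x (α • v₀ N + β • v₃ N + γ • v₂ N + δ • v₁ N) =
      α * cross N k x (v₀ N) + β * cross N k x (v₃ N) + γ * cross N k x (v₂ N) +
        δ * cross N k x (v₁ N) := by
    intro x
    simp only [cross, Matrix.mulVec_add, Matrix.mulVec_smul, pairing_add_right,
      pairing_smul_right]
    ring
  have hs : ((-1 : ℝ) ^ k) * omega N ≠ 0 :=
    mul_ne_zero (by positivity) (omega_pos hN).ne'
  refine ⟨_, _, _, _, _, hs, ?_, ?_, ?_, ?_, smul_R_pow_mulVec hN k _, ?_, ?_⟩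
  · rw [hadd]
    have := cross_v₃_v₀_pos hN h1 hk
    have := cross_v₃_v₁_pos hN h1 hk
    have := cross_v₃_v₂_nonneg hN h1 hk
    have := cross_v₃_v₃_pos hN h1 hk
    positivity
  · rw [hadd]
    exact comb_pos hα hβ hγ hδ (cross_v₀_v₀_pos hN h1 hk) (cross_v₀_v₃_pos hN h1 hk)
      (cross_v₀_v₂_pos hN h1 hk) (cross_v₀_v₁_pos hN h1 hk) hne
  · rw [hadd]
    exact (comb_pos hα hβ hγ hδ (cross_v₁_v₀_pos hN h1 hk) (cross_v₁_v₃_pos hN h1 hk)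
      (cross_v₁_v₂_pos hN h1 hk) (cross_v₁_v₁_pos hN h1 hk) hne).le
  · rw [hadd]
    have := cross_v₂_v₀_pos hN h1 hk
    have := cross_v₂_v₁_pos hN h1 hk
    have := cross_v₂_v₂_nonneg hN h1 hk
    have := cross_v₂_v₃_nonneg hN h1 hk
    positivity
  · intro h
    rw [hadd] at h
    exact absurd h (comb_pos hα hβ hγ hδ (cross_v₁_v₀_pos hN h1 hk) (cross_v₁_v₃_pos hN h1 hk)
      (cross_v₁_v₂_pos hN h1 hk) (cross_v₁_v₁_pos hN h1 hk) hne).ne'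
  · intro h
    rw [hadd] at h
    have q1 := mul_nonneg hβ (cross_v₂_v₃_nonneg hN h1 hk)
    have q2 := mul_nonneg hγ (cross_v₂_v₂_nonneg hN h1 hk)
    obtain ⟨rfl, hx, -, rfl⟩ := coeffs_eq_zero (γ := 0) (Q := 1) (x := β * cross N k (v₂ N) (v₃ N) +
      γ * cross N k (v₂ N) (v₂ N)) hα le_rfl hδ (cross_v₂_v₀_pos hN h1 hk) one_pos
      (cross_v₂_v₁_pos hN h1 hk) (by linarith) (by linarith)
    have hβ0 := mul_eq_zero.1 (by linarith : β * cross N k (v₂ N) (v₃ N) = 0)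
    have hγ0 := mul_eq_zero.1 (by linarith : γ * cross N k (v₂ N) (v₂ N) = 0)
    -- For k = 1 both surviving vertices have images in the span of v₂ and B v₃. For k ≥ 2 the
    -- v₃-term must vanish, and the v₂-term is then possible only at k = N - 1.
    rcases h1.eq_or_lt with rfl | h2
    · refine ⟨γ, -(β + γ), toMat (B N) *ᵥ v₃ N, ?_, Or.inr rfl, ?_⟩
      · intro h0
        exact hne ⟨rfl, by linarith, by linarith, rfl⟩
      · simp only [pow_one, Matrix.mulVec_add, Matrix.mulVec_smul, R_v₃ hN, R_v₂ hN]
        module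
    · obtain rfl := hβ0.resolve_right (cross_v₂_v₃_pos hN h2 hk).ne'
      have hγ' : γ ≠ 0 := fun h => hne ⟨rfl, rfl, h, rfl⟩
      have hk' : k + 1 = N := by
        by_contra hk'
        exact (cross_v₂_v₂_pos hN h2 (by omega)).ne' (hγ0.resolve_left hγ')
      refine ⟨γ * (-1) ^ (N + 1), -(γ * (-1) ^ (N + 1)), v₃ N, ?_, Or.inl rfl, ?_⟩
      · exact neg_ne_zero.2 (mul_ne_zero hγ' (by positivity))
      · simp only [zero_smul, zero_add, add_zero, Matrix.mulVec_smul, R_pow_pred_v₂ hN hk']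
        module

/-- In contrast to the cones without `B`, the coordinate measured by v₁ can vanish: at k = N - 1 the
image of B v₃ is v₃ up to sign. -/
theorem flipCoords_of_comb_B (hN : 4 ≤ N) {k : ℕ} (h1 : 1 ≤ k) (hk : k < N) {α β γ δ : ℝ}
    (hα : 0 ≤ α) (hβ : 0 ≤ β) (hγ : 0 ≤ γ) (hδ : 0 ≤ δ)
    (hne : ¬(α = 0 ∧ β = 0 ∧ γ = 0 ∧ δ = 0)) :
    FlipCoords N (toMat (R N ^ k) *ᵥ (α • v₀ N + β • (toMat (B N) *ᵥ v₃ N) + γ • v₂ N +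
      δ • (toMat (B N) *ᵥ v₁ N))) := by
  have hadd : ∀ x : V, cross N k x (α • v₀ N + β • (toMat (B N) *ᵥ v₃ N) + γ • v₂ N +
      δ • (toMat (B N) *ᵥ v₁ N)) =
      α * cross N k x (v₀ N) + β * cross N k x (toMat (B N) *ᵥ v₃ N) + γ * cross N k x (v₂ N) +
        δ * cross N k x (toMat (B N) *ᵥ v₁ N) := by
    intro x
    simp only [cross, Matrix.mulVec_add, Matrix.mulVec_smul, pairing_add_right,
      pairing_smul_right]
    ring
  have hs : ((-1 : ℝ) ^ k) * omega N ≠ 0 :=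
    mul_ne_zero (by positivity) (omega_pos hN).ne'
  refine ⟨_, _, _, _, _, hs, ?_, ?_, ?_, ?_, smul_R_pow_mulVec hN k _, ?_, ?_⟩
  · rw [hadd]
    have := cross_v₃_v₀_pos hN h1 hk
    have := cross_v₃_B_v₁_nonneg hN h1 hk
    have := cross_v₃_v₂_nonneg hN h1 hk
    have := cross_v₃_B_v₃_nonneg hN h1 hk
    positivity
  · rw [hadd]
    exact comb_pos hα hβ hγ hδ (cross_v₀_v₀_pos hN h1 hk) (cross_v₀_B_v₃_pos hN h1 hk)
      (cross_v₀_v₂_pos hN h1 hk) (cross_v₀_B_v₁_pos hN h1 hk) hne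
  · rw [hadd]
    have := cross_v₁_v₀_pos hN h1 hk
    have := cross_v₁_B_v₁_pos hN h1 hk
    have := cross_v₁_v₂_pos hN h1 hk
    have := cross_v₁_B_v₃_nonneg hN h1 hk
    positivity
  · rw [hadd]
    have := cross_v₂_v₀_pos hN h1 hk
    have := cross_v₂_B_v₁_pos hN h1 hk
    have := cross_v₂_v₂_nonneg hN h1 hk
    have := cross_v₂_B_v₃_nonneg hN h1 hk
    positivity
  · intro h
    rw [hadd] at h
    obtain ⟨rfl, hx, rfl, rfl⟩ := coeffs_eq_zero hα hγ hδ (cross_v₁_v₀_pos hN h1 hk)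
      (cross_v₁_v₂_pos hN h1 hk) (cross_v₁_B_v₁_pos hN h1 hk)
      (mul_nonneg hβ (cross_v₁_B_v₃_nonneg hN h1 hk)) h
    have hβ' : β ≠ 0 := fun h => hne ⟨rfl, h, rfl, rfl⟩
    have hk' : k + 1 = N := by
      by_contra hk'
      exact (cross_v₁_B_v₃_pos hN h1 (by omega)).ne' ((mul_eq_zero.1 hx).resolve_left hβ')
    refine ⟨-(β * (-1) ^ (N + 1)), neg_ne_zero.2 (mul_ne_zero hβ' (by positivity)), ?_⟩
    simp only [zero_smul, zero_add, add_zero, Matrix.mulVec_smul, R_pow_pred_B_v₃ hN hk']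
    module
  · intro h
    rw [hadd] at h
    have q1 := mul_nonneg hβ (cross_v₂_B_v₃_nonneg hN h1 hk)
    have q2 := mul_nonneg hγ (cross_v₂_v₂_nonneg hN h1 hk)
    obtain ⟨rfl, hx, -, rfl⟩ := coeffs_eq_zero (γ := 0) (Q := 1)
      (x := β * cross N k (v₂ N) (toMat (B N) *ᵥ v₃ N) +
      γ * cross N k (v₂ N) (v₂ N)) hα le_rfl hδ (cross_v₂_v₀_pos hN h1 hk) one_pos
      (cross_v₂_B_v₁_pos hN h1 hk) (by linarith) (by linarith)
    have hβ0 := mul_eq_zero.1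
      (by linarith : β * cross N k (v₂ N) (toMat (B N) *ᵥ v₃ N) = 0)
    have hγ0 := mul_eq_zero.1 (by linarith : γ * cross N k (v₂ N) (v₂ N) = 0)
    by_cases hk' : k + 1 = N
    · refine ⟨γ * (-1) ^ (N + 1), -((β + γ) * (-1) ^ (N + 1)), v₃ N, ?_, Or.inl rfl, ?_⟩
      · refine neg_ne_zero.2 (mul_ne_zero (fun h0 => ?_) (by positivity))
        exact hne ⟨rfl, by linarith, by linarith, rfl⟩
      · simp only [zero_smul, zero_add, add_zero, Matrix.mulVec_smul, Matrix.mulVec_add,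
          R_pow_pred_v₂ hN hk', R_pow_pred_B_v₃ hN hk']
        module
    · obtain rfl := hβ0.resolve_right (cross_v₂_B_v₃_pos hN h1 (by omega)).ne'
      have hγ' : γ ≠ 0 := fun h => hne ⟨rfl, rfl, h, rfl⟩
      obtain rfl : k = 1 := by
        by_contra hk1
        exact (cross_v₂_v₂_pos hN (by omega) (by omega)).ne' (hγ0.resolve_left hγ')
      refine ⟨γ, -γ, toMat (B N) *ᵥ v₃ N, neg_ne_zero.2 hγ', Or.inr rfl, ?_⟩
      simp only [zero_smul, zero_add, add_zero, pow_one, Matrix.mulVec_smul, R_v₂ hN]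
      module

theorem translate_vec (g : GSp N) (t : Tetra) (a b c d : ℝ) :
    (t.translate g).vec a b c d = toMat g *ᵥ t.vec a b c d := by
  simp only [Tetra.vec, Tetra.translate, Matrix.mulVec_add, Matrix.mulVec_smul]

/-- Every nonzero vector of a cone with index `≠ 0, 0'` has `FlipCoords`. -/
theorem flipCoords_of_mem_cone (hN : 4 ≤ N) (i : Idx N) (hi : (i.1 : ℕ) ≠ 0) {y : V}
    (hy : y ∈ (tetra i).cone) (hy0 : y ≠ 0) : FlipCoords N y := by
  obtain ⟨α, β, γ, δ, hα, hβ, hγ, hδ, rfl⟩ := hy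
  obtain ⟨k, b⟩ := i
  have h1 : 1 ≤ (k : ℕ) := Nat.one_le_iff_ne_zero.2 hi
  have hne : ¬(α = 0 ∧ β = 0 ∧ γ = 0 ∧ δ = 0) := by
    rintro ⟨rfl, rfl, rfl, rfl⟩
    exact hy0 (Tetra.vec_zero _)
  rw [tetra, translate_vec]
  cases b with
  | false =>
    have : place (k, false) = R N ^ (k : ℕ) := by simp [place]
    rw [this]
    exact flipCoords_of_comb hN h1 k.2 hα hβ hγ hδ hne
  | true =>
    have : place (k, true) = R N ^ (k : ℕ) * B N := by simp [place]
    rw [this, ← toMat_mulVec_mulVec]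
    have h := flipCoords_of_comb_B hN h1 k.2 hα hβ hγ hδ hne
    convert h using 2
    simp only [Tetra.vec, baseTetra, Matrix.mulVec_add, Matrix.mulVec_smul, B_v₀, B_v₂]

/-- The image of the base cone under `B`. -/
theorem B_vec (hN : 4 ≤ N) (a b c d : ℝ) : toMat (B N) *ᵥ (baseTetra N).vec a b c d =
    (baseTetra N).flip.vec (a + kap N * (b + d)) b (c + kap N * (b + d)) d := by
  simp only [Tetra.vec, Tetra.flip, baseTetra, Matrix.mulVec_add, Matrix.mulVec_smul, B_v₀, B_v₂,
    B_v₁ hN, B_v₃ hN]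
  module

theorem A_vec (hN : 4 ≤ N) (a b c d : ℝ) : toMat (A N) *ᵥ (baseTetra N).vec a b c d =
    (baseTetra N).flip.vec a b c d := by
  simp only [Tetra.vec, Tetra.flip, baseTetra, Matrix.mulVec_add, Matrix.mulVec_smul, A_v₀, A_v₂,
    A_v₁ hN, A_v₃ hN]

end

/-! ### The ping-pong configuration of the cones -/

section

variable {N : ℕ}

theorem GSp.ext_mulVec {g h : GSp N} (H : ∀ y, toMat g *ᵥ y = toMat h *ᵥ y) : g = h :=
  Subtype.ext (Units.ext (Matrix.ext_iff_mulVec.2 H))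

/-- The scalar `-1`. -/
def negOne (N : ℕ) : GSp N := ⟨-1, 1, by simp⟩

theorem negOne_mulVec (y : V) : toMat (negOne N) *ᵥ y = -y := by
  simp [toMat, negOne, Matrix.neg_mulVec]

theorem negOne_mul_negOne : negOne N * negOne N = 1 :=
  GSp.ext_mulVec fun y => by
    rw [← toMat_mulVec_mulVec, negOne_mulVec, negOne_mulVec, toMat_one, Matrix.one_mulVec, neg_neg]

theorem negOne_comm (g : GSp N) : g * negOne N = negOne N * g :=
  GSp.ext_mulVec fun y => by
    rw [← toMat_mulVec_mulVec, ← toMat_mulVec_mulVec, negOne_mulVec, negOne_mulVec,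
      Matrix.mulVec_neg]

theorem negOne_smul (L : LGr N) : negOne N • L = L := by
  apply Subtype.ext
  ext x
  rw [mem_smul_iff]
  constructor
  · rintro ⟨y, hy, rfl⟩
    rw [negOne_mulVec]; exact L.1.neg_mem hy
  · intro hx
    exact ⟨-x, L.1.neg_mem hx, by rw [negOne_mulVec, neg_neg]⟩

/-- Equality up to sign. -/
def SignEq (g h : GSp N) : Prop := g = h ∨ g = negOne N * h

namespace SignEq

variable {g g' h h' : GSp N}

theorem refl (g : GSp N) : SignEq g g := Or.inl rfl

theorem symm (H : SignEq g h) : SignEq h g := by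
  rcases H with rfl | rfl
  · exact refl _
  · right; rw [← mul_assoc, negOne_mul_negOne, one_mul]

theorem trans (H : SignEq g h) (H' : SignEq h h') : SignEq g h' := by
  rcases H with rfl | rfl
  · exact H'
  · rcases H' with rfl | rfl
    · exact Or.inr rfl
    · left; rw [← mul_assoc, negOne_mul_negOne, one_mul]

theorem mul (H : SignEq g h) (H' : SignEq g' h') : SignEq (g * g') (h * h') := by
  have h1 : ∀ k : GSp N, SignEq (k * g') (k * h') := by
    intro k
    rcases H' with rfl | rfl
    · exact refl _
    · right; rw [← mul_assoc, negOne_comm, mul_assoc]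
  refine (h1 g).trans ?_
  rcases H with rfl | rfl
  · exact refl _
  · right; rw [mul_assoc]

theorem pow (H : SignEq g 1) (n : ℕ) : SignEq (g ^ n) 1 := by
  induction n with
  | zero => exact Or.inl (pow_zero g)
  | succ n ih => rw [pow_succ]; simpa using ih.mul H

theorem smul_eq (H : SignEq g h) (L : LGr N) : g • L = h • L := by
  rcases H with rfl | rfl
  · rfl
  · rw [mul_smul, negOne_smul]

theorem conj_eq (H : SignEq g h) (k : GSp N) : g * k * g⁻¹ = h * k * h⁻¹ := by
  rcases H with rfl | rfl
  · rfl
  · rw [_root_.mul_inv_rev, mul_assoc (negOne N), ← negOne_comm, mul_assoc, ← mul_assoc (negOne N),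
      ← negOne_comm, mul_assoc h⁻¹, mul_inv_cancel, mul_one]

end SignEq

theorem signEq_R_pow_N (hN : 4 ≤ N) : SignEq (R N ^ N) 1 := by
  rcases neg_one_pow_eq_or ℝ (N + 1) with h | h
  · left
    refine GSp.ext_mulVec fun y => ?_
    rw [R_pow_N_mulVec hN, h, one_smul, toMat_one, Matrix.one_mulVec]
  · right
    refine GSp.ext_mulVec fun y => ?_
    rw [R_pow_N_mulVec hN, h, mul_one, negOne_mulVec, neg_one_smul]

theorem signEq_R_pow_mod (hN : 4 ≤ N) (m : ℕ) : SignEq (R N ^ (m % N)) (R N ^ m) := by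
  conv_rhs => rw [← Nat.mod_add_div m N, pow_add, pow_mul]
  simpa using (SignEq.refl (R N ^ (m % N))).mul ((signEq_R_pow_N hN).pow (m / N)).symm

theorem C_eq (N : ℕ) : C N = B N * R N := by
  rw [R, ← mul_assoc, B_mul_B, one_mul]

theorem R_pow_mul_B_mul_R_pow (N k : ℕ) : R N ^ k * B N * R N ^ k = B N := by
  have h : R N * B N * R N = B N := by
    rw [R, mul_assoc (B N * C N), ← mul_assoc (B N) (B N), B_mul_B, one_mul, mul_assoc, C_mul_C,
      mul_one]
  induction k with
  | zero => simp
  | succ k ih =>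
    rw [pow_succ, mul_assoc, mul_assoc, ← pow_succ, pow_succ', ← mul_assoc (B N),
      ← mul_assoc (R N), ← mul_assoc (R N), h, ← mul_assoc, ih]

theorem B_mul_R_pow (N k : ℕ) : B N * R N ^ k = (R N ^ k)⁻¹ * B N := by
  rw [eq_inv_mul_iff_mul_eq, ← mul_assoc, R_pow_mul_B_mul_R_pow]

/-- `h` takes the cone of index `i` to the cone of index `σ i`, up to sign. -/
def ActsBy (h : GSp N) (σ : Equiv.Perm (Idx N)) : Prop :=
  ∀ i, SignEq (h * place i) (place (σ i))

theorem ActsBy.one : ActsBy (1 : GSp N) 1 := fun i => by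
  rw [one_mul]; exact SignEq.refl _

theorem ActsBy.mul {g h : GSp N} {σ τ : Equiv.Perm (Idx N)} (H : ActsBy g σ) (H' : ActsBy h τ) :
    ActsBy (g * h) (σ * τ) := fun i => by
  have h1 := (SignEq.refl g).mul (H' i)
  rw [← mul_assoc] at h1
  exact h1.trans (H (τ i))

theorem ActsBy.inv {g : GSp N} {σ : Equiv.Perm (Idx N)} (H : ActsBy g σ) : ActsBy g⁻¹ σ⁻¹ :=
  fun i => by
    have h1 := (SignEq.refl g⁻¹).mul (H (σ⁻¹ i)).symm
    rwa [inv_mul_cancel_left, ← Equiv.Perm.mul_apply, mul_inv_cancel, Equiv.Perm.one_apply] at h1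

theorem ActsBy.pow {g : GSp N} {σ : Equiv.Perm (Idx N)} (H : ActsBy g σ) (n : ℕ) :
    ActsBy (g ^ n) (σ ^ n) := by
  induction n with
  | zero => simpa using ActsBy.one
  | succ n ih => rw [pow_succ, pow_succ]; exact ih.mul H

section

variable [NeZero N]

def rotPerm (N : ℕ) [NeZero N] : Equiv.Perm (Idx N) where
  toFun i := (i.1 + 1, i.2)
  invFun i := (i.1 - 1, i.2)
  left_inv i := by simp
  right_inv i := by simp

def flipPerm (N : ℕ) [NeZero N] : Equiv.Perm (Idx N) where
  toFun i := (-i.1, !i.2)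
  invFun i := (-i.1, !i.2)
  left_inv i := by simp
  right_inv i := by simp

/-- Indices wrap around modulo N because the N-th power of `R` is ±1; this is why everything is
taken up to sign, which acts trivially on Lagrangians. -/
theorem actsBy_R (hN : 4 ≤ N) : ActsBy (R N) (rotPerm N) := by
  rintro ⟨k, b⟩
  have h1 : SignEq (R N * R N ^ (k : ℕ)) (R N ^ ((k + 1 : Fin N) : ℕ)) := by
    have : ((k + 1 : Fin N) : ℕ) = ((k : ℕ) + 1) % N := by
      rw [Fin.val_add, Fin.val_one', Nat.add_mod_mod]
    rw [this, ← pow_succ']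
    exact (signEq_R_pow_mod hN _).symm
  cases b with
  | false => simpa [place, rotPerm] using h1
  | true => simpa [place, rotPerm, mul_assoc] using h1.mul (SignEq.refl (B N))

theorem actsBy_B (hN : 4 ≤ N) : ActsBy (B N) (flipPerm N) := by
  rintro ⟨k, b⟩
  have h1 : SignEq (R N ^ (k : ℕ))⁻¹ (R N ^ ((-k : Fin N) : ℕ)) := by
    have : ((-k : Fin N) : ℕ) = (N - (k : ℕ)) % N := Fin.val_neg' k
    rw [this]
    have h2 := (SignEq.refl (R N ^ (k : ℕ))⁻¹).mul (signEq_R_pow_N hN).symm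
    have e : R N ^ N = R N ^ (k : ℕ) * R N ^ (N - (k : ℕ)) := by
      rw [← pow_add, Nat.add_sub_cancel' k.2.le]
    rw [mul_one, e, inv_mul_cancel_left] at h2
    exact h2.trans (signEq_R_pow_mod hN _).symm
  cases b with
  | false => simpa [place, flipPerm, B_mul_R_pow] using h1.mul (SignEq.refl (B N))
  | true =>
    have e : B N * (R N ^ (k : ℕ) * B N) = (R N ^ (k : ℕ))⁻¹ := by
      rw [← mul_assoc, B_mul_R_pow, mul_assoc, B_mul_B, mul_one]
    simpa [place, flipPerm, e] using h1

/-- The permutation of the indices by `place i`. -/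
def idxPerm (i : Idx N) : Equiv.Perm (Idx N) :=
  rotPerm N ^ (i.1 : ℕ) * (if i.2 then flipPerm N else 1)

theorem actsBy_place (hN : 4 ≤ N) (i : Idx N) : ActsBy (place i) (idxPerm i) := by
  obtain ⟨k, b⟩ := i
  cases b with
  | false => simpa [place, idxPerm] using (actsBy_R hN).pow k
  | true => simpa [place, idxPerm] using ((actsBy_R hN).pow k).mul (actsBy_B hN)

theorem rotPerm_pow_apply (m : ℕ) (i : Idx N) :
    (rotPerm N ^ m) i = (i.1 + Fin.ofNat N m, i.2) := by
  induction m with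
  | zero => simp
  | succ m ih =>
    rw [pow_succ', Equiv.Perm.mul_apply, ih]
    refine Prod.ext ?_ rfl
    change i.1 + Fin.ofNat N m + 1 = _
    rw [add_assoc]
    congr 1
    apply Fin.ext
    simp [Fin.val_add]

theorem idxPerm_zero (i : Idx N) : idxPerm i (0, false) = i := by
  obtain ⟨k, b⟩ := i
  cases b with
  | false => simp [idxPerm, rotPerm_pow_apply]
  | true => simp [idxPerm, rotPerm_pow_apply, flipPerm]

end

/-- The dihedral group `⟨B, C⟩`. -/
def dihedral (N : ℕ) : Subgroup (GSp N) := Subgroup.closure {B N, C N}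

theorem B_mem_dihedral : B N ∈ dihedral N := Subgroup.subset_closure (Or.inl rfl)

theorem C_mem_dihedral : C N ∈ dihedral N := Subgroup.subset_closure (Or.inr rfl)

theorem R_mem_dihedral : R N ∈ dihedral N :=
  (dihedral N).mul_mem B_mem_dihedral C_mem_dihedral

theorem place_mem_dihedral (i : Idx N) : place i ∈ dihedral N := by
  have h := (dihedral N).pow_mem R_mem_dihedral (i.1 : ℕ)
  unfold place
  split
  · exact (dihedral N).mul_mem h B_mem_dihedral
  · exact h

theorem exists_actsBy (hN : 4 ≤ N) {h : GSp N} (hh : h ∈ dihedral N) : ∃ σ, ActsBy h σ := by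
  have : NeZero N := ⟨by omega⟩
  induction hh using Subgroup.closure_induction with
  | mem x hx =>
    rcases hx with rfl | rfl
    · exact ⟨_, actsBy_B hN⟩
    · rw [C_eq]; exact ⟨_, (actsBy_B hN).mul (actsBy_R hN)⟩
  | one => exact ⟨1, ActsBy.one⟩
  | mul x y _ _ hx hy =>
    obtain ⟨σ, hσ⟩ := hx
    obtain ⟨τ, hτ⟩ := hy
    exact ⟨_, hσ.mul hτ⟩
  | inv x _ hx =>
    obtain ⟨σ, hσ⟩ := hx
    exact ⟨_, hσ.inv⟩

theorem place_zero [NeZero N] : place ((0, false) : Idx N) = 1 := by simp [place]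

theorem place_zero_true [NeZero N] : place ((0, true) : Idx N) = B N := by simp [place]

/-- Every element of the dihedral group is a `place`, up to sign. -/
theorem exists_signEq_place (hN : 4 ≤ N) {h : GSp N} (hh : h ∈ dihedral N) :
    ∃ i : Idx N, SignEq h (place i) := by
  have : NeZero N := ⟨by omega⟩
  obtain ⟨σ, hσ⟩ := exists_actsBy hN hh
  exact ⟨σ (0, false), by simpa [place_zero] using hσ (0, false)⟩

/-- Modulo ±1 every element takes index 0 to some index and therefore equals its `place`. -/
theorem finite_dihedral (hN : 4 ≤ N) : (dihedral N : Set (GSp N)).Finite := by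
  refine ((Set.finite_range (place (N := N))).union
    (Set.finite_range fun i : Idx N => negOne N * place i)).subset fun h hh => ?_
  obtain ⟨i, hi | hi⟩ := exists_signEq_place hN hh
  · exact Or.inl ⟨i, hi.symm⟩
  · exact Or.inr ⟨i, hi.symm⟩

theorem reflectionGroup_eq (hN : 4 ≤ N) : reflectionGroup N =
    Subgroup.closure (Set.range (reflection (N := N)) ∪ (dihedral N : Set (GSp N))) := by
  have : NeZero N := ⟨by omega⟩
  have hd : dihedral N ≤ reflectionGroup N :=
    Subgroup.closure_mono fun x hx => Or.inr hx
  apply le_antisymm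
  · rw [reflectionGroup, Subgroup.closure_le]
    rintro x (rfl | hx)
    · refine Subgroup.subset_closure (Or.inl ⟨(0, false), ?_⟩)
      simp [reflection, place_zero]
    · exact Subgroup.subset_closure (Or.inr (Subgroup.subset_closure hx))
  · rw [Subgroup.closure_le]
    rintro x (⟨i, rfl⟩ | hx)
    · have h := hd (place_mem_dihedral i)
      exact Subgroup.mul_mem _ (Subgroup.mul_mem _ h (Subgroup.subset_closure (Or.inl rfl)))
        (Subgroup.inv_mem _ h)
    · exact hd hx

theorem toMat_pairing_ne (g : GSp N) : ∃ χ : ℝ, χ ≠ 0 ∧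
    ∀ x y : V, pairing N (toMat g *ᵥ x) (toMat g *ᵥ y) = χ * pairing N x y := by
  obtain ⟨χ, h⟩ := toMat_pairing g
  obtain ⟨ψ, h'⟩ := toMat_pairing g⁻¹
  -- If χ = 0, applying the inverse shows that the pairing vanishes identically, and then the factor
  -- 1 serves as well.
  by_cases hχ : χ = 0
  · refine ⟨1, one_ne_zero, fun x y => ?_⟩
    have := h' (toMat g *ᵥ x) (toMat g *ᵥ y)
    rw [toMat_inv_mulVec, toMat_inv_mulVec] at this
    rw [this, h, hχ]; simp
  · exact ⟨χ, hχ, h⟩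

theorem Tetra.IsSymplectic.translate {t : Tetra} {ω : ℝ} (ht : t.IsSymplectic N ω) (g : GSp N) :
    ∃ ω', (t.translate g).IsSymplectic N ω' := by
  obtain ⟨χ, hχ, h⟩ := toMat_pairing_ne g
  exact ⟨χ * ω, mul_ne_zero hχ ht.ne_zero, by simp [Tetra.translate, h, ht.e₁_f₁],
    by simp [Tetra.translate, h, ht.e₂_f₂], by simp [Tetra.translate, h, ht.e₁_e₂],
    by simp [Tetra.translate, h, ht.e₁_f₂], by simp [Tetra.translate, h, ht.e₂_f₁],
    by simp [Tetra.translate, h, ht.f₁_f₂]⟩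

theorem interiorCone_translate (g : GSp N) (t : Tetra) :
    (t.translate g).interiorCone = (toMat g *ᵥ ·) '' t.interiorCone := by
  ext x
  constructor
  · rintro ⟨a, b, c, d, ha, hb, hc, hd, h⟩
    exact ⟨_, t.vec_mem_interiorCone ha hb hc hd,
      ((translate_vec g t a b c d).symm.trans h.symm : _)⟩
  · rintro ⟨_, ⟨a, b, c, d, ha, hb, hc, hd, rfl⟩, rfl⟩
    exact ⟨a, b, c, d, ha, hb, hc, hd, (translate_vec g t a b c d).symm⟩

theorem mem_hit_translate (g : GSp N) (t : Tetra) (x : LGr N) :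
    x ∈ hit N (t.translate g).interiorCone ↔ g⁻¹ • x ∈ hit N t.interiorCone := by
  rw [interiorCone_translate, ← smul_hit g (L := g⁻¹ • x), smul_inv_smul]

theorem mem_coneHit_translate (g : GSp N) (t : Tetra) (x : LGr N) :
    x ∈ (t.translate g).coneHit N ↔ g⁻¹ • x ∈ t.coneHit N := by
  constructor
  · rintro ⟨_, ⟨⟨a, b, c, d, ha, hb, hc, hd, rfl⟩, hne⟩, h⟩
    rw [translate_vec] at hne h
    refine Tetra.IsSymplectic.vec_mem_coneHit ⟨ha, hb, hc, hd⟩ (fun h0 => hne ?_)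
      ((mem_inv_smul_iff _ _ _).2 h)
    rw [h0, Matrix.mulVec_zero]
  · rintro ⟨_, ⟨⟨a, b, c, d, ha, hb, hc, hd, rfl⟩, hne⟩, h⟩
    rw [mem_inv_smul_iff, ← translate_vec] at h
    refine Tetra.IsSymplectic.vec_mem_coneHit ⟨ha, hb, hc, hd⟩ (fun h0 => hne ?_) h
    rw [translate_vec] at h0
    exact toMat_injective g (by simpa using h0)

theorem closedSmallSide_eq (hN : 4 ≤ N) (i : Idx N) :
    closedSmallSide i = (tetra i).coneHit N := by
  obtain ⟨ω, h⟩ := (baseTetra_symp hN).translate (place i)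
  exact h.closure_smallSide hN

theorem A_smul_mem_coneHit (hN : 4 ≤ N) {x : LGr N} (hx : x ∈ (baseTetra N).flip.coneHit N) :
    A N • x ∈ (baseTetra N).coneHit N := by
  obtain ⟨_, ⟨⟨a, b, c, d, ha, hb, hc, hd, rfl⟩, hne⟩, h⟩ := hx
  have h' := mulVec_mem_smul (g := A N) h
  rw [← A_vec hN, toMat_mulVec_mulVec, A_mul_A, toMat_one, Matrix.one_mulVec] at h'
  refine Tetra.IsSymplectic.vec_mem_coneHit ⟨ha, hb, hc, hd⟩ (fun h0 => hne ?_) h'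
  rw [← A_vec hN, h0, Matrix.mulVec_zero]

theorem A_smul_mem_coneHit_flip (hN : 4 ≤ N) {x : LGr N} (hx : x ∈ (baseTetra N).coneHit N) :
    A N • x ∈ (baseTetra N).flip.coneHit N := by
  obtain ⟨_, ⟨⟨a, b, c, d, ha, hb, hc, hd, rfl⟩, hne⟩, h⟩ := hx
  have h' := mulVec_mem_smul (g := A N) h
  rw [A_vec hN] at h'
  refine Tetra.IsSymplectic.vec_mem_coneHit ⟨ha, hb, hc, hd⟩ (fun h0 => hne ?_) h'
  obtain ⟨rfl, rfl, rfl, rfl⟩ := (baseTetra_symp hN).flip.vec_eq_zero h0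
  exact Tetra.vec_zero _

/-- The geometric core of ping-pong: all other cones are inside ± the flipped base cone, by the
formula for `B` for index 0' and by the sign table for the rotated ones. -/
theorem coneHit_flip_of_index_ne [NeZero N] (hN : 4 ≤ N) {i : Idx N} (hi : i ≠ (0, false))
    {x : LGr N} (hx : x ∈ (tetra i).coneHit N) : x ∈ (baseTetra N).flip.coneHit N := by
  obtain ⟨y, ⟨hy, hy0⟩, hyx⟩ := hx
  by_cases hk : (i.1 : ℕ) = 0
  · obtain ⟨k, b⟩ := i
    obtain rfl : k = 0 := Fin.ext hk
    cases b with
    | false => exact absurd rfl hi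
    | true =>
      obtain ⟨a, b, c, d, ha, hb, hc, hd, rfl⟩ := hy
      rw [tetra, translate_vec, place_zero_true, B_vec hN] at hy0 hyx
      have := kap_pos hN
      exact Tetra.IsSymplectic.vec_mem_coneHit ⟨by positivity, hb, by positivity, hd⟩ hy0 hyx
  · obtain ⟨σ, a, b, c, d, hσ, ha, hb, hc, hd, e, -, -⟩ :=
      (flipCoords_of_mem_cone hN i hk hy hy0).exists_coords
    refine Tetra.IsSymplectic.vec_mem_coneHit ⟨ha, hb.le, hc, hd⟩ ?_
      (e ▸ x.1.smul_mem σ hyx)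
    rw [← e]; exact smul_ne_zero hσ hy0

theorem inv_smul_reflection_smul (i : Idx N) (x : LGr N) :
    (place i)⁻¹ • reflection i • x = A N • (place i)⁻¹ • x := by
  simp only [smul_smul, reflection, mul_assoc, inv_mul_cancel_left]

theorem ActsBy.inv_smul_smul {h : GSp N} {σ : Equiv.Perm (Idx N)} (H : ActsBy h σ) (i : Idx N)
    (x : LGr N) : (place (σ i))⁻¹ • h • x = (place i)⁻¹ • x := by
  rw [inv_smul_eq_iff, ← (H i).smul_eq, mul_smul, smul_inv_smul]

theorem ActsBy.mem_small {h : GSp N} {σ : Equiv.Perm (Idx N)} (H : ActsBy h σ) (i : Idx N)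
    (x : LGr N) :
    h • x ∈ hit N (tetra (σ i)).interiorCone ↔ x ∈ hit N (tetra i).interiorCone := by
  rw [tetra, tetra, mem_hit_translate, mem_hit_translate, H.inv_smul_smul]

theorem ActsBy.mem_closed {h : GSp N} {σ : Equiv.Perm (Idx N)} (H : ActsBy h σ) (i : Idx N)
    (x : LGr N) : h • x ∈ (tetra (σ i)).coneHit N ↔ x ∈ (tetra i).coneHit N := by
  rw [tetra, tetra, mem_coneHit_translate, mem_coneHit_translate, H.inv_smul_smul]

theorem ActsBy.mul_reflection {h : GSp N} {σ : Equiv.Perm (Idx N)} (H : ActsBy h σ) (i : Idx N) :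
    h * reflection i = reflection (σ i) * h := by
  rw [reflection, reflection, ← (H i).conj_eq (A N)]
  simp only [_root_.mul_inv_rev, mul_assoc, inv_mul_cancel, mul_one]

theorem reflection_mul_self (i : Idx N) : reflection i * reflection i = 1 := by
  simp only [reflection, mul_assoc, inv_mul_cancel_left]
  rw [← mul_assoc (A N), A_mul_A, one_mul, mul_inv_cancel]

theorem hit_interiorCone_subset_coneHit (hN : 4 ≤ N) (i : Idx N) :
    hit N (tetra i).interiorCone ⊆ (tetra i).coneHit N := by
  obtain ⟨ω, h⟩ := (baseTetra_symp hN).translate (place i)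
  exact hit_mono fun x hx => ⟨Tetra.interiorCone_subset_cone _ hx, h.mem_interiorCone_of_ne hx⟩

/-- The finite group permutes the cones transitively, so it is enough to treat i = 0. -/
theorem notMem_small_of_mem_closed (hN : 4 ≤ N) {i j : Idx N} (hij : i ≠ j) {x : LGr N}
    (hx : x ∈ (tetra j).coneHit N) : x ∉ hit N (tetra i).interiorCone := by
  have : NeZero N := ⟨by omega⟩
  have H := (actsBy_place hN i).inv
  have e : (idxPerm i)⁻¹ i = (0, false) := by
    rw [Equiv.Perm.inv_eq_iff_eq, idxPerm_zero]
  rw [← H.mem_closed] at hx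
  rw [← H.mem_small, e]
  intro h
  have hne : (idxPerm i)⁻¹ j ≠ (0, false) := fun h0 => by
    rw [← e] at h0
    exact hij ((idxPerm i)⁻¹.injective h0).symm
  rw [tetra, place_zero, mem_hit_translate, inv_one, one_smul] at h
  exact (baseTetra_symp hN).notMem_coneHit_flip h (coneHit_flip_of_index_ne hN hne hx)

/-- The ping-pong configuration given by the cones. -/
def conePingPong (hN : 4 ≤ N) : PingPong (GSp N) (LGr N) (Idx N) where
  small i := hit N (tetra i).interiorCone
  closed i := (tetra i).coneHit N
  refl := reflection
  H := dihedral N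
  Γ := reflectionGroup N
  refl_mul_self := reflection_mul_self
  small_subset := hit_interiorCone_subset_coneHit hN
  refl_smul_mem i x hx := by
    rw [tetra, mem_hit_translate] at hx
    rw [tetra, mem_coneHit_translate, inv_smul_reflection_smul]
    exact A_smul_mem_coneHit hN ((baseTetra_symp hN).coneHit_flip_of_notMem hN hx)
  refl_smul_notMem i x hx := by
    rw [tetra, mem_coneHit_translate] at hx
    rw [tetra, mem_hit_translate, inv_smul_reflection_smul]
    exact fun h => (baseTetra_symp hN).notMem_coneHit_flip h (A_smul_mem_coneHit_flip hN hx)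
  disjoint i j hij x hx := notMem_small_of_mem_closed hN hij hx
  finite_H := finite_dihedral hN
  perm h hh := by
    obtain ⟨σ, hσ⟩ := exists_actsBy hN hh
    exact ⟨σ, fun i => ⟨hσ.mul_reflection i, hσ.mem_small i, hσ.mem_closed i⟩⟩
  Γ_eq := reflectionGroup_eq hN

/-- Note the shift: Ω_2 is `approx 1`. -/
theorem domainApprox_succ (hN : 4 ≤ N) (n : ℕ) :
    domainApprox N (n + 1) = (conePingPong hN).approx n := by
  ext x
  have h := (conePingPong hN).mem_iUnion_lev_iff n x
  have : x ∈ limitApprox N (n + 1) ↔ ∃ i, x ∈ (conePingPong hN).lev n i := by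
    rw [← h]
    simp only [limitApprox, Set.mem_ofPred_eq, closedSmallSide_eq hN]
    rfl
  rw [domainApprox, Set.mem_compl_iff, this, not_exists]
  rfl

theorem innerDomain_eq (hN : 4 ≤ N) : innerDomain N = ⋃ n, (conePingPong hN).approx n := by
  ext x
  simp only [innerDomain, Set.mem_iUnion]
  constructor
  · rintro ⟨n, hn, hx⟩
    obtain ⟨m, rfl⟩ : ∃ m, n = m + 1 := ⟨n - 1, by omega⟩
    exact ⟨m, by rwa [← domainApprox_succ]⟩
  · rintro ⟨m, hx⟩
    exact ⟨m + 1, by omega, by rwa [domainApprox_succ hN]⟩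

theorem isClosed_lev (hN : 4 ≤ N) (n : ℕ) (i : Idx N) : IsClosed ((conePingPong hN).lev n i) := by
  induction n generalizing i with
  | zero =>
    obtain ⟨ω, h⟩ := (baseTetra_symp hN).translate (place i)
    exact h.isClosed_coneHit hN
  | succ n ih =>
    have : (conePingPong hN).lev (n + 1) i = (reflection i • · : LGr N → LGr N) ⁻¹'
        (⋃ j ∈ {j | j ≠ i}, (conePingPong hN).lev n j) := by
      ext x
      simp only [Set.mem_preimage, Set.mem_iUnion, Set.mem_ofPred_eq, exists_prop]
      rfl
    rw [this]
    exact (Set.Finite.isClosed_biUnion (Set.toFinite _) fun j _ => ih j).preimage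
      (continuous_const_smul _)

theorem isOpen_approx (hN : 4 ≤ N) (n : ℕ) : IsOpen ((conePingPong hN).approx n) := by
  have : (conePingPong hN).approx n = (⋃ i, (conePingPong hN).lev n i)ᶜ := by
    ext x; simp [PingPong.approx]
  rw [this, isOpen_compl_iff]
  exact isClosed_iUnion_of_finite fun i => isClosed_lev hN n i

theorem isOpen_innerDomain (hN : 4 ≤ N) : IsOpen (innerDomain N) := by
  rw [innerDomain_eq hN]
  exact isOpen_iUnion fun n => isOpen_approx hN n

/-- The sets `approx n` are open and increase with n, so both points have neighbourhoods in a common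
one, to which the ping-pong finiteness applies. -/
theorem locallyFinitePair_of_mem_approx (hN : 4 ≤ N) {n m : ℕ} {x y : LGr N}
    (hx : x ∈ (conePingPong hN).approx n) (hy : y ∈ (conePingPong hN).approx m) :
    LocallyFinitePair (reflectionGroup N) x y := by
  refine ⟨_, (conePingPong hN).finite_approx_approx (max n m), ?_⟩
  have h1 := (isOpen_approx hN (max n m)).mem_nhds
    ((conePingPong hN).approx_mono (le_max_left n m) hx)
  have h2 := (isOpen_approx hN (max n m)).mem_nhds
    ((conePingPong hN).approx_mono (le_max_right n m) hy)
  filter_upwards [Filter.prod_mem_prod h1 h2] with p hp γ hγ e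
  exact ⟨hγ, p.1, hp.1, e ▸ hp.2⟩

theorem actsProperlyDiscontinuously_innerDomain (hN : 4 ≤ N) :
    ActsProperlyDiscontinuously (reflectionGroup N) (innerDomain N) := by
  rw [innerDomain_eq hN]
  apply actsProperlyDiscontinuously_of_locallyFinitePair
  · intro γ hγ x hx
    obtain ⟨n, hx⟩ := Set.mem_iUnion.1 hx
    exact Set.mem_iUnion.2 ((conePingPong hN).smul_mem_iUnion_approx hγ hx)
  · intro x hx y hy
    obtain ⟨n, hx⟩ := Set.mem_iUnion.1 hx
    obtain ⟨m, hy⟩ := Set.mem_iUnion.1 hy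
    exact locallyFinitePair_of_mem_approx hN hx hy

theorem monodromyGroup_le (N : ℕ) : monodromyGroup N ≤ reflectionGroup N := by
  have hA : A N ∈ reflectionGroup N := Subgroup.subset_closure (Or.inl rfl)
  have hB : B N ∈ reflectionGroup N := Subgroup.subset_closure (Or.inr (Or.inl rfl))
  have hC : C N ∈ reflectionGroup N := Subgroup.subset_closure (Or.inr (Or.inr rfl))
  rw [monodromyGroup, Subgroup.closure_le]
  rintro x (rfl | rfl)
  · exact Subgroup.mul_mem _ hB hC
  · exact Subgroup.mul_mem _ hA hB

end

/-! ### The wall group `⟨A, B⟩` and the wing -/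

section

variable {N : ℕ}

/-- The direction of the image of `AB - 1`. -/
def axis (N : ℕ) : V := v₀ N + v₂ N

theorem axis_eq_vec (N : ℕ) : axis N = (baseTetra N).vec 1 0 1 0 := by
  simp [axis, Tetra.vec, baseTetra]

theorem pairing_axis_vec (hN : 4 ≤ N) (a b c d : ℝ) :
    pairing N (axis N) ((baseTetra N).vec a b c d) = omega N * (b + d) := by
  rw [axis_eq_vec, (baseTetra_symp hN).pairing_vec]; ring

theorem A_axis (N : ℕ) : toMat (A N) *ᵥ axis N = axis N := by
  rw [axis, Matrix.mulVec_add, A_v₀, A_v₂]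

theorem B_axis (N : ℕ) : toMat (B N) *ᵥ axis N = axis N := by
  rw [axis, Matrix.mulVec_add, B_v₀, B_v₂]

/-- The factor of the transvection `T`. -/
def shear (N : ℕ) : ℝ := kap N / omega N

theorem shear_pos (hN : 4 ≤ N) : 0 < shear N := div_pos (kap_pos hN) (omega_pos hN)

theorem T_vec (hN : 4 ≤ N) (a b c d : ℝ) : toMat (T N) *ᵥ (baseTetra N).vec a b c d =
    (baseTetra N).vec (a + kap N * (b + d)) b (c + kap N * (b + d)) d := by
  rw [T, ← toMat_mulVec_mulVec, B_vec hN, ← A_vec hN, toMat_mulVec_mulVec, A_mul_A, toMat_one,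
    Matrix.one_mulVec]

theorem T_mulVec (hN : 4 ≤ N) (y : V) :
    toMat (T N) *ᵥ y = y + (shear N * pairing N (axis N) y) • axis N := by
  obtain ⟨a, b, c, d, rfl⟩ := (baseTetra_symp hN).exists_vec y
  have h := (omega_pos hN).ne'
  have e : shear N * (omega N * (b + d)) = kap N * (b + d) := by rw [shear]; field_simp
  rw [T_vec hN, pairing_axis_vec hN, e, axis_eq_vec, Tetra.smul_vec, Tetra.vec_add]
  congr 1 <;> ring

theorem T_inv_mulVec (hN : 4 ≤ N) (y : V) :
    toMat (T N)⁻¹ *ᵥ y = y - (shear N * pairing N (axis N) y) • axis N := by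
  have h := T_mulVec hN (y - (shear N * pairing N (axis N) y) • axis N)
  rw [sub_eq_add_neg, ← neg_smul, pairing_add_right, pairing_smul_right, pairing_self, mul_zero,
    add_zero, add_assoc, ← add_smul, neg_add_cancel, zero_smul, add_zero] at h
  conv_lhs => rw [← h]
  rw [toMat_inv_mulVec, sub_eq_add_neg, ← neg_smul]

theorem T_zpow_mulVec (hN : 4 ≤ N) (n : ℤ) (y : V) :
    toMat (T N ^ n) *ᵥ y = y + (n * (shear N * pairing N (axis N) y)) • axis N := by
  induction n using Int.induction_on generalizing y with
  | zero => simp [toMat_one]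
  | succ n ih =>
    rw [_root_.zpow_add_one, ← toMat_mulVec_mulVec, T_mulVec hN, ih, pairing_add_right,
      pairing_smul_right, pairing_self]
    push_cast
    module
  | pred n ih =>
    rw [_root_.zpow_sub_one, ← toMat_mulVec_mulVec, T_inv_mulVec hN, ih, sub_eq_add_neg, ← neg_smul,
      pairing_add_right, pairing_smul_right, pairing_self]
    push_cast
    module

/-- The infinite dihedral group generated by `A` and `B`. -/
def wallGroup (N : ℕ) : Subgroup (GSp N) := Subgroup.closure {A N, B N}

theorem A_mem_wallGroup : A N ∈ wallGroup N := Subgroup.subset_closure (Or.inl rfl)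

theorem B_mem_wallGroup : B N ∈ wallGroup N := Subgroup.subset_closure (Or.inr rfl)

theorem T_zpow_mem_wallGroup (n : ℤ) : T N ^ n ∈ wallGroup N :=
  Subgroup.zpow_mem _ (Subgroup.mul_mem _ A_mem_wallGroup B_mem_wallGroup) n

theorem wallGroup_le (N : ℕ) : wallGroup N ≤ reflectionGroup N := by
  refine Subgroup.closure_mono ?_
  rintro x (rfl | rfl)
  · exact Or.inl rfl
  · exact Or.inr (Or.inl rfl)

theorem A_inv (N : ℕ) : (A N)⁻¹ = A N := inv_eq_of_mul_eq_one_left (A_mul_A N)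

theorem B_inv (N : ℕ) : (B N)⁻¹ = B N := inv_eq_of_mul_eq_one_left (B_mul_B N)

theorem T_inv (N : ℕ) : (T N)⁻¹ = B N * A N := by
  rw [T, _root_.mul_inv_rev, A_inv, B_inv]

theorem B_mul_T_zpow (N : ℕ) (n : ℤ) : B N * T N ^ n = T N ^ (-n) * B N := by
  have h : B N * T N * (B N)⁻¹ = (T N)⁻¹ := by
    rw [T_inv, B_inv, T, mul_assoc, mul_assoc, B_mul_B, mul_one]
  have h' : (B N * T N * (B N)⁻¹) ^ n = B N * T N ^ n * (B N)⁻¹ := conj_zpow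
  rw [_root_.zpow_neg, ← _root_.inv_zpow, ← h, h', inv_mul_cancel_right]

/-- `A` and `B` are involutions with product `T`, so the group is dihedral and its elements are
translations or reflections. -/
theorem exists_of_mem_wallGroup {d : GSp N} (hd : d ∈ wallGroup N) :
    ∃ n : ℤ, d = T N ^ n ∨ d = B N * T N ^ n := by
  have key : ∀ x ∈ ({A N, B N} : Set (GSp N)), ∀ y : GSp N,
      (∃ n : ℤ, y = T N ^ n ∨ y = B N * T N ^ n) →
      ∃ n : ℤ, x * y = T N ^ n ∨ x * y = B N * T N ^ n := by
    rintro x (rfl | rfl) y ⟨n, rfl | rfl⟩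
    · refine ⟨n - 1, Or.inr ?_⟩
      rw [sub_eq_add_neg, add_comm, _root_.zpow_add, _root_.zpow_neg_one, T_inv, ← mul_assoc, ← mul_assoc,
        B_mul_B, one_mul]
    · refine ⟨n + 1, Or.inl ?_⟩
      rw [add_comm, _root_.zpow_add, zpow_one, T, mul_assoc]
    · exact ⟨n, Or.inr rfl⟩
    · exact ⟨n, Or.inl (by rw [← mul_assoc, B_mul_B, one_mul])⟩
  induction hd using Subgroup.closure_induction_left with
  | one => exact ⟨0, Or.inl (zpow_zero _).symm⟩
  | mul_left x hx y _ ih => exact key x hx y ih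
  | inv_mul_cancel x hx y _ ih =>
    refine key x⁻¹ ?_ y ih
    rcases hx with rfl | rfl
    · exact Or.inl (A_inv N)
    · exact Or.inr (B_inv N)

theorem wallGroup_mulVec {w : V} (hA : toMat (A N) *ᵥ w = w) (hB : toMat (B N) *ᵥ w = w)
    {d : GSp N} (hd : d ∈ wallGroup N) : toMat d *ᵥ w = w := by
  induction hd using Subgroup.closure_induction with
  | mem x hx =>
    rcases hx with rfl | rfl
    exacts [hA, hB]
  | one => rw [toMat_one, Matrix.one_mulVec]
  | mul x y _ _ hx hy => rw [← toMat_mulVec_mulVec, hy, hx]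
  | inv x _ hx =>
    conv_lhs => rw [← hx]
    rw [toMat_inv_mulVec]

theorem mem_smul_wallGroup {w : V} (hA : toMat (A N) *ᵥ w = w) (hB : toMat (B N) *ᵥ w = w)
    {d : GSp N} (hd : d ∈ wallGroup N) {L : LGr N} : w ∈ (d • L).1 ↔ w ∈ L.1 := by
  have h := mem_inv_smul_iff d⁻¹ L w
  rwa [inv_inv, wallGroup_mulVec hA hB ((wallGroup N).inv_mem hd)] at h

theorem axis_mem_smul {d : GSp N} (hd : d ∈ wallGroup N) {L : LGr N} :
    axis N ∈ (d • L).1 ↔ axis N ∈ L.1 := mem_smul_wallGroup (A_axis N) (B_axis N) hd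

theorem A_wing (N : ℕ) (s t : ℝ) :
    toMat (A N) *ᵥ (baseTetra N).vec s 0 t 0 = (baseTetra N).vec s 0 t 0 := by
  simp [Tetra.vec, baseTetra, Matrix.mulVec_add, Matrix.mulVec_smul, A_v₀, A_v₂]

theorem B_wing (N : ℕ) (s t : ℝ) :
    toMat (B N) *ᵥ (baseTetra N).vec s 0 t 0 = (baseTetra N).vec s 0 t 0 := by
  simp [Tetra.vec, baseTetra, Matrix.mulVec_add, Matrix.mulVec_smul, B_v₀, B_v₂]

theorem exists_vec_of_mem_eWing {t : Tetra} {L : LGr N} (h : L ∈ t.eWing N) :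
    ∃ p q : ℝ, 0 ≤ p ∧ 0 ≤ q ∧ p + q = 1 ∧ t.vec p 0 q 0 ∈ L.1 := by
  obtain ⟨p, q, hp, hq, hpq, h⟩ := exists_of_mem_wing h
  exact ⟨p, q, hp, hq, hpq, by simpa [Tetra.vec] using h⟩

theorem wing_vec_ne_zero (hN : 4 ≤ N) {p q : ℝ} (hpq : p + q = 1) :
    (baseTetra N).vec p 0 q 0 ≠ 0 := by
  intro h
  obtain ⟨rfl, -, rfl, -⟩ := (baseTetra_symp hN).vec_eq_zero h
  norm_num at hpq

/-- `A` and `B` fix every vector of the edge, so each single photon of the wing is preserved. -/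
theorem smul_mem_eWing (hN : 4 ≤ N) {d : GSp N} (hd : d ∈ wallGroup N) {L : LGr N}
    (hL : L ∈ (baseTetra N).eWing N) : d • L ∈ (baseTetra N).eWing N := by
  obtain ⟨p, q, hp, hq, hpq, h⟩ := exists_vec_of_mem_eWing hL
  exact Tetra.IsSymplectic.mem_eWing_of_vec_mem hp hq (wing_vec_ne_zero hN hpq)
    ((mem_smul_wallGroup (A_wing N p q) (B_wing N p q) hd).2 h)

theorem photon_axis_subset_eWing (hN : 4 ≤ N) {L : LGr N} (h : axis N ∈ L.1) :
    L ∈ (baseTetra N).eWing N := by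
  rw [axis_eq_vec] at h
  refine Tetra.IsSymplectic.mem_eWing_of_vec_mem zero_le_one zero_le_one (fun h0 => ?_) h
  exact one_ne_zero ((baseTetra_symp hN).vec_eq_zero h0).1

theorem mem_eWing_tetra (i : Idx N) (L : LGr N) :
    L ∈ (tetra i).eWing N ↔ (place i)⁻¹ • L ∈ (baseTetra N).eWing N := by
  have h : ∀ s t : ℝ, s • (tetra i).e₁ + t • (tetra i).e₂ =
      toMat (place i) *ᵥ (s • (baseTetra N).e₁ + t • (baseTetra N).e₂) := by
    intro s t
    simp [tetra, Tetra.translate, Matrix.mulVec_add, Matrix.mulVec_smul]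
  simp only [Tetra.eWing, wing, photon, Set.mem_iUnion, Set.mem_ofPred_eq, mem_inv_smul_iff, h]

theorem place_eq_of_val_eq_zero {i : Idx N} (hi : (i.1 : ℕ) = 0) :
    place i = 1 ∨ place i = B N := by
  obtain ⟨k, b⟩ := i
  cases b <;> simp_all [place]

theorem place_mem_wallGroup {i : Idx N} (hi : (i.1 : ℕ) = 0) : place i ∈ wallGroup N := by
  rcases place_eq_of_val_eq_zero hi with h | h <;> rw [h]
  exacts [Subgroup.one_mem _, B_mem_wallGroup]

theorem reflection_mem_wallGroup {i : Idx N} (hi : (i.1 : ℕ) = 0) :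
    reflection i ∈ wallGroup N :=
  Subgroup.mul_mem _ (Subgroup.mul_mem _ (place_mem_wallGroup hi) A_mem_wallGroup)
    (Subgroup.inv_mem _ (place_mem_wallGroup hi))

theorem eWing_subset_coneHit (hN : 4 ≤ N) {i : Idx N} (hi : (i.1 : ℕ) = 0) :
    (baseTetra N).eWing N ⊆ (tetra i).coneHit N := by
  intro L hL
  rw [tetra, mem_coneHit_translate]
  obtain ⟨p, q, hp, hq, hpq, h⟩ := exists_vec_of_mem_eWing
    (smul_mem_eWing hN (Subgroup.inv_mem _ (place_mem_wallGroup hi)) hL)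
  exact Tetra.IsSymplectic.vec_mem_coneHit ⟨hp, le_rfl, hq, le_rfl⟩ (wing_vec_ne_zero hN hpq) h

theorem v₃_ne_zero (hN : 4 ≤ N) : v₃ N ≠ 0 := by
  rw [v₃_eq_vec]
  exact fun h => one_ne_zero ((baseTetra_symp hN).vec_eq_zero h).2.1

theorem C_inv (N : ℕ) : (C N)⁻¹ = C N := inv_eq_of_mul_eq_one_left (C_mul_C N)

theorem photon_v₃_smul {g : GSp N} (hg : toMat g *ᵥ v₃ N = -v₃ N) {L : LGr N}
    (h : v₃ N ∈ L.1) : v₃ N ∈ (g • L).1 := by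
  have := mulVec_mem_smul (g := g) h
  rw [hg] at this
  simpa using (g • L).1.neg_mem this

/-- Two vectors of a Lagrangian, in a cone and in the flipped cone, have complementary supports. -/
theorem Tetra.IsSymplectic.mul_eq_zero_of_mem {t : Tetra} {ω : ℝ} (ht : t.IsSymplectic N ω)
    {L : LGr N} {a b c d a' b' c' d' : ℝ} (h : 0 ≤ a ∧ 0 ≤ b ∧ 0 ≤ c ∧ 0 ≤ d)
    (h' : 0 ≤ a' ∧ 0 ≤ b' ∧ 0 ≤ c' ∧ 0 ≤ d') (hL : t.vec a b c d ∈ L.1)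
    (hL' : t.flip.vec a' b' c' d' ∈ L.1) :
    a * b' = 0 ∧ b * a' = 0 ∧ c * d' = 0 ∧ d * c' = 0 := by
  have e := L.2.2 _ hL _ hL'
  rw [t.flip_vec, ht.pairing_vec] at e
  have e := (mul_eq_zero.1 e).resolve_left ht.ne_zero
  have h1 := mul_nonneg h.1 h'.2.1
  have h2 := mul_nonneg h.2.1 h'.1
  have h3 := mul_nonneg h.2.2.1 h'.2.2.2
  have h4 := mul_nonneg h.2.2.2 h'.2.2.1
  refine ⟨?_, ?_, ?_, ?_⟩ <;> linarith

section

variable [NeZero N]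

/-- The index of the cone `C 𝒞₀`. -/
def lastIdx (N : ℕ) [NeZero N] : Idx N := (-1, true)

theorem lastIdx_ne (hN : 4 ≤ N) : ((lastIdx N).1 : ℕ) ≠ 0 := by
  rw [lastIdx, Fin.val_neg', Fin.val_one', Nat.mod_eq_of_lt (by omega : 1 < N),
    Nat.mod_eq_of_lt (by omega)]
  omega

/-- Since `C = B * R`, index 0 goes to 1 and then to the primed index -1. -/
theorem signEq_place_lastIdx (hN : 4 ≤ N) : SignEq (place (lastIdx N)) (C N) := by
  have h := (actsBy_B hN).mul (actsBy_R hN) (0, false)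
  rw [← C_eq, place_zero, mul_one] at h
  have e : (flipPerm N * rotPerm N) (0, false) = lastIdx N := by
    simp [flipPerm, rotPerm, lastIdx]
  rw [e] at h
  exact h.symm

theorem photon_v₃_subset_coneHit_zero (hN : 4 ≤ N) {L : LGr N} (h : v₃ N ∈ L.1) :
    L ∈ (tetra ((0, false) : Idx N)).coneHit N := by
  rw [tetra, mem_coneHit_translate, place_zero, inv_one, one_smul]
  rw [v₃_eq_vec] at h
  exact Tetra.IsSymplectic.vec_mem_coneHit (by norm_num)
    (by rw [← v₃_eq_vec]; exact v₃_ne_zero hN) h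

theorem inv_place_lastIdx_smul (hN : 4 ≤ N) (L : LGr N) :
    (place (lastIdx N))⁻¹ • L = C N • L := by
  rw [inv_smul_eq_iff, (signEq_place_lastIdx hN).smul_eq, smul_smul, C_mul_C, one_smul]

theorem photon_v₃_subset_coneHit_last (hN : 4 ≤ N) {L : LGr N} (h : v₃ N ∈ L.1) :
    L ∈ (tetra (lastIdx N)).coneHit N := by
  rw [tetra, mem_coneHit_translate, inv_place_lastIdx_smul hN]
  have h0 := photon_v₃_subset_coneHit_zero hN (photon_v₃_smul (C_v₃ hN) h)
  rwa [tetra, mem_coneHit_translate, place_zero, inv_one, one_smul] at h0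

theorem zero_ne_lastIdx (hN : 4 ≤ N) : ((0, false) : Idx N) ≠ lastIdx N := by
  intro h
  exact lastIdx_ne hN (by rw [← h]; rfl)

/-- The wing lies in the closed sides 0 and 0' and both reflections preserve it, so alternating
words never leave it. -/
theorem eWing_subset_lev (hN : 4 ≤ N) (n : ℕ) :
    (baseTetra N).eWing N ⊆ (conePingPong hN).lev n (0, false) :=
  ((conePingPong hN).mem_lev_of_invariant (i := (0, false)) (j := (0, true)) (by simp)
    (eWing_subset_coneHit hN rfl) (eWing_subset_coneHit hN rfl)
    (fun _ hx => smul_mem_eWing hN (reflection_mem_wallGroup rfl) hx)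
    (fun _ hx => smul_mem_eWing hN (reflection_mem_wallGroup rfl) hx) n).1

/-- The same argument with the closed sides of the base cone and of its image under `C`, whose
reflections both negate v₃. -/
theorem photon_v₃_subset_lev (hN : 4 ≤ N) (n : ℕ) :
    photon N (v₃ N) ⊆ (conePingPong hN).lev n (0, false) := by
  refine ((conePingPong hN).mem_lev_of_invariant (i := (0, false)) (j := lastIdx N)
    (zero_ne_lastIdx hN) (fun _ => photon_v₃_subset_coneHit_zero hN)
    (fun _ => photon_v₃_subset_coneHit_last hN) ?_ ?_ n).1
  · intro x hx
    change v₃ N ∈ (reflection ((0, false) : Idx N) • x).1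
    rw [reflection, place_zero, one_mul, inv_one, mul_one]
    exact photon_v₃_smul (A_v₃ hN) hx
  · intro x hx
    change v₃ N ∈ (reflection (lastIdx N) • x).1
    rw [reflection, (signEq_place_lastIdx hN).conj_eq, C_inv, mul_smul, mul_smul]
    exact photon_v₃_smul (C_v₃ hN) (photon_v₃_smul (A_v₃ hN) (photon_v₃_smul (C_v₃ hN) hx))

theorem eWing_subset_free (hN : 4 ≤ N) : (baseTetra N).eWing N ⊆ (conePingPong hN).free :=
  fun _ hx => (conePingPong hN).mem_free_of_mem_closed (i := (0, false)) (j := (0, true)) (by simp)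
    (eWing_subset_coneHit hN rfl hx) (eWing_subset_coneHit hN rfl hx)

theorem photon_v₃_subset_free (hN : 4 ≤ N) : photon N (v₃ N) ⊆ (conePingPong hN).free :=
  fun _ hx => (conePingPong hN).mem_free_of_mem_closed (zero_ne_lastIdx hN)
    (photon_v₃_subset_coneHit_zero hN hx) (photon_v₃_subset_coneHit_last hN hx)

theorem mem_coneHit_tetra_zero {L : LGr N} :
    L ∈ (tetra ((0, false) : Idx N)).coneHit N ↔ L ∈ (baseTetra N).coneHit N := by
  rw [tetra, mem_coneHit_translate, place_zero, inv_one, one_smul]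

/-- `B` adds kap (b' + d') to both `e`-coordinates. By complementary supports, either the vector of
the base cone has no `f`-part, or b' + d' = 0 and the other vector has none. -/
theorem mem_eWing_of_mem_coneHit_zero (hN : 4 ≤ N) {L : LGr N}
    (h : L ∈ (tetra ((0, false) : Idx N)).coneHit N)
    (h' : L ∈ (tetra ((0, true) : Idx N)).coneHit N) : L ∈ (baseTetra N).eWing N := by
  rw [mem_coneHit_tetra_zero] at h
  obtain ⟨_, ⟨⟨a, b, c, d, ha, hb, hc, hd, rfl⟩, hne⟩, hL⟩ := h
  obtain ⟨_, ⟨⟨a', b', c', d', ha', hb', hc', hd', rfl⟩, hne'⟩, hL'⟩ := h'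
  have hκ := kap_pos hN
  rw [tetra, translate_vec, place_zero_true, B_vec hN] at hne' hL'
  obtain ⟨h1, h2, h3, h4⟩ := (baseTetra_symp hN).mul_eq_zero_of_mem ⟨ha, hb, hc, hd⟩
    ⟨by positivity, hb', by positivity, hd'⟩ hL hL'
  by_cases hbd : b = 0 ∧ d = 0
  · obtain ⟨rfl, rfl⟩ := hbd
    exact Tetra.IsSymplectic.mem_eWing_of_vec_mem ha hc hne hL
  · have hk := mul_nonneg hκ.le (add_nonneg hb' hd')
    have hk0 : kap N * (b' + d') = 0 := by
      rcases not_and_or.1 hbd with h | h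
      · have := (mul_eq_zero.1 h2).resolve_left h; linarith
      · have := (mul_eq_zero.1 h4).resolve_left h; linarith
    have hs := (mul_eq_zero.1 hk0).resolve_left hκ.ne'
    obtain rfl : b' = 0 := by linarith
    obtain rfl : d' = 0 := by linarith
    rw [Tetra.flip_vec, neg_zero] at hne' hL'
    exact Tetra.IsSymplectic.mem_eWing_of_vec_mem (by linarith) (by linarith) hne' hL'

/-- The coordinate b' is strictly positive, which kills the v₀-coordinate of the first vector. The
remaining supports lead to v₃ or to the edge of the wing, since c' = 0 happens only on the line of
v₃. -/
theorem mem_eWing_or_photon (hN : 4 ≤ N) {L : LGr N} {i : Idx N} (hi : (i.1 : ℕ) ≠ 0)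
    (h : L ∈ (tetra ((0, false) : Idx N)).coneHit N) (h' : L ∈ (tetra i).coneHit N) :
    L ∈ (baseTetra N).eWing N ∨ v₃ N ∈ L.1 := by
  rw [mem_coneHit_tetra_zero] at h
  obtain ⟨_, ⟨⟨a, b, c, d, ha, hb, hc, hd, rfl⟩, hne⟩, hL⟩ := h
  obtain ⟨y, ⟨hy, hy0⟩, hyL⟩ := h'
  obtain ⟨σ, a', b', c', d', hσ, ha', hb', hc', hd', e, hc0, -⟩ :=
    (flipCoords_of_mem_cone hN i hi hy hy0).exists_coords
  have hL' : (baseTetra N).flip.vec a' b' c' d' ∈ L.1 := e ▸ L.1.smul_mem σ hyL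
  obtain ⟨h1, h2, h3, h4⟩ := (baseTetra_symp hN).mul_eq_zero_of_mem ⟨ha, hb, hc, hd⟩
    ⟨ha', hb'.le, hc', hd'⟩ hL hL'
  obtain rfl := (mul_eq_zero.1 h1).resolve_right hb'.ne'
  by_cases hc0' : c' = 0
  · obtain ⟨r, hr, rfl⟩ := hc0 hc0'
    exact Or.inr ((L.1.smul_mem_iff hr).1 hyL)
  obtain rfl := (mul_eq_zero.1 h4).resolve_right hc0'
  by_cases hb0 : b = 0
  · subst hb0
    exact Or.inl (Tetra.IsSymplectic.mem_eWing_of_vec_mem le_rfl hc hne hL)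
  obtain rfl := (mul_eq_zero.1 h2).resolve_left hb0
  by_cases hcz : c = 0
  · subst hcz
    right
    have e3 : (baseTetra N).vec 0 b 0 0 = b • v₃ N := by simp [Tetra.vec, baseTetra]
    rw [e3] at hL
    exact (L.1.smul_mem_iff hb0).1 hL
  obtain rfl := (mul_eq_zero.1 h3).resolve_left hcz
  left
  have hc'' : 0 < c' := lt_of_le_of_ne hc' (Ne.symm hc0')
  have hb'' : 0 < b := lt_of_le_of_ne hb (Ne.symm hb0)
  -- The two vectors are now combinations of v₃ and v₂; eliminating v₃ leaves a positive multiple of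
  -- v₂.
  have hm := L.1.add_mem (L.1.smul_mem b' hL) (L.1.smul_mem b hL')
  rw [Tetra.flip_vec, Tetra.smul_vec, Tetra.smul_vec, Tetra.vec_add] at hm
  have e2 : (baseTetra N).vec (b' * 0 + b * 0) (b' * b + b * -b') (b' * c + b * c')
      (b' * 0 + b * -0) = (baseTetra N).vec 0 0 (b' * c + b * c') 0 := by
    congr 1 <;> ring
  rw [e2] at hm
  have hpos : 0 < b' * c + b * c' := by positivity
  exact Tetra.IsSymplectic.mem_eWing_of_vec_mem le_rfl hpos.le
    (fun h0 => hpos.ne' ((baseTetra_symp hN).vec_eq_zero h0).2.2.1) hm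

/-- Points of two closed small sides are never left by the words of the reflections. -/
theorem mem_lev_of_mem_closed (hN : 4 ≤ N) {i j : Idx N} (hij : i ≠ j) {L : LGr N}
    (hi : L ∈ (tetra i).coneHit N) (hj : L ∈ (tetra j).coneHit N) (n : ℕ) :
    L ∈ (conePingPong hN).lev n i := by
  have H := actsBy_place hN i
  have e : (idxPerm i)⁻¹ i = (0, false) := by
    rw [Equiv.Perm.inv_eq_iff_eq, idxPerm_zero]
  rw [← H.inv.mem_closed, e] at hi
  rw [← H.inv.mem_closed] at hj
  have hne : (idxPerm i)⁻¹ j ≠ (0, false) := fun h0 => by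
    rw [← e] at h0
    exact hij ((idxPerm i)⁻¹.injective h0).symm
  have key : (place i)⁻¹ • L ∈ (conePingPong hN).lev n (0, false) := by
    generalize (idxPerm i)⁻¹ j = j' at hj hne
    by_cases hk : (j'.1 : ℕ) = 0
    · obtain ⟨k, b⟩ := j'
      obtain rfl : k = 0 := Fin.ext hk
      obtain rfl : b = true := by
        cases b
        · exact absurd rfl hne
        · rfl
      exact eWing_subset_lev hN n (mem_eWing_of_mem_coneHit_zero hN hi hj)
    · rcases mem_eWing_or_photon hN hk hi hj with h | h
      · exact eWing_subset_lev hN n h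
      · exact photon_v₃_subset_lev hN n h
  have h := ((conePingPong hN).smul_mem_lev (idxPerm i)
    (fun k => ⟨H.mul_reflection k, H.mem_small k, H.mem_closed k⟩) n (0, false) _).2 key
  rwa [idxPerm_zero, smul_inv_smul] at h

/-- Take a free translate. If it were in level 1, its reflection would lie in two closed sides,
hence in every level, which is impossible for the orbit of a point of Ω°. -/
theorem exists_smul_mem_approx_one (hN : 4 ≤ N) {n : ℕ} {x : LGr N}
    (hx : x ∈ (conePingPong hN).approx n) :
    ∃ γ ∈ reflectionGroup N, γ • x ∈ (conePingPong hN).approx 1 := by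
  obtain ⟨γ, hγ, hfree⟩ := (conePingPong hN).exists_smul_mem_free hx
  refine ⟨γ, hγ, ?_⟩
  rintro i ⟨j, hj, hmem⟩
  obtain ⟨m, hm⟩ := (conePingPong hN).smul_mem_iUnion_approx
    (Subgroup.mul_mem _ ((conePingPong hN).refl_mem i) hγ) hx
  rw [mul_smul] at hm
  exact hm i (mem_lev_of_mem_closed hN hj.symm
    ((conePingPong hN).refl_smul_mem i _ (hfree i)) hmem m)

end

end

/-! ### Attractor photons and orbits of the wall group -/

section

variable {N : ℕ}

/-- The orbit under the wall group avoids the closed small sides of index `≠ 0, 0'`. -/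
def AvoidsRotated (x : LGr N) : Prop :=
  ∀ d ∈ wallGroup N, ∀ i : Idx N, (i.1 : ℕ) ≠ 0 → d • x ∉ (tetra i).coneHit N

theorem AvoidsRotated.smul {x : LGr N} (hx : AvoidsRotated x) {d : GSp N}
    (hd : d ∈ wallGroup N) : AvoidsRotated (d • x) := by
  intro e he i hi
  rw [smul_smul]
  exact hx _ (Subgroup.mul_mem _ he hd) i hi

theorem mem_rankOneAttractorPhoton_iff (hN : 4 ≤ N) (L : LGr N) :
    L ∈ rankOneAttractorPhoton N ↔ axis N ∈ L.1 := by
  have hT : ∀ y, Matrix.mulVecLin (toMat (A N * B N) - 1) y =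
      (shear N * pairing N (axis N) y) • axis N := by
    intro y
    rw [Matrix.mulVecLin_apply, Matrix.sub_mulVec, Matrix.one_mulVec, ← T, T_mulVec hN,
      add_sub_cancel_left]
  constructor
  · intro h
    have h3 := h (LinearMap.mem_range_self _ (v₃ N))
    rw [hT, v₃_eq_vec, pairing_axis_vec hN] at h3
    refine (L.1.smul_mem_iff ?_).1 h3
    have := shear_pos hN
    have := omega_pos hN
    positivity
  · rintro h _ ⟨y, rfl⟩
    rw [hT]
    exact L.1.smul_mem _ h

theorem attractorPhotons_smul {γ : GSp N} (hγ : γ ∈ reflectionGroup N) {L : LGr N}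
    (hL : L ∈ attractorPhotons N) : γ • L ∈ attractorPhotons N := by
  obtain ⟨δ, hδ, M, hM, rfl⟩ := hL
  exact ⟨γ * δ, Subgroup.mul_mem _ hγ hδ, M, hM, (mul_smul _ _ _).symm⟩

theorem smul_mem_attractorPhotons {γ : GSp N} (hγ : γ ∈ reflectionGroup N) {L : LGr N} :
    γ • L ∈ attractorPhotons N ↔ L ∈ attractorPhotons N := by
  refine ⟨fun h => ?_, attractorPhotons_smul hγ⟩
  have := attractorPhotons_smul (Subgroup.inv_mem _ hγ) h
  rwa [inv_smul_smul] at this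

theorem mem_attractorPhotons_of_axis (hN : 4 ≤ N) {L : LGr N} (h : axis N ∈ L.1) :
    L ∈ attractorPhotons N :=
  ⟨1, Subgroup.one_mem _, L, Or.inl ((mem_rankOneAttractorPhoton_iff hN L).2 h), (one_smul _ _).symm⟩

theorem mem_attractorPhotons_of_v₃ {L : LGr N} (h : v₃ N ∈ L.1) : L ∈ attractorPhotons N :=
  ⟨1, Subgroup.one_mem _, L, Or.inr h, (one_smul _ _).symm⟩

/-- A point of the wing in a closed small side of index `≠ 0, 0'` is on an attractor photon
of a maximally unipotent element, and does not contain `v₀`. -/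
theorem eWing_mem_rotated (hN : 4 ≤ N) {p q : ℝ} (hp : 0 ≤ p) (hq : 0 ≤ q) (hpq : p + q = 1)
    {L : LGr N} (hL : (baseTetra N).vec p 0 q 0 ∈ L.1) {i : Idx N} (hi : (i.1 : ℕ) ≠ 0)
    (h : L ∈ (tetra i).coneHit N) : p = 0 ∧ L ∈ attractorPhotons N := by
  obtain ⟨y, ⟨hy, hy0⟩, hyL⟩ := h
  obtain ⟨σ, a', b', c', d', hσ, ha', hb', hc', hd', e, -, hd0⟩ :=
    (flipCoords_of_mem_cone hN i hi hy hy0).exists_coords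
  have hL' : (baseTetra N).flip.vec a' b' c' d' ∈ L.1 := e ▸ L.1.smul_mem σ hyL
  obtain ⟨h1, -, h3, -⟩ := (baseTetra_symp hN).mul_eq_zero_of_mem ⟨hp, le_rfl, hq, le_rfl⟩
    ⟨ha', hb'.le, hc', hd'⟩ hL hL'
  obtain rfl := (mul_eq_zero.1 h1).resolve_right hb'.ne'
  obtain rfl : q = 1 := by linarith
  -- With q = 1 the coordinate d' vanishes, so y is a combination of v₂ and w; since v₂ is in L, so
  -- is w, which is v₃ or B v₃.
  obtain ⟨r, s, w, hs, hw, rfl⟩ := hd0 (by linarith)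
  refine ⟨rfl, ?_⟩
  rw [← v₂_eq_vec] at hL
  have hwL : w ∈ L.1 :=
    (L.1.smul_mem_iff hs).1 ((L.1.add_mem_iff_right (L.1.smul_mem r hL)).1 hyL)
  rcases hw with rfl | rfl
  · exact mem_attractorPhotons_of_v₃ hwL
  · rw [← smul_mem_attractorPhotons (wallGroup_le N B_mem_wallGroup)]
    refine mem_attractorPhotons_of_v₃ ?_
    have := mulVec_mem_smul (g := B N) hwL
    rwa [B_B_mulVec] at this

theorem avoidsRotated_of_mem_eWing (hN : 4 ≤ N) {L : LGr N} (hL : L ∈ (baseTetra N).eWing N)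
    (hP : L ∉ attractorPhotons N) : AvoidsRotated L := by
  intro d hd i hi h
  obtain ⟨p, q, hp, hq, hpq, hm⟩ := exists_vec_of_mem_eWing (smul_mem_eWing hN hd hL)
  exact hP ((smul_mem_attractorPhotons (wallGroup_le N hd)).1
    (eWing_mem_rotated hN hp hq hpq hm hi h).2)

/-- For v₀ the edge coordinates are p = 1, q = 0, and contact with a rotated closed side requires p
= 0. -/
theorem avoidsRotated_of_v₀_mem (hN : 4 ≤ N) {L : LGr N} (hL : v₀ N ∈ L.1) :
    AvoidsRotated L := by
  intro d hd i hi h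
  have hm := (mem_smul_wallGroup (A_v₀ N) (B_v₀ N) hd).2 hL
  rw [v₀_eq_vec] at hm
  exact one_ne_zero (eWing_mem_rotated hN zero_le_one le_rfl (add_zero 1) hm hi h).1

/-! ### Wall orbits and free points. -/

/-- The compact slice of a cone. -/
def Tetra.slice (t : Tetra) : Set V :=
  {x | ∃ a b c d : ℝ, 0 ≤ a ∧ 0 ≤ b ∧ 0 ≤ c ∧ 0 ≤ d ∧ a + b + c + d = 1 ∧ x = t.vec a b c d}

theorem Tetra.isCompact_slice (t : Tetra) : IsCompact t.slice := by
  have hc : IsCompact {f : Fin 4 → ℝ | (∀ i, 0 ≤ f i) ∧ ∑ i, f i = 1} :=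
    isCompact_stdSimplex ℝ (Fin 4)
  have : t.slice = (fun f : Fin 4 → ℝ => t.vec (f 0) (f 1) (f 2) (f 3)) ''
      {f : Fin 4 → ℝ | (∀ i, 0 ≤ f i) ∧ ∑ i, f i = 1} := by
    ext x
    constructor
    · rintro ⟨a, b, c, d, ha, hb, hc, hd, hs, rfl⟩
      refine ⟨![a, b, c, d], ⟨fun i => by fin_cases i <;> simpa, ?_⟩, rfl⟩
      simpa [Fin.sum_univ_four] using hs
    · rintro ⟨f, ⟨hf, hs⟩, rfl⟩
      rw [Fin.sum_univ_four] at hs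
      exact ⟨f 0, f 1, f 2, f 3, hf 0, hf 1, hf 2, hf 3, hs, rfl⟩
  rw [this]
  refine hc.image ?_
  unfold Tetra.vec
  fun_prop

theorem Tetra.coneHit_eq_hit_slice {t : Tetra} {ω : ℝ} (ht : t.IsSymplectic N ω) :
    t.coneHit N = hit N t.slice := by
  ext L
  constructor
  · rintro ⟨_, ⟨⟨a, b, c, d, ha, hb, hc, hd, rfl⟩, hne⟩, hL⟩
    have hs : 0 < a + b + c + d := by
      by_contra! hs
      obtain rfl : a = 0 := by linarith
      obtain rfl : b = 0 := by linarith
      obtain rfl : c = 0 := by linarith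
      obtain rfl : d = 0 := by linarith
      exact hne t.vec_zero
    refine ⟨_, ⟨(a + b + c + d)⁻¹ * a, (a + b + c + d)⁻¹ * b, (a + b + c + d)⁻¹ * c,
      (a + b + c + d)⁻¹ * d, by positivity, by positivity, by positivity, by positivity, ?_,
      t.smul_vec _ _ _ _ _⟩, L.1.smul_mem _ hL⟩
    rw [← mul_add, ← mul_add, ← mul_add, inv_mul_cancel₀ hs.ne']
  · rintro ⟨_, ⟨a, b, c, d, ha, hb, hc, hd, hs, rfl⟩, hL⟩
    refine IsSymplectic.vec_mem_coneHit ⟨ha, hb, hc, hd⟩ (fun h => ?_) hL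
    obtain ⟨rfl, rfl, rfl, rfl⟩ := ht.vec_eq_zero h
    norm_num at hs

theorem LGr.isClosed (L : LGr N) : IsClosed (L.1 : Set V) := Submodule.closed_of_finiteDimensional _

/-- A point whose backward `T`-orbit stays in the closed small side of index `0` is on the wing. -/
theorem mem_eWing_of_forall_T_pow (hN : 4 ≤ N) {z : LGr N}
    (h : ∀ n : ℕ, T N ^ (-(n : ℤ)) • z ∈ (baseTetra N).coneHit N) :
    z ∈ (baseTetra N).eWing N := by
  have ht := baseTetra_symp hN
  have hκ := kap_pos hN
  have hω := omega_pos hN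
  -- The plane z contains T^n x for some x in the cone. After normalisation its pairing with the
  -- axis is O(1/n), because the shear increases the `e`-part and keeps the `f`-part.
  have hn : ∀ n : ℕ, 0 < n → ∃ x ∈ (baseTetra N).slice ∩ (z.1 : Set V), ∃ l : ℝ,
      0 ≤ l ∧ pairing N (axis N) x = omega N * l ∧ l * (2 * n * kap N) ≤ 1 := by
    intro n hn
    have hz := h n
    rw [Tetra.coneHit_eq_hit_slice ht] at hz
    obtain ⟨_, ⟨a, b, c, d, ha, hb, hc, hd, hs, rfl⟩, hL⟩ := hz
    rw [_root_.zpow_neg, mem_inv_smul_iff, T_zpow_mulVec hN, pairing_axis_vec hN] at hL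
    have e : ((n : ℤ) : ℝ) * (shear N * (omega N * (b + d))) = n * kap N * (b + d) := by
      rw [shear]; push_cast; field_simp
    rw [e, axis_eq_vec, Tetra.smul_vec, Tetra.vec_add] at hL
    set m := n * kap N * (b + d) with hm
    have hm0 : 0 ≤ m := by positivity
    have hS : 0 < 1 + 2 * m := by positivity
    -- The shear adds m to both `e`-coordinates, so the sum of the coordinates grows from 1 to 1 +
    -- 2m.
    refine ⟨_, ⟨⟨(1 + 2 * m)⁻¹ * (a + m), (1 + 2 * m)⁻¹ * b, (1 + 2 * m)⁻¹ * (c + m),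
      (1 + 2 * m)⁻¹ * d, by positivity, by positivity, by positivity, by positivity, ?_, rfl⟩, ?_⟩,
      (1 + 2 * m)⁻¹ * (b + d), by positivity, ?_, ?_⟩
    · rw [← mul_add, ← mul_add, ← mul_add, inv_mul_eq_one₀ hS.ne']; linarith
    · have := z.1.smul_mem (1 + 2 * m)⁻¹ hL
      rw [Tetra.smul_vec] at this
      simpa using this
    · rw [pairing_axis_vec hN]; ring
    · rw [inv_mul_eq_div, div_mul_eq_mul_div, div_le_one hS, hm]; linarith
  have hcomp : IsCompact ((baseTetra N).slice ∩ (z.1 : Set V)) :=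
    (baseTetra N).isCompact_slice.inter_right z.isClosed
  have hne : ((baseTetra N).slice ∩ (z.1 : Set V)).Nonempty := by
    obtain ⟨x, hx, -⟩ := hn 1 one_pos
    exact ⟨x, hx⟩
  have hcont : ContinuousOn (fun x => pairing N (axis N) x)
      ((baseTetra N).slice ∩ (z.1 : Set V)) :=
    ((continuous_pairing N).comp (by fun_prop : Continuous fun x : V => (axis N, x))).continuousOn
  obtain ⟨x, ⟨⟨a, b, c, d, ha, hb, hc, hd, hs, rfl⟩, hxz⟩, hmin⟩ := hcomp.exists_isMinOn hne hcont
  -- The minimum of ω (b + d) on the compact slice of z is at most ω/(2nκ) for every n > 0, hence it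
  -- is zero, and the minimiser lies on the edge of the wing.
  have hbd : b + d = 0 := by
    by_contra hbd
    have hpos : 0 < b + d := lt_of_le_of_ne (by positivity) (Ne.symm hbd)
    obtain ⟨n, hn'⟩ := exists_nat_gt (1 / ((b + d) * (2 * kap N)))
    have hn0 : 0 < n := by
      have : (0 : ℝ) < n := lt_of_le_of_lt (by positivity) hn'
      exact_mod_cast this
    obtain ⟨x', hx', l, hl, hlx, hl1⟩ := hn n hn0
    have hle : pairing N (axis N) ((baseTetra N).vec a b c d) ≤ pairing N (axis N) x' := hmin hx'
    rw [pairing_axis_vec hN, hlx] at hle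
    have hle' := le_of_mul_le_mul_left hle hω
    rw [div_lt_iff₀ (by positivity)] at hn'
    have : (b + d) * (2 * n * kap N) ≤ l * (2 * n * kap N) :=
      mul_le_mul_of_nonneg_right hle' (by positivity)
    linarith
  obtain rfl : b = 0 := by linarith
  obtain rfl : d = 0 := by linarith
  exact Tetra.IsSymplectic.mem_eWing_of_vec_mem ha hc
    (wing_vec_ne_zero hN (by linarith)) hxz

/-- Without a free translate, the wall orbit would alternate between the small sides 0 and 0' for
ever; the backward `T`-orbit would stay in the closed side 0, which puts the point on the wing, and
the wing is free. -/
theorem exists_wallGroup_smul_mem_free (hN : 4 ≤ N) {x : LGr N} (hx : AvoidsRotated x) :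
    ∃ d ∈ wallGroup N, d • x ∈ (conePingPong hN).free := by
  have : NeZero N := ⟨by omega⟩
  by_contra! hno
  have hB : ∀ L : LGr N, B N • L ∈ hit N (tetra ((0, false) : Idx N)).interiorCone ↔
      L ∈ hit N (tetra ((0, true) : Idx N)).interiorCone := by
    intro L
    rw [tetra, tetra, mem_hit_translate, mem_hit_translate, place_zero, place_zero_true, inv_one,
      one_smul, B_inv]
  have hor : ∀ d ∈ wallGroup N, d • x ∈ hit N (tetra ((0, false) : Idx N)).interiorCone ∨
      d • x ∈ hit N (tetra ((0, true) : Idx N)).interiorCone := by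
    intro d hd
    obtain ⟨⟨k, b⟩, hi⟩ : ∃ i, d • x ∈ (conePingPong hN).small i := by
      by_contra! h
      exact hno d hd h
    have hk : (k : ℕ) = 0 := by
      by_contra hk
      exact hx d hd (k, b) hk ((conePingPong hN).small_subset _ hi)
    obtain rfl : k = 0 := Fin.ext hk
    cases b
    exacts [Or.inl hi, Or.inr hi]
  obtain ⟨d, hd, hz⟩ : ∃ d ∈ wallGroup N,
      d • x ∈ hit N (tetra ((0, false) : Idx N)).interiorCone := by
    rcases hor 1 (Subgroup.one_mem _) with h | h
    · exact ⟨1, Subgroup.one_mem _, h⟩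
    · exact ⟨B N, B_mem_wallGroup, by rw [one_smul] at h; exact (hB x).2 h⟩
  -- The inverse of `T` is `B * A`. `A` takes a point of small side 0 out of it, hence into small
  -- side 0', and `B` brings it back.
  have hall : ∀ n : ℕ, T N ^ (-(n : ℤ)) • d • x ∈
      hit N (tetra ((0, false) : Idx N)).interiorCone := by
    intro n
    induction n with
    | zero => simpa using hz
    | succ n ih =>
      have e : T N ^ (-((n + 1 : ℕ) : ℤ)) = B N * (A N * T N ^ (-(n : ℤ))) := by
        rw [← mul_assoc, ← T_inv, ← _root_.zpow_neg_one, ← _root_.zpow_add]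
        congr 1
        push_cast
        ring
      rw [e, mul_smul, hB, mul_smul]
      have hA := (conePingPong hN).refl_smul_notMem (0, false) _
        ((conePingPong hN).small_subset _ ih)
      change reflection ((0, false) : Idx N) • _ ∉ _ at hA
      rw [reflection, place_zero, one_mul, inv_one, mul_one] at hA
      have := hor (A N * T N ^ (-(n : ℤ)) * d) (Subgroup.mul_mem _ (Subgroup.mul_mem _
        A_mem_wallGroup (T_zpow_mem_wallGroup _)) hd)
      rw [mul_smul, mul_smul] at this
      exact this.resolve_left hA
  have hw : d • x ∈ (baseTetra N).eWing N := by
    refine mem_eWing_of_forall_T_pow hN fun n => ?_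
    rw [← mem_coneHit_tetra_zero]
    exact (conePingPong hN).small_subset _ (hall n)
  exact hno d hd (eWing_subset_free hN hw)

theorem place_mulVec_axis_mem_cone (hN : 4 ≤ N) (i : Idx N) :
    toMat (place i) *ᵥ axis N ∈ (tetra i).cone ∧ toMat (place i) *ᵥ axis N ≠ 0 := by
  constructor
  · refine ⟨1, 0, 1, 0, zero_le_one, le_rfl, zero_le_one, le_rfl, ?_⟩
    rw [tetra, translate_vec, axis_eq_vec]
  · intro h
    have h0 : axis N = 0 := toMat_injective (place i) (by simpa using h)
    rw [axis_eq_vec] at h0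
    exact one_ne_zero ((baseTetra_symp hN).vec_eq_zero h0).1

theorem axis_mem_of_mem_attractorPhotons (hN : 4 ≤ N) {x : LGr N} (hx : AvoidsRotated x)
    (hP : x ∈ attractorPhotons N) : axis N ∈ x.1 := by
  have : NeZero N := ⟨by omega⟩
  obtain ⟨γ, hγ, M, hM, rfl⟩ := hP
  rw [Set.mem_union, mem_rankOneAttractorPhoton_iff hN] at hM
  have hfree : M ∈ (conePingPong hN).free := by
    rcases hM with h | h
    · exact eWing_subset_free hN (photon_axis_subset_eWing hN h)
    · exact photon_v₃_subset_free hN h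
  -- Modulo the wall group γ lies in the finite group, so only the photons of single cones remain.
  -- All those not containing the axis meet a rotated closed side.
  obtain ⟨d, hd, h, hh, rfl⟩ := (conePingPong hN).exists_mul_of_avoids
    (S := {i : Idx N | (i.1 : ℕ) = 0}) (fun i hi => reflection_mem_wallGroup hi) hγ hfree hx
  rw [mul_smul, axis_mem_smul hd]
  have hx' : AvoidsRotated (h • M) := by
    have := hx.smul (Subgroup.inv_mem _ hd)
    rwa [mul_smul, inv_smul_smul] at this
  obtain ⟨i, hi⟩ := exists_signEq_place hN hh
  rw [hi.smul_eq] at hx' ⊢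
  by_cases hi0 : (i.1 : ℕ) = 0
  · rcases hM with hM | hM
    · exact (axis_mem_smul (place_mem_wallGroup hi0)).2 hM
    · exfalso
      have h2 := hx'.smul (Subgroup.inv_mem _ (place_mem_wallGroup hi0)) 1 (Subgroup.one_mem _)
        (lastIdx N) (lastIdx_ne hN)
      rw [one_smul, inv_smul_smul] at h2
      exact h2 (photon_v₃_subset_coneHit_last hN hM)
  · exfalso
    have h2 := hx' 1 (Subgroup.one_mem _) i hi0
    rw [one_smul] at h2
    rcases hM with hM | hM
    · exact h2 ⟨_, place_mulVec_axis_mem_cone hN i, mulVec_mem_smul hM⟩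
    · refine h2 ?_
      rw [tetra, mem_coneHit_translate, inv_smul_smul, ← mem_coneHit_tetra_zero]
      exact photon_v₃_subset_coneHit_zero hN hM

end

/-! ### Dynamics of the transvection -/

section

variable {N : ℕ}

open Filter Topology Metric

theorem continuous_pairing_right (N : ℕ) (v : V) : Continuous fun x => pairing N v x :=
  (continuous_pairing N).comp (by fun_prop : Continuous fun x : V => (v, x))

/-- High powers of the transvection move compact sets off the fixed hyperplane towards the axis. -/
theorem exists_smul_T_zpow_mem_closedBall (hN : 4 ≤ N) {Q : Set V} (hQ : IsCompact Q)
    (hne : ∀ q ∈ Q, pairing N (axis N) q ≠ 0) {ε : ℝ} (hε : 0 < ε) :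
    ∃ n₀ : ℕ, ∀ n : ℤ, n₀ ≤ n.natAbs → ∀ q ∈ Q,
      ∃ r : ℝ, r • (toMat (T N ^ n) *ᵥ q) ∈ closedBall (axis N) ε := by
  have hτ := (shear_pos hN).ne'
  have hcont : ContinuousOn (fun q : V => (shear N * pairing N (axis N) q)⁻¹ • q) Q := by
    refine ContinuousOn.smul (ContinuousOn.inv₀ ?_ fun q hq => mul_ne_zero hτ (hne q hq))
      continuousOn_id
    exact (continuous_const.mul (continuous_pairing_right N _)).continuousOn
  obtain ⟨K, hK⟩ := hQ.exists_bound_of_continuousOn hcont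
  obtain ⟨n₀, hn₀⟩ := exists_nat_gt (K / ε)
  -- With c = n · shear · ⟨axis, q⟩, the vector c⁻¹ T^n q equals the axis plus c⁻¹ q, and c⁻¹ q is
  -- of size K/|n|.
  refine ⟨n₀ + 1, fun n hn q hq => ⟨(n * (shear N * pairing N (axis N) q))⁻¹, ?_⟩⟩
  have hn0 : (n : ℝ) ≠ 0 := by
    rintro h
    have : n = 0 := by exact_mod_cast h
    simp [this] at hn
  have hc : (n : ℝ) * (shear N * pairing N (axis N) q) ≠ 0 :=
    mul_ne_zero hn0 (mul_ne_zero hτ (hne q hq))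
  rw [T_zpow_mulVec hN, smul_add, smul_smul, inv_mul_cancel₀ hc, one_smul, mem_closedBall,
    dist_eq_norm, add_sub_cancel_right, mul_inv, mul_smul, norm_smul, norm_inv, Real.norm_eq_abs]
  have habs : (n₀ : ℝ) + 1 ≤ |(n : ℝ)| := by
    rw [← Int.cast_abs, Int.abs_eq_natAbs]
    exact_mod_cast hn
  have hpos : 0 < |(n : ℝ)| := abs_pos.2 hn0
  rw [inv_mul_le_iff₀ hpos]
  rw [div_lt_iff₀ hε] at hn₀
  have h1 := hK q hq
  nlinarith

/-- L is closed, so a small ball about q misses it, and missing a compact set is an open condition.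
It is stated for all small ε so that finitely many such conditions can be combined. -/
theorem eventually_notMem_hit_closedBall (hN : 4 ≤ N) {x : LGr N} {q : V} (hq : q ∉ x.1) :
    ∀ᶠ ε in 𝓝[>] (0 : ℝ), ∀ᶠ M in 𝓝 x, M ∉ hit N (closedBall q ε) := by
  have ho : (x.1 : Set V)ᶜ ∈ 𝓝 q := x.isClosed.isOpen_compl.mem_nhds hq
  obtain ⟨δ, hδ, hsub⟩ := nhds_basis_closedBall.mem_iff.1 ho
  filter_upwards [Ioc_mem_nhdsGT hδ] with ε hε
  refine (isClosed_hit hN (isCompact_closedBall q ε)).isOpen_compl.mem_nhds ?_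
  rintro ⟨y, hy, hyx⟩
  exact hsub (closedBall_subset_closedBall hε.2 hy) hyx

theorem exists_notMem_hit_closedBall (hN : 4 ≤ N) {x : LGr N} {q : V} (hq : q ∉ x.1) :
    ∃ ε > 0, ∀ᶠ M in 𝓝 x, M ∉ hit N (closedBall q ε) := by
  obtain ⟨ε, h, hε⟩ := ((eventually_notMem_hit_closedBall hN hq).and self_mem_nhdsWithin).exists
  exact ⟨ε, hε, h⟩

theorem hit_of_smul_mem {S : Set V} {M : LGr N} {r : ℝ} {y : V} (h : r • y ∈ S) (hy : y ∈ M.1) :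
    M ∈ hit N S := ⟨r • y, h, M.1.smul_mem r hy⟩

theorem mem_zpow_smul_iff (g : GSp N) (n : ℤ) (L : LGr N) (y : V) :
    y ∈ (g ^ n • L).1 ↔ toMat (g ^ (-n)) *ᵥ y ∈ L.1 := by
  rw [← mem_inv_smul_iff, ← _root_.zpow_neg, neg_neg]

/-- If T^n M contained a vector q of Q, then M would contain T^(-n) q, which for large |n| is
projectively close to the axis; planes near x avoid a neighbourhood of the axis. -/
theorem exists_forall_T_zpow_notMem_hit (hN : 4 ≤ N) {x : LGr N} (hx : axis N ∉ x.1) {Q : Set V}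
    (hQ : IsCompact Q) (hne : ∀ q ∈ Q, pairing N (axis N) q ≠ 0) :
    ∃ n₀ : ℕ, ∀ᶠ M in 𝓝 x, ∀ n : ℤ, n₀ ≤ n.natAbs → T N ^ n • M ∉ hit N Q := by
  obtain ⟨ε, hε, hM⟩ := exists_notMem_hit_closedBall hN hx
  obtain ⟨n₀, hn₀⟩ := exists_smul_T_zpow_mem_closedBall hN hQ hne hε
  refine ⟨n₀, ?_⟩
  filter_upwards [hM] with M hM n hn
  rintro ⟨q, hq, hqM⟩
  obtain ⟨r, hr⟩ := hn₀ (-n) (by simpa using hn) q hq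
  exact hM (hit_of_smul_mem hr ((mem_zpow_smul_iff _ _ _ _).1 hqM))

theorem finite_natAbs_lt (n₀ : ℕ) : {n : ℤ | n.natAbs < n₀}.Finite :=
  (Set.finite_Icc (-(n₀ : ℤ)) n₀).subset fun n hn => by
    simp only [Set.mem_ofPred_eq] at hn
    constructor <;> omega

theorem eventually_T_zpow_notMem_hit (hN : 4 ≤ N) {x : LGr N} (hx : axis N ∉ x.1) {Q : Set V}
    (hQ : IsCompact Q) (hne : ∀ q ∈ Q, pairing N (axis N) q ≠ 0)
    (hxQ : ∀ n : ℤ, T N ^ n • x ∉ hit N Q) :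
    ∀ᶠ M in 𝓝 x, ∀ n : ℤ, T N ^ n • M ∉ hit N Q := by
  obtain ⟨n₀, h⟩ := exists_forall_T_zpow_notMem_hit hN hx hQ hne
  have h' : ∀ᶠ M in 𝓝 x, ∀ n ∈ {n : ℤ | n.natAbs < n₀}, T N ^ n • M ∉ hit N Q := by
    rw [eventually_all_finite (finite_natAbs_lt n₀)]
    intro n _
    exact (continuous_const_smul (T N ^ n)).continuousAt.eventually
      ((isClosed_hit hN hQ).isOpen_compl.mem_nhds (hxQ n))
  filter_upwards [h, h'] with M h h' n
  rcases lt_or_ge n.natAbs n₀ with hn | hn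
  exacts [h' n hn, h n hn]

/-- For large |n| one fixed ball off the hyperplane orthogonal to the axis works. Each of the
finitely many other n allows every sufficiently small radius. -/
theorem exists_closedBall_T_zpow_notMem_hit (hN : 4 ≤ N) {x : LGr N} (hx : axis N ∉ x.1) {q : V}
    (hq : pairing N (axis N) q ≠ 0) (hxq : ∀ n : ℤ, q ∉ (T N ^ n • x).1) :
    ∃ ε > 0, ∀ᶠ M in 𝓝 x, ∀ n : ℤ, T N ^ n • M ∉ hit N (closedBall q ε) := by
  have ho : {y | pairing N (axis N) y ≠ 0} ∈ 𝓝 q :=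
    (isOpen_ne.preimage (continuous_pairing_right N (axis N))).mem_nhds hq
  obtain ⟨δ, hδ, hsub⟩ := nhds_basis_closedBall.mem_iff.1 ho
  obtain ⟨n₀, h⟩ := exists_forall_T_zpow_notMem_hit hN hx (isCompact_closedBall q δ)
    fun y hy => hsub hy
  have h' : ∀ᶠ ε in 𝓝[>] (0 : ℝ), ∀ n ∈ {n : ℤ | n.natAbs < n₀}, ∀ᶠ M in 𝓝 x,
      T N ^ n • M ∉ hit N (closedBall q ε) := by
    rw [eventually_all_finite (finite_natAbs_lt n₀)]
    intro n _
    filter_upwards [eventually_notMem_hit_closedBall hN (hxq n)] with ε hε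
    exact (continuous_const_smul (T N ^ n)).continuousAt.eventually hε
  obtain ⟨ε, h', hε⟩ := (h'.and (Ioc_mem_nhdsGT hδ)).exists
  refine ⟨ε, hε.1, ?_⟩
  rw [← eventually_all_finite (finite_natAbs_lt n₀)] at h'
  filter_upwards [h, h'] with M h h' n
  rcases lt_or_ge n.natAbs n₀ with hn | hn
  · exact h' n hn
  · exact fun hm => h n hn (hit_mono (closedBall_subset_closedBall hε.2) hm)

theorem LGr.exists_pairing_ne_of_notMem (hN : 4 ≤ N) {L : LGr N} {v : V} (hv : v ∉ L.1) :
    ∃ q ∈ L.1, pairing N v q ≠ 0 := by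
  by_contra! h
  refine hv (L.mem_of_pairing hN fun y hy => ?_)
  rw [pairing_swap, h y hy, neg_zero]

/-- As L = L^⊥, a plane without the axis has a vector off the hyperplane orthogonal to the axis, and
so do its neighbours; high powers of `T` push this vector towards the axis. -/
theorem exists_forall_T_zpow_mem_hit (hN : 4 ≤ N) {x : LGr N} (hx : axis N ∉ x.1) {ε : ℝ}
    (hε : 0 < ε) : ∃ n₀ : ℕ, ∀ᶠ M in 𝓝 x, ∀ n : ℤ, n₀ ≤ n.natAbs →
      T N ^ n • M ∈ hit N (closedBall (axis N) ε) := by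
  obtain ⟨q, hqx, hq⟩ := LGr.exists_pairing_ne_of_notMem hN hx
  have ho : {y | pairing N (axis N) y ≠ 0} ∈ 𝓝 q :=
    (isOpen_ne.preimage (continuous_pairing_right N (axis N))).mem_nhds hq
  obtain ⟨δ, hδ, hsub⟩ := nhds_basis_closedBall.mem_iff.1 ho
  obtain ⟨n₀, hn₀⟩ := exists_smul_T_zpow_mem_closedBall hN (isCompact_closedBall q δ)
    (fun y hy => hsub hy) hε
  refine ⟨n₀, ?_⟩
  filter_upwards [(isOpen_hit (N := N) (isOpen_ball (x := q) (ε := δ))).mem_nhds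
    ⟨q, mem_ball_self hδ, hqx⟩] with M hM n hn
  obtain ⟨y, hy, hyM⟩ := hM
  obtain ⟨r, hr⟩ := hn₀ n hn y (ball_subset_closedBall hy)
  exact hit_of_smul_mem hr (mulVec_mem_smul hyM)

/-- High powers take planes near x to planes that pass close to the axis, while planes near y stay
away from it. -/
theorem exists_bound_of_T_zpow_smul_eq (hN : 4 ≤ N) {x y : LGr N} (hx : axis N ∉ x.1)
    (hy : axis N ∉ y.1) : ∃ n₀ : ℕ, ∀ᶠ p in 𝓝 x ×ˢ 𝓝 y, ∀ n : ℤ,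
      T N ^ n • p.1 = p.2 → n.natAbs < n₀ := by
  obtain ⟨ε, hε, h2⟩ := exists_notMem_hit_closedBall hN hy
  obtain ⟨n₀, h1⟩ := exists_forall_T_zpow_mem_hit hN hx hε
  refine ⟨n₀, ?_⟩
  filter_upwards [h1.prod_mk h2] with p hp n e
  by_contra! hn
  exact hp.2 (e ▸ hp.1 n hn)

theorem finite_T_zpow_mul (hN : 4 ≤ N) {x y : LGr N} (g : GSp N) (hx : axis N ∉ (g • x).1)
    (hy : axis N ∉ y.1) : ∃ F : Set (GSp N), F.Finite ∧ ∀ᶠ p in 𝓝 x ×ˢ 𝓝 y, ∀ n : ℤ,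
      (T N ^ n * g) • p.1 = p.2 → T N ^ n * g ∈ F := by
  obtain ⟨n₀, h⟩ := exists_bound_of_T_zpow_smul_eq hN hx hy
  refine ⟨(fun n : ℤ => T N ^ n * g) '' {n | n.natAbs < n₀}, (finite_natAbs_lt n₀).image _, ?_⟩
  have ht : Tendsto (fun p : LGr N × LGr N => (g • p.1, p.2)) (𝓝 x ×ˢ 𝓝 y)
      (𝓝 (g • x) ×ˢ 𝓝 y) :=
    ((continuous_const_smul g).continuousAt.tendsto.comp tendsto_fst).prodMk tendsto_snd
  filter_upwards [ht.eventually h] with p hp n e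
  rw [mul_smul] at e
  exact ⟨n, hp n e, rfl⟩

/-! ### Points whose wall orbit is tame -/

/-- Points not containing the axis whose orbit under the wall group avoids the closed small sides
of index `≠ 0, 0'`. -/
def IsTame (x : LGr N) : Prop := AvoidsRotated x ∧ axis N ∉ x.1

theorem isTame_of_mem_eWing (hN : 4 ≤ N) {L : LGr N} (hL : L ∈ (baseTetra N).eWing N)
    (hP : L ∉ attractorPhotons N) : IsTame L :=
  ⟨avoidsRotated_of_mem_eWing hN hL hP, fun h => hP (mem_attractorPhotons_of_axis hN h)⟩

theorem IsTame.smul {x : LGr N} (hx : IsTame x) {d : GSp N} (hd : d ∈ wallGroup N) :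
    IsTame (d • x) := ⟨hx.1.smul hd, fun h => hx.2 ((axis_mem_smul hd).1 h)⟩

/-- Up to a nonzero scalar the pairing is -ω (b + d) in the flipped coordinates, with b > 0 and d ≥
0. -/
theorem pairing_axis_ne_zero (hN : 4 ≤ N) {i : Idx N} (hi : (i.1 : ℕ) ≠ 0) {y : V}
    (hy : y ∈ (tetra i).cone) (hy0 : y ≠ 0) : pairing N (axis N) y ≠ 0 := by
  obtain ⟨σ, a, b, c, d, hσ, ha, hb, hc, hd, e, -, -⟩ :=
    (flipCoords_of_mem_cone hN i hi hy hy0).exists_coords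
  intro h
  have h' : pairing N (axis N) (σ • y) = 0 := by rw [pairing_smul_right, h, mul_zero]
  rw [e, Tetra.flip_vec, pairing_axis_vec hN] at h'
  have := (mul_eq_zero.1 h').resolve_left (omega_pos hN).ne'
  linarith

theorem slice_subset {t : Tetra} {ω : ℝ} (ht : t.IsSymplectic N ω) {y : V} (hy : y ∈ t.slice) :
    y ∈ t.cone ∧ y ≠ 0 := by
  obtain ⟨a, b, c, d, ha, hb, hc, hd, hs, rfl⟩ := hy
  refine ⟨⟨a, b, c, d, ha, hb, hc, hd, rfl⟩, fun h => ?_⟩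
  obtain ⟨rfl, rfl, rfl, rfl⟩ := ht.vec_eq_zero h
  norm_num at hs

/-- The cones of index other than 0, 0' have compact slices off the hyperplane orthogonal to the
axis, so infinitely many conditions, one for each power of `T`, hold on a common neighbourhood. -/
theorem IsTame.eventually (hN : 4 ≤ N) {x : LGr N} (hx : IsTame x) : ∀ᶠ M in 𝓝 x, IsTame M := by
  have : NeZero N := ⟨by omega⟩
  have h1 : ∀ᶠ M in 𝓝 x, axis N ∉ M.1 := by
    obtain ⟨ε, hε, h⟩ := exists_notMem_hit_closedBall hN hx.2
    filter_upwards [h] with M hM hm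
    exact hM ⟨_, mem_closedBall_self hε.le, hm⟩
  have h2 : ∀ᶠ M in 𝓝 x, ∀ i : Idx N, (i.1 : ℕ) ≠ 0 → ∀ n : ℤ,
      T N ^ n • M ∉ (tetra i).coneHit N := by
    rw [eventually_all]
    intro i
    by_cases hi : (i.1 : ℕ) = 0
    · exact Eventually.of_forall fun M h => absurd hi h
    obtain ⟨ω, hω⟩ := (baseTetra_symp hN).translate (place i)
    have e : (tetra i).coneHit N = hit N (tetra i).slice := Tetra.coneHit_eq_hit_slice hω
    have := eventually_T_zpow_notMem_hit hN hx.2 (tetra i).isCompact_slice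
      (fun y hy => pairing_axis_ne_zero hN hi (slice_subset hω hy).1 (slice_subset hω hy).2)
      (fun n => by rw [← e]; exact hx.1 _ (T_zpow_mem_wallGroup n) i hi)
    filter_upwards [this] with M hM _ n
    rw [e]
    exact hM n
  filter_upwards [h1, h2] with M h1 h2
  refine ⟨fun d hd i hi => ?_, h1⟩
  obtain ⟨n, rfl | rfl⟩ := exists_of_mem_wallGroup hd
  · exact h2 i hi n
  -- The elements B T^n reduce to T^n, because `B` permutes the indices other than 0, 0'.
  · obtain ⟨j, rfl⟩ := (flipPerm N).surjective i
    rw [mul_smul, (actsBy_B hN).mem_closed]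
    refine h2 j (fun hj => hi ?_) n
    have : j.1 = 0 := Fin.ext hj
    simp [flipPerm, this]

/-- Move the point to a free one inside its wall orbit. If it is still in level 1, a reflection puts
it in two closed sides; tameness leaves only 0 and 0', whose intersection is in the wing, and
excludes the attractor photons. -/
theorem mem_domain_of_isTame (hN : 4 ≤ N) {x : LGr N} (hx : IsTame x) :
    ∃ γ ∈ reflectionGroup N, γ • x ∈ (conePingPong hN).approx 1 ∨
      (γ • x ∈ (baseTetra N).eWing N ∧ γ • x ∉ attractorPhotons N) := by
  have : NeZero N := ⟨by omega⟩
  obtain ⟨d, hd, hfree⟩ := exists_wallGroup_smul_mem_free hN hx.1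
  by_cases happ : d • x ∈ (conePingPong hN).approx 1
  · exact ⟨d, wallGroup_le N hd, Or.inl happ⟩
  have hz := hx.smul hd
  obtain ⟨i, j, hj, hmem⟩ : ∃ i, ∃ j ≠ i, reflection i • d • x ∈ (tetra j).coneHit N := by
    by_contra! h
    exact happ fun i ⟨j, hj, hm⟩ => h i j hj hm
  have hmem' : reflection i • d • x ∈ (tetra i).coneHit N :=
    (conePingPong hN).refl_smul_mem i _ (hfree i)
  have hdi : d • x ∈ (tetra i).coneHit N := by
    have h := (conePingPong hN).lev_succ_subset 0 i (⟨j, hj, hmem⟩ :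
      d • x ∈ (conePingPong hN).lev 1 i)
    exact h
  have hi : (i.1 : ℕ) = 0 := by
    by_contra hi
    exact hx.1 d hd i hi hdi
  have hri := reflection_mem_wallGroup hi
  have hj0 : (j.1 : ℕ) = 0 := by
    by_contra hj0
    exact hz.1 _ hri j hj0 hmem
  have hw : reflection i • d • x ∈ (baseTetra N).eWing N := by
    obtain ⟨k, b⟩ := i
    obtain ⟨l, c⟩ := j
    obtain rfl : k = 0 := Fin.ext hi
    obtain rfl : l = 0 := Fin.ext hj0
    cases b <;> cases c
    · exact absurd rfl hj
    · exact mem_eWing_of_mem_coneHit_zero hN hmem' hmem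
    · exact mem_eWing_of_mem_coneHit_zero hN hmem hmem'
    · exact absurd rfl hj
  refine ⟨reflection i * d, Subgroup.mul_mem _ (wallGroup_le N hri) (wallGroup_le N hd),
    Or.inr ?_⟩
  rw [mul_smul]
  exact ⟨hw, fun hP => (hz.smul hri).2 (axis_mem_of_mem_attractorPhotons hN (hz.smul hri).1 hP)⟩

theorem place_mem_reflectionGroup (i : Idx N) : place i ∈ reflectionGroup N :=
  Subgroup.closure_mono (fun _ hx => Or.inr hx) (place_mem_dihedral i)

/-- Replacing the wing points by tame points does not change Ω, but exhibits it as the orbit of an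
open set. -/
theorem mem_domain_iff (hN : 4 ≤ N) (x : LGr N) : x ∈ domain N ↔
    ∃ γ ∈ reflectionGroup N, γ • x ∈ (conePingPong hN).approx 1 ∨ IsTame (γ • x) := by
  have : NeZero N := ⟨by omega⟩
  constructor
  · rintro ⟨γ, hγ, y, hy | hy, rfl⟩
    · refine ⟨γ⁻¹, Subgroup.inv_mem _ hγ, Or.inl ?_⟩
      rw [inv_smul_smul, ← domainApprox_succ]
      exact hy
    · obtain ⟨i, hyi, hyP⟩ := Set.mem_iUnion.1 hy
      have hp := Subgroup.inv_mem _ (place_mem_reflectionGroup i)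
      refine ⟨(place i)⁻¹ * γ⁻¹, Subgroup.mul_mem _ hp (Subgroup.inv_mem _ hγ), Or.inr ?_⟩
      rw [mul_smul, inv_smul_smul]
      exact isTame_of_mem_eWing hN ((mem_eWing_tetra i y).1 hyi)
        fun h => hyP ((smul_mem_attractorPhotons hp).1 h)
  · have key : ∀ γ ∈ reflectionGroup N, (γ • x ∈ (conePingPong hN).approx 1 ∨
        (γ • x ∈ (baseTetra N).eWing N ∧ γ • x ∉ attractorPhotons N)) → x ∈ domain N := by
      intro γ hγ h
      refine ⟨γ⁻¹, Subgroup.inv_mem _ hγ, γ • x, ?_, (inv_smul_smul _ _).symm⟩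
      rcases h with h | h
      · left
        rwa [← domainApprox_succ] at h
      · refine Or.inr (Set.mem_iUnion.2 ⟨(0, false), ?_, h.2⟩)
        rw [mem_eWing_tetra, place_zero, inv_one, one_smul]
        exact h.1
    rintro ⟨γ, hγ, h | h⟩
    · exact key γ hγ (Or.inl h)
    · obtain ⟨δ, hδ, h⟩ := mem_domain_of_isTame hN h
      rw [smul_smul] at h
      exact key _ (Subgroup.mul_mem _ hδ hγ) h

theorem isOpen_domain (hN : 4 ≤ N) : IsOpen (domain N) := by
  rw [isOpen_iff_mem_nhds]
  intro x hx
  obtain ⟨γ, hγ, h⟩ := (mem_domain_iff hN x).1 hx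
  have hev : ∀ᶠ M in 𝓝 (γ • x), M ∈ (conePingPong hN).approx 1 ∨ IsTame M := by
    rcases h with h | h
    · filter_upwards [(isOpen_approx hN 1).mem_nhds h] with M hM using Or.inl hM
    · filter_upwards [h.eventually hN] with M hM using Or.inr hM
  filter_upwards [(continuous_const_smul γ).continuousAt.eventually hev] with M hM
  exact (mem_domain_iff hN M).2 ⟨γ, hγ, hM⟩

theorem smul_mem_domain {γ : GSp N} (hγ : γ ∈ reflectionGroup N) {x : LGr N}
    (hx : x ∈ domain N) : γ • x ∈ domain N := by
  obtain ⟨δ, hδ, y, hy, rfl⟩ := hx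
  exact ⟨γ * δ, Subgroup.mul_mem _ hγ hδ, y, hy, (mul_smul _ _ _).symm⟩

theorem innerDomain_subset_domain (hN : 4 ≤ N) : innerDomain N ⊆ domain N := by
  have : NeZero N := ⟨by omega⟩
  intro x hx
  rw [innerDomain_eq hN] at hx
  obtain ⟨n, hx⟩ := Set.mem_iUnion.1 hx
  obtain ⟨γ, hγ, h⟩ := exists_smul_mem_approx_one hN hx
  exact (mem_domain_iff hN x).2 ⟨γ, hγ, Or.inl h⟩

theorem eWing_disjoint_innerDomain (hN : 4 ≤ N) {x : LGr N}
    (hx : x ∈ (baseTetra N).eWing N) : x ∉ innerDomain N := by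
  have : NeZero N := ⟨by omega⟩
  rw [innerDomain_eq hN, Set.mem_iUnion]
  rintro ⟨n, hn⟩
  exact hn _ (eWing_subset_lev hN n hx)

end

/-! ### Proper discontinuity on the domain -/

section

variable {N : ℕ}

open Filter Topology Metric

theorem SignEq.inv {g h : GSp N} (H : SignEq g h) : SignEq g⁻¹ h⁻¹ := by
  rcases H with rfl | rfl
  · exact SignEq.refl _
  · right
    rw [_root_.mul_inv_rev, inv_eq_of_mul_eq_one_left negOne_mul_negOne, negOne_comm]

theorem SignEq.mulVec_mem {g h : GSp N} (H : SignEq g h) {y : V} {L : LGr N} :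
    toMat g *ᵥ y ∈ L.1 ↔ toMat h *ᵥ y ∈ L.1 := by
  rcases H with rfl | rfl
  · rfl
  · rw [← toMat_mulVec_mulVec, negOne_mulVec, neg_mem_iff]

theorem mulVec_axis_notMem (hN : 4 ≤ N) {g : GSp N} {i : Idx N} (hi : (i.1 : ℕ) ≠ 0)
    (hg : SignEq g (place i)) {x : LGr N} (hx : IsTame x) (n : ℤ) :
    toMat g *ᵥ axis N ∉ (T N ^ n • x).1 := by
  rw [hg.mulVec_mem]
  intro h
  exact hx.1 _ (T_zpow_mem_wallGroup n) i hi ⟨_, place_mulVec_axis_mem_cone hN i, h⟩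

/-- Only finitely many elements of a double coset of the transvections take points near a tame
point to points near a tame point. -/
theorem finite_T_zpow_mul_mul (hN : 4 ≤ N) {x y : LGr N} (hx : IsTame x) (hy : IsTame y)
    {h : GSp N} (hh : h ∈ dihedral N) : ∃ F : Set (GSp N), F.Finite ∧
      ∀ᶠ p in 𝓝 x ×ˢ 𝓝 y, ∀ m n : ℤ,
        (T N ^ m * h * T N ^ n) • p.1 = p.2 → T N ^ m * h * T N ^ n ∈ F := by
  -- If h is ±1 or ±B it normalises ⟨T⟩, and the two exponents merge into one.
  by_cases hD : ∃ i : Idx N, (i.1 : ℕ) = 0 ∧ SignEq h (place i)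
  · obtain ⟨i, hi, hs⟩ := hD
    have hcomm : ∀ n : ℤ, ∃ k : ℤ, h * T N ^ n = T N ^ k * h := by
      have hp : ∀ n : ℤ, ∃ k : ℤ, place i * T N ^ n = T N ^ k * place i := by
        intro n
        rcases place_eq_of_val_eq_zero hi with e | e <;> rw [e]
        · exact ⟨n, by rw [one_mul, mul_one]⟩
        · exact ⟨-n, B_mul_T_zpow N n⟩
      intro n
      obtain ⟨k, hk⟩ := hp n
      refine ⟨k, ?_⟩
      rcases hs with rfl | rfl
      · exact hk
      · rw [mul_assoc, hk, ← mul_assoc, ← negOne_comm, mul_assoc]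
    have haxis : axis N ∉ (h • x).1 := by
      rw [hs.smul_eq, axis_mem_smul (place_mem_wallGroup hi)]
      exact hx.2
    obtain ⟨F, hF, hev⟩ := finite_T_zpow_mul hN h haxis hy.2
    refine ⟨F, hF, ?_⟩
    filter_upwards [hev] with p hp m n
    obtain ⟨k, hk⟩ := hcomm n
    rw [mul_assoc, hk, ← mul_assoc, ← _root_.zpow_add]
    exact hp (m + k)
  · have hinv : ∀ i : Idx N, SignEq h⁻¹ (place i) → (i.1 : ℕ) ≠ 0 := by
      intro i hs hi
      refine hD ⟨i, hi, ?_⟩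
      have := hs.inv
      rw [inv_inv] at this
      rcases place_eq_of_val_eq_zero hi with e | e <;> rw [e] at this ⊢
      · simpa using this
      · rwa [B_inv] at this
    obtain ⟨i, hs⟩ := exists_signEq_place hN hh
    have hi : (i.1 : ℕ) ≠ 0 := fun hi => hD ⟨i, hi, hs⟩
    obtain ⟨i', hs'⟩ := exists_signEq_place hN ((dihedral N).inv_mem hh)
    have hi' := hinv i' hs'
    have hq : pairing N (axis N) (toMat h *ᵥ axis N) ≠ 0 := by
      have hc := place_mulVec_axis_mem_cone hN i
      have hc' := pairing_axis_ne_zero hN hi hc.1 hc.2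
      rcases hs with rfl | rfl
      · exact hc'
      · rw [← toMat_mulVec_mulVec, negOne_mulVec, pairing_neg_right]
        exact neg_ne_zero.2 hc'
    -- No T-translate of a plane near y meets a ball about h(axis), whereas T^n takes planes near x
    -- to planes that pass close to the axis once |n| is large. This bounds n.
    obtain ⟨ε, hε, hyε⟩ := exists_closedBall_T_zpow_notMem_hit hN hy.2 hq
      (mulVec_axis_notMem hN hi hs hy)
    have hcont : Continuous fun v : V => toMat h *ᵥ v := by fun_prop
    obtain ⟨δ, hδ, hsub⟩ := nhds_basis_closedBall.mem_iff.1
      (hcont.continuousAt.preimage_mem_nhds (closedBall_mem_nhds (toMat h *ᵥ axis N) hε))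
    obtain ⟨n₀, hxδ⟩ := exists_forall_T_zpow_mem_hit hN hx.2 hδ
    -- For fixed n the exponent m is bounded, since the axis is not in h T^n x: otherwise h⁻¹(axis),
    -- a vector of a rotated cone up to sign, would be in T^n x.
    have hfin : ∀ n : ℤ, ∃ F : Set (GSp N), F.Finite ∧ ∀ᶠ p in 𝓝 x ×ˢ 𝓝 y, ∀ m : ℤ,
        (T N ^ m * (h * T N ^ n)) • p.1 = p.2 → T N ^ m * (h * T N ^ n) ∈ F := by
      intro n
      refine finite_T_zpow_mul hN (h * T N ^ n) ?_ hy.2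
      rw [mul_smul, ← inv_inv h, mem_inv_smul_iff]
      exact mulVec_axis_notMem hN hi' hs' hx n
    choose F hF hFev using hfin
    refine ⟨⋃ n ∈ {n : ℤ | n.natAbs < n₀}, F n,
      (finite_natAbs_lt n₀).biUnion fun n _ => hF n, ?_⟩
    have hall := (eventually_all_finite (finite_natAbs_lt n₀)).2 fun n _ => hFev n
    filter_upwards [hall, hxδ.prod_mk hyε] with p hp hp' m n e
    rw [mul_assoc] at e ⊢
    have hn : n.natAbs < n₀ := by
      by_contra! hn
      obtain ⟨v, hv, hvM⟩ := hp'.1 n hn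
      refine hp'.2 (-m) ⟨toMat h *ᵥ v, hsub hv, ?_⟩
      rw [← e, mul_smul, mul_smul, _root_.zpow_neg, inv_smul_smul]
      exact mulVec_mem_smul hvM
    exact Set.mem_biUnion (x := n) hn (hp n hn m e)

/-- Near the two points everything is tame. Make the source free by a wall element d; since the
target avoids the rotated sides, γ d⁻¹ is a wall element times an element of the finite group, and γ
falls into finitely many double cosets of ⟨T⟩. -/
theorem locallyFinitePair_isTame (hN : 4 ≤ N) {x y : LGr N} (hx : IsTame x) (hy : IsTame y) :
    LocallyFinitePair (reflectionGroup N) x y := by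
  have hfin := fun h : dihedral N => finite_T_zpow_mul_mul hN hx hy h.2
  choose F hF hFev using hfin
  have : Finite (dihedral N) := (finite_dihedral hN).to_subtype
  refine ⟨⋃ h, F h, Set.finite_iUnion hF, ?_⟩
  filter_upwards [eventually_all.2 hFev, (hx.eventually hN).prod_mk (hy.eventually hN)]
    with p hp hp' γ hγ e
  obtain ⟨d, hd, hfree⟩ := exists_wallGroup_smul_mem_free hN hp'.1.1
  obtain ⟨d', hd', h, hh, e'⟩ := (conePingPong hN).exists_mul_of_avoids
    (S := {i : Idx N | (i.1 : ℕ) = 0}) (D := wallGroup N)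
    (fun i hi => reflection_mem_wallGroup hi)
    (γ := γ * d⁻¹) (Subgroup.mul_mem _ hγ (Subgroup.inv_mem _ (wallGroup_le N hd))) hfree
    (fun f hf i hi => by
      rw [mul_smul, inv_smul_smul, e]
      exact hp'.2.1 f hf i hi)
  have hform : ∃ (m n : ℤ) (k : dihedral N), γ = T N ^ m * k * T N ^ n := by
    have e2 : γ = d' * h * d := by rw [← e', inv_mul_cancel_right]
    obtain ⟨n, hn⟩ := exists_of_mem_wallGroup hd
    obtain ⟨m, hm⟩ := exists_of_mem_wallGroup hd'
    obtain ⟨m, u, hu, rfl⟩ : ∃ (m : ℤ) (u : GSp N), u ∈ dihedral N ∧ d' = T N ^ m * u := by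
      rcases hm with rfl | rfl
      · exact ⟨m, 1, Subgroup.one_mem _, (mul_one _).symm⟩
      · exact ⟨-m, B N, B_mem_dihedral, B_mul_T_zpow N m⟩
    obtain ⟨w, hw, rfl⟩ : ∃ w ∈ dihedral N, d = w * T N ^ n := by
      rcases hn with rfl | rfl
      · exact ⟨1, Subgroup.one_mem _, (one_mul _).symm⟩
      · exact ⟨B N, B_mem_dihedral, rfl⟩
    refine ⟨m, n, ⟨u * h * w, Subgroup.mul_mem _ (Subgroup.mul_mem _ hu hh) hw⟩, ?_⟩
    simp only [e2, mul_assoc]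
  obtain ⟨m, n, k, rfl⟩ := hform
  exact Set.mem_iUnion.2 ⟨k, hp k m n e⟩

/-- A plane through the axis is on the wing, which is disjoint from the invariant set Ω°. -/
theorem axis_notMem_of_mem_approx (hN : 4 ≤ N) {n : ℕ} {y : LGr N}
    (hy : y ∈ (conePingPong hN).approx n) {g : GSp N} (hg : g ∈ reflectionGroup N) :
    axis N ∉ (g • y).1 := by
  intro h
  refine eWing_disjoint_innerDomain hN (photon_axis_subset_eWing hN h) ?_
  rw [innerDomain_eq hN, Set.mem_iUnion]
  exact (conePingPong hN).smul_mem_iUnion_approx hg hy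

/-- Make the tame target free by a wall element d. The inverse of d γ takes a free point to `approx
n`, so d γ belongs to a finite set; what remains is one power of `T`, bounded by the dynamics. -/
theorem locallyFinitePair_approx_isTame (hN : 4 ≤ N) {n : ℕ} {y x : LGr N}
    (hy : y ∈ (conePingPong hN).approx n) (hx : IsTame x) :
    LocallyFinitePair (reflectionGroup N) y x := by
  set S : Set (GSp N) := {γ | γ ∈ reflectionGroup N ∧ ∃ z ∈ (conePingPong hN).free,
    γ • z ∈ (conePingPong hN).approx n} with hS
  have hSfin : S.Finite := (conePingPong hN).finite_free_approx n
  set S' : Set (GSp N) := S⁻¹ ∪ (B N * ·) '' S⁻¹ with hS'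
  have hS'fin : S'.Finite := hSfin.inv.union (hSfin.inv.image _)
  have hS'le : ∀ g ∈ S', g ∈ reflectionGroup N := by
    have h1 : ∀ g ∈ S⁻¹, g ∈ reflectionGroup N := fun g hg =>
      inv_inv g ▸ Subgroup.inv_mem _ hg.1
    rintro g (hg | ⟨g, hg, rfl⟩)
    · exact h1 g hg
    · exact Subgroup.mul_mem _ (wallGroup_le N B_mem_wallGroup) (h1 g hg)
  have hfin := fun g : S' => finite_T_zpow_mul hN (g : GSp N)
    (axis_notMem_of_mem_approx hN hy (hS'le g g.2)) hx.2
  choose F hF hFev using hfin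
  have : Finite S' := hS'fin.to_subtype
  refine ⟨⋃ g, F g, Set.finite_iUnion hF, ?_⟩
  filter_upwards [eventually_all.2 hFev,
    ((isOpen_approx hN n).eventually_mem hy).prod_mk (hx.eventually hN)] with p hp hp' γ hγ e
  obtain ⟨d, hd, hfree⟩ := exists_wallGroup_smul_mem_free hN hp'.2.1
  have hmem : (d * γ)⁻¹ ∈ S := by
    refine ⟨Subgroup.inv_mem _ (Subgroup.mul_mem _ (wallGroup_le N hd) hγ), _, hfree, ?_⟩
    rw [← e, ← mul_smul d γ, inv_smul_smul]
    exact hp'.1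
  have hform : ∃ (m : ℤ) (g : S'), γ = T N ^ m * g := by
    have e2 : γ = d⁻¹ * (d * γ) := by rw [inv_mul_cancel_left]
    obtain ⟨m, hm⟩ := exists_of_mem_wallGroup ((wallGroup N).inv_mem hd)
    rcases hm with hm | hm
    · exact ⟨m, ⟨d * γ, Or.inl hmem⟩, by rw [← hm]; exact e2⟩
    · refine ⟨-m, ⟨B N * (d * γ), Or.inr ⟨_, hmem, rfl⟩⟩, ?_⟩
      change γ = T N ^ (-m) * (B N * (d * γ))
      rw [← mul_assoc, ← B_mul_T_zpow, ← hm]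
      exact e2
  obtain ⟨m, g, rfl⟩ := hform
  exact Set.mem_iUnion.2 ⟨g, hp g m e⟩

theorem actsProperlyDiscontinuously_domain (hN : 4 ≤ N) :
    ActsProperlyDiscontinuously (reflectionGroup N) (domain N) := by
  apply actsProperlyDiscontinuously_of_locallyFinitePair
  · exact fun γ hγ x hx => smul_mem_domain hγ hx
  · intro x hx y hy
    obtain ⟨γ, hγ, h⟩ := (mem_domain_iff hN x).1 hx
    obtain ⟨δ, hδ, h'⟩ := (mem_domain_iff hN y).1 hy
    have key : LocallyFinitePair (reflectionGroup N) (γ • x) (δ • y) := by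
      rcases h with h | h <;> rcases h' with h' | h'
      · exact locallyFinitePair_of_mem_approx hN h h'
      · exact locallyFinitePair_approx_isTame hN h h'
      · exact (locallyFinitePair_approx_isTame hN h' h).symm
      · exact locallyFinitePair_isTame hN h h'
    have := (key.smul_left (Subgroup.inv_mem _ hγ)).smul_right (Subgroup.inv_mem _ hδ)
    rwa [inv_smul_smul, inv_smul_smul] at this

/-! ### Points of the domains -/

/-- The Lagrangian plane spanned by two orthogonal independent vectors. -/
theorem exists_lagrangian {p q : V} (hli : LinearIndependent ℝ ![p, q])
    (hpq : pairing N p q = 0) : ∃ L : LGr N, L.1 = Submodule.span ℝ {p, q} :=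
  ⟨LagFrame.span ⟨(p, q), hli, hpq⟩, rfl⟩

/-- The plane spanned by v₀ and v₁ works: v₀ puts it on the wing and makes its wall orbit avoid the
rotated sides, and it cannot contain the axis because the axis pairs nontrivially with v₁. -/
theorem exists_mem_domain_diff (hN : 4 ≤ N) : ∃ L ∈ domain N, L ∉ innerDomain N := by
  have ht := baseTetra_symp hN
  have : NeZero N := ⟨by omega⟩
  obtain ⟨L, hL⟩ := exists_lagrangian (N := N) (p := v₀ N) (q := v₁ N)
    (by
      rw [LinearIndependent.pair_iff]
      intro s t h
      rw [v₀_eq_vec, v₁_eq_vec, Tetra.smul_vec, Tetra.smul_vec, Tetra.vec_add] at h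
      have := ht.vec_eq_zero h
      constructor <;> linarith [this.1, this.2.2.2])
    (by rw [v₀_eq_vec, v₁_eq_vec, ht.pairing_vec]; ring)
  have h0 : v₀ N ∈ L.1 := by rw [hL]; exact Submodule.subset_span (Or.inl rfl)
  have h1 : v₁ N ∈ L.1 := by rw [hL]; exact Submodule.subset_span (Or.inr rfl)
  have haxis : axis N ∉ L.1 := by
    intro h
    have := L.2.2 _ h _ h1
    rw [v₁_eq_vec, pairing_axis_vec hN] at this
    have := omega_pos hN
    linarith
  refine ⟨L, (mem_domain_iff hN L).2 ⟨1, Subgroup.one_mem _, Or.inr ?_⟩, ?_⟩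
  · rw [one_smul]
    exact ⟨avoidsRotated_of_v₀_mem hN h0, haxis⟩
  · refine eWing_disjoint_innerDomain hN ?_
    rw [v₀_eq_vec] at h0
    refine Tetra.IsSymplectic.mem_eWing_of_vec_mem zero_le_one le_rfl (fun h => ?_) h0
    exact one_ne_zero (ht.vec_eq_zero h).1

/-- The plane spanned by v₁ + v₃ and v₀ - v₂ is invariant under `A` and meets no other closed cone:
its two `e`-coordinates are opposite, while a vector of another cone would have both nonnegative up
to one common scalar. So it is not even in level 1. -/
theorem innerDomain_nonempty (hN : 4 ≤ N) : (innerDomain N).Nonempty := by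
  have ht := baseTetra_symp hN
  have hκ := kap_pos hN
  have : NeZero N := ⟨by omega⟩
  obtain ⟨L, hL⟩ := exists_lagrangian (N := N) (p := (baseTetra N).vec 0 1 0 1)
    (q := (baseTetra N).vec 1 0 (-1) 0)
    (by
      rw [LinearIndependent.pair_iff]
      intro s t h
      rw [Tetra.smul_vec, Tetra.smul_vec, Tetra.vec_add] at h
      have := ht.vec_eq_zero h
      constructor <;> linarith [this.1, this.2.1])
    (by rw [ht.pairing_vec]; ring)
  have hmem : ∀ y, y ∈ L.1 ↔ ∃ r s : ℝ, y = (baseTetra N).vec s r (-s) r := by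
    intro y
    rw [hL, Submodule.mem_span_pair]
    have e : ∀ r s : ℝ, r • (baseTetra N).vec 0 1 0 1 + s • (baseTetra N).vec 1 0 (-1) 0 =
        (baseTetra N).vec s r (-s) r := by
      intro r s
      rw [Tetra.smul_vec, Tetra.smul_vec, Tetra.vec_add]
      congr 1 <;> ring
    simp only [e, eq_comm]
  have honly : ∀ j : Idx N, L ∈ (tetra j).coneHit N → j = (0, false) := by
    rintro ⟨k, b⟩ ⟨y, ⟨hy, hy0⟩, hyL⟩
    obtain ⟨r, s, e⟩ := (hmem y).1 hyL
    by_cases hk : (k : ℕ) = 0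
    · obtain rfl : k = 0 := Fin.ext hk
      cases b with
      | false => rfl
      | true =>
        exfalso
        obtain ⟨a', b', c', d', ha', hb', hc', hd', rfl⟩ := hy
        rw [tetra, translate_vec, place_zero_true, B_vec hN] at hy0 e
        rw [Tetra.flip_vec] at e
        obtain ⟨h1, h2, h3, h4⟩ := ht.vec_inj e
        have hm := mul_nonneg hκ.le (add_nonneg hb' hd')
        have hz : kap N * (b' + d') = 0 := by linarith
        have hz' := (mul_eq_zero.1 hz).resolve_left hκ.ne'
        obtain rfl : b' = 0 := by linarith
        obtain rfl : d' = 0 := by linarith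
        obtain rfl : a' = 0 := by linarith
        obtain rfl : c' = 0 := by linarith
        exact hy0 (by simp [Tetra.vec_zero])
    · exfalso
      obtain ⟨σ, a', b', c', d', hσ, ha', hb', hc', hd', e', hc0, -⟩ :=
        (flipCoords_of_mem_cone hN (k, b) hk hy hy0).exists_coords
      have e2 := e'
      rw [e, Tetra.smul_vec, Tetra.flip_vec] at e2
      obtain ⟨h1, h2, h3, h4⟩ := ht.vec_inj e2
      obtain ⟨ρ, hρ, h⟩ := hc0 (by linarith)
      rw [e, v₃_eq_vec, Tetra.smul_vec] at h
      obtain ⟨-, g2, -, g4⟩ := ht.vec_inj h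
      apply hρ
      linarith
  have hA : A N • L = L := by
    have hle : ∀ y ∈ L.1, toMat (A N) *ᵥ y ∈ L.1 := by
      intro y hy
      obtain ⟨r, s, rfl⟩ := (hmem y).1 hy
      rw [A_vec hN, Tetra.flip_vec, hmem]
      exact ⟨-r, s, rfl⟩
    apply Subtype.ext
    ext y
    rw [mem_smul_iff]
    constructor
    · rintro ⟨z, hz, rfl⟩
      exact hle z hz
    · intro hy
      exact ⟨_, hle y hy, by rw [toMat_mulVec_mulVec, A_mul_A, toMat_one, Matrix.one_mulVec]⟩
  refine ⟨L, ?_⟩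
  rw [innerDomain_eq hN]
  refine Set.mem_iUnion.2 ⟨1, fun i hi => ?_⟩
  obtain rfl := honly i ((conePingPong hN).lev_subset_closed 1 i hi)
  obtain ⟨j, hj, hm⟩ := hi
  change reflection ((0, false) : Idx N) • L ∈ _ at hm
  rw [reflection, place_zero, one_mul, inv_one, mul_one, hA] at hm
  exact hj (honly j hm)

theorem innerDomain_ssubset_domain (hN : 4 ≤ N) : innerDomain N ⊂ domain N := by
  obtain ⟨L, hL, hL'⟩ := exists_mem_domain_diff hN
  exact ⟨innerDomain_subset_domain hN, fun h => hL' (h hL)⟩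

end

/-! ### The hypergeometric triple -/

section

variable {N : ℕ}

theorem toMat_R (N : ℕ) : toMat (R N) =
    !![c1 N, -s1 N, 0, 0; s1 N, c1 N, 0, 0; 0, 0, c2 N, -s2 N; 0, 0, s2 N, c2 N] := by
  rw [R, toMat_mul, toMat_B, toMat_C, matB, matC]
  ext i j
  fin_cases i <;> fin_cases j <;> simp [Matrix.mul_apply, Fin.sum_univ_four]

theorem toMat_A_mul_C (N : ℕ) : toMat (A N * C N) =
    !![c1 N, -s1 N, 0, 0;
       r1 N * c1 N + s1 N, c1 N - r1 N * s1 N, r1 N * c2 N, -(r1 N * s2 N);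
       0, 0, c2 N, -s2 N;
       r2 N * c1 N, -(r2 N * s1 N), r2 N * c2 N + s2 N, c2 N - r2 N * s2 N] := by
  rw [toMat_mul, toMat_A, toMat_C, matA, matC]
  ext i j
  fin_cases i <;> fin_cases j <;> simp [Matrix.mul_apply, Fin.sum_univ_four] <;> ring

theorem charpoly_R (N : ℕ) : (toMat (R N)).charpoly =
    (X ^ 2 - Polynomial.C (2 * c1 N) * X + 1) * (X ^ 2 - Polynomial.C (2 * c2 N) * X + 1) := by
  have h1 := s1_sq N
  have h2 := s2_sq N
  apply Polynomial.funext
  intro t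
  rw [Matrix.eval_charpoly, toMat_R]
  have e : (Matrix.scalar (Fin 4) t - !![c1 N, -s1 N, 0, 0; s1 N, c1 N, 0, 0;
      0, 0, c2 N, -s2 N; 0, 0, s2 N, c2 N]).det =
      ((t - c1 N) ^ 2 + s1 N * s1 N) * ((t - c2 N) ^ 2 + s2 N * s2 N) := by
    simp [Matrix.det_succ_row_zero, Fin.sum_univ_succ, Matrix.submatrix, Fin.succAbove]
    ring
  rw [e, h1, h2]
  simp
  ring

theorem r1_mul_s1_mul (hN : 4 ≤ N) :
    r1 N * s1 N * (c1 N - c2 N) = 2 * (1 - c1 N) ^ 2 := by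
  have h1 := (s1_pos hN).ne'
  have h2 : c1 N - c2 N ≠ 0 := by
    have := cc1_lt_cc2 hN; simp only [cc1, cc2] at this; intro h; linarith
  rw [r1]; field_simp; ring

theorem r2_mul_s2_mul (hN : 4 ≤ N) :
    r2 N * s2 N * (c1 N - c2 N) = -(2 * (1 - c2 N) ^ 2) := by
  have h1 := (s2_pos hN).ne'
  have h2 : c2 N - c1 N ≠ 0 := by
    have := cc1_lt_cc2 hN; simp only [cc1, cc2] at this; intro h; linarith
  rw [r2]; field_simp; ring

/-- `A * C` is `T * R` with `T - 1` of rank one, so its characteristic polynomial is that of `R`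
plus terms linear in r₁ and r₂; the values of r₁, r₂ turn it into (X - 1)⁴. -/
theorem charpoly_A_mul_C (hN : 4 ≤ N) : (toMat (A N * C N)).charpoly = (X - 1) ^ 4 := by
  have h1 := s1_sq N
  have h2 := s2_sq N
  have h3 := r1_mul_s1_mul hN
  have h4 := r2_mul_s2_mul hN
  have h0 : c1 N - c2 N ≠ 0 := by
    have := cc1_lt_cc2 hN; simp only [cc1, cc2] at this; intro h; linarith
  apply Polynomial.funext
  intro t
  rw [Matrix.eval_charpoly, toMat_A_mul_C]
  have e : (Matrix.scalar (Fin 4) t - !![c1 N, -s1 N, 0, 0;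
       r1 N * c1 N + s1 N, c1 N - r1 N * s1 N, r1 N * c2 N, -(r1 N * s2 N);
       0, 0, c2 N, -s2 N;
       r2 N * c1 N, -(r2 N * s1 N), r2 N * c2 N + s2 N, c2 N - r2 N * s2 N]).det =
      ((t - c1 N) ^ 2 + s1 N * s1 N) * ((t - c2 N) ^ 2 + s2 N * s2 N)
      + r1 N * s1 N * t * ((t - c2 N) ^ 2 + s2 N * s2 N)
      + r2 N * s2 N * t * ((t - c1 N) ^ 2 + s1 N * s1 N) := by
    simp [Matrix.det_succ_row_zero, Fin.sum_univ_succ, Matrix.submatrix, Fin.succAbove]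
    ring
  rw [e, h1, h2]
  simp
  apply mul_left_cancel₀ h0
  linear_combination t * (t ^ 2 - 2 * c2 N * t + 1) * h3 + t * (t ^ 2 - 2 * c1 N * t + 1) * h4

theorem X_sub_exp_mul (μ : ℝ) : (X - Polynomial.C (Complex.exp (μ * Complex.I))) *
    (X - Polynomial.C (Complex.exp (-(μ * Complex.I)))) =
      X ^ 2 - Polynomial.C (2 * (Real.cos μ : ℂ)) * X + 1 := by
  have h1 : Complex.exp (μ * Complex.I) * Complex.exp (-(μ * Complex.I)) = 1 := by
    rw [← Complex.exp_add, add_neg_cancel, Complex.exp_zero]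
  have h2 : Complex.exp (μ * Complex.I) + Complex.exp (-(μ * Complex.I)) =
      2 * (Real.cos μ : ℂ) := by
    rw [Complex.ofReal_cos, Complex.two_cos, neg_mul]
  rw [← h2, Polynomial.C_add]
  have h3 := congrArg Polynomial.C h1
  rw [Polynomial.C_mul, Polynomial.C_1] at h3
  linear_combination h3

theorem map_charpoly_R (hN : 4 ≤ N) : (toMat (R N)).charpoly.map (algebraMap ℝ ℂ) =
    ∏ j : Fin 4, (X - Polynomial.C (Complex.exp (2 * Real.pi * Complex.I * (alpha N j : ℂ)))) := by
  have hN0 : (N : ℂ) ≠ 0 := by exact_mod_cast (by omega : N ≠ 0)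
  have e0 : Complex.exp (2 * Real.pi * Complex.I * (alpha N 0 : ℂ)) =
      Complex.exp (mu1 N * Complex.I) := by
    congr 1
    simp [alpha, mu1]; field_simp
  have e1 : Complex.exp (2 * Real.pi * Complex.I * (alpha N 1 : ℂ)) =
      Complex.exp (mu2 N * Complex.I) := by
    congr 1
    simp [alpha, mu2]; field_simp
  -- The third parameter is 1 minus the second, so the exponents agree only up to one period;
  -- likewise for the fourth and the first.
  have e2 : Complex.exp (2 * Real.pi * Complex.I * (alpha N 2 : ℂ)) =
      Complex.exp (-(mu2 N * Complex.I)) := by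
    rw [← Complex.exp_periodic (-(mu2 N * Complex.I))]
    congr 1
    simp [alpha, mu2]; field_simp; ring
  have e3 : Complex.exp (2 * Real.pi * Complex.I * (alpha N 3 : ℂ)) =
      Complex.exp (-(mu1 N * Complex.I)) := by
    rw [← Complex.exp_periodic (-(mu1 N * Complex.I))]
    congr 1
    simp [alpha, mu1]; field_simp; ring
  have h1 := X_sub_exp_mul (mu1 N)
  have h2 := X_sub_exp_mul (mu2 N)
  rw [Fin.prod_univ_four, e0, e1, e2, e3, charpoly_R]
  simp only [Polynomial.map_mul, Polynomial.map_add, Polynomial.map_sub, Polynomial.map_pow,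
    Polynomial.map_X, Polynomial.map_C, Polynomial.map_one, c1, c2, Complex.coe_algebraMap,
    Complex.ofReal_mul, Complex.ofReal_ofNat]
  rw [← h1, ← h2]
  ring

theorem alpha_eq (N : ℕ) (j : Fin 4) :
    alpha N j = ((N : ℝ) + (2 * (j : ℕ) - 3)) / (2 * N) := by
  fin_cases j <;> simp [alpha] <;> ring

/-- The differences of the parameters are (j - k)/N with |j - k| ≤ 3 < N, so the only integer among
them is 0. -/
theorem exp_alpha_injective (hN : 4 ≤ N) :
    Function.Injective fun j : Fin 4 => Complex.exp (2 * Real.pi * Complex.I * (alpha N j : ℂ)) := by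
  intro j k h
  have hN0 : (0 : ℝ) < N := by exact_mod_cast (by omega : 0 < N)
  have hN4 : (4 : ℝ) ≤ N := by exact_mod_cast hN
  obtain ⟨n, hn⟩ := Complex.exp_eq_exp_iff_exists_int.1 h
  have hπ : (2 * Real.pi * Complex.I : ℂ) ≠ 0 := Complex.two_pi_I_ne_zero
  have e : alpha N j = alpha N k + n := by
    have : (alpha N j : ℂ) = alpha N k + n := by
      apply mul_left_cancel₀ hπ
      rw [hn]; ring
    exact_mod_cast this
  rw [alpha_eq, alpha_eq] at e
  field_simp at e
  have hj : ((j : ℕ) : ℝ) ≤ 3 := by exact_mod_cast (by omega : (j : ℕ) ≤ 3)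
  have hk : ((k : ℕ) : ℝ) ≤ 3 := by exact_mod_cast (by omega : (k : ℕ) ≤ 3)
  have hj0 : (0 : ℝ) ≤ (j : ℕ) := Nat.cast_nonneg _
  have hk0 : (0 : ℝ) ≤ (k : ℕ) := Nat.cast_nonneg _
  have hjk : ((j : ℕ) : ℝ) - (k : ℕ) = N * n := by linarith
  have hn0 : n = 0 := by
    by_contra hn0
    rcases lt_or_gt_of_ne hn0 with h | h
    · have h1 : (n : ℝ) ≤ -1 := by exact_mod_cast (by omega : n ≤ -1)
      nlinarith
    · have h1 : (1 : ℝ) ≤ n := by exact_mod_cast (by omega : 1 ≤ n)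
      nlinarith
  rw [hn0, Int.cast_zero, mul_zero, sub_eq_zero] at hjk
  exact Fin.ext (by exact_mod_cast hjk)

/-- A real matrix with distinct complex eigenvalues has minimal polynomial equal to its
characteristic polynomial. -/
theorem minpoly_eq_charpoly_of_injective {n : Type*} [Fintype n] [DecidableEq n]
    (M : Matrix n n ℝ) (a : n → ℂ) (ha : Function.Injective a)
    (h : M.charpoly.map (algebraMap ℝ ℂ) = ∏ j, (X - Polynomial.C (a j))) :
    minpoly ℝ M = M.charpoly := by
  have hroot : ∀ j, (X - Polynomial.C (a j)) ∣ (minpoly ℝ M).map (algebraMap ℝ ℂ) := by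
    intro j
    have h1 : (M.map (algebraMap ℝ ℂ)).charpoly.IsRoot (a j) := by
      rw [Matrix.charpoly_map, h, ← Polynomial.dvd_iff_isRoot]
      exact Finset.dvd_prod_of_mem _ (Finset.mem_univ j)
    rw [← Matrix.charpoly_toLin', ← Module.End.hasEigenvalue_iff_isRoot_charpoly,
      Module.End.hasEigenvalue_iff_isRoot, Matrix.minpoly_toLin'] at h1
    rw [Polynomial.dvd_iff_isRoot]
    refine h1.dvd (minpoly.dvd ℂ _ ?_)
    have h2 := minpoly.aeval ℝ M
    have h3 := congrArg (RingHom.mapMatrix (m := n) (algebraMap ℝ ℂ)) h2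
    rw [map_zero, Polynomial.aeval_def, Polynomial.hom_eval₂] at h3
    have hcomp : (algebraMap ℂ (Matrix n n ℂ)).comp (algebraMap ℝ ℂ) =
        (algebraMap ℝ ℂ).mapMatrix.comp (algebraMap ℝ (Matrix n n ℝ)) := by
      refine RingHom.ext fun r => Matrix.ext fun i k => ?_
      simp only [RingHom.comp_apply, RingHom.mapMatrix_apply, Matrix.map_apply,
        Matrix.algebraMap_matrix_apply]
      split_ifs <;> simp
    rw [Polynomial.aeval_def, Polynomial.eval₂_map, hcomp]
    exact h3
  have hdvd : M.charpoly.map (algebraMap ℝ ℂ) ∣ (minpoly ℝ M).map (algebraMap ℝ ℂ) := by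
    rw [h]
    exact Finset.prod_dvd_of_coprime
      ((Polynomial.pairwise_coprime_X_sub_C ha).set_pairwise _) fun j _ => hroot j
  rw [Polynomial.map_dvd_map' (algebraMap ℝ ℂ)] at hdvd
  exact Polynomial.eq_of_monic_of_associated (minpoly.monic (Matrix.isIntegral M))
    M.charpoly_monic (associated_of_dvd_dvd M.minpoly_dvd_charpoly hdvd)

theorem rank_T_sub_one (hN : 4 ≤ N) : (toMat (T N) - 1).rank = 1 := by
  have h : LinearMap.range (Matrix.mulVecLin (toMat (T N) - 1)) = Submodule.span ℝ {axis N} := by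
    have hT : ∀ y, Matrix.mulVecLin (toMat (T N) - 1) y =
        (shear N * pairing N (axis N) y) • axis N := by
      intro y
      rw [Matrix.mulVecLin_apply, Matrix.sub_mulVec, Matrix.one_mulVec, T_mulVec hN,
        add_sub_cancel_left]
    apply le_antisymm
    · rintro _ ⟨y, rfl⟩
      rw [hT]
      exact Submodule.smul_mem _ _ (Submodule.mem_span_singleton_self _)
    · rw [Submodule.span_singleton_le_iff_mem]
      -- `T - 1` sends v₃ to `kap N • axis N`.
      refine ⟨(kap N)⁻¹ • v₃ N, ?_⟩
      have := (kap_pos hN).ne'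
      have := (omega_pos hN).ne'
      rw [hT, v₃_eq_vec, pairing_smul_right, pairing_axis_vec hN, shear]
      have : kap N / omega N * ((kap N)⁻¹ * (omega N * (1 + 0))) = 1 := by field_simp; ring
      rw [this, one_smul]
  rw [Matrix.rank, h, finrank_span_singleton]
  rw [axis_eq_vec]
  exact fun h => one_ne_zero ((baseTetra_symp hN).vec_eq_zero h).1

theorem det_T (N : ℕ) : (toMat (T N)).det = 1 := by
  rw [T, toMat_mul, Matrix.det_mul, toMat_A, toMat_B]
  simp [matA, matB, Matrix.det_succ_row_zero, Fin.sum_univ_succ, Matrix.submatrix, Fin.succAbove]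

/-- Vanishing of the entry (0, 2) of the cube would force r₁ s₁ (1 - c₂) = 0, but all three factors
are positive. Hence there is a single Jordan block of size 4. -/
theorem A_mul_C_sub_one_pow_three_ne_zero (hN : 4 ≤ N) : (toMat (A N * C N) - 1) ^ 3 ≠ 0 := by
  intro h
  have h02 := congrFun (congrFun h 0) 2
  have hs2 := s2_sq N
  have h3 := r1_mul_s1_mul hN
  have h4 := r2_mul_s2_mul hN
  have h0 : c1 N - c2 N ≠ 0 := by
    have := cc1_lt_cc2 hN; simp only [cc1, cc2] at this; intro h; linarith
  have hsum : r1 N * s1 N + r2 N * s2 N = 2 * c1 N + 2 * c2 N - 4 := by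
    apply mul_right_cancel₀ h0
    linear_combination h3 + h4
  rw [toMat_A_mul_C] at h02
  simp [pow_succ, Matrix.mul_apply, Fin.sum_univ_four, Matrix.one_apply] at h02
  have key : r1 N * s1 N * (1 - c2 N) = 0 := by
    linear_combination h02 - r1 N * s1 N * hs2 - r1 N * s1 N * c2 N * hsum
  have hu := mul_pos (mul_pos (r1_pos hN) (s1_pos hN)) (cc2_pos hN)
  rw [cc2] at hu
  exact hu.ne' key

theorem minpoly_A_mul_C (hN : 4 ≤ N) : minpoly ℝ (toMat (A N * C N)) = (X - 1) ^ 4 := by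
  have hdvd : minpoly ℝ (toMat (A N * C N)) ∣ (X - Polynomial.C 1) ^ 4 := by
    have := Matrix.minpoly_dvd_charpoly (toMat (A N * C N))
    rwa [charpoly_A_mul_C hN, ← Polynomial.C_1] at this
  obtain ⟨k, hk, hass⟩ := (dvd_prime_pow (Polynomial.prime_X_sub_C (1 : ℝ)) 4).1 hdvd
  have heq := Polynomial.eq_of_monic_of_associated
    (minpoly.monic (Matrix.isIntegral (toMat (A N * C N)))) ((Polynomial.monic_X_sub_C 1).pow k)
    hass
  obtain rfl : k = 4 := by
    by_contra hk4
    have h := minpoly.aeval ℝ (toMat (A N * C N))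
    rw [heq] at h
    simp only [map_pow, map_sub, Polynomial.aeval_X, map_one] at h
    exact A_mul_C_sub_one_pow_three_ne_zero hN (pow_eq_zero_of_le (by omega) h)
  rw [heq, Polynomial.C_1]

theorem isHypergeometricTriple (hN : 4 ≤ N) :
    IsHypergeometricTriple N (toMat (C N * A N)) (toMat (T N)) (toMat (R N)) := by
  have hinv : (toMat (C N * A N))⁻¹ = toMat (A N * C N) := by
    apply Matrix.inv_eq_left_inv
    rw [← toMat_mul, mul_assoc, ← mul_assoc (C N), C_mul_C, one_mul, A_mul_A, toMat_one]
  refine ⟨?_, map_charpoly_R hN,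
    minpoly_eq_charpoly_of_injective _ _ (exp_alpha_injective hN) (map_charpoly_R hN), ?_, ?_,
    rank_T_sub_one hN, ?_⟩
  · rw [← toMat_mul, ← toMat_mul, T, R]
    have : C N * A N * (A N * B N) * (B N * C N) = 1 := by
      rw [mul_assoc (C N), ← mul_assoc (A N), A_mul_A, one_mul, mul_assoc (C N),
        ← mul_assoc (B N), B_mul_B, one_mul, C_mul_C]
    rw [this, toMat_one]
  · rw [hinv, charpoly_A_mul_C hN]
  · rw [hinv, charpoly_A_mul_C hN, minpoly_A_mul_C hN]
  · have hN0 : (N : ℂ) ≠ 0 := by exact_mod_cast (by omega : N ≠ 0)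
    rw [det_T, Complex.ofReal_one]
    -- The four parameters add up to 2, so the exponent is an integral multiple of 2πi.
    have e : 2 * Real.pi * Complex.I * (∑ j : Fin 4, (1 - (alpha N j : ℂ))) =
        (2 : ℤ) * (2 * Real.pi * Complex.I) := by
      rw [Fin.sum_univ_four]
      simp [alpha]
      field_simp
      ring
    rw [e, Complex.exp_int_mul_two_pi_mul_I]

end

end CyclotomicCones

end

theorem theoremB (N : ℕ) (hN : 4 ≤ N) :
    CyclotomicCones.IsHypergeometricTriple N
      (CyclotomicCones.toMat (CyclotomicCones.C N * CyclotomicCones.A N))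
      (CyclotomicCones.toMat (CyclotomicCones.T N))
      (CyclotomicCones.toMat (CyclotomicCones.R N)) ∧
    IsOpen (CyclotomicCones.innerDomain N) ∧
    (CyclotomicCones.innerDomain N).Nonempty ∧
    IsOpen (CyclotomicCones.domain N) ∧
    CyclotomicCones.innerDomain N ⊂ CyclotomicCones.domain N ∧
    CyclotomicCones.ActsProperlyDiscontinuously
      (CyclotomicCones.reflectionGroup N) (CyclotomicCones.innerDomain N) ∧
    CyclotomicCones.ActsProperlyDiscontinuously
      (CyclotomicCones.reflectionGroup N) (CyclotomicCones.domain N) ∧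
    CyclotomicCones.ActsProperlyDiscontinuously
      (CyclotomicCones.monodromyGroup N) (CyclotomicCones.innerDomain N) ∧
    CyclotomicCones.ActsProperlyDiscontinuously
      (CyclotomicCones.monodromyGroup N) (CyclotomicCones.domain N) := by
  exact ⟨CyclotomicCones.isHypergeometricTriple hN, CyclotomicCones.isOpen_innerDomain hN,
    CyclotomicCones.innerDomain_nonempty hN, CyclotomicCones.isOpen_domain hN,
    CyclotomicCones.innerDomain_ssubset_domain hN,
    CyclotomicCones.actsProperlyDiscontinuously_innerDomain hN,
    CyclotomicCones.actsProperlyDiscontinuously_domain hN,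
    (CyclotomicCones.actsProperlyDiscontinuously_innerDomain hN).mono
      (CyclotomicCones.monodromyGroup_le N),
    (CyclotomicCones.actsProperlyDiscontinuously_domain hN).mono
      (CyclotomicCones.monodromyGroup_le N)⟩
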